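/- **Setting.** Let $\operatorname{Im}\tau>0$, $\theta_{ab}(z;\tau)=\sum_{n\in\mathbb Z}\exp\bigl(\pi i(\tfrac a2+n)^2\tau+2\pi i(\tfrac a2+n)(\tfrac b2+z)\bigr)$, $\theta_{ab}(z)=\theta_{ab}(z;\tau)$, let $\eta=r'/r$ be rational ($r\ge1$) with $\theta_{11}(2\eta)\neq0$, let $\lambda^\circ,c\in\mathbb C$, $\kappa\in\mathbb C\setminus\{0\}$, and put $\lambda_a=\lambda^\circ+2a\eta$; assume $\theta_{11}(\lambda_a)\ne0$ for all $a\in\mathbb Z$ in the main statement. Let $l_1,\dots,l_N\in\frac12\mathbb Z_{\ge0}$ with $M:=l_1+\dots+l_N\in\mathbb Z$. *Sklyanin algebra.* $V^l$ is the space of entire $f$ with $f(y+1)=f(-y)=f(y)$, $f(y+\tau)=e^{-4l\pi i(2y+\tau)}f(y)$. Write $\vartheta_0,\vartheta_1,\vartheta_2,\vartheta_3=\theta_{11},\theta_{10},\theta_{00},\theta_{01}$; $s_a(y)=\vartheta_a(\eta)\vartheta_a(2y)$ for $a\ne2$, $s_2(y)=i\,\vartheta_2(\eta)\vartheta_2(2y)$;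 $W_a(u)=\vartheta_a(u)/(2\theta_{11}(2\eta)\vartheta_a(\eta))$. The generators act on $V^l$ by $(\rho^l(S^a)f)(y)=\bigl(s_a(y-l\eta)f(y+\eta)-s_a(-y-l\eta)f(y-\eta)\bigr)/\theta_{11}(2y)$, and $L(u)=\sum_{a=0}^3W_a(u)\,\sigma^a\otimes\rho^l(S^a)$ with the Pauli matrices $\sigma^a$. *R matrices.* $R^{1/2,l}(u)=\sum_a\frac{W_a(u+\eta)}{\theta_{11}(u+(2l+1)\eta)}\,\rho^{1/2}(S^a)\otimes\rho^l(S^a)$. The matrix $R^{l,l'}(u)$ on $V^l\otimes V^{l'}$ is the fusion of these: multiplication of functions makes $V^l$ a quotient of $(V^{1/2})^{\otimes2l}$, and $R^{l,l'}(u)$ is induced by $R^{1/2,l'}_{2l}(u+(2l-1)\eta)\cdots R^{1/2,l'}_{2}(u-(2l-3)\eta)\,R^{1/2,l'}_1(u-(2l-1)\eta)$. *Bethe vectors.* For $\lambda-\lambda'=4m\eta$, $m\in\{-l,\dots,l\}$, let $\phi^{(l)}_{\lambda,\lambda'}(u;y)=\prod_s\theta_{10}(y+s)\theta_{10}(y-s)\in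 V^l$, where $s$ runs over $\frac{\lambda+u}2-(2j-l-1)\eta$ $(1\le j\le l+m)$ and $\frac{\lambda'-u}2-(2j-l-1)\eta$ $(1\le j\le l-m)$. Integers $a_0,\dots,a_N$ are admissible if $a_{j-1}-a_j\in\{-2l_j,-2l_j+2,\dots,2l_j\}$; then $|a_0,\dots,a_N;\vec z\,\rangle=\bigotimes_j\phi^{(l_j)}_{\lambda_{a_{j-1}},\lambda_{a_j}}(z_j)$ in $\mathcal H=V^{l_1}\otimes\dots\otimes V^{l_N}$. The pseudo-vacuum $\Omega_a(\vec z)$ is this vector for $a_j=a+2(l_1+\dots+l_j)$. The space of Bethe vectors $\mathfrak B_{\vec z}$ is the span of the functions $\nu\mapsto e^{2\pi ia\nu\eta}|a_0,\dots,a_N;\vec z\,\rangle$ of $\nu\in\mathbb Z/r\mathbb Z$ with admissible labels and $a_0=a_N=a$. *The system.* The boundary operator $Z$ maps $e^{2\pi ia_N\nu\eta}|a_0,\dots,a_N;z_1,\dots,z_N\rangle$ to $e^{2\pi ia_{N-1}\nu\eta}e^{c(a_N-a_{N-1}-2l_N)}|a_{N-1},a_0,\dots,a_{N-1};z_N+\kappa,z_1,\dots,z_{N-1}\rangle$.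 Let $Z^{(j)}$ be the operator $Z$ for the chain with sites in the order $1,\dots,j-1,j+1,\dots,N,j$, with tensor factors written in the original order, and $$A_j(\vec z)=R_{j,j-1}(z_j+\kappa-z_{j-1})\cdots R_{j,1}(z_j+\kappa-z_1)\,Z^{(j)}\,R_{j,N}(z_j-z_N)\cdots R_{j,j+1}(z_j-z_{j+1}),$$ where $R_{j,k}(u)$ is $R^{l_j,l_k}(u)$ acting on the factors $j,k$. With $\vec z_j=(z_1,\dots,z_j+\kappa,\dots,z_N)$ the system is $f(\vec z_j)=A_j(\vec z)f(\vec z)$, $j=1,\dots,N$, for $f(\vec z)\in\mathfrak B_{\vec z}$. *The vector $\Psi$.* Let $T(u)=L_N(u-z_N)\cdots L_1(u-z_1)$, $$M_\lambda(u)=\begin{pmatrix}-\theta_{01}(\frac{\lambda-u}2;\frac\tau2)&-\theta_{01}(\frac{\lambda+u}2;\frac\tau2)\\ \theta_{00}(\frac{\lambda-u}2;\frac\tau2)&\theta_{00}(\frac{\lambda+u}2;\frac\tau2)\end{pmatrix}\begin{pmatrix}1&0\\0&\theta_{11}(\lambda)^{-1}\end{pmatrix},$$ let $B_{a,a'}(u)$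 be the upper right entry of $M_{\lambda_a}(u)^{-1}T(u)M_{\lambda_{a'}}(u)$, and $$\Psi(\vec t\,)=\sum_{a=0}^{r-1}e^{2\pi ia\nu\eta}B_{a+1,a-1}(t_1)B_{a+2,a-2}(t_2)\cdots B_{a+M,a-M}(t_M)\,\Omega_{a-M}(\vec z).$$ *Scalar factor.* Put $\alpha^l(u)=\theta_{11}(u+2l\eta)/\theta_{11}(2\eta)$, $\delta^l(u)=\theta_{11}(u-2l\eta)/\theta_{11}(2\eta)$, $\alpha(u)=\theta_{11}(u-2\eta)/\theta_{11}(u)$. Let $F^l$ (for $l=l_1,\dots,l_N$) and $\Phi$ be meromorphic solutions on $\mathbb C$ of $$F^l(t+\kappa)=\frac{\delta^l(t)}{\alpha^l(t+\kappa)}F^l(t),\qquad \Phi(t+\kappa)=\frac{\alpha(-t)}{\alpha(t+\kappa)}\Phi(t),$$ and let $$\varphi(\vec z\,|\,\vec t\,)=e^{-\frac{2c}{\kappa}\sum_{i=1}^Mt_i}\prod_{1\le i<j\le M}\Phi(t_i-t_j)\prod_{j=1}^M\prod_{n=1}^NF^{l_n}(t_j-z_n).$$ *Cycles.* A subset $\mathcal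 C$ of $\vec x+\kappa\mathbb Z^M$ is a cycle with step $\kappa$ for a function $g$ on $\mathbb C^M$ if for every $\vec n\in\mathbb Z^M$ the sum $\sum_{\vec t\in\mathcal C}g(\vec t+\vec n\kappa)$ converges absolutely and is equal to $\sum_{\vec t\in\mathcal C}g(\vec t\,)$. The coefficients of $\Psi(\vec t\,)$ with respect to path vectors are linear combinations of theta monomials $$w(\vec t\,)=\prod_{i<j}\frac{\theta_{11}(t_i-t_j+2\sigma_{ij}\eta)}{\theta_{11}(t_i-t_j)}\prod_{i=1}^M\Bigl(\theta_{11}(t_i-z_{\pi(i)}+\lambda^\circ+k_i\eta)\prod_{n\ne\pi(i)}\theta_{11}(t_i-z_n+2\varepsilon_{in}l_n\eta)\Bigr)$$ with $\pi:\{1,\dots,M\}\to\{1,\dots,N\}$, $k_i\in\mathbb Z$, $\varepsilon_{in}\in\{\pm1\}$, $\sigma_{ij}\in\{-1,0,1\}$. We say that $\mathcal C$ is a cycle for $\varphi\Psi$ at $\vec z$ if it is a cycle for each function $\varphi(\vec z\,|\,\vec t\,)w(\vec t\,)$ of this form. **Theorem.** Let $\vec z\in\mathbb C^N$ be generic in the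 following sense: for every $n$ and $a\in\mathbb Z$ the vectors $\phi^{(l_n)}_{\lambda_a+4m\eta,\lambda_a}(z_n)$, $m=-l_n,\dots,l_n$, are linearly independent, and the factors $\theta_{11}$ in the denominators of the factors $R^{1/2,l_k}$ of the R matrices in $A_1(\vec z),\dots,A_N(\vec z)$ do not vanish. Let $\mathcal C\subset\vec x+\kappa\mathbb Z^M$ be a cycle with step $\kappa$ for $\varphi\Psi$ at $\vec z$; assume that $F^{l_n}$ is holomorphic at all points of $x_i-z_n+\kappa\mathbb Z$, that $\Phi$ and $\Phi/\theta_{11}$ are holomorphic at all points of $x_i-x_j+\kappa\mathbb Z$, $i<j$, and that $\theta_{11}(t_i)\neq0$ (that is, $M_\lambda(t_i)$ is invertible) for all $\vec t\in\mathcal C$ and all $i$. Then the sums $$f(\vec z\,)=\sum_{\vec t\in\mathcal C}\varphi(\vec z\,|\,\vec t\,)\Psi(\vec t\,)$$ converge at $\vec z$ and at $\vec z_1,\dots,\vec z_N$, their values lie in $\mathfrak B_{\vec z}$ and $\mathfrak B_{\vec z_j}$, and $$f(\vec z_j)=A_j(\vec z\,)f(\vec z\,),\qquad j=1,\dots,N.$$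 Moreover, if $\operatorname{Im}\kappa>0$, $p=e^{2\pi i\tau}$, $q=e^{2\pi i\kappa}$, $(x;p)_\infty=\prod_{m\ge0}(1-p^mx)$ and $(x;p,q)_\infty=\prod_{m,n\ge0}(1-p^mq^nx)$, then $$F^l(t)=e^{-4\pi il\eta t/\kappa-\pi it}\,\frac{(qe^{-2\pi it+4\pi il\eta};p,q)_\infty}{(e^{-2\pi it-4\pi il\eta};p,q)_\infty}\,\frac{(pqe^{2\pi it+4\pi il\eta};p,q)_\infty}{(pe^{2\pi it-4\pi il\eta};p,q)_\infty},$$ $$\Phi(t)=e^{4\pi i\eta t/\kappa}(e^{-2\pi it};p)_\infty(pe^{2\pi it};p)_\infty\frac{(qe^{-2\pi it-4\pi i\eta};p,q)_\infty}{(e^{-2\pi it+4\pi i\eta};p,q)_\infty}\,\frac{(pqe^{2\pi it-4\pi i\eta};p,q)_\infty}{(pe^{2\pi it+4\pi i\eta};p,q)_\infty}$$ are meromorphic on $\mathbb C$ and satisfy the above difference equations (for every $l\in\frac12\mathbb Z_{\ge0}$). -/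

import Mathlib

open Complex

noncomputable section

namespace EllipticKZ

/-! ### Theta functions -/

/-- The theta function `θ_{ab}(z; τ)` with characteristics `a, b ∈ {0, 1}`. -/
def theta (a b : ℂ) (z τ : ℂ) : ℂ :=
  ∑' n : ℤ, exp (Real.pi * I * (a / 2 + n) ^ 2 * τ + 2 * Real.pi * I * (a / 2 + n) * (b / 2 + z))

lemma theta_eq (a b z τ : ℂ) :
    theta a b z τ =
      exp (Real.pi * I * a ^ 2 / 4 * τ + Real.pi * I * a * (b / 2 + z)) *
        jacobiTheta₂ (z + b / 2 + a * τ / 2) τ := by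
  rw [theta, jacobiTheta₂, ← tsum_mul_left]
  congr 1
  ext n
  rw [jacobiTheta₂_term, ← Complex.exp_add]
  congr 1
  ring

lemma theta_differentiable (a b τ : ℂ) : Differentiable ℂ fun z => theta a b z τ := by
  have h : (fun z => theta a b z τ) = fun z =>
      exp (Real.pi * I * a ^ 2 / 4 * τ + Real.pi * I * a * (b / 2 + z)) *
        jacobiTheta₂ (z + b / 2 + a * τ / 2) τ := funext fun z => theta_eq a b z τ
  rw [h]
  refine Differentiable.mul (by fun_prop) ?_
  rcases lt_or_ge 0 τ.im with hτ | hτ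
  · intro z
    exact DifferentiableAt.comp (g := fun w => jacobiTheta₂ w τ) z
      (differentiableAt_jacobiTheta₂_fst _ hτ) (by fun_prop)
  · have : (fun z : ℂ => jacobiTheta₂ (z + b / 2 + a * τ / 2) τ) = fun _ => 0 :=
      funext fun z => jacobiTheta₂_undef _ hτ
    rw [this]
    fun_prop

lemma theta10_add_one (z τ : ℂ) : theta 1 0 (z + 1) τ = -theta 1 0 z τ := by
  rw [theta_eq, theta_eq]
  have h1 : z + 1 + 0 / 2 + 1 * τ / 2 = (z + 0 / 2 + 1 * τ / 2) + 1 := by ring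
  rw [h1, jacobiTheta₂_add_left]
  have h2 : (Real.pi : ℂ) * I * 1 ^ 2 / 4 * τ + Real.pi * I * 1 * (0 / 2 + (z + 1)) =
      (Real.pi * I * 1 ^ 2 / 4 * τ + Real.pi * I * 1 * (0 / 2 + z)) + Real.pi * I := by ring
  rw [h2, Complex.exp_add, Complex.exp_pi_mul_I]
  ring

lemma theta10_neg (z τ : ℂ) : theta 1 0 (-z) τ = theta 1 0 z τ := by
  rw [theta_eq, theta_eq]
  have h1 : -z + 0 / 2 + 1 * τ / 2 = -(z + 0 / 2 + 1 * τ / 2) + τ := by ring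
  rw [h1, jacobiTheta₂_add_left', jacobiTheta₂_neg_left, ← mul_assoc, ← Complex.exp_add]
  congr 2
  ring

lemma theta10_add_tau (z τ : ℂ) :
    theta 1 0 (z + τ) τ = exp (-Real.pi * I * (2 * z + τ)) * theta 1 0 z τ := by
  rw [theta_eq, theta_eq]
  have h1 : z + τ + 0 / 2 + 1 * τ / 2 = (z + 0 / 2 + 1 * τ / 2) + τ := by ring
  rw [h1, jacobiTheta₂_add_left', ← mul_assoc, ← mul_assoc, ← Complex.exp_add, ← Complex.exp_add]
  congr 2
  ring

/-! ### Parameters -/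

/-- The parameters: modulus `τ`, the rational number `η = rnum / r`, the dynamical parameter
`lam` (written `λ°`), the step `κ` and the boundary constant `c`. -/
structure Params where
  τ : ℂ
  rnum : ℤ
  r : ℕ
  lam : ℂ
  κ : ℂ
  c : ℂ

variable (P : Params)

def Params.η : ℂ := (P.rnum : ℂ) / (P.r : ℂ)

/-- `λ_a = λ° + 2 a η`. -/
def lamAt (a : ℤ) : ℂ := P.lam + 2 * a * P.η

def th11 (z : ℂ) : ℂ := theta 1 1 z P.τ
def th10 (z : ℂ) : ℂ := theta 1 0 z P.τ

/-- The four theta functions `θ_{11}, θ_{10}, θ_{00}, θ_{01}`, indexed by `0, 1, 2, 3`. -/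
def thIdx (a : Fin 4) (z : ℂ) : ℂ :=
  theta (![1, 1, 0, 0] a) (![1, 0, 0, 1] a) z P.τ

/-! ### Representations of the Sklyanin algebra

Spins `l ∈ {0, 1/2, 1, …}` are encoded by `d = 2 l ∈ ℕ`. -/

/-- The spin `l = d / 2` representation space `V^l = Θ_{00}^{4l+}`: entire even functions with
`f (y + 1) = f y` and `f (y + τ) = exp (-4 l π i (2 y + τ)) f y`. -/
def V (d : ℕ) : Submodule ℂ (ℂ → ℂ) where
  carrier := {f | Differentiable ℂ f ∧ (∀ y, f (y + 1) = f y) ∧ (∀ y, f (-y) = f y) ∧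
    ∀ y, f (y + P.τ) = exp (-2 * d * Real.pi * I * (2 * y + P.τ)) * f y}
  add_mem' := by
    rintro f g ⟨hf, hf1, hf2, hf3⟩ ⟨hg, hg1, hg2, hg3⟩
    refine ⟨hf.add hg, fun y => ?_, fun y => ?_, fun y => ?_⟩
    · simp [hf1, hg1]
    · simp [hf2, hg2]
    · simp only [Pi.add_apply, hf3, hg3]; ring
  zero_mem' := ⟨differentiable_const 0, by simp, by simp, by simp⟩
  smul_mem' := by
    rintro c f ⟨hf, hf1, hf2, hf3⟩
    refine ⟨hf.const_smul c, fun y => ?_, fun y => ?_, fun y => ?_⟩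
    · simp [hf1]
    · simp [hf2]
    · simp only [Pi.smul_apply, smul_eq_mul, hf3]; ring

lemma prod_mem_V {d : ℕ} (g : Fin d → V P 1) :
    (fun y => ∏ i, (g i : ℂ → ℂ) y) ∈ V P d := by
  refine ⟨?_, fun y => ?_, fun y => ?_, fun y => ?_⟩
  · exact Differentiable.fun_finsetProd fun i _ => (g i).2.1
  · exact Finset.prod_congr rfl fun i _ => (g i).2.2.1 y
  · exact Finset.prod_congr rfl fun i _ => (g i).2.2.2.1 y
  · have h : ∀ i : Fin d, (g i : ℂ → ℂ) (y + P.τ) =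
        exp (-2 * Real.pi * I * (2 * y + P.τ)) * (g i : ℂ → ℂ) y := fun i => by
      rw [(g i).2.2.2.2 y]; simp
    change ∏ i, (g i : ℂ → ℂ) (y + P.τ) = _
    rw [Finset.prod_congr rfl fun i _ => h i, Finset.prod_mul_distrib, Finset.prod_const,
      ← Complex.exp_nat_mul]
    simp only [Finset.card_univ, Fintype.card_fin]
    congr 2
    ring

/-- The product of `2 l` vectors of spin `1/2` is a vector of spin `l`. -/
def prodV {d : ℕ} (g : Fin d → V P 1) : V P d := ⟨_, prod_mem_V P g⟩

/-- The spin `1/2` vector `y ↦ θ_{10}(y + s) θ_{10}(y - s)`. -/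
def halfVec (s : ℂ) : V P 1 :=
  ⟨fun y => th10 P (y + s) * th10 P (y - s), by
    have hd : Differentiable ℂ (th10 P) := theta_differentiable 1 0 P.τ
    refine ⟨?_, fun y => ?_, fun y => ?_, fun y => ?_⟩
    · fun_prop
    · have h1 : y + 1 + s = y + s + 1 := by ring
      have h2 : y + 1 - s = y - s + 1 := by ring
      simp only [th10, h1, h2, theta10_add_one]; ring
    · have h1 : -y + s = -(y - s) := by ring
      have h2 : -y - s = -(y + s) := by ring
      simp only [th10, h1, h2, theta10_neg]; ring
    · have h1 : y + P.τ + s = y + s + P.τ := by ring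
      have h2 : y + P.τ - s = y - s + P.τ := by ring
      simp only [th10, h1, h2, theta10_add_tau]
      have h3 : exp (-2 * ((1 : ℕ) : ℂ) * Real.pi * I * (2 * y + P.τ)) =
          exp (-Real.pi * I * (2 * (y + s) + P.τ)) *
            exp (-Real.pi * I * (2 * (y - s) + P.τ)) := by
        rw [← Complex.exp_add]; congr 1; push_cast; ring
      rw [h3]; ring⟩

/-- `s_0, …, s_3`. -/
def sFun (a : Fin 4) (y : ℂ) : ℂ := ![1, 1, I, 1] a * thIdx P a P.η * thIdx P a (2 * y)

/-- `T` is the action of the generator `S^a` in the spin `l = d / 2` representation: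
`θ_{11}(2 y) (T f)(y) = s_a(y - l η) f(y + η) - s_a(-y - l η) f(y - η)`. -/
def IsSklyanin (d : ℕ) (a : Fin 4) (T : Module.End ℂ (V P d)) : Prop :=
  ∀ (f : V P d) (y : ℂ), th11 P (2 * y) * (T f : ℂ → ℂ) y =
    sFun P a (y - d / 2 * P.η) * (f : ℂ → ℂ) (y + P.η) -
      sFun P a (-y - d / 2 * P.η) * (f : ℂ → ℂ) (y - P.η)

open Classical in
/-- The operator `ρ^l(S^a)` on `V^l`, `l = d / 2`: the unique endomorphism that is given by the
difference operator of `IsSklyanin`. -/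
def rho (d : ℕ) (a : Fin 4) : Module.End ℂ (V P d) :=
  if h : ∃ T, IsSklyanin P d a T then h.choose else 0

/-- The coefficients `W_a^L(u)` of the `L` operator. -/
def WL (a : Fin 4) (u : ℂ) : ℂ := thIdx P a u / (2 * th11 P (2 * P.η) * thIdx P a P.η)

/-- Pauli matrices. -/
def pauli : Fin 4 → Matrix (Fin 2) (Fin 2) ℂ :=
  ![!![1, 0; 0, 1], !![0, 1; 1, 0], !![0, -I; I, 0], !![1, 0; 0, -1]]

/-! ### Intertwining vectors, path vectors, Bethe vectors -/

/-- The outgoing intertwining vector `φ^{(l)}_{λ,λ'}(u)`, `l = d / 2`, `λ - λ' = 4 m η`, where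
`k = l + m`: the product of `θ_{10}(y + s) θ_{10}(y - s)` over
`s = (λ + u)/2 - (2 j - l - 1) η`, `1 ≤ j ≤ l + m`, and
`s = (λ' - u)/2 - (2 j - l - 1) η`, `1 ≤ j ≤ l - m`. -/
def intVec (d k : ℕ) (lam lam' u : ℂ) : V P d :=
  prodV P fun i : Fin d =>
    if (i : ℕ) < k then
      halfVec P ((lam + u) / 2 - (2 * (((i : ℕ) : ℂ) + 1) - d / 2 - 1) * P.η)
    else
      halfVec P ((lam' - u) / 2 - (2 * (((i : ℕ) : ℂ) - k + 1) - d / 2 - 1) * P.η)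

/-- The pair `(a, b)` of consecutive labels satisfies `a - b ∈ {-2l, -2l + 2, …, 2l}`, `d = 2l`. -/
def Admissible (d : ℕ) (a b : ℤ) : Prop := ∃ k : ℕ, k ≤ d ∧ a - b = 2 * k - d

/-- `φ^{(l)}_{λ_a, λ_b}(u)` for an admissible pair `(a, b)`; here `l + m = (d + a - b) / 2`. -/
def stepVec (d : ℕ) (a b : ℤ) (u : ℂ) : V P d :=
  intVec P d ((d + a - b) / 2).toNat (lamAt P a) (lamAt P b) u

variable {N : ℕ} (d : Fin N → ℕ)

/-- The state space `V^{l_1} ⊗ ⋯ ⊗ V^{l_N}`, `d n = 2 l_n`. -/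
abbrev H : Type := PiTensorProduct ℂ fun n : Fin N => V P (d n)

/-- Path vectors for a chain whose site `n` stands at position `pos n` (counted from `0`):
site `n` carries `φ_{λ_a, λ_b}(z_n)` where `a`, `b` are the labels to the left and to the right of
that position. The tensor factors are kept in their original order. For `pos n = n` this is
the vector `|a_0, …, a_N; z_1, …, z_N⟩`. -/
def pathVecAt (pos : Fin N → ℕ) (a : ℕ → ℤ) (z : Fin N → ℂ) : H P d :=
  PiTensorProduct.tprod ℂ fun n => stepVec P (d n) (a (pos n)) (a (pos n + 1)) (z n)

def AdmissibleAt (pos : Fin N → ℕ) (a : ℕ → ℤ) : Prop :=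
  ∀ n, Admissible (d n) (a (pos n)) (a (pos n + 1))

/-- The labels `a_0 = a`, `a_j = a + 2 (l_1 + ⋯ + l_j)` of the pseudo-vacuum. -/
def vacLabels (a : ℤ) (j : ℕ) : ℤ := a + ∑ n : Fin N, if (n : ℕ) < j then (d n : ℤ) else 0

/-- The global pseudo-vacuum `Ω_a(z_1, …, z_N)`. -/
def pseudoVac (a : ℤ) (z : Fin N → ℂ) : H P d :=
  pathVecAt P d (fun n => (n : ℕ)) (vacLabels d a) z

/-- Functions `ν ↦ f(ν)` on `ℤ / r ℤ` with values in the state space. -/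
abbrev HFun : Type := ZMod P.r → H P d

/-- The character `e^{2 π i a ν η}` of `ν ∈ ℤ / r ℤ`. -/
def wave (a : ℤ) (ν : ZMod P.r) : ℂ := exp (2 * Real.pi * I * a * (ν.val : ℂ) * P.η)

/-- The function `ν ↦ e^{2 π i a ν η} v`. -/
def waveVec (a : ℤ) (v : H P d) : HFun P d := fun ν => wave P a ν • v

/-- The space of Bethe vectors: the span of all `e^{2 π i a ν η} |a_0, …, a_N; z_1, …, z_N⟩` with
`(a_0, …, a_N)` admissible and `a_0 = a_N = a`. -/
def betheSpace (z : Fin N → ℂ) : Submodule ℂ (HFun P d) :=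
  Submodule.span ℂ {f | ∃ a : ℕ → ℤ, AdmissibleAt d (fun n => (n : ℕ)) a ∧ a N = a 0 ∧
    f = waveVec P d (a 0) (pathVecAt P d (fun n => (n : ℕ)) a z)}

/-! ### The R matrix, by fusion -/

/-- The normalized coefficient of `ρ^{1/2}(S^a) ⊗ ρ^{l}(S^a)` in `R^{1/2, l}(u)`, `l = d / 2`. -/
def RCoef (d : ℕ) (a : Fin 4) (u : ℂ) : ℂ :=
  WL P a (u + P.η) / th11 P (u + (d + 1) * P.η)

/-- `T` is the operator `R^{l_j, l_k}_{j,k}(u)` on the state space. It acts on the `j`-th and the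
`k`-th tensor factors. The space `V^{l_j}` is the quotient of `(V^{1/2})^{⊗ 2 l_j}` by
the multiplication map `g_1 ⊗ ⋯ ⊗ g_{2 l_j} ↦ g_1 ⋯ g_{2 l_j}`, and
`R^{l_j, l_k}(u)` is induced on that quotient by the product
`R_{2 l_j}(u + (2 l_j - 1) η) ⋯ R_2(u - (2 l_j - 3) η) R_1(u - (2 l_j - 1) η)` of the matrices
`R^{1/2, l_k}(u) = ∑_a RCoef_a(u) ρ^{1/2}(S^a) ⊗ ρ^{l_k}(S^a)`. -/
def IsFusedR (j k : Fin N) (u : ℂ) (T : Module.End ℂ (H P d)) : Prop :=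
  ∀ (v : ∀ n, V P (d n)) (g : Fin (d j) → V P 1),
    T (PiTensorProduct.tprod ℂ (Function.update v j (prodV P g))) =
      ∑ w : Fin (d j) → Fin 4,
        (∏ i, RCoef P (d k) (w i) (u + (2 * ((i : ℕ) : ℂ) + 1 - d j) * P.η)) •
          PiTensorProduct.tprod ℂ
            (Function.update
              (Function.update v j (prodV P fun i => rho P 1 (w i) (g i)))
              k ((List.ofFn fun i => rho P (d k) (w i)).reverse.prod (v k)))

open Classical in
/-- The operator `R^{l_j, l_k}_{j,k}(u)` on the state space. -/
def Rop (j k : Fin N) (u : ℂ) : Module.End ℂ (H P d) :=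
  if h : ∃ T, IsFusedR P d j k u T then h.choose else 0

/-- The action of an operator on functions of `ν`, pointwise in `ν`. -/
def lift (T : Module.End ℂ (H P d)) : Module.End ℂ (HFun P d) := T.compLeft (ZMod P.r)

/-! ### The boundary operator and the system of difference equations -/

/-- `z_j = (z_1, …, z_j + κ, …, z_N)`. -/
def shiftZ (z : Fin N → ℂ) (j : Fin N) : Fin N → ℂ := Function.update z j (z j + P.κ)

/-- Positions in the chain `(1, …, j-1, j+1, …, N, j)`. -/
def posLast (j n : Fin N) : ℕ :=
  if n < j then (n : ℕ) else if n = j then N - 1 else (n : ℕ) - 1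

/-- Positions in the chain `(j, 1, …, j-1, j+1, …, N)`. -/
def posFirst (j n : Fin N) : ℕ :=
  if n < j then (n : ℕ) + 1 else if n = j then 0 else (n : ℕ)

/-- The labels `(a_{N-1}, a_0, …, a_{N-1})`. -/
def rotLabels (N : ℕ) (a : ℕ → ℤ) (k : ℕ) : ℤ := if k = 0 then a (N - 1) else a (k - 1)

/-- `T` is (an extension to all functions of `ν` of) the boundary operator `Z^{(j)}(κ, c)`,
which is defined on the space of Bethe vectors of the chain `(1, …, j-1, j+1, …, N, j)` by
`e^{2πi a_N ν η} |a_0, …, a_N; z_1, …, z_N, z_j⟩ ↦`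
`e^{2πi a_{N-1} ν η} e^{c (a_N - a_{N-1} - 2 l_j)} |a_{N-1}, a_0, …, a_{N-1}; z_j + κ, z_1, …, z_N⟩`
for all admissible `(a_0, …, a_N)` with `a_0 = a_N`. -/
def IsBoundary (z : Fin N → ℂ) (j : Fin N) (T : Module.End ℂ (HFun P d)) : Prop :=
  ∀ a : ℕ → ℤ, AdmissibleAt d (posLast j) a → a N = a 0 →
    T (waveVec P d (a N) (pathVecAt P d (posLast j) a z)) =
      exp (P.c * ((a N : ℂ) - a (N - 1) - d j)) •
        waveVec P d (a (N - 1)) (pathVecAt P d (posFirst j) (rotLabels N a) (shiftZ P z j))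

open Classical in
/-- The boundary operator `Z^{(j)}(κ, c)`. -/
def Zop (z : Fin N → ℂ) (j : Fin N) : Module.End ℂ (HFun P d) :=
  if h : ∃ T, IsBoundary P d z j T then h.choose else 0

/-- The operator
`A_j(z) = R_{j,j-1}(z_j + κ - z_{j-1}) ⋯ R_{j,1}(z_j + κ - z_1) Z^{(j)}`
`R_{j,N}(z_j - z_N) ⋯ R_{j,j+1}(z_j - z_{j+1})`. -/
def Aop (z : Fin N → ℂ) (j : Fin N) : Module.End ℂ (HFun P d) :=
  (((List.finRange N).filter (· < j)).reverse.map
      fun k => lift P d (Rop P d j k (z j + P.κ - z k))).prod *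
    Zop P d z j *
    (((List.finRange N).filter (j < ·)).reverse.map
      fun k => lift P d (Rop P d j k (z j - z k))).prod

/-! ### Monodromy matrix and Bethe vectors -/

/-- The operator that acts as `T` on the `n`-th tensor factor. -/
def site (n : Fin N) (T : Module.End ℂ (V P (d n))) : Module.End ℂ (H P d) :=
  PiTensorProduct.map (Function.update (fun _ => LinearMap.id) n T)

/-- `L_n^{l_n}(u) = ∑_a W_a^L(u) σ^a ⊗ ρ_n^{l_n}(S^a)`. -/
def Lop (n : Fin N) (u : ℂ) : Matrix (Fin 2) (Fin 2) (Module.End ℂ (H P d)) :=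
  fun i j => ∑ a, (WL P a u * pauli a i j) • site P d n (rho P (d n) a)

/-- The monodromy matrix `L_N(u - z_N) ⋯ L_1(u - z_1)`. -/
def monodromy (u : ℂ) (z : Fin N → ℂ) : Matrix (Fin 2) (Fin 2) (Module.End ℂ (H P d)) :=
  (List.ofFn fun n => Lop P d n (u - z n)).reverse.prod

/-- The matrix `M_λ(u)` of the gauge transformation. -/
def gauge (lam u : ℂ) : Matrix (Fin 2) (Fin 2) ℂ :=
  !![-theta 0 1 ((lam - u) / 2) (P.τ / 2), -theta 0 1 ((lam + u) / 2) (P.τ / 2);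
     theta 0 0 ((lam - u) / 2) (P.τ / 2), theta 0 0 ((lam + u) / 2) (P.τ / 2)] *
  !![1, 0; 0, (th11 P lam)⁻¹]

/-- The twisted monodromy matrix `M_λ(u)⁻¹ T(u) M_λ'(u)`. -/
def twistedMonodromy (lam lam' u : ℂ) (z : Fin N → ℂ) :
    Matrix (Fin 2) (Fin 2) (Module.End ℂ (H P d)) :=
  ((gauge P lam u)⁻¹).map (algebraMap ℂ (Module.End ℂ (H P d))) * monodromy P d u z *
    (gauge P lam' u).map (algebraMap ℂ (Module.End ℂ (H P d)))

/-- The operator `B_{a,a'}(u; z_N, …, z_1)`. -/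
def Bop (a a' : ℤ) (u : ℂ) (z : Fin N → ℂ) : Module.End ℂ (H P d) :=
  twistedMonodromy P d (lamAt P a) (lamAt P a') u z 0 1

/-- The vector `Ψ(t)`, as a function of `ν`. -/
def Psi {M : ℕ} (z : Fin N → ℂ) (t : Fin M → ℂ) : HFun P d := fun ν =>
  ∑ a ∈ Finset.range P.r, wave P a ν •
    (List.ofFn fun i : Fin M =>
      Bop P d ((a : ℤ) + ((i : ℕ) + 1)) ((a : ℤ) - ((i : ℕ) + 1)) (t i) z).prod
      (pseudoVac P d ((a : ℤ) - M) z)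

/-! ### The scalar factor and its difference equations -/

/-- `α^l(u) = θ_{11}(u + 2 l η) / θ_{11}(2 η)`, `l = d / 2`. -/
def alphaL (d : ℕ) (u : ℂ) : ℂ := th11 P (u + d * P.η) / th11 P (2 * P.η)

/-- `δ^l(u) = θ_{11}(u - 2 l η) / θ_{11}(2 η)`, `l = d / 2`. -/
def deltaL (d : ℕ) (u : ℂ) : ℂ := th11 P (u - d * P.η) / th11 P (2 * P.η)

/-- `α(u) = θ_{11}(u - 2 η) / θ_{11}(u)`. -/
def alphaFun (u : ℂ) : ℂ := th11 P (u - 2 * P.η) / th11 P u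

/-- `F` is a meromorphic solution of `F(t + κ) = δ^l(t) / α^l(t + κ) F(t)`. -/
def IsSolF (d : ℕ) (F : ℂ → ℂ) : Prop :=
  Meromorphic F ∧ ∀ᶠ t in Filter.codiscrete ℂ,
    F (t + P.κ) = deltaL P d t / alphaL P d (t + P.κ) * F t

/-- `Φ` is a meromorphic solution of `Φ(t + κ) = α(-t) / α(t + κ) Φ(t)`. -/
def IsSolPhi (Φ : ℂ → ℂ) : Prop :=
  Meromorphic Φ ∧ ∀ᶠ t in Filter.codiscrete ℂ,
    Φ (t + P.κ) = alphaFun P (-t) / alphaFun P (t + P.κ) * Φ t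

/-- The function `φ(z | t)`. -/
def phiFun {M : ℕ} (F : ℕ → ℂ → ℂ) (Φ : ℂ → ℂ) (z : Fin N → ℂ) (t : Fin M → ℂ) : ℂ :=
  exp (-2 * P.c / P.κ * ∑ i, t i) *
    (∏ i, ∏ j ∈ Finset.Ioi i, Φ (t i - t j)) *
    ∏ j, ∏ n, F (d n) (t j - z n)

/-! ### Cycles and Jackson sums -/

/-- `C` is a subset of `x + κ ℤ^M` and a cycle with step `κ` for the function `g`: the sum of
`g(t + n κ)` over `t ∈ C` converges for every `n ∈ ℤ^M`, and it does not depend on `n`. -/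
def IsCycle {M : ℕ} (κ : ℂ) (x : Fin M → ℂ) (C : Set (Fin M → ℂ)) (g : (Fin M → ℂ) → ℂ) : Prop :=
  (∀ t ∈ C, ∃ m : Fin M → ℤ, t = fun i => x i + m i * κ) ∧
  ∃ s : ℂ, ∀ n : Fin M → ℤ, HasSum (fun t : C => g fun i => (t : Fin M → ℂ) i + n i * κ) s

/-- `Φ(s) / θ_{11}(s)`, with its limit at the removable singularities. -/
def divTheta (Φ : ℂ → ℂ) (s : ℂ) : ℂ :=
  if th11 P s = 0 then deriv Φ s / deriv (th11 P) s else Φ s / th11 P s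

/-- The function `φ(z | t) w(t)`, where `w` is the theta monomial
`∏_{i<j} θ_{11}(t_i - t_j + 2 σ_{ij} η) / θ_{11}(t_i - t_j) ·`
`∏_i (θ_{11}(t_i - z_{π(i)} + λ° + k_i η) ∏_{n ≠ π(i)} θ_{11}(t_i - z_n + 2 ε_{in} l_n η))`,
with `π : {1, …, M} → {1, …, N}`, `k_i ∈ ℤ`, `ε_{in} = ±1` and `σ_{ij} ∈ {-1, 0, 1}`. -/
def weightTerm {M : ℕ} (F : ℕ → ℂ → ℂ) (Φ : ℂ → ℂ) (z : Fin N → ℂ)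
    (π : Fin M → Fin N) (k : Fin M → ℤ) (ε : Fin M → Fin N → ℤˣ) (σ : Fin M → Fin M → SignType)
    (t : Fin M → ℂ) : ℂ :=
  exp (-2 * P.c / P.κ * ∑ i, t i) *
    (∏ i, ∏ j ∈ Finset.Ioi i,
      th11 P (t i - t j + 2 * ((σ i j : ℤ) : ℂ) * P.η) * divTheta P Φ (t i - t j)) *
    (∏ j, ∏ n, F (d n) (t j - z n)) *
    ∏ i, (th11 P (t i - z (π i) + P.lam + k i * P.η) *
      ∏ n ∈ Finset.univ.erase (π i), th11 P (t i - z n + ((ε i n : ℤ) : ℂ) * d n * P.η))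

/-- `v` is the sum of the vectors `g t`, `t ∈ C`, in the finite-dimensional state space:
the sum converges absolutely to `v` in every coordinate. -/
def IsJacksonSum {M : ℕ} (C : Set (Fin M → ℂ)) (g : (Fin M → ℂ) → H P d) (v : H P d) : Prop :=
  ∀ ξ : Module.Dual ℂ (H P d), HasSum (fun t : C => ξ (g t)) (ξ v)

open Classical in
/-- `f(z) = ∑_{t ∈ C} φ(z | t) Ψ(t)`, as a function of `ν` (with the value `0` where the sum
diverges). -/
def fSol {M : ℕ} (F : ℕ → ℂ → ℂ) (Φ : ℂ → ℂ) (C : Set (Fin M → ℂ)) (z : Fin N → ℂ) :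
    HFun P d := fun ν =>
  if h : ∃ v, IsJacksonSum P d C (fun t => phiFun P d F Φ z t • Psi P d z t ν) v
  then h.choose else 0

/-! ### Explicit solutions -/

/-- `(x; p)_∞`. -/
def poch (x p : ℂ) : ℂ := ∏' m : ℕ, (1 - p ^ m * x)

/-- `(x; p, q)_∞`. -/
def poch2 (x p q : ℂ) : ℂ := ∏' m : ℕ × ℕ, (1 - p ^ m.1 * q ^ m.2 * x)

/-- `e(x) = exp (2 π i x)`. -/
def expo (x : ℂ) : ℂ := exp (2 * Real.pi * I * x)

/-- The infinite product for `F^l(t)`, `l = d / 2`, with `p = e(τ)`, `q = e(κ)`. -/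
def FProd (d : ℕ) (t : ℂ) : ℂ :=
  exp (-2 * Real.pi * I * d * P.η * t / P.κ - Real.pi * I * t) *
    (poch2 (expo P.κ * expo (-t + d * P.η)) (expo P.τ) (expo P.κ) /
      poch2 (expo (-t - d * P.η)) (expo P.τ) (expo P.κ)) *
    (poch2 (expo P.τ * expo P.κ * expo (t + d * P.η)) (expo P.τ) (expo P.κ) /
      poch2 (expo P.τ * expo (t - d * P.η)) (expo P.τ) (expo P.κ))

/-- The infinite product for `Φ(t)`, with `p = e(τ)`, `q = e(κ)`. -/
def PhiProd (t : ℂ) : ℂ :=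
  exp (4 * Real.pi * I * P.η * t / P.κ) *
    poch (expo (-t)) (expo P.τ) * poch (expo P.τ * expo t) (expo P.τ) *
    (poch2 (expo P.κ * expo (-t - 2 * P.η)) (expo P.τ) (expo P.κ) /
      poch2 (expo (-t + 2 * P.η)) (expo P.τ) (expo P.κ)) *
    (poch2 (expo P.τ * expo P.κ * expo (t - 2 * P.η)) (expo P.τ) (expo P.κ) /
      poch2 (expo P.τ * expo (t + 2 * P.η)) (expo P.τ) (expo P.κ))

end EllipticKZ

end

open Complex

noncomputable section

namespace EllipticKZ

local notation "pureTensor" => PiTensorProduct.tprod ℂ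

section

/-! ### Elementary properties of theta functions -/

/-- The general term of the theta series. -/
def thetaTerm (a b z τ : ℂ) (n : ℤ) : ℂ :=
  exp (Real.pi * I * (a / 2 + n) ^ 2 * τ + 2 * Real.pi * I * (a / 2 + n) * (b / 2 + z))

lemma theta_eq_tsum (a b z τ : ℂ) : theta a b z τ = ∑' n : ℤ, thetaTerm a b z τ n := rfl

lemma summable_thetaTerm (a b z : ℂ) {τ : ℂ} (hτ : 0 < τ.im) :
    Summable (thetaTerm a b z τ) := by
  have h : thetaTerm a b z τ = fun n : ℤ =>
      exp (Real.pi * I * a ^ 2 / 4 * τ + Real.pi * I * a * (b / 2 + z)) *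
        jacobiTheta₂_term n (z + b / 2 + a * τ / 2) τ := by
    funext n
    rw [thetaTerm, jacobiTheta₂_term, ← Complex.exp_add]
    congr 1
    ring
  rw [h]
  exact ((summable_jacobiTheta₂_term_iff _ _).2 hτ).mul_left _

lemma exp_two_pi_I_int (n : ℤ) : exp (2 * Real.pi * I * n) = 1 := by
  rw [Complex.exp_eq_one_iff]; exact ⟨n, by ring⟩

lemma theta_zero_add_two (b z τ : ℂ) : theta 0 (b + 2) z τ = theta 0 b z τ := by
  rw [theta, theta]
  refine tsum_congr fun n => ?_
  rw [← mul_one (exp (_ + 2 * Real.pi * I * (0 / 2 + n) * (b / 2 + z))), ← exp_two_pi_I_int n,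
    ← Complex.exp_add]
  congr 1; ring

lemma theta_one_add_two (b z τ : ℂ) : theta 1 (b + 2) z τ = -theta 1 b z τ := by
  rw [theta, theta, ← tsum_neg]
  refine tsum_congr fun n => ?_
  have h : exp (2 * Real.pi * I * n + Real.pi * I) = -1 := by
    rw [Complex.exp_add, exp_two_pi_I_int, Complex.exp_pi_mul_I]; ring
  rw [← mul_neg_one, ← h, ← Complex.exp_add]
  congr 1; ring

lemma theta_add_half (a b z τ : ℂ) : theta a b (z + 1 / 2) τ = theta a (b + 1) z τ := by
  rw [theta, theta]
  refine tsum_congr fun n => ?_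
  congr 1; ring

lemma theta_neg (b z τ : ℂ) : theta 0 b (-z) τ = theta 0 (-b) z τ := by
  rw [theta, theta, ← (Equiv.neg ℤ).tsum_eq]
  refine tsum_congr fun n => ?_
  congr 1; simp; ring

lemma theta_one_neg (b z τ : ℂ) : theta 1 b (-z) τ = theta 1 (-b) z τ := by
  rw [theta, theta, ← (Equiv.subLeft (-1 : ℤ)).tsum_eq]
  refine tsum_congr fun n => ?_
  congr 1; simp; ring

lemma theta_add_tau (a b z τ : ℂ) :
    theta a b (z + τ) τ = exp (-Real.pi * I * (2 * z + b + τ)) * theta a b z τ := by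
  rw [theta, theta, ← tsum_mul_left, ← (Equiv.addRight (1 : ℤ)).tsum_eq (fun n => _ * _)]
  refine tsum_congr fun n => ?_
  rw [← Complex.exp_add]
  congr 1; simp; ring

/-- The addition formula that expresses products of theta functions of modulus `τ / 2` in terms
of theta functions of modulus `τ`. -/
lemma theta_mul_theta (b b' x y : ℂ) {τ : ℂ} (hτ : 0 < τ.im) :
    theta 0 b x (τ / 2) * theta 0 b' y (τ / 2) =
      theta 0 (b + b') (x + y) τ * theta 0 (b - b') (x - y) τ +
        theta 1 (b + b') (x + y) τ * theta 1 (b - b') (x - y) τ := by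
  have hτ2 : 0 < (τ / 2).im := by
    have : (τ / 2).im = τ.im / 2 := by simp
    rw [this]; positivity
  have hsum := fun a b z => (summable_thetaTerm a b z hτ).norm
  have hsum2 := fun a b z => (summable_thetaTerm a b z hτ2).norm
  simp only [theta_eq_tsum]
  rw [tsum_mul_tsum_of_summable_norm (hsum2 _ _ _) (hsum2 _ _ _),
    tsum_mul_tsum_of_summable_norm (hsum _ _ _) (hsum _ _ _),
    tsum_mul_tsum_of_summable_norm (hsum _ _ _) (hsum _ _ _)]
  let e : (ℤ × ℤ) ⊕ (ℤ × ℤ) ≃ ℤ × ℤ :=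
    { toFun := Sum.elim (fun p => (p.1 + p.2, p.1 - p.2)) (fun p => (p.1 + p.2 + 1, p.1 - p.2))
      invFun := fun p => if (p.1 + p.2) % 2 = 0 then Sum.inl ((p.1 + p.2) / 2, (p.1 - p.2) / 2)
        else Sum.inr ((p.1 + p.2) / 2, (p.1 - p.2) / 2)
      left_inv := by
        rintro (⟨p, q⟩ | ⟨p, q⟩)
        · have : (p + q + (p - q)) % 2 = 0 := by omega
          simp only [Sum.elim_inl, this, if_true, Sum.inl.injEq, Prod.mk.injEq]
          omega
        · have : ¬ (p + q + 1 + (p - q)) % 2 = 0 := by omega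
          simp only [Sum.elim_inr, this, if_false, Sum.inr.injEq, Prod.mk.injEq]
          omega
      right_inv := by
        rintro ⟨m, n⟩
        dsimp only
        split_ifs with h
        · simp only [Sum.elim_inl, Prod.mk.injEq]; omega
        · simp only [Sum.elim_inr, Prod.mk.injEq]; omega }
  have hs : Summable fun p : ℤ × ℤ => thetaTerm 0 b x (τ / 2) p.1 * thetaTerm 0 b' y (τ / 2) p.2 :=
    summable_mul_of_summable_norm (hsum2 _ _ _) (hsum2 _ _ _)
  rw [← e.tsum_eq, Summable.tsum_sum]
  · congr 1
    · refine tsum_congr fun p => ?_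
      simp only [e, Equiv.coe_fn_mk, Sum.elim_inl, thetaTerm, ← Complex.exp_add]
      congr 1; push_cast; ring
    · refine tsum_congr fun p => ?_
      simp only [e, Equiv.coe_fn_mk, Sum.elim_inr, thetaTerm, ← Complex.exp_add]
      congr 1; push_cast; ring
  · exact ((e.summable_iff.2 hs).comp_injective Sum.inl_injective)
  · exact ((e.summable_iff.2 hs).comp_injective Sum.inr_injective)

variable {P : Params}

lemma th11_neg (z : ℂ) : th11 P (-z) = -th11 P z := by
  have h := theta_one_add_two (-1) z P.τ
  norm_num at h
  rw [th11, th11, theta_one_neg, h]; simp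

lemma th11_sub_comm (x y : ℂ) : th11 P (x - y) = -th11 P (y - x) := by
  rw [← th11_neg, neg_sub]

lemma th11_zero : th11 P 0 = 0 := by
  have h := th11_neg (P := P) 0
  rw [neg_zero] at h
  exact self_eq_neg.1 h

lemma th11_add_one (z : ℂ) : th11 P (z + 1) = -th11 P z := by
  have : z + 1 = z + 1 / 2 + 1 / 2 := by ring
  rw [th11, this, theta_add_half, theta_add_half, add_assoc, one_add_one_eq_two, theta_one_add_two,
    th11]

lemma th11_sub_one (z : ℂ) : th11 P (z - 1) = -th11 P z := by
  have h := th11_add_one (P := P) (z - 1)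
  rw [sub_add_cancel] at h
  rw [h, neg_neg]

lemma th11_add_two_int (z : ℂ) (n : ℤ) : th11 P (z + 2 * n) = th11 P z := by
  induction n using Int.induction_on with
  | zero => simp
  | succ n ih =>
    have : z + 2 * ((n : ℤ) + 1 : ℤ) = z + 2 * (n : ℤ) + 1 + 1 := by push_cast; ring
    rw [this, th11_add_one, th11_add_one, ih, neg_neg]
  | pred n ih =>
    have : z + 2 * ((-n : ℤ) - 1 : ℤ) = z + 2 * (-n : ℤ) - 1 - 1 := by push_cast; ring
    rw [this, th11_sub_one, th11_sub_one, ih, neg_neg]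

lemma th11_add_tau (z : ℂ) :
    th11 P (z + P.τ) = -exp (-Real.pi * I * (2 * z + P.τ)) * th11 P z := by
  have h : -Real.pi * I * (2 * z + 1 + P.τ) =
      -Real.pi * I * (2 * z + P.τ) + -(Real.pi * I) := by ring
  rw [th11, theta_add_tau, h, Complex.exp_add, Complex.exp_neg (Real.pi * I), Complex.exp_pi_mul_I,
    th11]
  norm_num

lemma th11_differentiable : Differentiable ℂ (th11 P) := theta_differentiable 1 1 P.τ

lemma th11_continuous : Continuous (th11 P) := th11_differentiable.continuous

lemma th10_eq (z : ℂ) : th10 P z = -th11 P (z + 1 / 2) := by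
  have h := theta_one_add_two 0 z P.τ
  norm_num at h
  rw [th11, theta_add_half, one_add_one_eq_two, h, neg_neg, th10]

/-! ### The vectors `e(x)` in the plane -/

/-- The determinant of two vectors in the plane. -/
def dt (a b : Fin 2 → ℂ) : ℂ := a 0 * b 1 - a 1 * b 0

/-- The columns of the gauge matrix. -/
def ev (P : Params) (x : ℂ) : Fin 2 → ℂ :=
  ![-theta 0 1 x (P.τ / 2), theta 0 0 x (P.τ / 2)]

lemma ev_neg (x : ℂ) : ev P (-x) = ev P x := by
  have h := theta_zero_add_two (-1) x (P.τ / 2)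
  norm_num at h
  simp only [ev, theta_neg, neg_zero, h]

lemma ev_add_one (x : ℂ) : ev P (x + 1) = ev P x := by
  have h1 := theta_zero_add_two 0 x (P.τ / 2)
  have h2 := theta_zero_add_two 1 x (P.τ / 2)
  norm_num at h1 h2
  have : x + 1 = x + 1 / 2 + 1 / 2 := by ring
  rw [ev, this, theta_add_half, theta_add_half, theta_add_half, theta_add_half]
  norm_num
  rw [h1, h2, ev]

lemma ev_add_half (x : ℂ) :
    ev P (x + 1 / 2) = ![-theta 0 0 x (P.τ / 2), theta 0 1 x (P.τ / 2)] := by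
  have h := theta_zero_add_two 0 x (P.τ / 2)
  norm_num at h
  rw [ev, theta_add_half, theta_add_half]
  norm_num
  exact h

lemma continuous_ev : Continuous (ev P) := by
  refine continuous_pi fun i => ?_
  fin_cases i
  · exact (theta_differentiable 0 1 (P.τ / 2)).continuous.neg
  · exact (theta_differentiable 0 0 (P.τ / 2)).continuous

lemma dt_self (a : Fin 2 → ℂ) : dt a a = 0 := by rw [dt]; ring

lemma dt_swap (a b : Fin 2 → ℂ) : dt a b = -dt b a := by rw [dt, dt]; ring

/-- Cramer's rule in the plane. -/
lemma dt_smul_eq (a b v : Fin 2 → ℂ) : dt a b • v = dt v b • a + dt a v • b := by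
  funext i
  fin_cases i <;> simp [dt] <;> ring

lemma dt_plucker (a b c d : Fin 2 → ℂ) :
    dt a b * dt c d - dt a c * dt b d + dt a d * dt b c = 0 := by
  simp only [dt]; ring

section products

variable (hτ : 0 < P.τ.im)
include hτ

lemma theta01_mul_theta01 (p q : ℂ) : theta 0 1 p (P.τ / 2) * theta 0 1 q (P.τ / 2) =
    thIdx P 2 (p + q) * thIdx P 2 (p - q) - thIdx P 1 (p + q) * thIdx P 1 (p - q) := by
  have h1 := theta_zero_add_two 0 (p + q) P.τ
  have h2 := theta_one_add_two 0 (p + q) P.τ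
  norm_num at h1 h2
  rw [theta_mul_theta _ _ _ _ hτ, one_add_one_eq_two, sub_self, h1, h2]
  simp [thIdx]; ring

lemma theta00_mul_theta00 (p q : ℂ) : theta 0 0 p (P.τ / 2) * theta 0 0 q (P.τ / 2) =
    thIdx P 2 (p + q) * thIdx P 2 (p - q) + thIdx P 1 (p + q) * thIdx P 1 (p - q) := by
  rw [theta_mul_theta _ _ _ _ hτ, add_zero, sub_self]
  simp [thIdx]

lemma theta01_mul_theta00 (p q : ℂ) : theta 0 1 p (P.τ / 2) * theta 0 0 q (P.τ / 2) =
    thIdx P 3 (p + q) * thIdx P 3 (p - q) + thIdx P 0 (p + q) * thIdx P 0 (p - q) := by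
  rw [theta_mul_theta _ _ _ _ hτ, add_zero, sub_zero]
  simp [thIdx]

lemma theta00_mul_theta01 (p q : ℂ) : theta 0 0 p (P.τ / 2) * theta 0 1 q (P.τ / 2) =
    thIdx P 3 (p + q) * thIdx P 3 (p - q) - thIdx P 0 (p + q) * thIdx P 0 (p - q) := by
  have h1 := theta_zero_add_two (-1) (p - q) P.τ
  have h2 := theta_one_add_two (-1) (p - q) P.τ
  norm_num at h1 h2
  rw [theta_mul_theta _ _ _ _ hτ, zero_add, zero_sub, ← h1, ← neg_eq_iff_eq_neg.2 h2]
  simp [thIdx]; ring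

lemma dt_ev (x y : ℂ) : dt (ev P x) (ev P y) = -2 * th11 P (x + y) * th11 P (x - y) := by
  have h1 := theta00_mul_theta01 hτ x y
  have h2 := theta01_mul_theta00 hτ x y
  have h0 : ∀ z, thIdx P 0 z = th11 P z := fun z => by simp [thIdx, th11]
  simp only [h0] at h1 h2
  simp only [dt, ev, Matrix.cons_val_zero, Matrix.cons_val_one]
  linear_combination h1 - h2

/-- The three-term identity of Weierstrass. -/
lemma th11_three_term (a b c d : ℂ) :
    th11 P (a + b) * th11 P (a - b) * (th11 P (c + d) * th11 P (c - d)) -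
      th11 P (a + c) * th11 P (a - c) * (th11 P (b + d) * th11 P (b - d)) +
      th11 P (a + d) * th11 P (a - d) * (th11 P (b + c) * th11 P (b - c)) = 0 := by
  have h := dt_plucker (ev P a) (ev P b) (ev P c) (ev P d)
  simp only [dt_ev hτ] at h
  linear_combination h / 4

/-- The signs in `s_a`. -/
lemma sum_thIdx_pauli (u w : ℂ) (i j : Fin 2) :
    ∑ a, ![1, 1, I, 1] a * thIdx P a u * thIdx P a w * pauli a i j =
      ev P ((u - w) / 2 + 1 / 2) i *
        (![-ev P ((u + w) / 2 + 1 / 2) 1, ev P ((u + w) / 2 + 1 / 2) 0] : Fin 2 → ℂ) j := by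
  have e1 : (u + w) / 2 + (u - w) / 2 = u := by ring
  have e2 : (u + w) / 2 - (u - w) / 2 = w := by ring
  have h1 := theta01_mul_theta01 hτ ((u + w) / 2) ((u - w) / 2)
  have h2 := theta00_mul_theta00 hτ ((u + w) / 2) ((u - w) / 2)
  have h3 := theta01_mul_theta00 hτ ((u + w) / 2) ((u - w) / 2)
  have h4 := theta00_mul_theta01 hτ ((u + w) / 2) ((u - w) / 2)
  rw [e1, e2] at h1 h2 h3 h4
  rw [ev_add_half, ev_add_half]
  fin_cases i <;> fin_cases j <;>
    simp only [Fin.sum_univ_four, pauli, Fin.zero_eta, Fin.mk_one, Matrix.cons_val_zero,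
      Matrix.cons_val_one, Matrix.cons_val, Matrix.of_apply]
  · linear_combination -h3
  · linear_combination -h2 - thIdx P 2 u * thIdx P 2 w * I_sq
  · linear_combination h1 + thIdx P 2 u * thIdx P 2 w * I_sq
  · linear_combination h4

end products

end

section

/-! ### Entire functions: divisibility, cancellation, quasi-periodicity -/

lemma dense_ne_zero {g : ℂ → ℂ} (hg : Differentiable ℂ g) (h : ∃ z, g z ≠ 0) :
    Dense {z | g z ≠ 0} := by
  obtain ⟨z₀, hz₀⟩ := h
  have ha : AnalyticOnNhd ℂ g Set.univ := fun z _ => hg.analyticAt z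
  rw [dense_iff_closure_eq, Set.eq_univ_iff_forall]
  intro z
  rw [mem_closure_iff_frequently]
  by_contra hcon
  rw [Filter.not_frequently] at hcon
  have h0 : g =ᶠ[nhds z] 0 := by
    filter_upwards [hcon] with w hw
    simpa using hw
  exact hz₀ (ha.eqOn_zero_of_preconnected_of_eventuallyEq_zero isPreconnected_univ
    (Set.mem_univ z) h0 (Set.mem_univ z₀))

lemma eq_of_mul_eq_mul {E : Type*} [AddCommGroup E] [Module ℂ E] [TopologicalSpace E] [T2Space E]
    {g : ℂ → ℂ} {h₁ h₂ : ℂ → E} (hg : Dense {z | g z ≠ 0})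
    (c₁ : Continuous h₁) (c₂ : Continuous h₂) (h : ∀ z, g z • h₁ z = g z • h₂ z) : h₁ = h₂ :=
  c₁.ext_on hg c₂ fun z hz => smul_right_injective E (show g z ≠ 0 from hz) (h z)

/-- An entire function that vanishes at the zeros of `g`, which are all simple, is divisible
by `g`. -/
lemma exists_entire_quotient {f g : ℂ → ℂ} (hf : Differentiable ℂ f) (hg : Differentiable ℂ g)
    (hs : ∀ z, g z = 0 → deriv g z ≠ 0) (h0 : ∀ z, g z = 0 → f z = 0) :
    ∃ h : ℂ → ℂ, Differentiable ℂ h ∧ ∀ z, f z = g z * h z := by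
  refine ⟨fun z => if g z = 0 then deriv f z / deriv g z else f z / g z, fun z => ?_, fun z => ?_⟩
  · by_cases hz : g z = 0
    · have hne : dslope g z z ≠ 0 := by rw [dslope_same]; exact hs z hz
      have hdg : DifferentiableAt ℂ (dslope g z) z :=
        ((Complex.differentiableOn_dslope Filter.univ_mem).2 hg.differentiableOn).differentiableAt
          Filter.univ_mem
      have hdf : DifferentiableAt ℂ (dslope f z) z :=
        ((Complex.differentiableOn_dslope Filter.univ_mem).2 hf.differentiableOn).differentiableAt
          Filter.univ_mem
      refine (hdf.div hdg hne).congr_of_eventuallyEq ?_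
      filter_upwards [hdg.continuousAt.eventually_ne hne] with w hw
      rcases eq_or_ne w z with rfl | hwz
      · simp [hz, dslope_same]
      · have e1 : g w = (w - z) * dslope g z w := by
          have := sub_smul_dslope g z w
          rw [hz, sub_zero, smul_eq_mul] at this; exact this.symm
        have e2 : f w = (w - z) * dslope f z w := by
          have := sub_smul_dslope f z w
          rw [h0 z hz, sub_zero, smul_eq_mul] at this; exact this.symm
        have hwz' : w - z ≠ 0 := sub_ne_zero.2 hwz
        have : g w ≠ 0 := by rw [e1]; exact mul_ne_zero hwz' hw
        rw [if_neg this, e1, e2, Pi.div_apply, mul_div_mul_left _ _ hwz']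
    · refine ((hf z).div (hg z) hz).congr_of_eventuallyEq ?_
      filter_upwards [(hg z).continuousAt.eventually_ne hz] with w hw
      rw [if_neg hw, Pi.div_apply]
  · by_cases hz : g z = 0
    · rw [h0 z hz, hz, zero_mul]
    · simp only [if_neg hz]; field_simp

lemma quasiperiodic_lattice {f : ℂ → ℂ} {τ k s s' : ℂ} (hs : s ≠ 0) (hs' : s' ≠ 0)
    (h1 : ∀ z, f (z + 1) = s * f z)
    (h2 : ∀ z, f (z + τ) = s' * exp (-k * Real.pi * I * (2 * z + τ)) * f z) (m n : ℤ) (z : ℂ) :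
    f (z + m + n * τ) = s ^ m * s' ^ n * exp (-k * Real.pi * I * (2 * n * z + n ^ 2 * τ)) * f z := by
  have hm : ∀ (m : ℤ) (z : ℂ), f (z + m) = s ^ m * f z := by
    intro m
    induction m using Int.induction_on with
    | zero => simp
    | succ m ih =>
      intro z
      rw [Int.cast_add, Int.cast_one, ← add_assoc, h1, ih, zpow_add_one₀ hs]; ring
    | pred m ih =>
      intro z
      have h := h1 (z + ((-m - 1 : ℤ) : ℂ))
      have e : z + ((-m - 1 : ℤ) : ℂ) + 1 = z + ((-m : ℤ) : ℂ) := by push_cast; ring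
      rw [e, ih] at h
      rw [zpow_sub_one₀ hs]
      field_simp
      linear_combination -h
  have hn : ∀ (n : ℤ) (z : ℂ), f (z + n * τ) =
      s' ^ n * exp (-k * Real.pi * I * (2 * n * z + n ^ 2 * τ)) * f z := by
    intro n
    induction n using Int.induction_on with
    | zero => simp
    | succ n ih =>
      intro z
      have e : z + ((n + 1 : ℤ) : ℂ) * τ = z + ((n : ℤ) : ℂ) * τ + τ := by push_cast; ring
      have e2 : -k * Real.pi * I * (2 * ((n + 1 : ℤ) : ℂ) * z + ((n + 1 : ℤ) : ℂ) ^ 2 * τ) =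
        -k * Real.pi * I * (2 * (z + ((n : ℤ) : ℂ) * τ) + τ) +
          -k * Real.pi * I * (2 * ((n : ℤ) : ℂ) * z + ((n : ℤ) : ℂ) ^ 2 * τ) := by push_cast; ring
      rw [e, h2, ih, zpow_add_one₀ hs', e2, Complex.exp_add]
      ring
    | pred n ih =>
      intro z
      have h := h2 (z + ((-n - 1 : ℤ) : ℂ) * τ)
      have e : z + ((-n - 1 : ℤ) : ℂ) * τ + τ = z + ((-n : ℤ) : ℂ) * τ := by push_cast; ring
      have e2 : -k * Real.pi * I * (2 * ((-n : ℤ) : ℂ) * z + ((-n : ℤ) : ℂ) ^ 2 * τ) =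
        -k * Real.pi * I * (2 * (z + ((-n - 1 : ℤ) : ℂ) * τ) + τ) +
          -k * Real.pi * I * (2 * ((-n - 1 : ℤ) : ℂ) * z + ((-n - 1 : ℤ) : ℂ) ^ 2 * τ) := by
        push_cast; ring
      rw [e, ih, e2, Complex.exp_add] at h
      rw [zpow_sub_one₀ hs']
      have hne := Complex.exp_ne_zero (-k * Real.pi * I * (2 * (z + ((-n - 1 : ℤ) : ℂ) * τ) + τ))
      apply mul_left_cancel₀ (mul_ne_zero hs' hne)
      rw [← h]
      field_simp
  rw [add_right_comm, hm, hn]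
  ring

/-- A doubly periodic entire function is constant. -/
lemma eq_of_doubly_periodic {h : ℂ → ℂ} (hd : Differentiable ℂ h) {τ : ℂ} (hτ : 0 < τ.im)
    (h1 : ∀ z, h (z + 1) = h z) (h2 : ∀ z, h (z + τ) = h z) (z w : ℂ) : h z = h w := by
  apply hd.apply_eq_apply_of_bounded
  have hper : ∀ (m n : ℤ) (z : ℂ), h (z + m + n * τ) = h z := fun m n z => by
    have := quasiperiodic_lattice (f := h) (τ := τ) (k := 0) one_ne_zero one_ne_zero
      (fun z => by rw [one_mul, h1]) (fun z => by simp [h2]) m n z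
    simpa using this
  have hK : IsCompact ((fun p : ℝ × ℝ => h (p.1 + p.2 * τ)) '' (Set.Icc 0 1 ×ˢ Set.Icc 0 1)) := by
    apply (isCompact_Icc.prod isCompact_Icc).image
    have := hd.continuous
    fun_prop
  refine hK.isBounded.subset ?_
  rintro _ ⟨z, rfl⟩
  let b : ℝ := z.im / τ.im
  let a : ℝ := z.re - b * τ.re
  have hz : z = a + b * τ := by
    apply Complex.ext
    · simp [a]
    · simp [b]; field_simp
  refine ⟨(Int.fract a, Int.fract b), ⟨⟨Int.fract_nonneg _, (Int.fract_lt_one _).le⟩,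
    ⟨Int.fract_nonneg _, (Int.fract_lt_one _).le⟩⟩, ?_⟩
  have := hper ⌊a⌋ ⌊b⌋ ((Int.fract a : ℝ) + (Int.fract b : ℝ) * τ)
  simp only
  rw [← this]
  congr 1
  rw [hz]
  have ea : (a : ℂ) = ((⌊a⌋ : ℤ) : ℂ) + ((Int.fract a : ℝ) : ℂ) := by
    exact_mod_cast (Int.floor_add_fract a).symm
  have eb : (b : ℂ) = ((⌊b⌋ : ℤ) : ℂ) + ((Int.fract b : ℝ) : ℂ) := by
    exact_mod_cast (Int.floor_add_fract b).symm
  rw [ea, eb]; ring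

/-! ### Infinite products -/

section tprod
variable {ι : Type*} {c : ι → ℂ}

lemma multipliable_one_sub_mul (hc : Summable c) (x : ℂ) : Multipliable fun i => 1 - c i * x := by
  have h := multipliable_one_add_of_summable (f := fun i => -(c i * x))
    (by simpa using (hc.mul_right x).norm)
  simpa only [sub_eq_add_neg] using h

lemma differentiable_tprod_one_sub_mul (hc : Summable c) :
    Differentiable ℂ fun x => ∏' i, (1 - c i * x) := by
  intro x₀
  have hb : DifferentiableOn ℂ (fun x => ∏' i, (1 - c i * x)) (Metric.ball 0 (‖x₀‖ + 1)) := by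
    have h := (hc.norm.mul_right (‖x₀‖ + 1)).hasProdLocallyUniformlyOn_one_add
      (f := fun i x => -(c i * x)) (K := Metric.ball (0 : ℂ) (‖x₀‖ + 1)) Metric.isOpen_ball
      (.of_forall fun i x hx => ?_) (fun i => by fun_prop)
    · simp only [← sub_eq_add_neg] at h
      exact h.differentiableOn (.of_forall fun _ => by
        simpa [Finset.prod_fn] using DifferentiableOn.finsetProd (fun _ _ => by fun_prop))
        Metric.isOpen_ball
    · rw [norm_neg, norm_mul]
      gcongr
      simpa using (Metric.mem_ball.1 hx).le
  exact hb.differentiableAt (Metric.isOpen_ball.mem_nhds (by simp))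

lemma tprod_one_sub_mul_ne_zero (hc : Summable c) {x : ℂ} (h : ∀ i, c i * x ≠ 1) :
    ∏' i, (1 - c i * x) ≠ 0 := by
  have := tprod_one_add_ne_zero_of_summable (f := fun i => -(c i * x))
    (fun i => by rw [← sub_eq_add_neg]; exact sub_ne_zero.2 (h i).symm)
    (by simpa using (hc.mul_right x).norm)
  simpa only [sub_eq_add_neg] using this

end tprod

lemma expo_add (x y : ℂ) : expo (x + y) = expo x * expo y := by
  rw [expo, expo, expo, ← Complex.exp_add]; congr 1; ring

lemma expo_ne_zero (x : ℂ) : expo x ≠ 0 := Complex.exp_ne_zero _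

lemma expo_zero : expo 0 = 1 := by simp [expo]

lemma expo_neg (x : ℂ) : expo (-x) = (expo x)⁻¹ := by
  rw [expo, expo, ← Complex.exp_neg]; congr 1; ring

lemma expo_int (n : ℤ) : expo n = 1 := exp_two_pi_I_int n

lemma expo_one : expo 1 = 1 := by simpa using expo_int 1

lemma expo_eq_one_iff (x : ℂ) : expo x = 1 ↔ ∃ n : ℤ, x = n := by
  rw [expo, Complex.exp_eq_one_iff]
  have h : (2 * Real.pi * I : ℂ) ≠ 0 := Complex.two_pi_I_ne_zero
  refine exists_congr fun n => ⟨fun e => ?_, fun e => by rw [e]; ring⟩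
  apply mul_left_cancel₀ h
  rw [e]; ring

lemma expo_nat_mul (n : ℕ) (x : ℂ) : expo (n * x) = expo x ^ n := by
  rw [expo, expo, ← Complex.exp_nat_mul]; congr 1; ring

lemma norm_expo_lt_one {x : ℂ} (hx : 0 < x.im) : ‖expo x‖ < 1 := by
  rw [expo, Complex.norm_exp, Real.exp_lt_one_iff]
  have : (2 * Real.pi * I * x).re = -(2 * Real.pi * x.im) := by simp
  rw [this]
  have := Real.pi_pos
  simp only [Left.neg_neg_iff]; positivity

lemma differentiable_expo : Differentiable ℂ expo := by unfold expo; fun_prop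

section poch
variable {p q : ℂ} (hp : ‖p‖ < 1)
include hp

lemma summable_pow : Summable fun m : ℕ => p ^ m := summable_geometric_of_norm_lt_one hp

lemma differentiable_poch : Differentiable ℂ fun x => poch x p :=
  differentiable_tprod_one_sub_mul (summable_pow hp)

lemma poch_eq (x : ℂ) : poch x p = (1 - x) * poch (p * x) p := by
  have h : Multipliable fun m : ℕ => 1 - p ^ (m + 1) * x :=
    (multipliable_one_sub_mul (summable_pow hp) (p * x)).congr fun m => by ring
  have h2 : poch (p * x) p = ∏' m : ℕ, (1 - p ^ (m + 1) * x) := tprod_congr fun m => by ring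
  have h3 := tprod_eq_zero_mul' (f := fun m : ℕ => 1 - p ^ m * x) h
  rw [h2, poch, h3, pow_zero, one_mul]

lemma poch_ne_zero {x : ℂ} (h : ∀ m : ℕ, p ^ m * x ≠ 1) : poch x p ≠ 0 :=
  tprod_one_sub_mul_ne_zero (summable_pow hp) h

variable (hq : ‖q‖ < 1)
include hq

lemma summable_pow_mul_pow : Summable fun m : ℕ × ℕ => p ^ m.1 * q ^ m.2 :=
  summable_mul_of_summable_norm (summable_pow hp).norm (summable_pow hq).norm

lemma differentiable_poch2 : Differentiable ℂ fun x => poch2 x p q :=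
  differentiable_tprod_one_sub_mul (summable_pow_mul_pow hp hq)

lemma poch2_eq (x : ℂ) : poch2 x p q = poch x p * poch2 (q * x) p q := by
  let e : ℕ ⊕ (ℕ × ℕ) ≃ ℕ × ℕ :=
    { toFun := Sum.elim (fun m => (m, 0)) (fun m => (m.1, m.2 + 1))
      invFun := fun m => if m.2 = 0 then Sum.inl m.1 else Sum.inr (m.1, m.2 - 1)
      left_inv := by rintro (m | m) <;> simp
      right_inv := by
        rintro ⟨m, n⟩
        rcases n with _ | n <;> simp }
  rw [poch2, ← e.tprod_eq, Multipliable.tprod_sum]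
  · congr 1
    · rw [poch]; refine tprod_congr fun m => ?_
      simp [e]
    · rw [poch2]; refine tprod_congr fun m => ?_
      simp only [e, Equiv.coe_fn_mk, Sum.elim_inr]; ring
  · have := multipliable_one_sub_mul (summable_pow hp) x
    refine this.congr fun m => by simp [e]
  · have := multipliable_one_sub_mul (summable_pow_mul_pow hp hq) (q * x)
    refine this.congr fun m => ?_
    simp only [e, Function.comp, Equiv.coe_fn_mk, Sum.elim_inr]; ring

omit hp hq in
lemma poch2_zero : poch2 0 p q = 1 := by simp [poch2]

end poch

/-! ### The product formula for `θ₁₁` and its zeros -/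

/-- The infinite product for `θ₁₁`, up to a constant. -/
def thetaProd (P : Params) (t : ℂ) : ℂ :=
  exp (Real.pi * I * t) * (poch (expo (-t)) (expo P.τ) * poch (expo P.τ * expo t) (expo P.τ))

variable {P : Params} (hτ : 0 < P.τ.im)
include hτ

lemma differentiable_thetaProd : Differentiable ℂ (thetaProd P) := by
  have h := differentiable_poch (norm_expo_lt_one hτ)
  have he := differentiable_expo
  have h1 : Differentiable ℂ fun t => poch (expo (-t)) (expo P.τ) :=
    h.comp (he.comp differentiable_neg)
  have h2 : Differentiable ℂ fun t => poch (expo P.τ * expo t) (expo P.τ) :=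
    h.comp (he.const_mul _)
  unfold thetaProd
  fun_prop

omit hτ in
lemma thetaProd_add_one (t : ℂ) : thetaProd P (t + 1) = -1 * thetaProd P t := by
  have e1 : expo (-(t + 1)) = expo (-t) := by
    rw [neg_add, expo_add, expo_neg 1, expo_one]; simp
  have e2 : expo (t + 1) = expo t := by rw [expo_add, expo_one, mul_one]
  rw [thetaProd, e1, e2, mul_add, Complex.exp_add, mul_one, Complex.exp_pi_mul_I, thetaProd]; ring

lemma thetaProd_add_tau (t : ℂ) :
    thetaProd P (t + P.τ) = -1 * exp (-1 * Real.pi * I * (2 * t + P.τ)) * thetaProd P t := by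
  have hp := norm_expo_lt_one hτ
  set p := expo P.τ with hpdef
  have hp0 : p ≠ 0 := expo_ne_zero _
  have ht0 : expo t ≠ 0 := expo_ne_zero _
  have e1 : expo (-(t + P.τ)) = p⁻¹ * expo (-t) := by rw [neg_add, expo_add, expo_neg P.τ]; ring
  have e2 : expo (t + P.τ) = p * expo t := by rw [expo_add]; ring
  have f1 := poch_eq hp (p⁻¹ * expo (-t))
  have f2 := poch_eq hp (p * expo t)
  have e3 : p * (p⁻¹ * expo (-t)) = expo (-t) := by field_simp
  rw [e3] at f1
  have key : poch (p⁻¹ * expo (-t)) p * poch (p * (p * expo t)) p =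
      -(p⁻¹ * expo (-t)) * (poch (expo (-t)) p * poch (p * expo t) p) := by
    rw [f1, f2, expo_neg]; field_simp; ring
  have e4 : exp (-1 * Real.pi * I * (2 * t + P.τ)) * exp (Real.pi * I * t) =
      exp (Real.pi * I * (t + P.τ)) * (p⁻¹ * expo (-t)) := by
    rw [hpdef, ← expo_neg, expo, expo, ← Complex.exp_add, ← Complex.exp_add, ← Complex.exp_add]
    congr 1; ring
  rw [thetaProd, e1, e2, key, thetaProd]
  linear_combination (poch (expo (-t)) p * poch (p * expo t) p) * e4

lemma thetaProd_eq_zero {t : ℂ} (h : thetaProd P t = 0) : ∃ m n : ℤ, t = m + n * P.τ := by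
  have hp := norm_expo_lt_one hτ
  rw [thetaProd, mul_eq_zero, or_iff_right (Complex.exp_ne_zero _), mul_eq_zero] at h
  rcases h with h | h
  · by_contra hcon
    refine poch_ne_zero hp (fun k hk => hcon ?_) h
    rw [← expo_nat_mul, ← expo_add, expo_eq_one_iff] at hk
    obtain ⟨n, hn⟩ := hk
    exact ⟨-n, k, by push_cast; linear_combination -hn⟩
  · by_contra hcon
    refine poch_ne_zero hp (fun k hk => hcon ?_) h
    rw [← expo_nat_mul, ← expo_add, ← expo_add, expo_eq_one_iff] at hk
    obtain ⟨n, hn⟩ := hk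
    exact ⟨n, -k - 1, by push_cast; linear_combination hn⟩

omit hτ in
lemma deriv_ne_zero_of_quasiperiodic {f : ℂ → ℂ} (hf : Differentiable ℂ f)
    (h1 : ∀ z, f (z + 1) = -1 * f z)
    (h2 : ∀ z, f (z + P.τ) = -1 * exp (-1 * Real.pi * I * (2 * z + P.τ)) * f z)
    (h0 : f 0 = 0) (hd : deriv f 0 ≠ 0) (m n : ℤ) : deriv f (m + n * P.τ) ≠ 0 := by
  have hq := quasiperiodic_lattice (f := f) (τ := P.τ) (k := 1) (neg_ne_zero.2 one_ne_zero)
    (neg_ne_zero.2 one_ne_zero) h1 h2 m n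
  have hD : HasDerivAt (fun z => f (z + m + n * P.τ)) (deriv f (m + n * P.τ)) 0 := by
    have h := ((hf (0 + (m + n * P.τ))).hasDerivAt).comp_add_const 0 (m + n * P.τ)
    simpa [add_assoc] using h
  have hc : DifferentiableAt ℂ (fun z : ℂ => (-1 : ℂ) ^ m * (-1) ^ n *
      exp (-1 * Real.pi * I * (2 * n * z + n ^ 2 * P.τ))) 0 := by fun_prop
  have hD2 := hc.hasDerivAt.mul (hf 0).hasDerivAt
  have hE : (fun z => f (z + m + n * P.τ)) = (fun z : ℂ => (-1 : ℂ) ^ m * (-1) ^ n *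
      exp (-1 * Real.pi * I * (2 * n * z + n ^ 2 * P.τ))) * f := by
    funext z; simp only [Pi.mul_apply]; rw [hq]
  rw [hE] at hD
  rw [hD.unique hD2, h0, mul_zero, zero_add]
  refine mul_ne_zero (mul_ne_zero (mul_ne_zero ?_ ?_) (Complex.exp_ne_zero _)) hd <;>
    exact zpow_ne_zero _ (by norm_num)

omit hτ in
lemma thetaProd_zero : thetaProd P 0 = 0 := by
  have : poch (1 : ℂ) (expo P.τ) = 0 := by
    rw [poch]; exact tprod_of_exists_eq_zero ⟨0, by simp⟩
  simp [thetaProd, expo_zero, this]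

lemma deriv_thetaProd_zero : deriv (thetaProd P) 0 ≠ 0 := by
  have hp := norm_expo_lt_one hτ
  let G : ℂ → ℂ := fun t => exp (Real.pi * I * t) *
    (poch (expo P.τ * expo (-t)) (expo P.τ) * poch (expo P.τ * expo t) (expo P.τ))
  have hE : thetaProd P = (fun t => 1 - expo (-t)) * G := by
    funext t
    simp only [Pi.mul_apply, G]
    rw [thetaProd, poch_eq hp (expo (-t))]; ring
  have h := differentiable_poch hp
  have he := differentiable_expo
  have h1 : Differentiable ℂ fun t => poch (expo P.τ * expo (-t)) (expo P.τ) :=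
    h.comp ((he.comp differentiable_neg).const_mul _)
  have h2 : Differentiable ℂ fun t => poch (expo P.τ * expo t) (expo P.τ) :=
    h.comp (he.const_mul _)
  have hG : Differentiable ℂ G := by fun_prop
  have hD1 : HasDerivAt (fun t => 1 - expo (-t)) (2 * Real.pi * I) 0 := by
    have : HasDerivAt (fun t : ℂ => exp (2 * Real.pi * I * (-t)))
        (exp (2 * Real.pi * I * (-0)) * (2 * Real.pi * I * (-1))) 0 := by
      refine HasDerivAt.cexp ?_
      exact ((hasDerivAt_id (0 : ℂ)).neg).const_mul _
    simpa [expo] using this.const_sub 1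
  have hD := hD1.mul (hG 0).hasDerivAt
  rw [hE, hD.deriv]
  have hne : poch (expo P.τ) (expo P.τ) ≠ 0 := by
    refine poch_ne_zero hp fun m hm => ?_
    rw [← pow_succ] at hm
    have := congrArg (‖·‖) hm
    simp only [norm_pow, norm_one] at this
    exact absurd this (pow_lt_one₀ (norm_nonneg _) hp (Nat.succ_ne_zero m)).ne
  simp only [G, neg_zero, expo_zero, mul_one, sub_self, zero_mul, add_zero, mul_zero,
    Complex.exp_zero, one_mul]
  exact mul_ne_zero Complex.two_pi_I_ne_zero (mul_ne_zero hne hne)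

omit hτ in
lemma th11_lattice (m n : ℤ) (z : ℂ) : th11 P (z + m + n * P.τ) =
    (-1) ^ m * (-1) ^ n * exp (-1 * Real.pi * I * (2 * n * z + n ^ 2 * P.τ)) * th11 P z :=
  quasiperiodic_lattice (f := th11 P) (neg_ne_zero.2 one_ne_zero) (neg_ne_zero.2 one_ne_zero)
    (fun z => by rw [th11_add_one, neg_one_mul])
    (fun z => by rw [th11_add_tau]; ring_nf) m n z

omit hτ in
lemma th11_eq_zero_of_lattice (m n : ℤ) : th11 P (m + n * P.τ) = 0 := by
  have h := th11_lattice (P := P) m n 0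
  rw [th11_zero, mul_zero, zero_add] at h
  exact h

/-- The product formula for `θ₁₁`. -/
lemma exists_th11_eq : ∃ C : ℂ, ∀ t, th11 P t = C * thetaProd P t := by
  have hdp := differentiable_thetaProd hτ
  have hz : ∀ z, thetaProd P z = 0 → deriv (thetaProd P) z ≠ 0 := by
    intro z hz
    obtain ⟨m, n, rfl⟩ := thetaProd_eq_zero hτ hz
    exact deriv_ne_zero_of_quasiperiodic hdp thetaProd_add_one (thetaProd_add_tau hτ)
      thetaProd_zero (deriv_thetaProd_zero hτ) m n
  obtain ⟨h, hh, he⟩ := exists_entire_quotient (th11_differentiable (P := P)) hdp hz (by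
    intro z hz
    obtain ⟨m, n, rfl⟩ := thetaProd_eq_zero hτ hz
    exact th11_eq_zero_of_lattice m n)
  have hne : ∃ z, thetaProd P z ≠ 0 := by
    by_contra hcon
    push Not at hcon
    exact deriv_thetaProd_zero hτ (by rw [funext hcon]; simp)
  have hd := dense_ne_zero hdp hne
  have p1 : (fun z => h (z + 1)) = h := by
    refine eq_of_mul_eq_mul hd (hh.continuous.comp (by fun_prop)) hh.continuous fun z => ?_
    have h1 := th11_add_one (P := P) z
    rw [he, he, thetaProd_add_one] at h1
    simp only [smul_eq_mul]
    linear_combination -h1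
  have p2 : (fun z => h (z + P.τ)) = h := by
    refine eq_of_mul_eq_mul hd (hh.continuous.comp (by fun_prop)) hh.continuous fun z => ?_
    have h1 := th11_add_tau (P := P) z
    have e : -1 * Real.pi * I * (2 * z + P.τ) = -Real.pi * I * (2 * z + P.τ) := by ring
    rw [he, he, thetaProd_add_tau hτ, e] at h1
    simp only [smul_eq_mul]
    apply mul_left_cancel₀ (Complex.exp_ne_zero (-Real.pi * I * (2 * z + P.τ)))
    linear_combination -h1
  refine ⟨h 0, fun t => ?_⟩
  rw [he, eq_of_doubly_periodic hh hτ (fun z => congrFun p1 z) (fun z => congrFun p2 z) t 0,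
    mul_comm]

variable (hη : th11 P (2 * P.η) ≠ 0)
include hη

lemma exists_th11_eq_ne_zero : ∃ C : ℂ, C ≠ 0 ∧ ∀ t, th11 P t = C * thetaProd P t := by
  obtain ⟨C, hC⟩ := exists_th11_eq hτ
  refine ⟨C, ?_, hC⟩
  rintro rfl
  exact hη (by rw [hC, zero_mul])

lemma th11_eq_zero_iff (z : ℂ) : th11 P z = 0 ↔ ∃ m n : ℤ, z = m + n * P.τ := by
  constructor
  · intro h
    obtain ⟨C, hC, he⟩ := exists_th11_eq_ne_zero hτ hη
    rw [he, mul_eq_zero, or_iff_right hC] at h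
    exact thetaProd_eq_zero hτ h
  · rintro ⟨m, n, rfl⟩
    exact th11_eq_zero_of_lattice m n

lemma deriv_th11_ne_zero {z : ℂ} (hz : th11 P z = 0) : deriv (th11 P) z ≠ 0 := by
  obtain ⟨C, hC, he⟩ := exists_th11_eq_ne_zero hτ hη
  obtain ⟨m, n, rfl⟩ := (th11_eq_zero_iff hτ hη z).1 hz
  have : th11 P = fun t => C * thetaProd P t := funext he
  rw [this, deriv_const_mul _ (differentiable_thetaProd hτ _)]
  exact mul_ne_zero hC (deriv_ne_zero_of_quasiperiodic (differentiable_thetaProd hτ)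
    thetaProd_add_one (thetaProd_add_tau hτ) thetaProd_zero (deriv_thetaProd_zero hτ) m n)

end

section

/-! ### Explicit solutions of the scalar difference equations -/

lemma eventually_codiscrete_ne_zero {g : ℂ → ℂ} (hg : Differentiable ℂ g) (h : ∃ z, g z ≠ 0) :
    ∀ᶠ z in Filter.codiscrete ℂ, g z ≠ 0 := by
  obtain ⟨z₀, hz₀⟩ := h
  have ha : AnalyticOnNhd ℂ g Set.univ := fun z _ => hg.analyticAt z
  have := ha.preimage_zero_mem_codiscreteWithin (x := z₀) hz₀ (Set.mem_univ _)
    isConnected_univ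
  filter_upwards [this] with z hz using by simpa using hz

variable {P : Params} (hτ : 0 < P.τ.im) (hκ : 0 < P.κ.im)

/-- The quotient of double products that solves the difference equation with
multiplier `θ₁₁(t - s) / θ₁₁(t + κ + s)` up to an exponential. -/
def doubleQuot (P : Params) (s t : ℂ) : ℂ :=
  (poch2 (expo P.κ * expo (-t + s)) (expo P.τ) (expo P.κ) /
      poch2 (expo (-t - s)) (expo P.τ) (expo P.κ)) *
    (poch2 (expo P.τ * expo P.κ * expo (t + s)) (expo P.τ) (expo P.κ) /
      poch2 (expo P.τ * expo (t - s)) (expo P.τ) (expo P.κ))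

include hτ hκ

lemma differentiable_poch2_expo (c b ε : ℂ) :
    Differentiable ℂ fun t => poch2 (c * expo (ε * t + b)) (expo P.τ) (expo P.κ) := by
  have h := differentiable_poch2 (norm_expo_lt_one hτ) (norm_expo_lt_one hκ)
  have he := differentiable_expo
  have h1 : Differentiable ℂ fun t => c * expo (ε * t + b) :=
    (he.comp (by fun_prop : Differentiable ℂ fun t => ε * t + b)).const_mul _
  exact h.comp h1

lemma exists_poch2_expo_ne_zero {c ε : ℂ} (b : ℂ) (hc : c ≠ 0) (hε : ε ≠ 0) :
    ∃ t, poch2 (c * expo (ε * t + b)) (expo P.τ) (expo P.κ) ≠ 0 := by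
  have h := differentiable_poch2 (norm_expo_lt_one hτ) (norm_expo_lt_one hκ)
  have hd := dense_ne_zero h ⟨0, by rw [poch2_zero]; exact one_ne_zero⟩
  obtain ⟨x, hx0, hx⟩ := hd.inter_open_nonempty {0}ᶜ isOpen_compl_singleton ⟨1, by simp⟩
  obtain ⟨y, hy⟩ : ∃ y, expo y = x / c := by
    refine ⟨Complex.log (x / c) / (2 * Real.pi * I), ?_⟩
    rw [expo, mul_div_cancel₀ _ Complex.two_pi_I_ne_zero, Complex.exp_log]
    exact div_ne_zero hx0 hc
  refine ⟨(y - b) / ε, ?_⟩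
  have : ε * ((y - b) / ε) + b = y := by field_simp; ring
  rw [this, hy, mul_div_cancel₀ _ hc]
  exact hx

lemma meromorphic_doubleQuot (s : ℂ) : Meromorphic (doubleQuot P s) := by
  intro t
  have d := fun c b ε => (differentiable_poch2_expo hτ hκ c b ε).analyticAt t |>.meromorphicAt
  have h1 := d (expo P.κ) s (-1)
  have h2 := d 1 (-s) (-1)
  have h3 := d (expo P.τ * expo P.κ) s 1
  have h4 := d (expo P.τ) (-s) 1
  simp only [neg_one_mul, one_mul, ← sub_eq_add_neg] at h1 h2 h3 h4
  exact (h1.div h2).mul (h3.div h4)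

lemma doubleQuot_add (s : ℂ) : ∀ᶠ t in Filter.codiscrete ℂ,
    doubleQuot P s (t + P.κ) * (exp (-(Real.pi * I * (t + P.κ + s))) * thetaProd P (t + P.κ + s)) =
      exp (-(Real.pi * I * (t - s))) * thetaProd P (t - s) * doubleQuot P s t := by
  have hp := norm_expo_lt_one hτ
  have hq := norm_expo_lt_one hκ
  have n1 := eventually_codiscrete_ne_zero (differentiable_poch2_expo hτ hκ 1 (-P.κ - s) (-1))
    (exists_poch2_expo_ne_zero hτ hκ _ one_ne_zero (by norm_num))
  have n2 := eventually_codiscrete_ne_zero (differentiable_poch2_expo hτ hκ (expo P.τ) (-s) 1)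
    (exists_poch2_expo_ne_zero hτ hκ _ (expo_ne_zero _) one_ne_zero)
  filter_upwards [n1, n2] with t h1 h2
  have hW : ∀ x, exp (-(Real.pi * I * x)) * thetaProd P x =
      poch (expo (-x)) (expo P.τ) * poch (expo P.τ * expo x) (expo P.τ) := fun x => by
    rw [thetaProd, ← mul_assoc, ← Complex.exp_add]; simp
  rw [hW, hW]
  have hk : expo P.κ ≠ 0 := expo_ne_zero _
  have a1 : expo P.κ * expo (-(t + P.κ) + s) = expo (-t + s) := by
    rw [← expo_add]; congr 1; ring
  have a2 : expo P.κ * expo (-(t + P.κ + s)) = expo (-t - s) := by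
    rw [← expo_add]; congr 1; ring
  have a3 : expo P.τ * expo (t + P.κ + s) = expo P.τ * expo P.κ * expo (t + s) := by
    rw [← expo_add, ← expo_add, ← expo_add]; congr 1; ring
  have a4 : expo P.κ * (expo P.τ * expo P.κ * expo (t + s)) =
      expo P.τ * expo P.κ * expo (t + P.κ + s) := by
    rw [← expo_add, ← expo_add, ← expo_add, ← expo_add]; congr 1; ring
  have a5 : expo P.κ * (expo P.τ * expo (t - s)) = expo P.τ * expo (t + P.κ - s) := by
    rw [← expo_add, ← expo_add, ← expo_add]; congr 1; ring
  have a6 : -(t + P.κ) - s = -(t + P.κ + s) := by ring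
  have a7 : -(t - s) = -t + s := by ring
  have e1 := poch2_eq hp hq (expo (-t + s))
  have e2 := poch2_eq hp hq (expo (-(t + P.κ + s)))
  have e3 := poch2_eq hp hq (expo P.τ * expo P.κ * expo (t + s))
  have e4 := poch2_eq hp hq (expo P.τ * expo (t - s))
  rw [a2] at e2
  rw [a4] at e3
  rw [a5] at e4
  have b1 : -1 * t + (-P.κ - s) = -(t + P.κ + s) := by ring
  have b2 : 1 * t + -s = t - s := by ring
  rw [one_mul, b1, e2] at h1
  rw [b2, e4] at h2
  have h1a := left_ne_zero_of_mul h1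
  have h1b := right_ne_zero_of_mul h1
  have h2a := left_ne_zero_of_mul h2
  have h2b := right_ne_zero_of_mul h2
  rw [doubleQuot, doubleQuot, a1, a3, a6, a7, e1, e2, e3, e4]
  field_simp

variable (hη : th11 P (2 * P.η) ≠ 0)
include hη

lemma isSolF_FProd (hκ0 : P.κ ≠ 0) (d : ℕ) : IsSolF P d (FProd P d) := by
  have hF : FProd P d = fun t =>
      exp (-2 * Real.pi * I * d * P.η * t / P.κ - Real.pi * I * t) * doubleQuot P (d * P.η) t := by
    funext t; rw [FProd, doubleQuot]; ring
  obtain ⟨C, hC, hθ⟩ := exists_th11_eq_ne_zero hτ hη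
  refine ⟨?_, ?_⟩
  · rw [hF]
    intro t
    have h1 : Differentiable ℂ fun t =>
      exp (-2 * Real.pi * I * d * P.η * t / P.κ - Real.pi * I * t) := by fun_prop
    exact (h1.analyticAt t).meromorphicAt.mul (meromorphic_doubleQuot hτ hκ _ t)
  · have hn : ∃ z, th11 P (z + P.κ + d * P.η) ≠ 0 := ⟨2 * P.η - P.κ - d * P.η, by
      rw [show 2 * P.η - P.κ - d * P.η + P.κ + d * P.η = 2 * P.η by ring]; exact hη⟩
    have hd : Differentiable ℂ fun z => th11 P (z + P.κ + d * P.η) :=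
      (th11_differentiable (P := P)).comp (by fun_prop)
    filter_upwards [doubleQuot_add hτ hκ (d * P.η), eventually_codiscrete_ne_zero hd hn] with t ht h0
    rw [hF, deltaL, alphaL, div_div_div_cancel_right₀ hη, div_mul_eq_mul_div, eq_div_iff h0, hθ, hθ]
    have x1 : exp (-2 * Real.pi * I * d * P.η * (t + P.κ) / P.κ - Real.pi * I * (t + P.κ)) =
        exp (-2 * Real.pi * I * d * P.η * t / P.κ - Real.pi * I * t) * exp (Real.pi * I * (t - d * P.η)) *
        exp (-(Real.pi * I * (t + P.κ + d * P.η))) := by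
      rw [← Complex.exp_add, ← Complex.exp_add]; congr 1; field_simp; ring
    have x2 : exp (-(Real.pi * I * (t - d * P.η))) * exp (Real.pi * I * (t - d * P.η)) = 1 := by
      rw [← Complex.exp_add]; simp
    dsimp only
    rw [x1]
    linear_combination (exp (-2 * Real.pi * I * d * P.η * t / P.κ - Real.pi * I * t) *
      exp (Real.pi * I * (t - d * P.η)) * C) * ht + (exp (-2 * Real.pi * I * d * P.η * t / P.κ -
      Real.pi * I * t) * C * thetaProd P (t - d * P.η) * doubleQuot P (d * P.η) t) * x2

lemma isSolPhi_PhiProd (hκ0 : P.κ ≠ 0) : IsSolPhi P (PhiProd P) := by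
  have hF : PhiProd P = fun t => exp (4 * Real.pi * I * P.η * t / P.κ - Real.pi * I * t) *
      thetaProd P t * doubleQuot P (-2 * P.η) t := by
    funext t
    have e1 : exp (4 * Real.pi * I * P.η * t / P.κ) = exp (4 * Real.pi * I * P.η * t / P.κ -
      Real.pi * I * t) * exp (Real.pi * I * t) := by rw [← Complex.exp_add]; ring_nf
    have e2 : ∀ x : ℂ, x + -2 * P.η = x - 2 * P.η := fun x => by ring
    have e3 : ∀ x : ℂ, x - -2 * P.η = x + 2 * P.η := fun x => by ring
    rw [PhiProd, doubleQuot, thetaProd, e1, e2, e2, e3, e3]; ring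
  obtain ⟨C, hC, hθ⟩ := exists_th11_eq_ne_zero hτ hη
  refine ⟨?_, ?_⟩
  · rw [hF]
    intro t
    have h1 : Differentiable ℂ fun t =>
      exp (4 * Real.pi * I * P.η * t / P.κ - Real.pi * I * t) := by fun_prop
    exact ((h1.analyticAt t).meromorphicAt.mul
      ((differentiable_thetaProd hτ).analyticAt t).meromorphicAt).mul
      (meromorphic_doubleQuot hτ hκ _ t)
  · have hn : ∀ c : ℂ, ∃ z, th11 P (z + c) ≠ 0 := fun c => ⟨2 * P.η - c, by
      rw [sub_add_cancel]; exact hη⟩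
    have hd : ∀ c : ℂ, Differentiable ℂ fun z => th11 P (z + c) := fun c =>
      (th11_differentiable (P := P)).comp (by fun_prop)
    filter_upwards [doubleQuot_add hτ hκ (-2 * P.η),
      eventually_codiscrete_ne_zero (hd (P.κ - 2 * P.η)) (hn _),
      eventually_codiscrete_ne_zero (hd P.κ) (hn _),
      eventually_codiscrete_ne_zero (hd 0) (hn _)] with t ht h0 h1 h2
    have e2 : t + (P.κ - 2 * P.η) = t + P.κ + -2 * P.η := by ring
    have e2' : t + P.κ - 2 * P.η = t + P.κ + -2 * P.η := by ring
    have e3 : -t - 2 * P.η = -(t - -2 * P.η) := by ring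
    rw [add_zero] at h2
    rw [e2] at h0
    rw [hF, alphaFun, alphaFun, e3, th11_neg, th11_neg, neg_div_neg_eq, e2', hθ, hθ, hθ, hθ]
    rw [hθ] at h0 h1 h2
    have h0' := right_ne_zero_of_mul h0
    have h1' := right_ne_zero_of_mul h1
    have h2' := right_ne_zero_of_mul h2
    have x1 : exp (4 * Real.pi * I * P.η * (t + P.κ) / P.κ - Real.pi * I * (t + P.κ)) =
        exp (4 * Real.pi * I * P.η * t / P.κ - Real.pi * I * t) * exp (Real.pi * I * (t - -2 * P.η)) *
        exp (-(Real.pi * I * (t + P.κ + -2 * P.η))) := by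
      rw [← Complex.exp_add, ← Complex.exp_add]; congr 1; field_simp; ring
    have x2 : exp (-(Real.pi * I * (t - -2 * P.η))) * exp (Real.pi * I * (t - -2 * P.η)) = 1 := by
      rw [← Complex.exp_add]; simp
    dsimp only
    rw [x1]
    generalize exp (4 * Real.pi * I * P.η * t / P.κ - Real.pi * I * t) = E
    generalize exp (-(Real.pi * I * (t - -2 * P.η))) = E₁ at *
    generalize exp (Real.pi * I * (t - -2 * P.η)) = E₂ at *
    generalize exp (-(Real.pi * I * (t + P.κ + -2 * P.η))) = E₃ at *
    generalize thetaProd P (t + P.κ + -2 * P.η) = a at *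
    generalize thetaProd P (t - -2 * P.η) = b at *
    generalize doubleQuot P (-2 * P.η) t = f at *
    generalize doubleQuot P (-2 * P.η) (t + P.κ) = g at *
    field_simp
    linear_combination E * E₂ * ht + E * b * f * x2

end

variable {P : Params}

/-! ### The spaces `V^l` -/

lemma V_lattice {d : ℕ} (f : V P d) (m n : ℤ) (y : ℂ) : (f : ℂ → ℂ) (y + m + n * P.τ) =
    exp (-(2 * d : ℂ) * Real.pi * I * (2 * n * y + n ^ 2 * P.τ)) * (f : ℂ → ℂ) y := by
  have h := quasiperiodic_lattice (f := f) (τ := P.τ) (k := 2 * d) one_ne_zero one_ne_zero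
    (fun z => by rw [one_mul, f.2.2.1]) (fun z => by rw [f.2.2.2.2, one_mul]; ring_nf) m n y
  simpa using h

lemma V_continuous {d : ℕ} (f : V P d) : Continuous (f : ℂ → ℂ) := f.2.1.continuous

lemma halfVec_add_half (s y : ℂ) :
    (halfVec P (s + 1 / 2) : ℂ → ℂ) y = -(th11 P (y + s) * th11 P (y - s)) := by
  change th10 P (y + (s + 1 / 2)) * th10 P (y - (s + 1 / 2)) = _
  have e1 : y + (s + 1 / 2) + 1 / 2 = y + s + 1 := by ring
  have e2 : y - (s + 1 / 2) + 1 / 2 = y - s := by ring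
  rw [th10_eq, th10_eq, e1, e2, th11_add_one]; ring

section
variable (hτ : 0 < P.τ.im) (hη : th11 P (2 * P.η) ≠ 0)
include hτ hη

lemma exists_V_quotient {d : ℕ} (p : V P (d + 1)) {s : ℂ} (hs : th11 P (2 * s) ≠ 0)
    (hp : (p : ℂ → ℂ) s = 0) :
    ∃ q : V P d, ∀ y, (p : ℂ → ℂ) y = th11 P (y + s) * th11 P (y - s) * (q : ℂ → ℂ) y := by
  have hdth := th11_differentiable (P := P)
  have hg : Differentiable ℂ fun y => th11 P (y + s) * th11 P (y - s) :=
    (hdth.comp (by fun_prop : Differentiable ℂ fun y => y + s)).mul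
      (hdth.comp (by fun_prop : Differentiable ℂ fun y => y - s))
  have h2s : ∀ y, th11 P (y + s) = 0 → th11 P (y - s) = 0 → False := fun y h1 h2 => by
    rw [th11_eq_zero_iff hτ hη] at h1 h2
    obtain ⟨m, n, h1⟩ := h1
    obtain ⟨m', n', h2⟩ := h2
    exact hs ((th11_eq_zero_iff hτ hη _).2 ⟨m - m', n - n', by
      push_cast; linear_combination h1 - h2⟩)
  have hderiv : ∀ y, HasDerivAt (fun y => th11 P (y + s) * th11 P (y - s))
      (deriv (th11 P) (y + s) * th11 P (y - s) + th11 P (y + s) * deriv (th11 P) (y - s)) y :=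
    fun y => (hdth _).hasDerivAt.comp_add_const y s |>.mul
      ((hdth _).hasDerivAt.comp_sub_const y s)
  have hdiv := exists_entire_quotient p.2.1 hg (fun y hy => by
      rw [(hderiv y).deriv]
      rcases mul_eq_zero.1 hy with h | h
      · rw [h, zero_mul, add_zero]
        exact mul_ne_zero (deriv_th11_ne_zero hτ hη h) fun h' => h2s y h h'
      · rw [h, mul_zero, zero_add]
        exact mul_ne_zero (fun h' => h2s y h' h) (deriv_th11_ne_zero hτ hη h))
    (fun y hy => by
      rcases mul_eq_zero.1 hy with h | h
      · rw [th11_eq_zero_iff hτ hη] at h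
        obtain ⟨m, n, h⟩ := h
        have e : y = -s + m + n * P.τ := by linear_combination h
        rw [e, V_lattice, p.2.2.2.1, hp, mul_zero]
      · rw [th11_eq_zero_iff hτ hη] at h
        obtain ⟨m, n, h⟩ := h
        have e : y = s + m + n * P.τ := by linear_combination h
        rw [e, V_lattice, hp, mul_zero])
  obtain ⟨h, hh, he⟩ := hdiv
  have hd : Dense {y | th11 P (y + s) * th11 P (y - s) ≠ 0} := by
    refine dense_ne_zero hg ?_
    by_contra hcon
    push Not at hcon
    have h0 := (hderiv s).deriv
    rw [funext hcon] at h0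
    simp only [deriv_const, sub_self, th11_zero, mul_zero, zero_add] at h0
    rw [← two_mul] at h0
    exact mul_ne_zero hs (deriv_th11_ne_zero hτ hη th11_zero) h0.symm
  refine ⟨⟨h, hh, fun y => ?_, fun y => ?_, fun y => ?_⟩, he⟩
  · refine congrFun (eq_of_mul_eq_mul hd (hh.continuous.comp (continuous_add_const 1)) hh.continuous
      fun z => ?_) y
    have h1 := p.2.2.1 z
    have e1 : z + 1 + s = z + s + 1 := by ring
    have e2 : z + 1 - s = z - s + 1 := by ring
    rw [he, he, e1, e2, th11_add_one, th11_add_one] at h1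
    simp only [smul_eq_mul, Function.comp]
    linear_combination h1
  · refine congrFun (eq_of_mul_eq_mul hd (hh.continuous.comp continuous_neg) hh.continuous
      fun z => ?_) y
    have h1 := p.2.2.2.1 z
    have e1 : -z + s = -(z - s) := by ring
    have e2 : -z - s = -(z + s) := by ring
    rw [he, he, e1, e2, th11_neg, th11_neg] at h1
    simp only [smul_eq_mul, Function.comp]
    linear_combination h1
  · refine congrFun (eq_of_mul_eq_mul hd (hh.continuous.comp (continuous_add_const P.τ))
      ((by fun_prop : Continuous fun y => exp (-2 * d * Real.pi * I * (2 * y + P.τ))).mul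
        hh.continuous) fun z => ?_) y
    have h1 := p.2.2.2.2 z
    have e1 : z + P.τ + s = z + s + P.τ := by ring
    have e2 : z + P.τ - s = z - s + P.τ := by ring
    have e3 : exp (-2 * ((d + 1 : ℕ) : ℂ) * Real.pi * I * (2 * z + P.τ)) =
      exp (-Real.pi * I * (2 * (z + s) + P.τ)) * exp (-Real.pi * I * (2 * (z - s) + P.τ)) *
        exp (-2 * d * Real.pi * I * (2 * z + P.τ)) := by
      rw [← Complex.exp_add, ← Complex.exp_add]; congr 1; push_cast; ring
    rw [he, he, e1, e2, th11_add_tau, th11_add_tau, e3] at h1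
    simp only [smul_eq_mul, Pi.mul_apply, Function.comp]
    apply mul_left_cancel₀ (mul_ne_zero (Complex.exp_ne_zero (-Real.pi * I * (2 * (z + s) + P.τ)))
      (Complex.exp_ne_zero (-Real.pi * I * (2 * (z - s) + P.τ))))
    linear_combination h1

lemma V_eq_zero {d : ℕ} (p : V P d) (x : Fin (d + 1) → ℂ) (h2 : ∀ i, th11 P (2 * x i) ≠ 0)
    (hx : ∀ i j, i ≠ j → th11 P (x i + x j) * th11 P (x i - x j) ≠ 0)
    (hp : ∀ i, (p : ℂ → ℂ) (x i) = 0) : p = 0 := by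
  induction d with
  | zero =>
    ext y
    rw [eq_of_doubly_periodic p.2.1 hτ p.2.2.1 (fun z => by rw [p.2.2.2.2]; simp) y (x 0), hp]
    rfl
  | succ d ih =>
    obtain ⟨q, hq⟩ := exists_V_quotient hτ hη p (h2 (Fin.last _)) (hp (Fin.last _))
    have hq0 : q = 0 := by
      refine ih q (fun i => x i.castSucc) (fun i => h2 _)
        (fun i j hij => hx _ _ fun h => hij (Fin.castSucc_injective _ h)) fun i => ?_
      have h := hq (x i.castSucc)
      rw [hp] at h
      exact (mul_eq_zero.1 h.symm).resolve_left (hx _ _ (Fin.castSucc_lt_last i).ne)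
    ext y
    rw [hq, hq0]; simp

lemma th11_real_irrational {x : ℝ} (hx : Irrational x) : th11 P x ≠ 0 := by
  rw [Ne, th11_eq_zero_iff hτ hη]
  rintro ⟨m, n, h⟩
  have him := congrArg Complex.im h
  simp only [Complex.ofReal_im, Complex.add_im, Complex.intCast_im, Complex.mul_im,
    Complex.intCast_re, zero_mul, add_zero, zero_add] at him
  have hn : (n : ℝ) = 0 := (mul_eq_zero.1 him.symm).resolve_right hτ.ne'
  have hn0 : n = 0 := by exact_mod_cast hn
  subst hn0
  simp only [Int.cast_zero, zero_mul, add_zero] at h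
  exact hx.ne_int m (by exact_mod_cast h)

/-- Interpolation in `V^l` by products of vectors of spin `1/2`. -/
lemma exists_interpolation (d : ℕ) : ∃ (x : Fin (d + 1) → ℂ) (c : Fin (d + 1) → ℂ)
    (G : Fin (d + 1) → Fin d → ℂ), ∀ p : V P d,
      p = ∑ i, (c i * (p : ℂ → ℂ) (x i)) • prodV P fun j => halfVec P (G i j) := by
  let x : Fin (d + 1) → ℂ := fun i => (((i : ℕ) + 1 : ℕ) * √2 : ℝ)
  have hirr : ∀ k : ℤ, k ≠ 0 → th11 P ((k * √2 : ℝ) : ℂ) ≠ 0 := fun k hk =>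
    th11_real_irrational hτ hη (irrational_sqrt_two.intCast_mul hk)
  have h2 : ∀ i, th11 P (2 * x i) ≠ 0 := fun i => by
    have := hirr (2 * ((i : ℕ) + 1)) (by positivity)
    convert this using 2
    simp only [x]; push_cast; ring
  have hx : ∀ i j, i ≠ j → th11 P (x i + x j) * th11 P (x i - x j) ≠ 0 := fun i j hij => by
    have hij' : (i : ℕ) ≠ j := fun h => hij (Fin.ext h)
    refine mul_ne_zero ?_ ?_
    · have := hirr ((i : ℕ) + 1 + ((j : ℕ) + 1)) (by positivity)
      convert this using 2
      simp only [x]; push_cast; ring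
    · have := hirr ((i : ℤ) - (j : ℤ)) (by omega)
      convert this using 2
      simp only [x]; push_cast; ring
  let b : Fin (d + 1) → V P d := fun i => prodV P fun j => halfVec P (x (i.succAbove j) + 1 / 2)
  have hb : ∀ i y, (b i : ℂ → ℂ) y =
      ∏ j : Fin d, -(th11 P (y + x (i.succAbove j)) * th11 P (y - x (i.succAbove j))) :=
    fun i y => by
      change ∏ j, (halfVec P (x (i.succAbove j) + 1 / 2) : ℂ → ℂ) y = _
      exact Finset.prod_congr rfl fun j _ => halfVec_add_half _ _
  have hbii : ∀ i, (b i : ℂ → ℂ) (x i) ≠ 0 := fun i => by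
    rw [hb]
    exact Finset.prod_ne_zero_iff.2 fun j _ => neg_ne_zero.2 (hx _ _ (Fin.succAbove_ne i j).symm)
  have hbij : ∀ i k, k ≠ i → (b i : ℂ → ℂ) (x k) = 0 := fun i k hk => by
    obtain ⟨j, rfl⟩ := Fin.exists_succAbove_eq hk
    rw [hb]
    exact Finset.prod_eq_zero (Finset.mem_univ j) (by rw [sub_self, th11_zero]; ring)
  refine ⟨x, fun i => ((b i : ℂ → ℂ) (x i))⁻¹, fun i j => x (i.succAbove j) + 1 / 2, fun p => ?_⟩
  change p = ∑ i, (((b i : ℂ → ℂ) (x i))⁻¹ * (p : ℂ → ℂ) (x i)) • b i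
  rw [← sub_eq_zero]
  refine V_eq_zero hτ hη _ x h2 hx fun k => ?_
  rw [Submodule.coe_sub, Pi.sub_apply, Submodule.coe_sum, Finset.sum_apply, Finset.sum_eq_single k]
  · rw [Submodule.coe_smul, Pi.smul_apply, smul_eq_mul]
    field_simp [hbii k]; ring
  · intro i _ hik
    rw [Submodule.coe_smul, Pi.smul_apply, hbij i k hik.symm, smul_zero]
  · simp

/-! ### The Sklyanin algebra -/

omit hτ hη in
lemma thIdx_zero (z : ℂ) : thIdx P 0 z = th11 P z := by simp [thIdx, th11]

omit hτ hη in
lemma thIdx_add_one (a : Fin 4) (z : ℂ) :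
    thIdx P a (z + 1) = (![-1, -1, 1, 1] : Fin 4 → ℂ) a * thIdx P a z := by
  have e : z + 1 = z + 1 / 2 + 1 / 2 := by ring
  have h2 := theta_zero_add_two 0 z P.τ
  norm_num at h2
  have h3 := theta_zero_add_two 1 z P.τ
  norm_num at h3
  have h1 := theta_one_add_two 0 z P.τ
  norm_num at h1
  have h0 := theta_one_add_two 1 z P.τ
  norm_num at h0
  fin_cases a <;> simp only [thIdx, e, theta_add_half] <;> norm_num <;> assumption

omit hτ hη in
lemma thIdx_add_two (a : Fin 4) (z : ℂ) : thIdx P a (z + 2) = thIdx P a z := by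
  have e : z + 2 = z + 1 + 1 := by ring
  rw [e, thIdx_add_one, thIdx_add_one]
  fin_cases a <;> simp

omit hτ hη in
lemma thIdx_add_two_tau (a : Fin 4) (z : ℂ) :
    thIdx P a (z + 2 * P.τ) = exp (-4 * Real.pi * I * (z + P.τ)) * thIdx P a z := by
  have e : z + 2 * P.τ = z + P.τ + P.τ := by ring
  have h1 : exp (-(2 * Real.pi * I)) = 1 := by
    rw [Complex.exp_neg, Complex.exp_two_pi_mul_I, inv_one]
  rw [thIdx, e, theta_add_tau, theta_add_tau, ← mul_assoc, ← Complex.exp_add]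
  fin_cases a
  · simp only [thIdx, Fin.zero_eta, Matrix.cons_val_zero]
    rw [← mul_one (exp (-4 * Real.pi * I * (z + P.τ))), ← h1, ← Complex.exp_add, h1]
    congr 2; ring
  · simp [thIdx]; left; congr 1; ring
  · simp [thIdx]; left; congr 1; ring
  · simp only [thIdx, Fin.reduceFinMk, Matrix.cons_val]
    rw [← mul_one (exp (-4 * Real.pi * I * (z + P.τ))), ← h1, ← Complex.exp_add, h1]
    congr 2; ring

omit hτ hη in
lemma theta_one_eq (b z τ : ℂ) : theta 1 b z τ =
    exp (Real.pi * I * τ / 4 + Real.pi * I * (b / 2 + z)) * theta 0 b (z + τ / 2) τ := by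
  rw [theta, theta, ← tsum_mul_left]
  refine tsum_congr fun n => ?_
  rw [← Complex.exp_add]; congr 1; ring

lemma thIdx_eta_ne_zero (a : Fin 4) : thIdx P a P.η ≠ 0 := by
  have key : ∀ (s : ℂ) (m n : ℤ), 2 * s = m + n * P.τ → th11 P (P.η + s) ≠ 0 := by
    intro s m n hs h
    rw [th11_eq_zero_iff hτ hη] at h
    obtain ⟨m', n', h⟩ := h
    exact hη ((th11_eq_zero_iff hτ hη _).2 ⟨2 * m' - m, 2 * n' - n, by
      push_cast; linear_combination 2 * h - hs⟩)
  have key2 : ∀ b, theta 1 b (P.η - P.τ / 2) P.τ ≠ 0 → theta 0 b P.η P.τ ≠ 0 := by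
    intro b h
    rw [theta_one_eq, sub_add_cancel] at h
    exact right_ne_zero_of_mul h
  have h10 : ∀ z, th11 P (z + 1 / 2) ≠ 0 → theta 1 0 z P.τ ≠ 0 := fun z hz => by
    have := th10_eq (P := P) z
    rw [th10] at this
    rw [this]; exact neg_ne_zero.2 hz
  fin_cases a
  · have := key 0 0 0 (by simp)
    simpa [thIdx_zero] using this
  · exact h10 _ (key (1 / 2) 1 0 (by simp))
  · refine key2 0 (h10 _ ?_)
    have := key (1 / 2 - P.τ / 2) 1 (-1) (by push_cast; ring)
    rwa [show P.η - P.τ / 2 + 1 / 2 = P.η + (1 / 2 - P.τ / 2) by ring]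
  · refine key2 1 ?_
    have := key (-(P.τ / 2)) 0 (-1) (by push_cast; ring)
    rwa [← sub_eq_add_neg] at this

omit hτ in
lemma dense_th11_two_mul_ne_zero : Dense {y | th11 P (2 * y) ≠ 0} :=
  dense_ne_zero (th11_differentiable.comp (by fun_prop : Differentiable ℂ fun y : ℂ => 2 * y))
    ⟨P.η, hη⟩

omit hτ hη in
lemma differentiable_sFun (a : Fin 4) : Differentiable ℂ (sFun P a) := by
  have h : Differentiable ℂ (thIdx P a) := theta_differentiable _ _ _
  have h2 : Differentiable ℂ fun y => thIdx P a (2 * y) :=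
    h.comp (by fun_prop : Differentiable ℂ fun y : ℂ => 2 * y)
  exact h2.const_mul _

omit hτ hη in
lemma sFun_add_one (a : Fin 4) (y : ℂ) : sFun P a (y + 1) = sFun P a y := by
  rw [sFun, sFun, mul_add, mul_one, thIdx_add_two]

omit hτ hη in
lemma sFun_add_tau (a : Fin 4) (y : ℂ) :
    sFun P a (y + P.τ) = exp (-4 * Real.pi * I * (2 * y + P.τ)) * sFun P a y := by
  rw [sFun, sFun, mul_add, thIdx_add_two_tau]; ring

omit hτ hη in
lemma sFun_sub_tau (a : Fin 4) (y : ℂ) :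
    sFun P a (y - P.τ) = exp (4 * Real.pi * I * (2 * y - P.τ)) * sFun P a y := by
  have h := sFun_add_tau (P := P) a (y - P.τ)
  rw [sub_add_cancel] at h
  rw [h, ← mul_assoc, ← Complex.exp_add]
  have : 4 * Real.pi * I * (2 * y - P.τ) + -4 * Real.pi * I * (2 * (y - P.τ) + P.τ) = 0 := by ring
  rw [this, Complex.exp_zero, one_mul]

/-- The numerator of the difference operator `ρ^l(S^a)`. -/
def skNum (P : Params) (d : ℕ) (a : Fin 4) (f : ℂ → ℂ) (y : ℂ) : ℂ :=
  sFun P a (y - d / 2 * P.η) * f (y + P.η) - sFun P a (-y - d / 2 * P.η) * f (y - P.η)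

omit hτ hη in
lemma skNum_add_one {d : ℕ} (a : Fin 4) (f : V P d) (y : ℂ) :
    skNum P d a f (y + 1) = skNum P d a f y := by
  have e1 : y + 1 - d / 2 * P.η = y - d / 2 * P.η + 1 := by ring
  have e2 : y + 1 + P.η = y + P.η + 1 := by ring
  have e3 : -y - d / 2 * P.η = -(y + 1) - d / 2 * P.η + 1 := by ring
  have e4 : y + 1 - P.η = y - P.η + 1 := by ring
  rw [skNum, skNum, e1, e2, e4, sFun_add_one, f.2.2.1, f.2.2.1, e3, sFun_add_one]

omit hτ hη in
lemma skNum_neg {d : ℕ} (a : Fin 4) (f : V P d) (y : ℂ) :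
    skNum P d a f (-y) = -skNum P d a f y := by
  have e2 : -y + P.η = -(y - P.η) := by ring
  have e4 : -y - P.η = -(y + P.η) := by ring
  rw [skNum, skNum, e2, e4, f.2.2.2.1, f.2.2.2.1, neg_neg]; ring

omit hτ hη in
lemma skNum_add_tau {d : ℕ} (a : Fin 4) (f : V P d) (y : ℂ) :
    skNum P d a f (y + P.τ) = exp (-(4 + 2 * d) * Real.pi * I * (2 * y + P.τ)) *
      skNum P d a f y := by
  have e1 : y + P.τ - d / 2 * P.η = y - d / 2 * P.η + P.τ := by ring
  have e2 : y + P.τ + P.η = y + P.η + P.τ := by ring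
  have e3 : -(y + P.τ) - d / 2 * P.η = -y - d / 2 * P.η - P.τ := by ring
  have e4 : y + P.τ - P.η = y - P.η + P.τ := by ring
  have f1 : exp (-(4 + 2 * d) * Real.pi * I * (2 * y + P.τ)) =
      exp (-4 * Real.pi * I * (2 * (y - d / 2 * P.η) + P.τ)) *
        exp (-2 * d * Real.pi * I * (2 * (y + P.η) + P.τ)) := by
    rw [← Complex.exp_add]; congr 1; ring
  have f2 : exp (-(4 + 2 * d) * Real.pi * I * (2 * y + P.τ)) =
      exp (4 * Real.pi * I * (2 * (-y - d / 2 * P.η) - P.τ)) *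
        exp (-2 * d * Real.pi * I * (2 * (y - P.η) + P.τ)) := by
    rw [← Complex.exp_add]; congr 1; ring
  rw [skNum, skNum, e1, e2, e3, e4, sFun_add_tau, sFun_sub_tau, f.2.2.2.2, f.2.2.2.2]
  linear_combination sFun P a (-y - d / 2 * P.η) * (f : ℂ → ℂ) (y - P.η) * f2 -
    sFun P a (y - d / 2 * P.η) * (f : ℂ → ℂ) (y + P.η) * f1

lemma exists_skNum_eq {d : ℕ} (a : Fin 4) (f : V P d) :
    ∃ g : V P d, ∀ y, skNum P d a f y = th11 P (2 * y) * (g : ℂ → ℂ) y := by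
  have hdth := th11_differentiable (P := P)
  have hg : Differentiable ℂ fun y => th11 P (2 * y) :=
    hdth.comp (by fun_prop : Differentiable ℂ fun y : ℂ => 2 * y)
  have hs := differentiable_sFun (P := P) a
  have hN : Differentiable ℂ (skNum P d a f) := by
    have hf := f.2.1
    have h1 : Differentiable ℂ fun y => sFun P a (y - d / 2 * P.η) := hs.comp (by fun_prop)
    have h2 : Differentiable ℂ fun y => sFun P a (-y - d / 2 * P.η) := hs.comp (by fun_prop)
    have h3 : Differentiable ℂ fun y => (f : ℂ → ℂ) (y + P.η) := hf.comp (by fun_prop)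
    have h4 : Differentiable ℂ fun y => (f : ℂ → ℂ) (y - P.η) := hf.comp (by fun_prop)
    exact (h1.mul h3).sub (h2.mul h4)
  obtain ⟨h, hh, he⟩ := exists_entire_quotient hN hg (fun y hy => by
      have := ((hdth (2 * y)).hasDerivAt.comp y ((hasDerivAt_id y).const_mul 2)).deriv
      change deriv (fun y => th11 P (2 * y)) y = _ at this
      rw [this, mul_one]
      exact mul_ne_zero (deriv_th11_ne_zero hτ hη hy) two_ne_zero) (fun y hy => by
      rw [th11_eq_zero_iff hτ hη] at hy
      obtain ⟨m, n, hy⟩ := hy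
      have hq := quasiperiodic_lattice (f := skNum P d a f) (τ := P.τ) (k := 4 + 2 * d)
        one_ne_zero one_ne_zero (fun z => by rw [one_mul, skNum_add_one])
        (fun z => by rw [skNum_add_tau, one_mul]) m n (-y)
      have e : -y + m + n * P.τ = y := by linear_combination -hy
      have e2 : -(4 + 2 * d : ℂ) * Real.pi * I * (2 * n * (-y) + n ^ 2 * P.τ) =
          2 * Real.pi * I * ((2 + d) * n * m : ℤ) := by
        push_cast
        linear_combination (4 + 2 * d : ℂ) * Real.pi * I * n * hy
      rw [e, e2, exp_two_pi_I_int, skNum_neg] at hq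
      simp only [one_zpow, one_mul] at hq
      exact self_eq_neg.1 hq)
  have hd := dense_th11_two_mul_ne_zero hη
  refine ⟨⟨h, hh, fun y => ?_, fun y => ?_, fun y => ?_⟩, he⟩
  · refine congrFun (eq_of_mul_eq_mul hd (hh.continuous.comp (continuous_add_const 1))
      hh.continuous fun z => ?_) y
    have h1 := skNum_add_one a f z
    rw [he, he, mul_add, mul_one, show 2 * z + 2 = 2 * z + 2 * ((1 : ℤ) : ℂ) by push_cast; ring,
      th11_add_two_int] at h1
    exact h1
  · refine congrFun (eq_of_mul_eq_mul hd (hh.continuous.comp continuous_neg) hh.continuous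
      fun z => ?_) y
    have h1 := skNum_neg a f z
    rw [he, he, mul_neg, th11_neg] at h1
    simp only [smul_eq_mul, Function.comp]
    linear_combination -h1
  · refine congrFun (eq_of_mul_eq_mul hd (hh.continuous.comp (continuous_add_const P.τ))
      ((by fun_prop : Continuous fun y => exp (-2 * d * Real.pi * I * (2 * y + P.τ))).mul
        hh.continuous) fun z => ?_) y
    have h1 := skNum_add_tau a f z
    have e1 : 2 * (z + P.τ) = 2 * z + 2 * P.τ := by ring
    have e3 : exp (-(4 + 2 * d) * Real.pi * I * (2 * z + P.τ)) =
      exp (-4 * Real.pi * I * (2 * z + P.τ)) * exp (-2 * d * Real.pi * I * (2 * z + P.τ)) := by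
      rw [← Complex.exp_add]; congr 1; ring
    rw [he, he, e1, ← thIdx_zero, thIdx_add_two_tau, thIdx_zero, e3] at h1
    simp only [smul_eq_mul, Pi.mul_apply, Function.comp]
    apply mul_left_cancel₀ (Complex.exp_ne_zero (-4 * Real.pi * I * (2 * z + P.τ)))
    linear_combination h1

omit hτ in
lemma V_ext_mul {d : ℕ} {f g : V P d}
    (h : ∀ y, th11 P (2 * y) * (f : ℂ → ℂ) y = th11 P (2 * y) * (g : ℂ → ℂ) y) : f = g :=
  Subtype.ext (eq_of_mul_eq_mul (dense_th11_two_mul_ne_zero hη) (V_continuous f)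
    (V_continuous g) h)

lemma rho_spec (d : ℕ) (a : Fin 4) : IsSklyanin P d a (rho P d a) := by
  have hex : ∃ T, IsSklyanin P d a T := by
    choose g hg using fun f : V P d => exists_skNum_eq hτ hη a f
    refine ⟨⟨⟨g, fun f f' => V_ext_mul hη fun y => ?_⟩, fun c f => V_ext_mul hη fun y => ?_⟩,
      fun f y => (hg f y).symm⟩
    · rw [← hg, Submodule.coe_add (g f), Pi.add_apply, mul_add, ← hg, ← hg]
      simp only [skNum, Submodule.coe_add, Pi.add_apply]; ring
    · rw [← hg, RingHom.id_apply, Submodule.coe_smul c (g f), Pi.smul_apply, smul_eq_mul,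
        mul_left_comm, ← hg]
      simp only [skNum, Submodule.coe_smul, Pi.smul_apply, smul_eq_mul]; ring
  rw [rho, dif_pos hex]
  exact hex.choose_spec

end

/-! ### Matrices of operators and their contractions -/

section bracket
variable {A : Type*} [Ring A] [Algebra ℂ A]

/-- The contraction of a matrix of operators with the covector `dt r ·` and the vector `c`. -/
def br (T : Matrix (Fin 2) (Fin 2) A) : (Fin 2 → ℂ) →ₗ[ℂ] (Fin 2 → ℂ) →ₗ[ℂ] A :=
  LinearMap.mk₂ ℂ (fun r c => (r 0 * c 0) • T 1 0 + (r 0 * c 1) • T 1 1 -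
      (r 1 * c 0) • T 0 0 - (r 1 * c 1) • T 0 1)
    (fun r r' c => by simp only [Pi.add_apply]; module)
    (fun s r c => by simp only [Pi.smul_apply, smul_eq_mul]; module)
    (fun r c c' => by simp only [Pi.add_apply]; module)
    (fun s r c => by simp only [Pi.smul_apply, smul_eq_mul]; module)

lemma br_apply (T : Matrix (Fin 2) (Fin 2) A) (r c : Fin 2 → ℂ) :
    br T r c = (r 0 * c 0) • T 1 0 + (r 0 * c 1) • T 1 1 -
      (r 1 * c 0) • T 0 0 - (r 1 * c 1) • T 0 1 := rfl

lemma dt_pauli (a : Fin 4) (r c : Fin 2 → ℂ) :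
    dt ((pauli a).mulVec r) c = (![1, -1, -1, -1] : Fin 4 → ℂ) a * dt r ((pauli a).mulVec c) := by
  fin_cases a <;> simp [dt, pauli, Matrix.mulVec, dotProduct, Fin.sum_univ_two] <;> ring

end bracket

/-- The matrix `L(u)` of the spin `l = d / 2` representation. -/
def Ls (P : Params) (d : ℕ) (u : ℂ) : Matrix (Fin 2) (Fin 2) (Module.End ℂ (V P d)) :=
  fun i j => ∑ a, (WL P a u * pauli a i j) • rho P d a

section
variable (hτ : 0 < P.τ.im) (hη : th11 P (2 * P.η) ≠ 0)
include hτ hη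

lemma sum_WL_sFun (u w : ℂ) (i j : Fin 2) :
    ∑ a, WL P a u * pauli a i j * sFun P a w = (2 * th11 P (2 * P.η))⁻¹ *
      (ev P (u / 2 - w + 1 / 2) i *
        (![-ev P (u / 2 + w + 1 / 2) 1, ev P (u / 2 + w + 1 / 2) 0] : Fin 2 → ℂ) j) := by
  have h := sum_thIdx_pauli hτ u (2 * w) i j
  have e1 : (u - 2 * w) / 2 + 1 / 2 = u / 2 - w + 1 / 2 := by ring
  have e2 : (u + 2 * w) / 2 + 1 / 2 = u / 2 + w + 1 / 2 := by ring
  rw [e1, e2] at h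
  rw [← h, Finset.mul_sum]
  refine Finset.sum_congr rfl fun a _ => ?_
  have ha := thIdx_eta_ne_zero hτ hη a
  rw [WL, sFun]
  field_simp

/-- The action of `L(u)` as a difference operator of rank one coefficients. -/
lemma br_Ls (d : ℕ) (u : ℂ) (r c : Fin 2 → ℂ) (f : V P d) (x : ℂ) :
    th11 P (2 * x) * (br (Ls P d u) r c f : ℂ → ℂ) (x - 1 / 2) =
      -(2 * th11 P (2 * P.η))⁻¹ *
      (dt r (ev P (u / 2 + d / 2 * P.η - x)) * dt (ev P (u / 2 - d / 2 * P.η + x)) c *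
          (f : ℂ → ℂ) (x + P.η - 1 / 2) -
        dt r (ev P (u / 2 + d / 2 * P.η + x)) * dt (ev P (u / 2 - d / 2 * P.η - x)) c *
          (f : ℂ → ℂ) (x - P.η - 1 / 2)) := by
  have hL : ∀ i j, th11 P (2 * x) * (Ls P d u i j f : ℂ → ℂ) (x - 1 / 2) =
      -(2 * th11 P (2 * P.η))⁻¹ *
      (ev P (u / 2 + d / 2 * P.η - x) i *
        (![-ev P (u / 2 - d / 2 * P.η + x) 1, ev P (u / 2 - d / 2 * P.η + x) 0] : Fin 2 → ℂ) j *
          (f : ℂ → ℂ) (x + P.η - 1 / 2) -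
        ev P (u / 2 + d / 2 * P.η + x) i *
        (![-ev P (u / 2 - d / 2 * P.η - x) 1, ev P (u / 2 - d / 2 * P.η - x) 0] : Fin 2 → ℂ) j *
          (f : ℂ → ℂ) (x - P.η - 1 / 2)) := by
    intro i j
    have h1 := sum_WL_sFun hτ hη u (x - 1 / 2 - d / 2 * P.η) i j
    have h2 := sum_WL_sFun hτ hη u (-(x - 1 / 2) - d / 2 * P.η) i j
    have e1 : u / 2 - (x - 1 / 2 - d / 2 * P.η) + 1 / 2 = u / 2 + d / 2 * P.η - x + 1 := by ring
    have e2 : u / 2 + (x - 1 / 2 - d / 2 * P.η) + 1 / 2 = u / 2 - d / 2 * P.η + x := by ring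
    have e3 : u / 2 - (-(x - 1 / 2) - d / 2 * P.η) + 1 / 2 = u / 2 + d / 2 * P.η + x := by ring
    have e4 : u / 2 + (-(x - 1 / 2) - d / 2 * P.η) + 1 / 2 = u / 2 - d / 2 * P.η - x + 1 := by
      ring
    rw [e1, e2, ev_add_one] at h1
    rw [e3, e4, ev_add_one] at h2
    have hx : th11 P (2 * x) = -th11 P (2 * (x - 1 / 2)) := by
      rw [show 2 * (x - 1 / 2) = 2 * x - 1 by ring, th11_sub_one, neg_neg]
    have f1 : x - 1 / 2 + P.η = x + P.η - 1 / 2 := by ring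
    have f2 : x - 1 / 2 - P.η = x - P.η - 1 / 2 := by ring
    have hsum : (Ls P d u i j f : ℂ → ℂ) (x - 1 / 2) =
        ∑ a, WL P a u * pauli a i j * (rho P d a f : ℂ → ℂ) (x - 1 / 2) := by
      simp only [Ls, LinearMap.sum_apply, LinearMap.smul_apply, Submodule.coe_sum,
        Finset.sum_apply, Submodule.coe_smul, Pi.smul_apply, smul_eq_mul]
    have hterm : ∀ a, th11 P (2 * (x - 1 / 2)) *
        (WL P a u * pauli a i j * (rho P d a f : ℂ → ℂ) (x - 1 / 2)) =
        WL P a u * pauli a i j * sFun P a (x - 1 / 2 - d / 2 * P.η) *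
          (f : ℂ → ℂ) (x + P.η - 1 / 2) -
        WL P a u * pauli a i j * sFun P a (-(x - 1 / 2) - d / 2 * P.η) *
          (f : ℂ → ℂ) (x - P.η - 1 / 2) := fun a => by
      have h := rho_spec hτ hη d a f (x - 1 / 2)
      rw [f1, f2] at h
      linear_combination WL P a u * pauli a i j * h
    rw [hsum, hx, neg_mul, Finset.mul_sum, Finset.sum_congr rfl fun a _ => hterm a,
      Finset.sum_sub_distrib, ← Finset.sum_mul, ← Finset.sum_mul, h1, h2]
    ring
  have e : (br (Ls P d u) r c f : ℂ → ℂ) (x - 1 / 2) =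
      r 0 * c 0 * (Ls P d u 1 0 f : ℂ → ℂ) (x - 1 / 2) +
      r 0 * c 1 * (Ls P d u 1 1 f : ℂ → ℂ) (x - 1 / 2) -
      r 1 * c 0 * (Ls P d u 0 0 f : ℂ → ℂ) (x - 1 / 2) -
      r 1 * c 1 * (Ls P d u 0 1 f : ℂ → ℂ) (x - 1 / 2) := by
    simp only [br_apply, LinearMap.sub_apply, LinearMap.add_apply, LinearMap.smul_apply,
      Submodule.coe_sub, Submodule.coe_add, Submodule.coe_smul, Pi.sub_apply, Pi.add_apply,
      Pi.smul_apply, smul_eq_mul]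
  have h00 := hL 0 0
  have h01 := hL 0 1
  have h10 := hL 1 0
  have h11 := hL 1 1
  simp only [Matrix.cons_val_zero, Matrix.cons_val_one] at h00 h01 h10 h11
  rw [e]
  simp only [dt]
  linear_combination r 0 * c 0 * h10 + r 0 * c 1 * h11 - r 1 * c 0 * h00 - r 1 * c 1 * h01

/-! ### The two-dimensional representation -/

omit hτ hη in
lemma ev_add_tau (x : ℂ) : ev P (x + P.τ) = exp (-2 * Real.pi * I * (2 * x + P.τ)) • ev P x := by
  have key : ∀ b : ℤ, theta 0 b (x + P.τ) (P.τ / 2) =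
      exp (-2 * Real.pi * I * (2 * x + P.τ)) * theta 0 b x (P.τ / 2) := fun b => by
    have e : x + P.τ = x + P.τ / 2 + P.τ / 2 := by ring
    rw [e, theta_add_tau, theta_add_tau, ← mul_assoc, ← Complex.exp_add]
    congr 1
    rw [← mul_one (exp (-2 * Real.pi * I * (2 * x + P.τ))), ← exp_two_pi_I_int (-b),
      ← Complex.exp_add]
    congr 1; push_cast; ring
  have k0 := key 0
  have k1 := key 1
  simp only [Int.cast_zero, Int.cast_one] at k0 k1
  simp only [ev, k0, k1]
  funext i
  fin_cases i <;> simp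

/-- The spin `1/2` vector that corresponds to a vector of the plane. -/
def gv (P : Params) : (Fin 2 → ℂ) →ₗ[ℂ] V P 1 where
  toFun v := ⟨fun y => dt (ev P (y + 1 / 2)) v, by
    refine ⟨?_, fun y => ?_, fun y => ?_, fun y => ?_⟩
    · have h0 : Differentiable ℂ fun y => ev P (y + 1 / 2) 0 :=
        ((theta_differentiable 0 1 (P.τ / 2)).neg).comp (by fun_prop)
      have h1 : Differentiable ℂ fun y => ev P (y + 1 / 2) 1 :=
        (theta_differentiable 0 0 (P.τ / 2)).comp (by fun_prop)
      exact (h0.mul_const _).sub (h1.mul_const _)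
    · beta_reduce
      rw [show y + 1 + 1 / 2 = y + 1 / 2 + 1 by ring, ev_add_one]
    · beta_reduce
      rw [show -y + 1 / 2 = -(y + 1 / 2) + 1 by ring, ev_add_one, ev_neg]
    · beta_reduce
      rw [show y + P.τ + 1 / 2 = y + 1 / 2 + P.τ by ring, ev_add_tau]
      have : exp (-2 * Real.pi * I * (2 * (y + 1 / 2) + P.τ)) =
          exp (-2 * ((1 : ℕ) : ℂ) * Real.pi * I * (2 * y + P.τ)) := by
        have h1 := exp_two_pi_I_int (-1)
        rw [show -2 * Real.pi * I * (2 * (y + 1 / 2) + P.τ) =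
            -2 * ((1 : ℕ) : ℂ) * Real.pi * I * (2 * y + P.τ) + 2 * Real.pi * I * ((-1 : ℤ) : ℂ) by
          push_cast; ring, Complex.exp_add, h1, mul_one]
      rw [this]
      simp only [dt, Pi.smul_apply, smul_eq_mul]; ring⟩
  map_add' v w := by ext y; simp [dt]; ring
  map_smul' c v := by ext y; simp [dt]; ring

omit hτ hη in
lemma gv_apply (v : Fin 2 → ℂ) (y : ℂ) : (gv P v : ℂ → ℂ) y = dt (ev P (y + 1 / 2)) v := rfl

omit hη in
lemma halfVec_eq (s : ℂ) : halfVec P s = gv P ((-1 / 2 : ℂ) • ev P s) := by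
  ext y
  rw [map_smul, Submodule.coe_smul, Pi.smul_apply, gv_apply, dt_ev hτ]
  change th10 P (y + s) * th10 P (y - s) = _
  rw [th10_eq, th10_eq, show y + s + 1 / 2 = y + 1 / 2 + s by ring,
    show y - s + 1 / 2 = y + 1 / 2 - s by ring, smul_eq_mul]
  ring

lemma gv_surjective : Function.Surjective (gv P) := by
  intro p
  obtain ⟨x, c, G, h⟩ := exists_interpolation hτ hη 1
  have hp : ∀ i, prodV P (fun j => halfVec P (G i j)) = halfVec P (G i 0) := fun i => by
    ext y
    change ∏ j : Fin 1, (halfVec P (G i j) : ℂ → ℂ) y = _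
    simp
  refine ⟨∑ i, (c i * (p : ℂ → ℂ) (x i)) • ((-1 / 2 : ℂ) • ev P (G i 0)), ?_⟩
  rw [map_sum]
  conv_rhs => rw [h p]
  refine Finset.sum_congr rfl fun i _ => ?_
  rw [map_smul, hp, halfVec_eq hτ]

omit hη in
lemma dt_ev_pauli_ev (a : Fin 4) (p q : ℂ) : dt (ev P p) ((pauli a).mulVec (ev P q)) =
    (![-2, -2, 2 * I, 2] : Fin 4 → ℂ) a * thIdx P a (p + q) * thIdx P a (p - q) := by
  have h1 := theta01_mul_theta01 hτ p q
  have h2 := theta00_mul_theta00 hτ p q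
  have h3 := theta01_mul_theta00 hτ p q
  have h4 := theta00_mul_theta01 hτ p q
  fin_cases a <;> simp [dt, ev, pauli, Matrix.mulVec, dotProduct, Fin.sum_univ_two]
  · linear_combination h4 - h3
  · linear_combination h1 - h2
  · linear_combination I * h1 + I * h2
  · linear_combination h3 + h4

lemma rho_one_gv (a : Fin 4) (v : Fin 2 → ℂ) :
    rho P 1 a (gv P v) = th11 P (2 * P.η) • gv P ((pauli a).mulVec v) := by
  refine V_ext_mul hη fun y => ?_
  rw [rho_spec hτ hη, Submodule.coe_smul, Pi.smul_apply, smul_eq_mul, gv_apply, gv_apply, gv_apply]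
  have s1 : sFun P a (y - (1 : ℕ) / 2 * P.η) =
      1 / 2 * dt (ev P (y + 1 / 2)) ((pauli a).mulVec (ev P (y - P.η + 1 / 2))) := by
    rw [dt_ev_pauli_ev hτ, show y + 1 / 2 + (y - P.η + 1 / 2) =
      2 * (y - (1 : ℕ) / 2 * P.η) + 1 by push_cast; ring, thIdx_add_one,
      show y + 1 / 2 - (y - P.η + 1 / 2) = P.η by ring, sFun]
    fin_cases a <;> simp <;> ring
  have s2 : sFun P a (-y - (1 : ℕ) / 2 * P.η) =
      1 / 2 * dt (ev P (y + 1 / 2)) ((pauli a).mulVec (ev P (y + P.η + 1 / 2))) := by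
    rw [show ev P (y + 1 / 2) = ev P (-y + 1 / 2) by
        rw [← ev_neg, ← ev_add_one]; congr 1; ring,
      show ev P (y + P.η + 1 / 2) = ev P (-y - P.η + 1 / 2) by
        rw [← ev_neg, ← ev_add_one]; congr 1; ring,
      dt_ev_pauli_ev hτ, show -y + 1 / 2 + (-y - P.η + 1 / 2) =
      2 * (-y - (1 : ℕ) / 2 * P.η) + 1 by push_cast; ring, thIdx_add_one,
      show -y + 1 / 2 - (-y - P.η + 1 / 2) = P.η by ring, sFun]
    fin_cases a <;> simp <;> ring
  have hD := dt_ev hτ (y - P.η + 1 / 2) (y + P.η + 1 / 2)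
  rw [show y - P.η + 1 / 2 + (y + P.η + 1 / 2) = 2 * y + 1 by ring, th11_add_one,
    show y - P.η + 1 / 2 - (y + P.η + 1 / 2) = -(2 * P.η) by ring, th11_neg] at hD
  have hC := congrArg (fun w => dt (ev P (y + 1 / 2)) ((pauli a).mulVec w))
    (dt_smul_eq (ev P (y - P.η + 1 / 2)) (ev P (y + P.η + 1 / 2)) v)
  simp only [Matrix.mulVec_add, Matrix.mulVec_smul] at hC
  have hlin : ∀ (c : ℂ) (r w : Fin 2 → ℂ), dt r (c • w) = c * dt r w := fun c r w => by
    simp only [dt, Pi.smul_apply, smul_eq_mul]; ring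
  have hadd : ∀ (r w w' : Fin 2 → ℂ), dt r (w + w') = dt r w + dt r w' := fun r w w' => by
    simp only [dt, Pi.add_apply]; ring
  rw [hadd, hlin, hlin, hlin, hD, dt_swap v] at hC
  rw [s1, s2]
  linear_combination (1 / 2) * hC

end

/-! ### The eight-vertex R matrix and the vertex-face correspondence -/

lemma dt_add_right (r v w : Fin 2 → ℂ) : dt r (v + w) = dt r v + dt r w := by
  simp only [dt, Pi.add_apply]; ring

lemma dt_smul_right (c : ℂ) (r v : Fin 2 → ℂ) : dt r (c • v) = c * dt r v := by
  simp only [dt, Pi.smul_apply, smul_eq_mul]; ring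

lemma dt_add_left (r v w : Fin 2 → ℂ) : dt (r + v) w = dt r w + dt v w := by
  simp only [dt, Pi.add_apply]; ring

lemma dt_smul_left (c : ℂ) (r v : Fin 2 → ℂ) : dt (c • r) v = c * dt r v := by
  simp only [dt, Pi.smul_apply, smul_eq_mul]; ring

/-- The pairing `dt` as a bilinear form. -/
def dtL : (Fin 2 → ℂ) →ₗ[ℂ] (Fin 2 → ℂ) →ₗ[ℂ] ℂ :=
  LinearMap.mk₂ ℂ dt dt_add_left dt_smul_left dt_add_right (fun c r v => dt_smul_right c r v)

@[simp] lemma dtL_apply (r v : Fin 2 → ℂ) : dtL r v = dt r v := rfl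

section RR
variable {A : Type*} [AddCommGroup A] [Module ℂ A]

/-- A bilinear map, evaluated on `R(w) (p ⊗ q)` with the eight-vertex R matrix. -/
def RR (P : Params) (w : ℂ) (β : (Fin 2 → ℂ) →ₗ[ℂ] (Fin 2 → ℂ) →ₗ[ℂ] A) (p q : Fin 2 → ℂ) : A :=
  ∑ a, (th11 P (2 * P.η) ^ 2 * WL P a (w + P.η)) •
    β ((pauli a).mulVec p) ((pauli a).mulVec q)

lemma bilin_apply_eq (β : (Fin 2 → ℂ) →ₗ[ℂ] (Fin 2 → ℂ) →ₗ[ℂ] A) (p q : Fin 2 → ℂ) :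
    β p q = (p 0 * q 0) • β ![1, 0] ![1, 0] + (p 0 * q 1) • β ![1, 0] ![0, 1] +
      (p 1 * q 0) • β ![0, 1] ![1, 0] + (p 1 * q 1) • β ![0, 1] ![0, 1] := by
  have h : ∀ v : Fin 2 → ℂ, v = v 0 • ![1, 0] + v 1 • ![0, 1] := fun v => by
    funext i; fin_cases i <;> simp
  conv_lhs => rw [h p, h q]
  simp only [map_add, map_smul, LinearMap.add_apply, LinearMap.smul_apply]
  module

lemma RR_flip (w : ℂ) (β : (Fin 2 → ℂ) →ₗ[ℂ] (Fin 2 → ℂ) →ₗ[ℂ] A) (p q : Fin 2 → ℂ) :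
    RR P w β p q = RR P w β.flip q p := rfl

/-- Identities between images of the R matrix follow from their contractions. -/
lemma RR_eq_of_contract {w : ℂ} {p q p₁ q₁ p₂ q₂ : Fin 2 → ℂ} {c₁ c₂ : ℂ}
    (h : ∀ r s, RR P w ((LinearMap.mul ℂ ℂ).compl₁₂ (dtL r) (dtL s)) p q =
      c₁ * (dt r p₁ * dt s q₁) + c₂ * (dt r p₂ * dt s q₂))
    (β : (Fin 2 → ℂ) →ₗ[ℂ] (Fin 2 → ℂ) →ₗ[ℂ] A) :
    RR P w β p q = c₁ • β p₁ q₁ + c₂ • β p₂ q₂ := by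
  have h00 := h ![0, 1] ![0, 1]
  have h01 := h ![0, 1] ![1, 0]
  have h10 := h ![1, 0] ![0, 1]
  have h11 := h ![1, 0] ![1, 0]
  simp only [RR, LinearMap.compl₁₂_apply, dtL_apply, LinearMap.mul_apply', dt, smul_eq_mul,
    Matrix.cons_val_zero, Matrix.cons_val_one, zero_mul, one_mul, zero_sub, sub_zero] at h00 h01 h10 h11
  have key : RR P w β p q =
      (∑ a, th11 P (2 * P.η) ^ 2 * WL P a (w + P.η) *
        (-(pauli a).mulVec p 0 * -(pauli a).mulVec q 0)) • β ![1, 0] ![1, 0] +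
      (-∑ a, th11 P (2 * P.η) ^ 2 * WL P a (w + P.η) *
        (-(pauli a).mulVec p 0 * (pauli a).mulVec q 1)) • β ![1, 0] ![0, 1] +
      (-∑ a, th11 P (2 * P.η) ^ 2 * WL P a (w + P.η) *
        ((pauli a).mulVec p 1 * -(pauli a).mulVec q 0)) • β ![0, 1] ![1, 0] +
      (∑ a, th11 P (2 * P.η) ^ 2 * WL P a (w + P.η) *
        ((pauli a).mulVec p 1 * (pauli a).mulVec q 1)) • β ![0, 1] ![0, 1] := by
    simp only [RR, ← Finset.sum_neg_distrib, Finset.sum_smul, ← Finset.sum_add_distrib]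
    refine Finset.sum_congr rfl fun a _ => ?_
    rw [bilin_apply_eq β]
    module
  rw [key, h00, h01, h10, h11, bilin_apply_eq β p₁, bilin_apply_eq β p₂]
  module

end RR

lemma dense_forall_th11_ne_zero (hη : th11 P (2 * P.η) ≠ 0) (l : List (ℂ × ℂ))
    (hl : ∀ p ∈ l, p.1 ≠ 0) : Dense {z | ∀ p ∈ l, th11 P (p.1 * z + p.2) ≠ 0} := by
  induction l with
  | nil => simp
  | cons p l ih =>
    have h1 : Differentiable ℂ fun z => th11 P (p.1 * z + p.2) :=
      th11_differentiable.comp (by fun_prop : Differentiable ℂ fun z : ℂ => p.1 * z + p.2)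
    have hd : Dense {z | th11 P (p.1 * z + p.2) ≠ 0} :=
      dense_ne_zero h1 ⟨(2 * P.η - p.2) / p.1, by
        have := hl p (by simp)
        rwa [mul_div_cancel₀ _ this, sub_add_cancel]⟩
    have ho : IsOpen {z | th11 P (p.1 * z + p.2) ≠ 0} :=
      isOpen_compl_singleton.preimage h1.continuous
    convert hd.inter_of_isOpen_left (ih fun q hq => hl q (by simp [hq])) ho using 1
    ext z; simp

lemma continuous_dt {X : Type*} [TopologicalSpace X] {f g : X → Fin 2 → ℂ} (hf : Continuous f)
    (hg : Continuous g) : Continuous fun x => dt (f x) (g x) := by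
  unfold dt; fun_prop

section
variable (hτ : 0 < P.τ.im) (hη : th11 P (2 * P.η) ≠ 0)
include hτ hη

/-- The R matrix, contracted with `ev P x` in the second factor. -/
lemma RR_contract (w : ℂ) (r p q : Fin 2 → ℂ) (x : ℂ) :
    th11 P (2 * x) * RR P w ((LinearMap.mul ℂ ℂ).compl₁₂ (dtL r) (dtL (ev P x))) p q =
      -(1 / 2) * (dt r (ev P (w / 2 + P.η - x)) * dt (ev P (w / 2 + x)) p * dt (ev P (x + P.η)) q -
        dt r (ev P (w / 2 + P.η + x)) * dt (ev P (w / 2 - x)) p * dt (ev P (x - P.η)) q) := by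
  have h := br_Ls hτ hη 1 (w + P.η) r p (gv P q) x
  have hL : (br (Ls P 1 (w + P.η)) r p (gv P q) : ℂ → ℂ) (x - 1 / 2) =
      ∑ a, WL P a (w + P.η) * th11 P (2 * P.η) * dt r ((pauli a).mulVec p) *
        dt (ev P x) ((pauli a).mulVec q) := by
    simp only [br_apply, Ls, LinearMap.sub_apply, LinearMap.add_apply, LinearMap.smul_apply,
      LinearMap.sum_apply, rho_one_gv hτ hη, Submodule.coe_sub, Submodule.coe_add,
      Submodule.coe_smul, Submodule.coe_sum, Pi.sub_apply, Pi.add_apply, Pi.smul_apply,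
      Finset.sum_apply, smul_eq_mul, gv_apply, sub_add_cancel, Finset.mul_sum]
    rw [← Finset.sum_add_distrib, ← Finset.sum_sub_distrib, ← Finset.sum_sub_distrib]
    refine Finset.sum_congr rfl fun a _ => ?_
    simp only [dt, Matrix.mulVec, dotProduct, Fin.sum_univ_two]
    ring
  have hR : RR P w ((LinearMap.mul ℂ ℂ).compl₁₂ (dtL r) (dtL (ev P x))) p q =
      th11 P (2 * P.η) * (br (Ls P 1 (w + P.η)) r p (gv P q) : ℂ → ℂ) (x - 1 / 2) := by
    rw [hL, RR, Finset.mul_sum]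
    refine Finset.sum_congr rfl fun a _ => ?_
    simp only [LinearMap.compl₁₂_apply, dtL_apply, LinearMap.mul_apply', smul_eq_mul]
    ring
  rw [hR, mul_left_comm, h]
  simp only [gv_apply, sub_add_cancel, Nat.cast_one]
  rw [show (w + P.η) / 2 + 1 / 2 * P.η - x = w / 2 + P.η - x by ring,
    show (w + P.η) / 2 - 1 / 2 * P.η + x = w / 2 + x by ring,
    show (w + P.η) / 2 + 1 / 2 * P.η + x = w / 2 + P.η + x by ring,
    show (w + P.η) / 2 - 1 / 2 * P.η - x = w / 2 - x by ring]
  field_simp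

omit hτ hη in
lemma RR_contract_cramer (w : ℂ) (r p q a b s : Fin 2 → ℂ) :
    dt a b * RR P w ((LinearMap.mul ℂ ℂ).compl₁₂ (dtL r) (dtL s)) p q =
      dt s b * RR P w ((LinearMap.mul ℂ ℂ).compl₁₂ (dtL r) (dtL a)) p q +
      dt a s * RR P w ((LinearMap.mul ℂ ℂ).compl₁₂ (dtL r) (dtL b)) p q := by
  simp only [RR, Finset.mul_sum, ← Finset.sum_add_distrib]
  refine Finset.sum_congr rfl fun c _ => ?_
  simp only [LinearMap.compl₁₂_apply, dtL_apply, LinearMap.mul_apply', smul_eq_mul, dt]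
  ring

omit hτ hη in
lemma continuous_RR_contract (w : ℂ) (r s : Fin 2 → ℂ) {p q : ℂ → Fin 2 → ℂ} (hp : Continuous p)
    (hq : Continuous q) : Continuous fun V =>
      RR P w ((LinearMap.mul ℂ ℂ).compl₁₂ (dtL r) (dtL s)) (p V) (q V) := by
  simp only [RR, LinearMap.compl₁₂_apply, dtL_apply, LinearMap.mul_apply', smul_eq_mul]
  refine continuous_finsetSum _ fun a _ => continuous_const.mul ?_
  exact (continuous_dt continuous_const (by fun_prop)).mul
    (continuous_dt continuous_const (by fun_prop))

/-- The diagonal vertex-face relation. -/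
lemma RR_diag {A : Type*} [AddCommGroup A] [Module ℂ A]
    (β : (Fin 2 → ℂ) →ₗ[ℂ] (Fin 2 → ℂ) →ₗ[ℂ] A) (U V a : ℂ) :
    RR P (2 * (U - V)) β (ev P (U + a)) (ev P (V + a - P.η)) =
      th11 P (2 * (U - V) + 2 * P.η) • β (ev P (U + a - P.η)) (ev P (V + a)) := by
  obtain ⟨δ, rfl⟩ : ∃ δ, U = V + δ := ⟨U - V, by ring⟩
  rw [show 2 * (V + δ - V) = 2 * δ by ring]
  have key : ∀ r s, (fun V => RR P (2 * δ) ((LinearMap.mul ℂ ℂ).compl₁₂ (dtL r) (dtL s))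
      (ev P (V + δ + a)) (ev P (V + a - P.η))) = fun V => th11 P (2 * δ + 2 * P.η) *
        (dt r (ev P (V + δ + a - P.η)) * dt s (ev P (V + a))) := by
    intro r s
    refine (continuous_RR_contract _ _ _ (continuous_ev.comp (by fun_prop))
      (continuous_ev.comp (by fun_prop))).ext_on (dense_forall_th11_ne_zero hη
        [(2, 2 * a - 2 * P.η), (2, 2 * a - 4 * P.η), (2, 2 * a)] (by simp))
      (continuous_const.mul ((continuous_dt continuous_const (continuous_ev.comp (by fun_prop))).mul
        (continuous_dt continuous_const (continuous_ev.comp (by fun_prop))))) fun V hV => ?_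
    simp only [List.mem_cons, List.not_mem_nil, or_false, forall_eq_or_imp, forall_eq,
      Set.mem_ofPred_eq] at hV
    obtain ⟨h1, h2, h3⟩ := hV
    simp only [Function.comp_apply]
    have c1 := RR_contract hτ hη (2 * δ) r (ev P (V + δ + a)) (ev P (V + a - P.η)) (V + a)
    have c2 := RR_contract hτ hη (2 * δ) r (ev P (V + δ + a)) (ev P (V + a - P.η))
      (V + a - 2 * P.η)
    rw [show 2 * δ / 2 + (V + a) = V + δ + a by ring, dt_self, dt_self] at c1
    rw [show V + a - 2 * P.η + P.η = V + a - P.η by ring, dt_self,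
      show 2 * δ / 2 + P.η + (V + a - 2 * P.η) = V + δ + a - P.η by ring,
      dt_ev hτ (2 * δ / 2 - (V + a - 2 * P.η)), dt_ev hτ (V + a - 2 * P.η - P.η),
      show 2 * δ / 2 - (V + a - 2 * P.η) + (V + δ + a) = 2 * δ + 2 * P.η by ring,
      show 2 * δ / 2 - (V + a - 2 * P.η) - (V + δ + a) = -(2 * V + (2 * a - 2 * P.η)) by ring,
      show V + a - 2 * P.η - P.η + (V + a - P.η) = 2 * V + (2 * a - 4 * P.η) by ring,
      show V + a - 2 * P.η - P.η - (V + a - P.η) = -(2 * P.η) by ring,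
      show 2 * (V + a - 2 * P.η) = 2 * V + (2 * a - 4 * P.η) by ring, th11_neg, th11_neg] at c2
    have e := RR_contract_cramer (P := P) (2 * δ) r (ev P (V + δ + a)) (ev P (V + a - P.η))
      (ev P (V + a)) (ev P (V + a - 2 * P.η)) s
    have hD := dt_ev hτ (V + a) (V + a - 2 * P.η)
    rw [show V + a + (V + a - 2 * P.η) = 2 * V + (2 * a - 2 * P.η) by ring,
      show V + a - (V + a - 2 * P.η) = 2 * P.η by ring] at hD
    rw [hD] at e
    rw [show 2 * (V + a) = 2 * V + 2 * a by ring] at c1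
    have z1 : RR P (2 * δ) ((LinearMap.mul ℂ ℂ).compl₁₂ (dtL r) (dtL (ev P (V + a))))
      (ev P (V + δ + a)) (ev P (V + a - P.η)) = 0 := by
      apply mul_left_cancel₀ h3; rw [c1]; ring
    rw [z1, mul_zero, zero_add] at e
    apply mul_left_cancel₀ (mul_ne_zero (mul_ne_zero (by norm_num : (-2 : ℂ) ≠ 0) h1) hη)
    apply mul_left_cancel₀ h2
    rw [e, dt_swap (ev P (V + a)) s]
    linear_combination -dt s (ev P (V + a)) * c2
  rw [RR_eq_of_contract (c₁ := th11 P (2 * δ + 2 * P.η)) (p₁ := ev P (V + δ + a - P.η))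
    (q₁ := ev P (V + a)) (c₂ := 0) (p₂ := 0) (q₂ := 0)
    (fun r s => by rw [congrFun (key r s) V]; ring), zero_smul, add_zero]

/-- The vertex-face relation. -/
lemma RR_face {A : Type*} [AddCommGroup A] [Module ℂ A]
    (β : (Fin 2 → ℂ) →ₗ[ℂ] (Fin 2 → ℂ) →ₗ[ℂ] A) (U V : ℂ) {a : ℂ} (ha : th11 P (2 * a) ≠ 0) :
    RR P (2 * (U - V)) β (ev P (U - a)) (ev P (V + a + P.η)) =
      (th11 P (2 * (U - V)) * th11 P (2 * a + 2 * P.η) / th11 P (2 * a)) •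
        β (ev P (U - a + P.η)) (ev P (V + a)) +
      (-(th11 P (2 * (U - V) - 2 * a) * th11 P (2 * P.η) / th11 P (2 * a))) •
        β (ev P (U + a + P.η)) (ev P (V - a)) := by
  obtain ⟨δ, rfl⟩ : ∃ δ, U = V + δ := ⟨U - V, by ring⟩
  rw [show 2 * (V + δ - V) = 2 * δ by ring]
  have key : ∀ r s, (fun V => RR P (2 * δ) ((LinearMap.mul ℂ ℂ).compl₁₂ (dtL r) (dtL s))
      (ev P (V + δ - a)) (ev P (V + a + P.η))) = fun V =>
      (th11 P (2 * δ) * th11 P (2 * a + 2 * P.η) / th11 P (2 * a)) *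
        (dt r (ev P (V + δ - a + P.η)) * dt s (ev P (V + a))) +
      (-(th11 P (2 * δ - 2 * a) * th11 P (2 * P.η) / th11 P (2 * a))) *
        (dt r (ev P (V + δ + a + P.η)) * dt s (ev P (V - a))) := by
    intro r s
    refine (continuous_RR_contract _ _ _ (continuous_ev.comp (by fun_prop))
      (continuous_ev.comp (by fun_prop))).ext_on (dense_forall_th11_ne_zero hη
        [(2, 0), (2, 2 * a), (2, -2 * a)] (by simp)) ?_ fun V hV => ?_
    · refine (continuous_const.mul ((continuous_dt continuous_const
        (continuous_ev.comp (by fun_prop))).mul (continuous_dt continuous_const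
          (continuous_ev.comp (by fun_prop))))).add (continuous_const.mul ((continuous_dt
            continuous_const (continuous_ev.comp (by fun_prop))).mul (continuous_dt
              continuous_const (continuous_ev.comp (by fun_prop)))))
    simp only [List.mem_cons, List.not_mem_nil, or_false, forall_eq_or_imp, forall_eq,
      Set.mem_ofPred_eq, add_zero] at hV
    obtain ⟨h1, h2, h3⟩ := hV
    simp only [Function.comp_apply]
    have c1 := RR_contract hτ hη (2 * δ) r (ev P (V + δ - a)) (ev P (V + a + P.η)) (V + a)
    have c2 := RR_contract hτ hη (2 * δ) r (ev P (V + δ - a)) (ev P (V + a + P.η)) (V - a)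
    rw [dt_self,
      show 2 * δ / 2 + P.η + (V + a) = V + δ + a + P.η by ring, dt_ev hτ (2 * δ / 2 - (V + a)),
      dt_ev hτ (V + a - P.η),
      show 2 * δ / 2 - (V + a) + (V + δ - a) = 2 * δ - 2 * a by ring,
      show 2 * δ / 2 - (V + a) - (V + δ - a) = -(2 * V) by ring,
      show V + a - P.η + (V + a + P.η) = 2 * V + 2 * a by ring,
      show V + a - P.η - (V + a + P.η) = -(2 * P.η) by ring,
      show 2 * (V + a) = 2 * V + 2 * a by ring, th11_neg, th11_neg] at c1
    rw [show 2 * δ / 2 + (V - a) = V + δ - a by ring, dt_self,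
      show 2 * δ / 2 + P.η + (V - a) = V + δ - a + P.η by ring, dt_ev hτ (2 * δ / 2 - (V - a)),
      dt_ev hτ (V - a - P.η),
      show 2 * δ / 2 - (V - a) + (V + δ - a) = 2 * δ by ring,
      show 2 * δ / 2 - (V - a) - (V + δ - a) = -(2 * V + -2 * a) by ring,
      show V - a - P.η + (V + a + P.η) = 2 * V by ring,
      show V - a - P.η - (V + a + P.η) = -(2 * a + 2 * P.η) by ring,
      show 2 * (V - a) = 2 * V + -2 * a by ring, th11_neg, th11_neg] at c2
    have e := RR_contract_cramer (P := P) (2 * δ) r (ev P (V + δ - a)) (ev P (V + a + P.η))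
      (ev P (V + a)) (ev P (V - a)) s
    have hD := dt_ev hτ (V + a) (V - a)
    rw [show V + a + (V - a) = 2 * V by ring, show V + a - (V - a) = 2 * a by ring] at hD
    rw [hD, dt_swap (ev P (V + a)) s] at e
    have z1 := mul_left_cancel₀ h2 (c1.trans (b := _) (c := th11 P (2 * V + 2 * a) *
      (2 * (dt r (ev P (V + δ + a + P.η)) * th11 P (2 * δ - 2 * a) * th11 P (2 * V) *
        th11 P (2 * P.η)))) (by ring))
    have z2 := mul_left_cancel₀ h3 (c2.trans (b := _) (c := th11 P (2 * V + -2 * a) *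
      (2 * (dt r (ev P (V + δ - a + P.η)) * th11 P (2 * δ) * th11 P (2 * V) *
        th11 P (2 * a + 2 * P.η)))) (by ring))
    rw [z1, z2] at e
    apply mul_left_cancel₀ (mul_ne_zero (mul_ne_zero (by norm_num : (-2 : ℂ) ≠ 0) h1) ha)
    rw [e]
    have hi := mul_inv_cancel₀ ha
    simp only [div_eq_mul_inv]
    linear_combination (2 * th11 P (2 * V) * (th11 P (2 * δ) * th11 P (2 * a + 2 * P.η) *
      (dt r (ev P (V + δ - a + P.η)) * dt s (ev P (V + a))) - th11 P (2 * δ - 2 * a) *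
        th11 P (2 * P.η) * (dt r (ev P (V + δ + a + P.η)) * dt s (ev P (V - a))))) * hi
  exact RR_eq_of_contract (fun r s => congrFun (key r s) V) β

lemma RR_face' {A : Type*} [AddCommGroup A] [Module ℂ A]
    (β : (Fin 2 → ℂ) →ₗ[ℂ] (Fin 2 → ℂ) →ₗ[ℂ] A) (U V : ℂ) {a : ℂ} (ha : th11 P (2 * a) ≠ 0) :
    RR P (2 * (U - V)) β (ev P (U - a - P.η)) (ev P (V + a)) =
      (th11 P (2 * (U - V)) * th11 P (2 * a + 2 * P.η) / th11 P (2 * a)) •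
        β (ev P (U - a)) (ev P (V + a - P.η)) +
      (-(th11 P (2 * (U - V) - 2 * a) * th11 P (2 * P.η) / th11 P (2 * a))) •
        β (ev P (U + a)) (ev P (V - a - P.η)) := by
  have h := RR_face hτ hη β.flip (-V) (-U) ha
  rw [RR_flip, LinearMap.flip_flip, show -V - -U = U - V by ring] at h
  simp only [LinearMap.flip_apply] at h
  rw [← ev_neg (U - a - P.η), ← ev_neg (V + a), ← ev_neg (U - a), ← ev_neg (V + a - P.η),
    ← ev_neg (U + a), ← ev_neg (V - a - P.η)]
  convert h using 4 <;> ring_nf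

end

/-! ### The RTT relation -/

section RTT
variable {A : Type*} [Ring A] [Algebra ℂ A]

/-- The RTT relation for a family of matrices of operators, in contracted form. -/
def RTT (P : Params) (T : ℂ → Matrix (Fin 2) (Fin 2) A) : Prop :=
  ∀ u v r₁ r₂ c₁ c₂,
    RR P (u - v) ((LinearMap.mul ℂ A).compl₁₂ ((br (T u)).flip c₁) ((br (T v)).flip c₂)) r₁ r₂ =
      RR P (u - v) ((LinearMap.mul ℂ A).flip.compl₁₂ (br (T u) r₁) (br (T v) r₂)) c₁ c₂

end RTT

section RRlin
variable {A B : Type*} [AddCommGroup A] [Module ℂ A] [AddCommGroup B] [Module ℂ B]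

lemma RR_compr₂ (w : ℂ) (β : (Fin 2 → ℂ) →ₗ[ℂ] (Fin 2 → ℂ) →ₗ[ℂ] A) (E : A →ₗ[ℂ] B)
    (p q : Fin 2 → ℂ) : E (RR P w β p q) = RR P w (β.compr₂ E) p q := by
  simp only [RR, map_sum, map_smul, LinearMap.compr₂_apply]

lemma RR_add_map (w : ℂ) (β γ : (Fin 2 → ℂ) →ₗ[ℂ] (Fin 2 → ℂ) →ₗ[ℂ] A) (p q : Fin 2 → ℂ) :
    RR P w (β + γ) p q = RR P w β p q + RR P w γ p q := by
  simp only [RR, LinearMap.add_apply, smul_add, Finset.sum_add_distrib]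

lemma RR_smul_map (w c : ℂ) (β : (Fin 2 → ℂ) →ₗ[ℂ] (Fin 2 → ℂ) →ₗ[ℂ] A) (p q : Fin 2 → ℂ) :
    RR P w (c • β) p q = c • RR P w β p q := by
  simp only [RR, LinearMap.smul_apply, Finset.smul_sum, smul_comm c]

/-- The bilinear form `(r₁, r₂) ↦ dt r₁ p * dt r₂ q`. -/
def dt2 (p q : Fin 2 → ℂ) : (Fin 2 → ℂ) →ₗ[ℂ] (Fin 2 → ℂ) →ₗ[ℂ] ℂ :=
  (LinearMap.mul ℂ ℂ).compl₁₂ (dtL.flip p) (dtL.flip q)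

@[simp] lemma dt2_apply (p q r₁ r₂ : Fin 2 → ℂ) : dt2 p q r₁ r₂ = dt r₁ p * dt r₂ q := rfl

lemma RR_dt2 (w : ℂ) (p q r₁ r₂ : Fin 2 → ℂ) :
    RR P w (dt2 p q) r₁ r₂ = RR P w ((LinearMap.mul ℂ ℂ).compl₁₂ (dtL r₁) (dtL r₂)) p q := by
  simp only [RR, dt2_apply, LinearMap.compl₁₂_apply, dtL_apply, LinearMap.mul_apply']
  refine Finset.sum_congr rfl fun a _ => ?_
  rw [dt_pauli, dt_pauli, mul_mul_mul_comm,
    show (![1, -1, -1, -1] : Fin 4 → ℂ) a * (![1, -1, -1, -1] : Fin 4 → ℂ) a = 1 by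
      fin_cases a <;> simp, one_mul]

end RRlin

/-- Evaluation of the image of a vector at a point. -/
def evalAt {d : ℕ} (f : V P d) (y : ℂ) : Module.End ℂ (V P d) →ₗ[ℂ] ℂ where
  toFun X := (X f : ℂ → ℂ) y
  map_add' X Y := by simp
  map_smul' c X := by simp

lemma evalAt_apply {d : ℕ} (f : V P d) (y : ℂ) (X : Module.End ℂ (V P d)) :
    evalAt f y X = (X f : ℂ → ℂ) y := rfl

section
variable (hτ : 0 < P.τ.im) (hη : th11 P (2 * P.η) ≠ 0)
include hτ hη

lemma br_Ls_div (d : ℕ) (u : ℂ) (r c : Fin 2 → ℂ) (f : V P d) {x : ℂ} (hx : th11 P (2 * x) ≠ 0) :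
    (br (Ls P d u) r c f : ℂ → ℂ) (x - 1 / 2) =
      -(2 * th11 P (2 * P.η))⁻¹ * (th11 P (2 * x))⁻¹ *
      (dt r (ev P (u / 2 + d / 2 * P.η - x)) * dt (ev P (u / 2 - d / 2 * P.η + x)) c *
          (f : ℂ → ℂ) (x + P.η - 1 / 2) -
        dt r (ev P (u / 2 + d / 2 * P.η + x)) * dt (ev P (u / 2 - d / 2 * P.η - x)) c *
          (f : ℂ → ℂ) (x - P.η - 1 / 2)) := by
  apply mul_left_cancel₀ hx
  rw [br_Ls hτ hη]
  linear_combination (2 * th11 P (2 * P.η))⁻¹ *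
      (dt r (ev P (u / 2 + d / 2 * P.η - x)) * dt (ev P (u / 2 - d / 2 * P.η + x)) c *
          (f : ℂ → ℂ) (x + P.η - 1 / 2) -
        dt r (ev P (u / 2 + d / 2 * P.η + x)) * dt (ev P (u / 2 - d / 2 * P.η - x)) c *
          (f : ℂ → ℂ) (x - P.η - 1 / 2)) * mul_inv_cancel₀ hx

lemma br_Ls_br_Ls (d : ℕ) (u v : ℂ) (r₁ r₂ c₁ c₂ : Fin 2 → ℂ) (f : V P d) {x U U' W W' : ℂ}
    (hx : th11 P (2 * x) ≠ 0) (hxp : th11 P (2 * x + 2 * P.η) ≠ 0)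
    (hxm : th11 P (2 * x - 2 * P.η) ≠ 0)
    (hU : u / 2 + d / 2 * P.η = U) (hU' : u / 2 - d / 2 * P.η = U')
    (hW : v / 2 + d / 2 * P.η = W) (hW' : v / 2 - d / 2 * P.η = W') :
    ((br (Ls P d u) r₁ c₁ * br (Ls P d v) r₂ c₂) f : ℂ → ℂ) (x - 1 / 2) =
      (2 * th11 P (2 * P.η))⁻¹ ^ 2 * (th11 P (2 * x))⁻¹ *
      ((th11 P (2 * x + 2 * P.η))⁻¹ *
        (dt c₁ (ev P (U' + x)) * dt c₂ (ev P (W' + x + P.η)) * (f : ℂ → ℂ) (x + 2 * P.η - 1 / 2) *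
            dt2 (ev P (U - x)) (ev P (W - x - P.η)) r₁ r₂ -
          dt c₁ (ev P (U' + x)) * dt c₂ (ev P (W' - x - P.η)) * (f : ℂ → ℂ) (x - 1 / 2) *
            dt2 (ev P (U - x)) (ev P (W + x + P.η)) r₁ r₂) -
        (th11 P (2 * x - 2 * P.η))⁻¹ *
        (dt c₁ (ev P (U' - x)) * dt c₂ (ev P (W' + x - P.η)) * (f : ℂ → ℂ) (x - 1 / 2) *
            dt2 (ev P (U + x)) (ev P (W - x + P.η)) r₁ r₂ -
          dt c₁ (ev P (U' - x)) * dt c₂ (ev P (W' - x + P.η)) * (f : ℂ → ℂ) (x - 2 * P.η - 1 / 2) *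
            dt2 (ev P (U + x)) (ev P (W + x - P.η)) r₁ r₂)) := by
  rw [Module.End.mul_apply, br_Ls_div hτ hη d u r₁ c₁ _ hx,
    br_Ls_div hτ hη d v r₂ c₂ f (x := x + P.η) (by rwa [mul_add]),
    br_Ls_div hτ hη d v r₂ c₂ f (x := x - P.η) (by rwa [mul_sub]), hU, hU', hW, hW',
    show W - (x + P.η) = W - x - P.η by ring, show W - (x - P.η) = W - x + P.η by ring,
    show W' - (x + P.η) = W' - x - P.η by ring, show W' - (x - P.η) = W' - x + P.η by ring,
    show W + (x + P.η) = W + x + P.η by ring, show W + (x - P.η) = W + x - P.η by ring,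
    show W' + (x + P.η) = W' + x + P.η by ring, show W' + (x - P.η) = W' + x - P.η by ring,
    show x + P.η + P.η - 1 / 2 = x + 2 * P.η - 1 / 2 by ring,
    show x + P.η - P.η - 1 / 2 = x - 1 / 2 by ring,
    show x - P.η + P.η - 1 / 2 = x - 1 / 2 by ring,
    show x - P.η - P.η - 1 / 2 = x - 2 * P.η - 1 / 2 by ring,
    mul_add, mul_sub]
  simp only [dt_swap _ c₁, dt_swap _ c₂, dt2_apply]
  ring_nf

/-- The L operator satisfies the RTT relation. -/
theorem rtt_Ls (d : ℕ) : RTT P (Ls P d) := by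
  intro u v r₁ r₂ c₁ c₂
  ext f y
  obtain ⟨U, hU⟩ : ∃ U, u / 2 + d / 2 * P.η = U := ⟨_, rfl⟩
  obtain ⟨U', hU'⟩ : ∃ U', u / 2 - d / 2 * P.η = U' := ⟨_, rfl⟩
  obtain ⟨W, hW⟩ : ∃ W, v / 2 + d / 2 * P.η = W := ⟨_, rfl⟩
  obtain ⟨W', hW'⟩ : ∃ W', v / 2 - d / 2 * P.η = W' := ⟨_, rfl⟩
  have hw : u - v = 2 * (U - W) := by rw [← hU, ← hW]; ring
  have hw' : u - v = 2 * (U' - W') := by rw [← hU', ← hW']; ring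
  have hden := dense_forall_th11_ne_zero hη [(2, 1), (2, 1 + 2 * P.η), (2, 1 - 2 * P.η)]
    (by simp)
  refine congrFun ((V_continuous _).ext_on hden (V_continuous _) fun y hy => ?_) y
  obtain ⟨x, rfl⟩ : ∃ x, y = x - 1 / 2 := ⟨y + 1 / 2, by ring⟩
  simp only [List.mem_cons, List.not_mem_nil, or_false, forall_eq_or_imp, forall_eq,
      Set.mem_ofPred_eq] at hy
  rw [show 2 * (x - 1 / 2) + 1 = 2 * x by ring,
    show 2 * (x - 1 / 2) + (1 + 2 * P.η) = 2 * x + 2 * P.η by ring,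
    show 2 * (x - 1 / 2) + (1 - 2 * P.η) = 2 * x - 2 * P.η by ring] at hy
  obtain ⟨hx, hxp, hxm⟩ := hy
  have hxn : th11 P (2 * -x) ≠ 0 := by
    rw [mul_neg, th11_neg]; exact neg_ne_zero.2 hx
  rw [← evalAt_apply f, ← evalAt_apply f]
  refine (RR_compr₂ (A := Module.End ℂ (V P d)) (B := ℂ) _ _ (evalAt f _) _ _).trans (Eq.trans ?_ (RR_compr₂ (A := Module.End ℂ (V P d)) (B := ℂ) _ _ (evalAt f _) _ _).symm)
  have hl : ((LinearMap.mul ℂ (Module.End ℂ (V P d))).compl₁₂ ((br (Ls P d u)).flip c₁)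
      ((br (Ls P d v)).flip c₂)).compr₂ (evalAt f (x - 1 / 2)) =
      ((2 * th11 P (2 * P.η))⁻¹ ^ 2 * (th11 P (2 * x))⁻¹) •
      ((th11 P (2 * x + 2 * P.η))⁻¹ •
        ((dt c₁ (ev P (U' + x)) * dt c₂ (ev P (W' + x + P.η)) *
            (f : ℂ → ℂ) (x + 2 * P.η - 1 / 2)) • dt2 (ev P (U - x)) (ev P (W - x - P.η)) +
          (-(dt c₁ (ev P (U' + x)) * dt c₂ (ev P (W' - x - P.η)) * (f : ℂ → ℂ) (x - 1 / 2))) •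
            dt2 (ev P (U - x)) (ev P (W + x + P.η))) +
        (-(th11 P (2 * x - 2 * P.η))⁻¹) •
        ((dt c₁ (ev P (U' - x)) * dt c₂ (ev P (W' + x - P.η)) * (f : ℂ → ℂ) (x - 1 / 2)) •
            dt2 (ev P (U + x)) (ev P (W - x + P.η)) +
          (-(dt c₁ (ev P (U' - x)) * dt c₂ (ev P (W' - x + P.η)) *
            (f : ℂ → ℂ) (x - 2 * P.η - 1 / 2))) • dt2 (ev P (U + x)) (ev P (W + x - P.η)))) := by
    refine LinearMap.ext₂ fun r₁ r₂ => ?_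
    refine (br_Ls_br_Ls hτ hη d u v r₁ r₂ c₁ c₂ f hx hxp hxm hU hU' hW hW').trans ?_
    simp only [LinearMap.smul_apply, LinearMap.add_apply, smul_eq_mul]
    ring
  have hr : ((LinearMap.mul ℂ (Module.End ℂ (V P d))).flip.compl₁₂ (br (Ls P d u) r₁)
      (br (Ls P d v) r₂)).compr₂ (evalAt f (x - 1 / 2)) =
      ((2 * th11 P (2 * P.η))⁻¹ ^ 2 * (th11 P (2 * x))⁻¹) •
      ((th11 P (2 * x + 2 * P.η))⁻¹ •
        ((dt r₂ (ev P (W - x)) * dt r₁ (ev P (U - x - P.η)) *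
            (f : ℂ → ℂ) (x + 2 * P.η - 1 / 2)) • dt2 (ev P (U' + x + P.η)) (ev P (W' + x)) +
          (-(dt r₂ (ev P (W - x)) * dt r₁ (ev P (U + x + P.η)) * (f : ℂ → ℂ) (x - 1 / 2))) •
            dt2 (ev P (U' - x - P.η)) (ev P (W' + x))) +
        (-(th11 P (2 * x - 2 * P.η))⁻¹) •
        ((dt r₂ (ev P (W + x)) * dt r₁ (ev P (U - x + P.η)) * (f : ℂ → ℂ) (x - 1 / 2)) •
            dt2 (ev P (U' + x - P.η)) (ev P (W' - x)) +
          (-(dt r₂ (ev P (W + x)) * dt r₁ (ev P (U + x - P.η)) *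
            (f : ℂ → ℂ) (x - 2 * P.η - 1 / 2))) • dt2 (ev P (U' - x + P.η)) (ev P (W' - x)))) := by
    refine LinearMap.ext₂ fun c₁ c₂ => ?_
    refine (br_Ls_br_Ls hτ hη d v u r₂ r₁ c₂ c₁ f hx hxp hxm hW hW' hU hU').trans ?_
    simp only [LinearMap.smul_apply, LinearMap.add_apply, smul_eq_mul, dt2_apply]
    ring
  have d1 := fun r₁ r₂ => RR_diag hτ hη ((LinearMap.mul ℂ ℂ).compl₁₂ (dtL r₁) (dtL r₂)) U W (-x)
  have d2 := fun r₁ r₂ => RR_face hτ hη ((LinearMap.mul ℂ ℂ).compl₁₂ (dtL r₁) (dtL r₂)) U W hx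
  have d3 := fun r₁ r₂ => RR_face hτ hη ((LinearMap.mul ℂ ℂ).compl₁₂ (dtL r₁) (dtL r₂)) U W hxn
  have d4 := fun r₁ r₂ => RR_diag hτ hη ((LinearMap.mul ℂ ℂ).compl₁₂ (dtL r₁) (dtL r₂)) U W x
  have e1 := fun r₁ r₂ => RR_diag hτ hη ((LinearMap.mul ℂ ℂ).compl₁₂ (dtL r₁) (dtL r₂)) U' W'
    (x + P.η)
  have e2 := fun r₁ r₂ => RR_face' hτ hη ((LinearMap.mul ℂ ℂ).compl₁₂ (dtL r₁) (dtL r₂)) U' W' hx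
  have e3 := fun r₁ r₂ => RR_face' hτ hη ((LinearMap.mul ℂ ℂ).compl₁₂ (dtL r₁) (dtL r₂)) U' W' hxn
  have e4 := fun r₁ r₂ => RR_diag hτ hη ((LinearMap.mul ℂ ℂ).compl₁₂ (dtL r₁) (dtL r₂)) U' W'
    (-x + P.η)
  rw [← hw] at d1 d2 d3 d4
  rw [← hw'] at e1 e2 e3 e4
  have t1 : th11 P (2 * -x) = -th11 P (2 * x) := by rw [mul_neg, th11_neg]
  have t2 : th11 P (2 * -x + 2 * P.η) = -th11 P (2 * x - 2 * P.η) := by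
    rw [← th11_neg]; congr 1; ring
  simp only [← add_assoc, ← sub_eq_add_neg, sub_neg_eq_add, add_sub_cancel_right, t1, t2,
    LinearMap.compl₁₂_apply, dtL_apply, LinearMap.mul_apply', smul_eq_mul]
    at d1 d2 d3 d4 e1 e2 e3 e4
  rw [hl, hr]
  simp only [RR_smul_map, RR_add_map, RR_dt2, d1, d2, d3, d4, e1, e2, e3, e4, smul_eq_mul]
  have i1 := mul_inv_cancel₀ hx
  have i2 := mul_inv_cancel₀ hxp
  have i3 := mul_inv_cancel₀ hxm
  generalize (f : ℂ → ℂ) (x + 2 * P.η - 1 / 2) = fp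
  generalize (f : ℂ → ℂ) (x - 2 * P.η - 1 / 2) = fm
  generalize (f : ℂ → ℂ) (x - 1 / 2) = f0
  generalize (2 * th11 P (2 * P.η))⁻¹ = K
  congr 1
  simp only [div_eq_mul_inv, inv_neg]
  generalize th11 P (2 * x) = X at *
  linear_combination (-(th11 P (u - v) * X⁻¹ * f0) *
    (dt r₁ (ev P (U - x + P.η)) * dt r₂ (ev P (W + x)) * (dt c₁ (ev P (U' + x)) *
      dt c₂ (ev P (W' - x - P.η))) - dt r₁ (ev P (U + x + P.η)) * dt r₂ (ev P (W - x)) *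
        (dt c₁ (ev P (U' - x)) * dt c₂ (ev P (W' + x - P.η))))) * (i2 - i3)

end

/-! ### Products of solutions of the RTT relation -/

section
variable {A : Type*} [Ring A] [Algebra ℂ A]

/-- The basis of the plane. -/
def basisE (k : Fin 2) : Fin 2 → ℂ := Pi.single k 1

/-- The basis of the plane that is dual to `basisE` with respect to `dt`. -/
def basisF (k : Fin 2) : Fin 2 → ℂ := ![![0, -1], ![1, 0]] k

lemma br_mul (Y X : Matrix (Fin 2) (Fin 2) A) (r c : Fin 2 → ℂ) :
    br (Y * X) r c = ∑ k, br Y r (basisE k) * br X (basisF k) c := by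
  simp only [br_apply, Matrix.mul_apply, Fin.sum_univ_two, basisE, basisF, Matrix.cons_val_zero,
    Matrix.cons_val_one, Pi.single_eq_same, ne_eq, zero_ne_one, one_ne_zero, not_false_eq_true,
    Pi.single_eq_of_ne, mul_one, mul_zero, zero_smul, zero_mul, smul_add, add_zero, zero_add,
    sub_zero, neg_mul, one_mul, neg_smul, sub_neg_eq_add, mul_add, add_mul,
    mul_sub, sub_mul, smul_mul_assoc, mul_smul_comm]
  module

lemma sum_pauli_transfer (G G' : (Fin 2 → ℂ) →ₗ[ℂ] (Fin 2 → ℂ) →ₗ[ℂ] A) (a : Fin 4) :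
    ∑ k, ∑ k', G ((pauli a).mulVec (basisE k)) ((pauli a).mulVec (basisE k')) *
        G' (basisF k) (basisF k') =
      ∑ k, ∑ k', G (basisE k) (basisE k') *
        G' ((pauli a).mulVec (basisF k)) ((pauli a).mulVec (basisF k')) := by
  have hb : ∀ β : (Fin 2 → ℂ) →ₗ[ℂ] (Fin 2 → ℂ) →ₗ[ℂ] A, ∃ b₀ b₁ b₂ b₃, ∀ p q, β p q =
      (p 0 * q 0) • b₀ + (p 0 * q 1) • b₁ + (p 1 * q 0) • b₂ + (p 1 * q 1) • b₃ :=
    fun β => ⟨_, _, _, _, bilin_apply_eq β⟩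
  obtain ⟨b₀, b₁, b₂, b₃, hG⟩ := hb G
  obtain ⟨b₀', b₁', b₂', b₃', hG'⟩ := hb G'
  simp only [hG, hG', Fin.sum_univ_two, basisE, basisF,
    Matrix.mulVec, dotProduct]
  fin_cases a <;> simp [pauli] <;> abel

lemma br_commute {X Y : Matrix (Fin 2) (Fin 2) A} (h : ∀ i j i' j', Commute (X i j) (Y i' j'))
    (r c r' c' : Fin 2 → ℂ) : Commute (br X r c) (br Y r' c') := by
  simp only [br_apply]
  have h' : ∀ i j i' j' (s s' : ℂ), Commute (s • X i j) (s' • Y i' j') := fun i j i' j' s s' =>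
    ((h i j i' j').smul_left s).smul_right s'
  have h1 : ∀ i j (s : ℂ), Commute (s • X i j) ((r' 0 * c' 0) • Y 1 0 + (r' 0 * c' 1) • Y 1 1 -
      (r' 1 * c' 0) • Y 0 0 - (r' 1 * c' 1) • Y 0 1) := fun i j s =>
    (((h' _ _ _ _ _ _).add_right (h' _ _ _ _ _ _)).sub_right (h' _ _ _ _ _ _)).sub_right
      (h' _ _ _ _ _ _)
  exact (((h1 _ _ _).add_left (h1 _ _ _)).sub_left (h1 _ _ _)).sub_left (h1 _ _ _)

theorem RTT.mul {X Y : ℂ → Matrix (Fin 2) (Fin 2) A} (hX : RTT P X) (hY : RTT P Y)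
    (h : ∀ u v i j i' j', Commute (X u i j) (Y v i' j')) : RTT P fun u => Y u * X u := by
  intro u v r₁ r₂ c₁ c₂
  have hc : ∀ u v r c r' c', br (X u) r c * br (Y v) r' c' = br (Y v) r' c' * br (X u) r c :=
    fun u v r c r' c' => br_commute (h u v) r c r' c'
  have hRR : ∀ (β : (Fin 2 → ℂ) →ₗ[ℂ] (Fin 2 → ℂ) →ₗ[ℂ] A) p q, RR P (u - v) β p q =
      ∑ a, (th11 P (2 * P.η) ^ 2 * WL P a (u - v + P.η)) •
        β ((pauli a).mulVec p) ((pauli a).mulVec q) := fun _ _ _ => rfl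
  have l1 : RR P (u - v) ((LinearMap.mul ℂ A).compl₁₂ ((br (Y u * X u)).flip c₁)
      ((br (Y v * X v)).flip c₂)) r₁ r₂ = ∑ k, ∑ k',
      RR P (u - v) ((LinearMap.mul ℂ A).compl₁₂ ((br (Y u)).flip (basisE k))
        ((br (Y v)).flip (basisE k'))) r₁ r₂ *
        (br (X u) (basisF k) c₁ * br (X v) (basisF k') c₂) := by
    simp only [hRR, Finset.sum_mul]
    conv_rhs => enter [2, k]; rw [Finset.sum_comm]
    rw [Finset.sum_comm]
    refine Finset.sum_congr rfl fun a _ => ?_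
    simp only [LinearMap.compl₁₂_apply, LinearMap.flip_apply, LinearMap.mul_apply', br_mul,
      Finset.sum_mul, Finset.mul_sum, Finset.smul_sum, smul_mul_assoc]
    rw [Finset.sum_comm]
    refine Finset.sum_congr rfl fun k _ => Finset.sum_congr rfl fun k' _ => ?_
    congr 1
    simp only [mul_assoc]
    congr 1
    simp only [← mul_assoc]
    rw [hc]
  have l2 : RR P (u - v) ((LinearMap.mul ℂ A).flip.compl₁₂ (br (Y u * X u) r₁)
      (br (Y v * X v) r₂)) c₁ c₂ = ∑ k, ∑ k', (br (Y v) r₂ (basisE k') * br (Y u) r₁ (basisE k)) *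
      RR P (u - v) ((LinearMap.mul ℂ A).flip.compl₁₂ (br (X u) (basisF k))
        (br (X v) (basisF k'))) c₁ c₂ := by
    simp only [hRR, Finset.mul_sum]
    conv_rhs => enter [2, k]; rw [Finset.sum_comm]
    rw [Finset.sum_comm]
    refine Finset.sum_congr rfl fun a _ => ?_
    simp only [LinearMap.compl₁₂_apply, LinearMap.flip_apply, LinearMap.mul_apply', br_mul,
      Finset.sum_mul, Finset.mul_sum, Finset.smul_sum, mul_smul_comm]
    refine Finset.sum_congr rfl fun k _ => Finset.sum_congr rfl fun k' _ => ?_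
    congr 1
    simp only [mul_assoc]
    congr 1
    simp only [← mul_assoc]
    rw [hc]
  rw [l1, l2]
  simp only [hY u v r₁ r₂, ← hX u v _ _ c₁ c₂]
  simp only [hRR, Finset.sum_mul, Finset.mul_sum]
  have hswap : ∀ F : Fin 2 → Fin 2 → Fin 4 → A, ∑ k, ∑ k', ∑ a, F k k' a =
      ∑ a, ∑ k, ∑ k', F k k' a := fun F => by
    conv_lhs => enter [2, k]; rw [Finset.sum_comm]
    rw [Finset.sum_comm]
  rw [hswap, hswap]
  refine Finset.sum_congr rfl fun a _ => ?_
  have ht := sum_pauli_transfer ((LinearMap.mul ℂ A).flip.compl₁₂ (br (Y u) r₁) (br (Y v) r₂))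
    ((LinearMap.mul ℂ A).compl₁₂ ((br (X u)).flip c₁) ((br (X v)).flip c₂)) a
  simp only [LinearMap.compl₁₂_apply, LinearMap.flip_apply, LinearMap.mul_apply'] at ht ⊢
  simp only [smul_mul_assoc, mul_smul_comm, ← Finset.smul_sum]
  rw [ht]

end

/-! ### Gauge transformed monodromy matrices -/

section
variable {A : Type*} [Ring A] [Algebra ℂ A]

/-- The entry `B_{b,a}(t)` of the gauge transformed matrix of operators. -/
def opB (P : Params) (T : ℂ → Matrix (Fin 2) (Fin 2) A) (b a : ℤ) (t : ℂ) : A :=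
  (-(2 * th11 P t * th11 P (lamAt P a) * th11 P (lamAt P b))⁻¹) •
    br (T t) (ev P ((lamAt P b + t) / 2)) (ev P ((lamAt P a + t) / 2))

/-- The entry `A_{b,a}(t)` of the gauge transformed matrix of operators. -/
def opA (P : Params) (T : ℂ → Matrix (Fin 2) (Fin 2) A) (b a : ℤ) (t : ℂ) : A :=
  (-(2 * th11 P t * th11 P (lamAt P b))⁻¹) •
    br (T t) (ev P ((lamAt P b + t) / 2)) (ev P ((lamAt P a - t) / 2))

/-- The entry `D_{b,a}(t)` of the gauge transformed matrix of operators. -/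
def opD (P : Params) (T : ℂ → Matrix (Fin 2) (Fin 2) A) (b a : ℤ) (t : ℂ) : A :=
  ((2 * th11 P t * th11 P (lamAt P a))⁻¹) •
    br (T t) (ev P ((lamAt P b - t) / 2)) (ev P ((lamAt P a + t) / 2))

/-- The entry `C_{b,a}(t)` of the gauge transformed matrix of operators. -/
def opC (P : Params) (T : ℂ → Matrix (Fin 2) (Fin 2) A) (b a : ℤ) (t : ℂ) : A :=
  ((2 * th11 P t)⁻¹) • br (T t) (ev P ((lamAt P b - t) / 2)) (ev P ((lamAt P a - t) / 2))

lemma lamAt_add (a b : ℤ) : lamAt P (a + b) = lamAt P a + 2 * b * P.η := by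
  simp only [lamAt]; push_cast; ring

lemma lamAt_sub (a b : ℤ) : lamAt P (a - b) = lamAt P a - 2 * b * P.η := by
  simp only [lamAt]; push_cast; ring

variable (hτ : 0 < P.τ.im) (hη : th11 P (2 * P.η) ≠ 0) (hl : ∀ a, th11 P (lamAt P a) ≠ 0)
include hτ hη hl

omit hη hl in
lemma br_mul_gauge (Y X : Matrix (Fin 2) (Fin 2) A) (r c : Fin 2 → ℂ) (s t : ℂ) :
    (2 * th11 P t * th11 P s) • br (Y * X) r c =
      br Y r (ev P ((s + t) / 2)) * br X (ev P ((s - t) / 2)) c -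
      br Y r (ev P ((s - t) / 2)) * br X (ev P ((s + t) / 2)) c := by
  have hD := dt_ev hτ ((s - t) / 2) ((s + t) / 2)
  rw [show (s - t) / 2 + (s + t) / 2 = s by ring, show (s - t) / 2 - (s + t) / 2 = -t by ring,
    th11_neg] at hD
  rw [show 2 * th11 P t * th11 P s = dt (ev P ((s - t) / 2)) (ev P ((s + t) / 2)) by rw [hD]; ring]
  generalize ev P ((s - t) / 2) = p
  generalize ev P ((s + t) / 2) = q
  rw [br_mul, Fin.sum_univ_two]
  have h : ∀ v : Fin 2 → ℂ, v = v 0 • basisE 0 + v 1 • basisE 1 := fun v => by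
    funext i; fin_cases i <;> simp [basisE]
  have h' : ∀ v : Fin 2 → ℂ, v = v 1 • (-1 : ℂ) • basisF 0 + v 0 • basisF 1 := fun v => by
    funext i; fin_cases i <;> simp [basisF]
  rw [show br Y r q = q 0 • br Y r (basisE 0) + q 1 • br Y r (basisE 1) by
      rw [← map_smul, ← map_smul, ← map_add, ← h q],
    show br Y r p = p 0 • br Y r (basisE 0) + p 1 • br Y r (basisE 1) by
      rw [← map_smul, ← map_smul, ← map_add, ← h p],
    show br X p c = p 1 • (-1 : ℂ) • br X (basisF 0) c + p 0 • br X (basisF 1) c by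
      conv_lhs => rw [h' p]
      simp,
    show br X q c = q 1 • (-1 : ℂ) • br X (basisF 0) c + q 0 • br X (basisF 1) c by
      conv_lhs => rw [h' q]
      simp]
  simp only [dt, add_mul, mul_add, smul_mul_assoc, mul_smul_comm]
  module

omit hη in
lemma opB_mul (Y X : ℂ → Matrix (Fin 2) (Fin 2) A) (b a m : ℤ) {t : ℂ} (ht : th11 P t ≠ 0) :
    opB P (fun u => Y u * X u) b a t =
      opA P Y b m t * opB P X m a t + opB P Y b m t * opD P X m a t := by
  have h := br_mul_gauge hτ (Y t) (X t) (ev P ((lamAt P b + t) / 2)) (ev P ((lamAt P a + t) / 2))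
    (lamAt P m) t
  have h2 : 2 * th11 P t * th11 P (lamAt P m) ≠ 0 := by simp [ht, hl]
  simp only [opB, opA, opD]
  rw [← inv_smul_smul₀ h2 (br (Y t * X t) _ _), h]
  simp only [smul_mul_smul_comm, smul_sub, smul_smul, neg_mul, mul_neg]
  have e : ∀ x y : ℂ, (2 * th11 P t * x * y)⁻¹ = (2 * th11 P t)⁻¹ * x⁻¹ * y⁻¹ := fun x y => by
    rw [mul_inv, mul_inv]
  simp only [e, mul_inv]
  module

omit hη in
lemma opD_mul (Y X : ℂ → Matrix (Fin 2) (Fin 2) A) (b a m : ℤ) {t : ℂ} (ht : th11 P t ≠ 0) :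
    opD P (fun u => Y u * X u) b a t =
      opC P Y b m t * opB P X m a t + opD P Y b m t * opD P X m a t := by
  have h := br_mul_gauge hτ (Y t) (X t) (ev P ((lamAt P b - t) / 2)) (ev P ((lamAt P a + t) / 2))
    (lamAt P m) t
  have h2 : 2 * th11 P t * th11 P (lamAt P m) ≠ 0 := by simp [ht, hl]
  simp only [opB, opD, opC]
  rw [← inv_smul_smul₀ h2 (br (Y t * X t) _ _), h]
  simp only [smul_mul_smul_comm, smul_sub, smul_smul, neg_mul, mul_neg, mul_inv]
  module

omit hη in
lemma opC_mul (Y X : ℂ → Matrix (Fin 2) (Fin 2) A) (b a m : ℤ) {t : ℂ} (ht : th11 P t ≠ 0) :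
    opC P (fun u => Y u * X u) b a t =
      opC P Y b m t * opA P X m a t + opD P Y b m t * opC P X m a t := by
  have h := br_mul_gauge hτ (Y t) (X t) (ev P ((lamAt P b - t) / 2)) (ev P ((lamAt P a - t) / 2))
    (lamAt P m) t
  have h2 : 2 * th11 P t * th11 P (lamAt P m) ≠ 0 := by simp [ht, hl]
  simp only [opA, opD, opC]
  rw [← inv_smul_smul₀ h2 (br (Y t * X t) _ _), h]
  simp only [smul_mul_smul_comm, smul_sub, smul_smul, neg_mul, mul_neg, mul_inv]
  module

variable {T : ℂ → Matrix (Fin 2) (Fin 2) A} (hT : RTT P T)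
include hT

omit hl in
lemma opB_mul_opB (b a : ℤ) {u v : ℂ} (huv : th11 P (u - v + 2 * P.η) ≠ 0) :
    opB P T b a u * opB P T (b + 1) (a - 1) v = opB P T b a v * opB P T (b + 1) (a - 1) u := by
  have h := hT u v (ev P (u / 2 + lamAt P (b + 1) / 2)) (ev P (v / 2 + lamAt P (b + 1) / 2 - P.η))
    (ev P (u / 2 + lamAt P a / 2)) (ev P (v / 2 + lamAt P a / 2 - P.η))
  rw [show u - v = 2 * (u / 2 - v / 2) by ring, RR_diag hτ hη, RR_diag hτ hη,
    show 2 * (u / 2 - v / 2) = u - v by ring] at h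
  simp only [LinearMap.compl₁₂_apply, LinearMap.flip_apply, LinearMap.mul_apply'] at h
  have h := smul_right_injective A huv h
  simp only [opB, smul_mul_smul_comm]
  have e1 := lamAt_add (P := P) b 1
  have e2 := lamAt_sub (P := P) a 1
  push_cast at e1 e2
  convert congrArg (fun X => (-(2 * th11 P u * th11 P (lamAt P a) * th11 P (lamAt P b))⁻¹ *
    -(2 * th11 P v * th11 P (lamAt P (a - 1)) * th11 P (lamAt P (b + 1)))⁻¹) • X) h using 2
  · congr 2 <;> congr 2 <;> first | (rw [e1]; ring) | (rw [e2]; ring) | ring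
  · simp only [mul_inv]; ring
  · congr 2 <;> congr 2 <;> first | (rw [e1]; ring) | (rw [e2]; ring) | ring

lemma opA_mul_opB (b a : ℤ) {u v : ℂ} (huv : th11 P (u - v) ≠ 0) :
    opA P T b a v * opB P T (b + 1) (a - 1) u =
      alphaFun P (v - u) • (opB P T b (a - 2) u * opA P T (b + 1) (a - 1) v) +
      (-(th11 P (u - v + lamAt P (a - 1)) * th11 P (2 * P.η) /
        (th11 P (lamAt P (a - 1)) * th11 P (u - v)))) •
        (opB P T b (a - 2) v * opA P T (b + 1) (a - 1) u) := by
  have hn : th11 P (2 * (-lamAt P (a - 1) / 2)) ≠ 0 := by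
    rw [mul_div_cancel₀ _ two_ne_zero, th11_neg]; exact neg_ne_zero.2 (hl _)
  have h := hT u v (ev P (u / 2 + lamAt P (b + 1) / 2)) (ev P (v / 2 + lamAt P (b + 1) / 2 - P.η))
    (ev P (u / 2 - (-lamAt P (a - 1) / 2) - P.η)) (ev P (v / 2 + (-lamAt P (a - 1) / 2)))
  rw [show u - v = 2 * (u / 2 - v / 2) by ring, RR_diag hτ hη, RR_face' hτ hη _ _ _ hn,
    show 2 * (u / 2 - v / 2) = u - v by ring] at h
  simp only [LinearMap.compl₁₂_apply, LinearMap.flip_apply, LinearMap.mul_apply'] at h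
  have e1 := lamAt_add (P := P) b 1
  have e2 := lamAt_sub (P := P) a 1
  have e3 := lamAt_sub (P := P) a 2
  push_cast at e1 e2 e3
  rw [show u / 2 + lamAt P (b + 1) / 2 - P.η = (lamAt P b + u) / 2 by rw [e1]; ring,
    show v / 2 + lamAt P (b + 1) / 2 = (lamAt P (b + 1) + v) / 2 by ring,
    show (lamAt P (b + 1) + v) / 2 - P.η = (lamAt P b + v) / 2 by rw [e1]; ring,
    show u / 2 + lamAt P (b + 1) / 2 = (lamAt P (b + 1) + u) / 2 by ring,
    show u / 2 - -lamAt P (a - 1) / 2 - P.η = (lamAt P (a - 2) + u) / 2 by rw [e2, e3]; ring,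
    show u / 2 - -lamAt P (a - 1) / 2 = (lamAt P (a - 1) + u) / 2 by ring,
    show v / 2 + -lamAt P (a - 1) / 2 - P.η = -((lamAt P a - v) / 2) by rw [e2]; ring,
    show v / 2 + -lamAt P (a - 1) / 2 = -((lamAt P (a - 1) - v) / 2) by ring,
    show u / 2 + -lamAt P (a - 1) / 2 = -((lamAt P (a - 1) - u) / 2) by ring,
    show v / 2 - -lamAt P (a - 1) / 2 - P.η = (lamAt P (a - 2) + v) / 2 by rw [e2, e3]; ring,
    show 2 * (-lamAt P (a - 1) / 2) + 2 * P.η = -lamAt P (a - 2) by rw [e2, e3]; ring,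
    show 2 * (-lamAt P (a - 1) / 2) = -lamAt P (a - 1) by ring, ev_neg, ev_neg, ev_neg, th11_neg,
    th11_neg, sub_neg_eq_add] at h
  have l1 := hl a
  have l2 := hl (a - 1)
  have l3 := hl (a - 2)
  have hw : th11 P (v - u) = -th11 P (u - v) := th11_sub_comm _ _
  have hw2 : th11 P (v - u - 2 * P.η) = -th11 P (u - v + 2 * P.η) := by
    rw [← th11_neg]; congr 1; ring
  simp only [opB, opA, smul_mul_smul_comm, alphaFun, hw, hw2]
  have h' : br (T v) (ev P ((lamAt P b + v) / 2)) (ev P ((lamAt P a - v) / 2)) *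
      br (T u) (ev P ((lamAt P (b + 1) + u) / 2)) (ev P ((lamAt P (a - 1) + u) / 2)) =
      (th11 P (u - v) * th11 P (lamAt P (a - 2)) / th11 P (lamAt P (a - 1)))⁻¹ •
        (th11 P (u - v + 2 * P.η) •
          (br (T u) (ev P ((lamAt P b + u) / 2)) (ev P ((lamAt P (a - 2) + u) / 2)) *
            br (T v) (ev P ((lamAt P (b + 1) + v) / 2)) (ev P ((lamAt P (a - 1) - v) / 2))) -
        (th11 P (u - v + lamAt P (a - 1)) * th11 P (2 * P.η) / th11 P (lamAt P (a - 1))) •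
          (br (T v) (ev P ((lamAt P b + v) / 2)) (ev P ((lamAt P (a - 2) + v) / 2)) *
            br (T u) (ev P ((lamAt P (b + 1) + u) / 2)) (ev P ((lamAt P (a - 1) - u) / 2)))) := by
    have hne : th11 P (u - v) * th11 P (lamAt P (a - 2)) / th11 P (lamAt P (a - 1)) ≠ 0 := by
      simp [huv, l2, l3]
    rw [eq_inv_smul_iff₀ hne, h]
    simp only [mul_neg, div_neg, neg_neg, neg_div]
    module
  rw [h']
  simp only [smul_sub, smul_smul]
  rw [sub_eq_add_neg, ← neg_smul]
  simp only [mul_inv, inv_div, neg_mul, mul_neg, neg_neg, div_eq_mul_inv, inv_inv, inv_neg]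
  have j2 := mul_inv_cancel₀ l2
  congr 2
  · linear_combination ((2 : ℂ)⁻¹ ^ 2 * (th11 P v)⁻¹ * (th11 P u)⁻¹ * (th11 P (lamAt P b))⁻¹ *
      (th11 P (lamAt P (b + 1)))⁻¹ * (th11 P (u - v))⁻¹ * (th11 P (lamAt P (a - 2)))⁻¹ *
      th11 P (u - v + 2 * P.η)) * j2
  · linear_combination (-(2 : ℂ)⁻¹ ^ 2 * (th11 P v)⁻¹ * (th11 P u)⁻¹ * (th11 P (lamAt P b))⁻¹ *
      (th11 P (lamAt P (b + 1)))⁻¹ * (th11 P (u - v))⁻¹ * (th11 P (lamAt P (a - 2)))⁻¹ *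
      th11 P (u - v + lamAt P (a - 1)) * th11 P (2 * P.η) * (th11 P (lamAt P (a - 1)))⁻¹) * j2

lemma opD_mul_opB (b a : ℤ) {u v : ℂ} (huv : th11 P (u - v) ≠ 0) :
    opD P T b a v * opB P T (b + 1) (a - 1) u =
      alphaFun P (u - v) • (opB P T (b + 2) a u * opD P T (b + 1) (a - 1) v) +
      (th11 P (u - v + lamAt P (b + 1)) * th11 P (2 * P.η) /
        (th11 P (lamAt P (b + 1)) * th11 P (u - v))) •
        (opB P T (b + 2) a v * opD P T (b + 1) (a - 1) u) := by
  have hn : th11 P (2 * (lamAt P (b + 1) / 2)) ≠ 0 := by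
    rw [mul_div_cancel₀ _ two_ne_zero]; exact hl _
  have h := hT v u (ev P (v / 2 - lamAt P (b + 1) / 2)) (ev P (u / 2 + lamAt P (b + 1) / 2 + P.η))
    (ev P (v / 2 + lamAt P a / 2)) (ev P (u / 2 + lamAt P a / 2 - P.η))
  rw [show v - u = 2 * (v / 2 - u / 2) by ring, RR_diag hτ hη, RR_face hτ hη _ _ _ hn,
    show 2 * (v / 2 - u / 2) = v - u by ring] at h
  simp only [LinearMap.compl₁₂_apply, LinearMap.flip_apply, LinearMap.mul_apply'] at h
  have e1 := lamAt_add (P := P) b 1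
  have e2 := lamAt_sub (P := P) a 1
  have e3 := lamAt_add (P := P) b 2
  push_cast at e1 e2 e3
  have hw : th11 P (v - u) = -th11 P (u - v) := th11_sub_comm _ _
  have hw2 : th11 P (v - u + 2 * P.η) = -th11 P (u - v - 2 * P.η) := by
    rw [← th11_neg]; congr 1; ring
  have hw3 : th11 P (v - u - lamAt P (b + 1)) = -th11 P (u - v + lamAt P (b + 1)) := by
    rw [← th11_neg]; congr 1; ring
  rw [show v / 2 - lamAt P (b + 1) / 2 + P.η = -((lamAt P b - v) / 2) by rw [e1]; ring,
    show v / 2 - lamAt P (b + 1) / 2 = -((lamAt P (b + 1) - v) / 2) by ring,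
    show u / 2 + lamAt P (b + 1) / 2 + P.η = (lamAt P (b + 2) + u) / 2 by rw [e1, e3]; ring,
    show u / 2 + lamAt P (b + 1) / 2 = (lamAt P (b + 1) + u) / 2 by ring,
    show v / 2 + lamAt P (b + 1) / 2 + P.η = (lamAt P (b + 2) + v) / 2 by rw [e1, e3]; ring,
    show u / 2 - lamAt P (b + 1) / 2 = -((lamAt P (b + 1) - u) / 2) by ring,
    show v / 2 + lamAt P a / 2 - P.η = (lamAt P (a - 1) + v) / 2 by rw [e2]; ring,
    show v / 2 + lamAt P a / 2 = (lamAt P a + v) / 2 by ring,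
    show u / 2 + lamAt P a / 2 - P.η = (lamAt P (a - 1) + u) / 2 by rw [e2]; ring,
    show u / 2 + lamAt P a / 2 = (lamAt P a + u) / 2 by ring,
    show 2 * (lamAt P (b + 1) / 2) + 2 * P.η = lamAt P (b + 2) by rw [e1, e3]; ring,
    show 2 * (lamAt P (b + 1) / 2) = lamAt P (b + 1) by ring, ev_neg, ev_neg, ev_neg,
    hw, hw2, hw3] at h
  have l1 := hl a
  have l2 := hl (b + 1)
  have l3 := hl (b + 2)
  simp only [opB, opD, smul_mul_smul_comm, alphaFun]
  have h' : br (T v) (ev P ((lamAt P b - v) / 2)) (ev P ((lamAt P a + v) / 2)) *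
      br (T u) (ev P ((lamAt P (b + 1) + u) / 2)) (ev P ((lamAt P (a - 1) + u) / 2)) =
      (th11 P (u - v) * th11 P (lamAt P (b + 2)) / th11 P (lamAt P (b + 1)))⁻¹ •
        (th11 P (u - v - 2 * P.η) •
          (br (T u) (ev P ((lamAt P (b + 2) + u) / 2)) (ev P ((lamAt P a + u) / 2)) *
            br (T v) (ev P ((lamAt P (b + 1) - v) / 2)) (ev P ((lamAt P (a - 1) + v) / 2))) +
        (th11 P (u - v + lamAt P (b + 1)) * th11 P (2 * P.η) / th11 P (lamAt P (b + 1))) •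
          (br (T v) (ev P ((lamAt P (b + 2) + v) / 2)) (ev P ((lamAt P a + v) / 2)) *
            br (T u) (ev P ((lamAt P (b + 1) - u) / 2)) (ev P ((lamAt P (a - 1) + u) / 2)))) := by
    have hne : th11 P (u - v) * th11 P (lamAt P (b + 2)) / th11 P (lamAt P (b + 1)) ≠ 0 := by
      simp [huv, l2, l3]
    rw [eq_inv_smul_iff₀ hne, ← neg_inj, ← neg_smul]
    simp only [neg_mul, neg_div, neg_neg] at h
    rw [neg_add, ← neg_smul, ← h]
    module
  rw [h']
  simp only [smul_smul, smul_add]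
  simp only [mul_inv, inv_div, neg_mul, mul_neg, neg_neg, div_eq_mul_inv, inv_inv, inv_neg]
  have j2 := mul_inv_cancel₀ l2
  congr 2
  · linear_combination (-(2 : ℂ)⁻¹ ^ 2 * (th11 P v)⁻¹ * (th11 P u)⁻¹ * (th11 P (lamAt P a))⁻¹ *
      (th11 P (lamAt P (a - 1)))⁻¹ * (th11 P (u - v))⁻¹ * (th11 P (lamAt P (b + 2)))⁻¹ *
      th11 P (u - v - 2 * P.η)) * j2
  · linear_combination (-(2 : ℂ)⁻¹ ^ 2 * (th11 P v)⁻¹ * (th11 P u)⁻¹ * (th11 P (lamAt P a))⁻¹ *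
      (th11 P (lamAt P (a - 1)))⁻¹ * (th11 P (u - v))⁻¹ * (th11 P (lamAt P (b + 2)))⁻¹ *
      th11 P (u - v + lamAt P (b + 1)) * th11 P (2 * P.η) * (th11 P (lamAt P (b + 1)))⁻¹) * j2

end

/-! ### Ordered products of creation operators -/

section creation
variable {A : Type*} [Ring A] {ι : Type*}

/-- `B_{b+1,a-1}(i₁) B_{b+2,a-2}(i₂) ⋯`. -/
def creationList (B : ℤ → ℤ → ι → A) : ℤ → ℤ → List ι → A
  | _, _, [] => 1
  | b, a, i :: l => B (b + 1) (a - 1) i * creationList B (b + 1) (a - 1) l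

/-- The product of the creation operators with parameters in a finite set. -/
def creation (B : ℤ → ℤ → ι → A) (b a : ℤ) (S : Finset ι) : A := creationList B b a S.toList

variable {B C : ℤ → ℤ → ι → A}
  (hB : ∀ b a i j, i ≠ j → B b a i * B (b + 1) (a - 1) j = B b a j * B (b + 1) (a - 1) i)

lemma creationList_perm
    (hB : ∀ b a i j, i ≠ j → B b a i * B (b + 1) (a - 1) j = B b a j * B (b + 1) (a - 1) i)
    {l l' : List ι} (h : l.Perm l') (b a : ℤ) : creationList B b a l = creationList B b a l' := by
  induction h generalizing b a with
  | nil => rfl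
  | cons i _ ih => rw [creationList, creationList, ih]
  | swap i j l =>
    simp only [creationList, ← mul_assoc]
    rcases eq_or_ne i j with rfl | hij
    · rfl
    · rw [hB _ _ _ _ hij]
  | trans _ _ h1 h2 => exact (h1 b a).trans (h2 b a)

@[simp] lemma creation_empty (b a : ℤ) : creation B b a ∅ = 1 := by
  simp [creation, creationList]

include hB
variable [DecidableEq ι]

lemma creation_insert {s : ι} {S : Finset ι} (hs : s ∉ S) (b a : ℤ) :
    creation B b a (insert s S) = B (b + 1) (a - 1) s * creation B (b + 1) (a - 1) S := by
  rw [creation, creationList_perm hB (Finset.toList_insert hs), creationList, creation]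

/-- The commutation of an operator through a product of creation operators. -/
lemma mul_creation [Algebra ℂ A] {ε : ℤ} {f : ι → ι → ℂ} {g : ℤ → ℤ → ι → ι → ℂ}
    (hC : ∀ b a i j, i ≠ j → C b a i * B (b + 1) (a - 1) j =
      f i j • (B (b + 1 + ε) (a - 1 + ε) j * C (b + 1) (a - 1) i) +
      g b a i j • (B (b + 1 + ε) (a - 1 + ε) i * C (b + 1) (a - 1) j))
    (h3 : ∀ b a i j k, i ≠ j → i ≠ k → j ≠ k →
      f i k * g (b + 1) (a - 1) i j + g b a i k * g (b + 1) (a - 1) k j = g b a i j * f j k)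
    {s : ι} {S : Finset ι} (hs : s ∉ S) (b a : ℤ) :
    C b a s * creation B b a S =
      (∏ j ∈ S, f s j) • (creation B (b + ε) (a + ε) S * C (b + S.card) (a - S.card) s) +
      ∑ j ∈ S, (g b a s j * ∏ k ∈ S.erase j, f j k) •
        (creation B (b + ε) (a + ε) (insert s (S.erase j)) * C (b + S.card) (a - S.card) j) := by
  induction S using Finset.induction_on generalizing s b a with
  | empty => simp
  | insert k S hk ih =>
    have hsS : s ∉ S := fun h => hs (Finset.mem_insert_of_mem h)
    have hsk : s ≠ k := fun h => hs (h ▸ Finset.mem_insert_self _ _)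
    have hb : b + 1 + ε = b + ε + 1 := by ring
    have ha : a - 1 + ε = a + ε - 1 := by ring
    have hcb : b + 1 + (S.card : ℤ) = b + ((S.card + 1 : ℕ) : ℤ) := by push_cast; ring
    have hca : a - 1 - (S.card : ℤ) = a - ((S.card + 1 : ℕ) : ℤ) := by push_cast; ring
    have h1 := ih hsS (b + 1) (a - 1)
    have h2 := ih hk (b + 1) (a - 1)
    rw [hb, ha, hcb, hca] at h1 h2
    rw [creation_insert hB hk, ← mul_assoc, hC _ _ _ _ hsk, hb, ha, add_mul, smul_mul_assoc,
      smul_mul_assoc, mul_assoc, mul_assoc, h1, h2, Finset.card_insert_of_notMem hk,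
      Finset.prod_insert hk, Finset.sum_insert hk, Finset.erase_insert hk]
    generalize hn : b + ((S.card + 1 : ℕ) : ℤ) = b'
    generalize hn : a - ((S.card + 1 : ℕ) : ℤ) = a'
    simp only [mul_add, Finset.mul_sum, mul_smul_comm, smul_add, Finset.smul_sum, ← mul_assoc,
      smul_smul]
    rw [← creation_insert hB hk, ← creation_insert hB hsS]
    have e : ∀ j ∈ S, (g b a s j * ∏ x ∈ (insert k S).erase j, f j x) •
        (creation B (b + ε) (a + ε) (insert s ((insert k S).erase j)) * C b' a' j) =
        (f s k * g (b + 1) (a - 1) s j * ∏ x ∈ S.erase j, f j x) •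
        (B (b + ε + 1) (a + ε - 1) k * creation B (b + ε + 1) (a + ε - 1) (insert s (S.erase j)) *
          C b' a' j) +
        (g b a s k * g (b + 1) (a - 1) k j * ∏ x ∈ S.erase j, f j x) •
        (B (b + ε + 1) (a + ε - 1) s * creation B (b + ε + 1) (a + ε - 1) (insert k (S.erase j)) *
          C b' a' j) := fun j hj => by
      have hjk : j ≠ k := fun h => hk (h ▸ hj)
      have hsj : s ≠ j := fun h => hsS (h ▸ hj)
      have hk' : k ∉ S.erase j := fun h => hk (Finset.mem_of_mem_erase h)
      have hs' : s ∉ S.erase j := fun h => hsS (Finset.mem_of_mem_erase h)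
      rw [Finset.erase_insert_of_ne (Ne.symm hjk), Finset.prod_insert hk',
        ← creation_insert hB (show k ∉ insert s (S.erase j) by simp [hsk.symm, hk']),
        ← creation_insert hB (show s ∉ insert k (S.erase j) by simp [hsk, hs']),
        Finset.insert_comm k s, ← add_smul]
      congr 1
      linear_combination (-∏ x ∈ S.erase j, f j x) * h3 b a s j k hsj hsk hjk
    rw [Finset.sum_congr rfl e, Finset.sum_add_distrib]
    abel

end creation

/-! ### The action of creation operators on a composite system -/

section twoPart
variable {H : Type*} [AddCommGroup H] [Module ℂ H] {ι : Type*} [DecidableEq ι]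

open Finset in
/-- The action of the creation operators of a composite system on the vacuum. -/
lemma creation_composite {B BX BY DX AY : ℤ → ℤ → ι → Module.End ℂ H}
    {al : ι → ι → ℂ} {g : ℤ → ι → ι → ℂ} {dX aY : ι → ℂ} {Ω : ℤ → ℤ → H} {a₀ m₀ b₀ : ℤ}
    (hB : ∀ b a i j, i ≠ j → B b a i * B (b + 1) (a - 1) j = B b a j * B (b + 1) (a - 1) i)
    (hX : ∀ b a i j, i ≠ j → BX b a i * BX (b + 1) (a - 1) j = BX b a j * BX (b + 1) (a - 1) i)
    (hY : ∀ b a i j, i ≠ j → BY b a i * BY (b + 1) (a - 1) j = BY b a j * BY (b + 1) (a - 1) i)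
    (hco : ∀ b a m i, B b a i = AY b m i * BX m a i + BY b m i * DX m a i)
    (hcBB : ∀ b a i b' a' j, Commute (BX b a i) (BY b' a' j))
    (hcBA : ∀ b a i b' a' j, Commute (BX b a i) (AY b' a' j))
    (hcDB : ∀ b a i b' a' j, Commute (DX b a i) (BY b' a' j))
    (hA : ∀ b a i j, i ≠ j → AY b a i * BY (b + 1) (a - 1) j =
      al i j • (BY (b + 1 + -1) (a - 1 + -1) j * AY (b + 1) (a - 1) i) +
      (-g (a - 1) i j) • (BY (b + 1 + -1) (a - 1 + -1) i * AY (b + 1) (a - 1) j))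
    (hD : ∀ b a i j, i ≠ j → DX b a i * BX (b + 1) (a - 1) j =
      al j i • (BX (b + 1 + 1) (a - 1 + 1) j * DX (b + 1) (a - 1) i) +
      g (b + 1) i j • (BX (b + 1 + 1) (a - 1 + 1) i * DX (b + 1) (a - 1) j))
    (hA3 : ∀ a i j k, i ≠ j → i ≠ k → j ≠ k →
      al i k * -g (a - 1) i j + -g a i k * -g (a - 1) k j = -g a i j * al j k)
    (hD3 : ∀ b i j k, i ≠ j → i ≠ k → j ≠ k →
      al k i * g (b + 1) i j + g b i k * g (b + 1) k j = g b i j * al k j)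
    (hdX : ∀ p q i, DX (m₀ + p) (a₀ + p) i (Ω p q) = dX i • Ω (p + 1) q)
    (haY : ∀ p q i, AY (b₀ + q) (m₀ + q) i (Ω p q) = aY i • Ω p (q - 1)) (S : Finset ι) :
    creation B (b₀ - #S) (a₀ + #S) S (Ω 0 0) =
      ∑ J ∈ S.powerset, ((∏ i ∈ S \ J, ∏ j ∈ J, al i j) * (∏ i ∈ S \ J, aY i) * ∏ j ∈ J, dX j) •
        creation BY (b₀ - #S) (m₀ + #J - #(S \ J)) J
          (creation BX (m₀ + #J - #(S \ J)) (a₀ + #S) (S \ J) (Ω #J (-#(S \ J)))) := by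
  have hcr : ∀ {B' C' : ℤ → ℤ → ι → Module.End ℂ H}, (∀ b a i b' a' j, Commute (B' b a i) (C' b' a' j)) →
      ∀ b a i b' a' (J : Finset ι), Commute (B' b a i) (creation C' b' a' J) := by
    intro B' C' h b a i b' a' J
    rw [creation]
    generalize J.toList = l
    induction l generalizing b' a' with
    | nil => exact Commute.one_right _
    | cons j l ih => exact (h _ _ _ _ _ _).mul_right (ih _ _)
  have hcl : ∀ b a i b' a' (I : Finset ι), Commute (AY b a i) (creation BX b' a' I) :=
    hcr fun b a i b' a' j => (hcBA b' a' j b a i).symm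
  have offA := fun {s : ι} {J : Finset ι} (hs : s ∉ J) => mul_creation (C := AY) (ε := -1) (f := al)
    (g := fun _ a i j => -g (a - 1) i j) hY hA (fun _ a i j k h1 h2 h3 => hA3 (a - 1) i j k h1 h2 h3)
    hs
  have offD := fun {s : ι} {J : Finset ι} (hs : s ∉ J) => mul_creation (C := DX) (ε := 1)
    (f := fun i j => al j i) (g := fun b _ i j => g (b + 1) i j) hX hD
    (fun b _ i j k h1 h2 h3 => hD3 (b + 1) i j k h1 h2 h3) hs
  have hAterm : ∀ (J I : Finset ι) (s : ι) (n : ℕ), s ∉ J → s ∉ I → #J + #I = n →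
      AY (b₀ - n) (m₀ + #J - #I) s (BX (m₀ + #J - #I) (a₀ + n) s
        (creation BY (b₀ - n) (m₀ + #J - #I) J
          (creation BX (m₀ + #J - #I) (a₀ + n) I (Ω #J (-#I))))) =
      ((∏ j ∈ J, al s j) * aY s) • creation BY (b₀ - n - 1) (m₀ + #J - #I - 1) J
        (creation BX (m₀ + #J - #I - 1) (a₀ + n + 1) (insert s I) (Ω #J (-#I - 1))) +
      ∑ j ∈ J, (-g (m₀ + #J - #I - 1) s j * (∏ k ∈ J.erase j, al j k) * aY j) •
        creation BY (b₀ - n - 1) (m₀ + #J - #I - 1) (insert s (J.erase j))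
        (creation BX (m₀ + #J - #I - 1) (a₀ + n + 1) (insert s I) (Ω #J (-#I - 1))) := by
    intro J I s n hsJ hsI hn
    have hn' : (n : ℤ) = #J + #I := by exact_mod_cast hn.symm
    have e1 : b₀ - n + (#J : ℤ) = b₀ + -#I := by rw [hn']; ring
    have e2 : m₀ + #J - #I - #J = m₀ + -(#I : ℤ) := by ring
    have hcX := fun j => congrArg (fun X => X (Ω #J (-#I))) (hcl (b₀ + -#I) (m₀ + -#I) j
      (m₀ + #J - #I - 1) (a₀ + n + 1) (insert s I)).eq
    simp only [Module.End.mul_apply, haY, map_smul] at hcX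
    have hins := creation_insert hX hsI (m₀ + #J - #I - 1) (a₀ + n + 1)
    rw [sub_add_cancel, add_sub_cancel_right] at hins
    have hmv := (hcr hcBB (m₀ + #J - #I) (a₀ + n) s (b₀ - n) (m₀ + #J - #I) J).eq
    rw [← Module.End.mul_apply (BX _ _ _), hmv, Module.End.mul_apply,
      ← Module.End.mul_apply (BX _ _ _), ← hins, ← Module.End.mul_apply (AY _ _ _), offA hsJ,
      e1, e2, ← sub_eq_add_neg, ← sub_eq_add_neg]
    simp only [LinearMap.add_apply, LinearMap.smul_apply, LinearMap.sum_apply,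
      Module.End.mul_apply, hcX, map_smul, smul_smul]
  have hDterm : ∀ (J I : Finset ι) (s : ι) (n : ℕ), s ∉ J → s ∉ I → #J + #I = n →
      BY (b₀ - n) (m₀ + #J - #I) s (DX (m₀ + #J - #I) (a₀ + n) s
        (creation BY (b₀ - n) (m₀ + #J - #I) J
          (creation BX (m₀ + #J - #I) (a₀ + n) I (Ω #J (-#I))))) =
      ((∏ i ∈ I, al i s) * dX s) • creation BY (b₀ - n - 1) (m₀ + #J - #I + 1) (insert s J)
        (creation BX (m₀ + #J - #I + 1) (a₀ + n + 1) I (Ω (#J + 1) (-#I))) +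
      ∑ i ∈ I, (g (m₀ + #J - #I + 1) s i * (∏ k ∈ I.erase i, al k i) * dX i) •
        creation BY (b₀ - n - 1) (m₀ + #J - #I + 1) (insert s J)
        (creation BX (m₀ + #J - #I + 1) (a₀ + n + 1) (insert s (I.erase i))
          (Ω (#J + 1) (-#I))) := by
    intro J I s n hsJ hsI hn
    have hn' : (n : ℤ) = #J + #I := by exact_mod_cast hn.symm
    have e1 : a₀ + n - (#I : ℤ) = a₀ + #J := by rw [hn']; ring
    have e2 : m₀ + #J - #I + #I = m₀ + (#J : ℤ) := by ring
    have hins := creation_insert hY hsJ (b₀ - n - 1) (m₀ + #J - #I + 1)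
    rw [sub_add_cancel, add_sub_cancel_right] at hins
    have hmv := (hcr hcDB (m₀ + #J - #I) (a₀ + n) s (b₀ - n) (m₀ + #J - #I) J).eq
    rw [← Module.End.mul_apply (DX _ _ _), hmv, Module.End.mul_apply,
      ← Module.End.mul_apply (BY _ _ _), ← hins, ← Module.End.mul_apply (DX _ _ _), offD hsI,
      e1, e2]
    simp only [LinearMap.add_apply, LinearMap.smul_apply, LinearMap.sum_apply, map_add, map_sum,
      Module.End.mul_apply, hdX, map_smul, smul_smul]
  induction S using Finset.induction_on with
  | empty => simp
  | insert s S hs ih =>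
    have hb : b₀ - ((#S + 1 : ℕ) : ℤ) = b₀ - #S - 1 := by push_cast; ring
    have ha : a₀ + ((#S + 1 : ℕ) : ℤ) = a₀ + #S + 1 := by push_cast; ring
    rw [Finset.card_insert_of_notMem hs, creation_insert hB hs, hb, ha, sub_add_cancel,
      add_sub_cancel_right, Module.End.mul_apply, ih, map_sum, Finset.sum_powerset_insert hs]
    have part : ∀ J ∈ S.powerset, B (b₀ - #S) (a₀ + #S) s
        (((∏ i ∈ S \ J, ∏ j ∈ J, al i j) * (∏ i ∈ S \ J, aY i) * ∏ j ∈ J, dX j) •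
        creation BY (b₀ - #S) (m₀ + #J - #(S \ J)) J
          (creation BX (m₀ + #J - #(S \ J)) (a₀ + #S) (S \ J) (Ω #J (-#(S \ J))))) =
        ((∏ i ∈ S \ J, ∏ j ∈ J, al i j) * (∏ i ∈ S \ J, aY i) * ∏ j ∈ J, dX j) •
          (((∏ j ∈ J, al s j) * aY s) • creation BY (b₀ - #S - 1) (m₀ + #J - #(S \ J) - 1) J
            (creation BX (m₀ + #J - #(S \ J) - 1) (a₀ + #S + 1) (insert s (S \ J))
              (Ω #J (-#(S \ J) - 1)))) +
        ((∏ i ∈ S \ J, ∏ j ∈ J, al i j) * (∏ i ∈ S \ J, aY i) * ∏ j ∈ J, dX j) •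
          (((∏ i ∈ S \ J, al i s) * dX s) •
          creation BY (b₀ - #S - 1) (m₀ + #J - #(S \ J) + 1) (insert s J)
          (creation BX (m₀ + #J - #(S \ J) + 1) (a₀ + #S + 1) (S \ J)
            (Ω (#J + 1) (-#(S \ J))))) +
        (∑ j ∈ J, ((∏ i ∈ S \ J, ∏ j ∈ J, al i j) * (∏ i ∈ S \ J, aY i) * ∏ j ∈ J, dX j) •
          (-g (m₀ + #J - #(S \ J) - 1) s j * (∏ k ∈ J.erase j, al j k) * aY j) •
          creation BY (b₀ - #S - 1) (m₀ + #J - #(S \ J) - 1) (insert s (J.erase j))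
          (creation BX (m₀ + #J - #(S \ J) - 1) (a₀ + #S + 1) (insert s (S \ J))
            (Ω #J (-#(S \ J) - 1))) +
        ∑ i ∈ S \ J, ((∏ i ∈ S \ J, ∏ j ∈ J, al i j) * (∏ i ∈ S \ J, aY i) * ∏ j ∈ J, dX j) •
          (g (m₀ + #J - #(S \ J) + 1) s i * (∏ k ∈ (S \ J).erase i, al k i) * dX i) •
          creation BY (b₀ - #S - 1) (m₀ + #J - #(S \ J) + 1) (insert s J)
          (creation BX (m₀ + #J - #(S \ J) + 1) (a₀ + #S + 1) (insert s ((S \ J).erase i))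
            (Ω (#J + 1) (-#(S \ J))))) := fun J hJ => by
      have hJS := Finset.mem_powerset.1 hJ
      have hsJ : s ∉ J := fun h => hs (hJS h)
      have hsI : s ∉ S \ J := fun h => hs (Finset.mem_sdiff.1 h).1
      have hn : #J + #(S \ J) = #S := by
        rw [add_comm, Finset.card_sdiff_add_card_eq_card hJS]
      rw [map_smul, hco _ _ (m₀ + #J - #(S \ J)), LinearMap.add_apply, Module.End.mul_apply,
        Module.End.mul_apply, hAterm J (S \ J) s #S hsJ hsI hn, hDterm J (S \ J) s #S hsJ hsI hn]
      simp only [smul_add, Finset.smul_sum]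
      abel
    rw [Finset.sum_congr rfl part]
    simp only [Finset.sum_add_distrib]
    have hunw : (∑ J ∈ S.powerset, ∑ j ∈ J,
          ((∏ i ∈ S \ J, ∏ j ∈ J, al i j) * (∏ i ∈ S \ J, aY i) * ∏ j ∈ J, dX j) •
          (-g (m₀ + #J - #(S \ J) - 1) s j * (∏ k ∈ J.erase j, al j k) * aY j) •
          creation BY (b₀ - #S - 1) (m₀ + #J - #(S \ J) - 1) (insert s (J.erase j))
          (creation BX (m₀ + #J - #(S \ J) - 1) (a₀ + #S + 1) (insert s (S \ J))
            (Ω #J (-#(S \ J) - 1)))) +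
        ∑ J ∈ S.powerset, ∑ i ∈ S \ J,
          ((∏ i ∈ S \ J, ∏ j ∈ J, al i j) * (∏ i ∈ S \ J, aY i) * ∏ j ∈ J, dX j) •
          (g (m₀ + #J - #(S \ J) + 1) s i * (∏ k ∈ (S \ J).erase i, al k i) * dX i) •
          creation BY (b₀ - #S - 1) (m₀ + #J - #(S \ J) + 1) (insert s J)
          (creation BX (m₀ + #J - #(S \ J) + 1) (a₀ + #S + 1) (insert s ((S \ J).erase i))
            (Ω (#J + 1) (-#(S \ J)))) = 0 := by
      rw [Finset.sum_sigma', Finset.sum_sigma', ← eq_neg_iff_add_eq_zero, ← Finset.sum_neg_distrib]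
      refine Finset.sum_bij' (fun x _ => ⟨x.1.erase x.2, x.2⟩) (fun x _ => ⟨insert x.2 x.1, x.2⟩)
        ?_ ?_ ?_ ?_ ?_
      · rintro ⟨J, j⟩ h
        simp only [Finset.mem_sigma, Finset.mem_powerset, Finset.mem_sdiff, Finset.mem_erase,
          ne_eq, not_true_eq_false, false_and, not_false_eq_true, and_true] at h ⊢
        exact ⟨(Finset.erase_subset _ _).trans h.1, h.1 h.2⟩
      · rintro ⟨J, j⟩ h
        simp only [Finset.mem_sigma, Finset.mem_powerset, Finset.mem_sdiff] at h ⊢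
        exact ⟨Finset.insert_subset h.2.1 h.1, Finset.mem_insert_self _ _⟩
      · rintro ⟨J, j⟩ h
        simp only [Finset.mem_sigma] at h
        simp [Finset.insert_erase h.2]
      · rintro ⟨J, j⟩ h
        simp only [Finset.mem_sigma, Finset.mem_sdiff] at h
        simp [Finset.erase_insert h.2.2]
      · rintro ⟨J, j⟩ h
        simp only [Finset.mem_sigma, Finset.mem_powerset] at h
        obtain ⟨hJS, hj⟩ := h
        obtain ⟨K, hjK, rfl⟩ : ∃ K, j ∉ K ∧ insert j K = J :=
          ⟨J.erase j, Finset.notMem_erase _ _, Finset.insert_erase hj⟩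
        obtain ⟨I, hI⟩ : ∃ I, S \ insert j K = I := ⟨_, rfl⟩
        have hjI : j ∉ I := by rw [← hI]; simp
        have hSK : S \ K = insert j I := by
          rw [← hI]
          ext i
          simp only [Finset.mem_sdiff, Finset.mem_insert]
          have := Finset.insert_subset_iff.1 hJS
          by_cases hij : i = j
          · subst hij; simp [hjK, this.1]
          · simp [hij]
        dsimp only
        rw [hI, Finset.erase_insert hjK, hSK, Finset.erase_insert hjI,
          Finset.card_insert_of_notMem hjK, Finset.card_insert_of_notMem hjI]
        have c1 : m₀ + ((#K + 1 : ℕ) : ℤ) - #I - 1 = m₀ + #K - ((#I + 1 : ℕ) : ℤ) + 1 := by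
          push_cast; ring
        have c2 : -((#I + 1 : ℕ) : ℤ) = -#I - 1 := by push_cast; ring
        have c3 : ((#K + 1 : ℕ) : ℤ) = #K + 1 := by push_cast; ring
        rw [c1, c2, c3, smul_smul, smul_smul, ← neg_smul]
        congr 1
        simp only [Finset.prod_insert hjI, Finset.prod_insert hjK, Finset.prod_mul_distrib]
        ring
    rw [hunw, add_zero]
    congr 1
    · refine Finset.sum_congr rfl fun J hJ => ?_
      have hJS := Finset.mem_powerset.1 hJ
      have hsJ : s ∉ J := fun h => hs (hJS h)
      have hsI : s ∉ S \ J := fun h => hs (Finset.mem_sdiff.1 h).1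
      have hI : insert s S \ J = insert s (S \ J) := Finset.insert_sdiff_of_notMem _ hsJ
      rw [hI, Finset.card_insert_of_notMem hsI, Finset.prod_insert hsI, Finset.prod_insert hsI,
        smul_smul]
      have c1 : m₀ + (#J : ℤ) - ((#(S \ J) + 1 : ℕ) : ℤ) = m₀ + #J - #(S \ J) - 1 := by
        push_cast; ring
      have c2 : -((#(S \ J) + 1 : ℕ) : ℤ) = -#(S \ J) - 1 := by push_cast; ring
      rw [c1, c2]
      congr 1
      ring
    · refine Finset.sum_congr rfl fun J hJ => ?_
      have hJS := Finset.mem_powerset.1 hJ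
      have hsJ : s ∉ J := fun h => hs (hJS h)
      have hI : insert s S \ insert s J = S \ J := by
        rw [Finset.insert_sdiff_insert]
        ext i
        simp only [Finset.mem_sdiff, Finset.mem_insert, not_or]
        exact ⟨fun h => ⟨h.1, h.2.2⟩, fun h => ⟨h.1, fun he => hs (he ▸ h.1), h.2⟩⟩
      rw [hI, Finset.card_insert_of_notMem hsJ, Finset.prod_insert hsJ, smul_smul]
      have c1 : m₀ + ((#J + 1 : ℕ) : ℤ) - #(S \ J) = m₀ + #J - #(S \ J) + 1 := by
        push_cast; ring
      have c3 : ((#J + 1 : ℕ) : ℤ) = #J + 1 := by push_cast; ring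
      rw [c1, c3]
      congr 1
      simp only [Finset.prod_insert hsJ, Finset.prod_mul_distrib]
      ring

end twoPart

/-! ### Strings of theta functions -/

/-- `∏_{i<n} θ₁₁(x + c - 2 i η)`. -/
def strP (P : Params) (n : ℕ) (c x : ℂ) : ℂ := ∏ i ∈ Finset.range n, th11 P (x + c - 2 * i * P.η)

/-- `∏_{i<n} θ₁₁(x - c + 2 i η)`. -/
def strQ (P : Params) (n : ℕ) (c x : ℂ) : ℂ := ∏ i ∈ Finset.range n, th11 P (x - c + 2 * i * P.η)

lemma strP_succ (n : ℕ) (c x : ℂ) :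
    strP P (n + 1) c x = strP P n c x * th11 P (x + c - 2 * n * P.η) := by
  rw [strP, Finset.prod_range_succ, strP]

lemma strP_succ' (n : ℕ) (c x : ℂ) :
    strP P (n + 1) c x = strP P n (c - 2 * P.η) x * th11 P (x + c) := by
  rw [strP, Finset.prod_range_succ', strP]
  congr 1
  · refine Finset.prod_congr rfl fun i _ => ?_
    congr 1; push_cast; ring
  · congr 1; push_cast; ring

lemma strQ_succ (n : ℕ) (c x : ℂ) :
    strQ P (n + 1) c x = strQ P n c x * th11 P (x - c + 2 * n * P.η) := by
  rw [strQ, Finset.prod_range_succ, strQ]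

lemma strQ_succ' (n : ℕ) (c x : ℂ) :
    strQ P (n + 1) c x = strQ P n (c - 2 * P.η) x * th11 P (x - c) := by
  rw [strQ, Finset.prod_range_succ', strQ]
  congr 1
  · refine Finset.prod_congr rfl fun i _ => ?_
    congr 1; push_cast; ring
  · congr 1; push_cast; ring

lemma strP_add (n : ℕ) (c x y : ℂ) : strP P n c (x + y) = strP P n (c + y) x :=
  Finset.prod_congr rfl fun i _ => by congr 1; ring

lemma strQ_add (n : ℕ) (c x y : ℂ) : strQ P n c (x + y) = strQ P n (c - y) x :=
  Finset.prod_congr rfl fun i _ => by congr 1; ring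

/-- `∏_{i<n} θ₁₁(x + c - 2 i η) θ₁₁(x - c + 2 i η)`. -/
def grp (P : Params) (n : ℕ) (c x : ℂ) : ℂ := strP P n c x * strQ P n c x

lemma grp_neg (n : ℕ) (c x : ℂ) : grp P n c (-x) = grp P n c x := by
  simp only [grp, strP, strQ, ← Finset.prod_mul_distrib]
  refine Finset.prod_congr rfl fun i _ => ?_
  rw [show -x + c - 2 * i * P.η = -(x - c + 2 * i * P.η) by ring,
    show -x - c + 2 * i * P.η = -(x + c - 2 * i * P.η) by ring, th11_neg, th11_neg]
  ring

lemma grp_sub (n : ℕ) (c x y : ℂ) : grp P n c (x - y) = grp P n c (-x + y) := by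
  rw [← grp_neg, neg_sub, neg_add_eq_sub]

lemma grp_extend (n : ℕ) (c x : ℂ) : grp P n c (x + P.η) *
    (th11 P (x + (c - 2 * n * P.η + P.η)) * th11 P (x - (c + P.η))) = grp P (n + 1) (c + P.η) x := by
  rw [grp, grp, strP_add, strQ_add, strP_succ, strQ_succ',
    show x + (c - 2 * n * P.η + P.η) = x + (c + P.η) - 2 * n * P.η by ring,
    show c + P.η - 2 * P.η = c - P.η by ring]
  ring

lemma grp_shrink (n : ℕ) (c x : ℂ) : grp P (n + 1) c (x + P.η) =
    grp P n (c - P.η) x * (th11 P (x + (c + P.η)) * th11 P (x - (c - 2 * n * P.η - P.η))) := by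
  rw [grp, grp, strP_add, strQ_add, strP_succ', strQ_succ,
    show x - (c - P.η) + 2 * n * P.η = x - (c - 2 * n * P.η - P.η) by ring,
    show c + P.η - 2 * P.η = c - P.η by ring]
  ring

lemma grp_down (n : ℕ) (c x : ℂ) : grp P n c (x + P.η) * th11 P (x + (c - 2 * n * P.η + P.η)) =
    grp P n (c - P.η) x * th11 P (x + (c + P.η)) := by
  have h := (strP_succ (P := P) n (c + P.η) x).symm.trans (strP_succ' n (c + P.η) x)
  rw [show x + (c + P.η) - 2 * n * P.η = x + (c - 2 * n * P.η + P.η) by ring,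
    show c + P.η - 2 * P.η = c - P.η by ring] at h
  rw [grp, grp, strP_add, strQ_add]
  linear_combination strQ P n (c - P.η) x * h

lemma grp_up (n : ℕ) (c x : ℂ) : grp P n c (x + P.η) * th11 P (x - (c + P.η)) =
    grp P n (c + P.η) x * th11 P (x - (c - 2 * n * P.η + P.η)) := by
  have h := (strQ_succ (P := P) n (c + P.η) x).symm.trans (strQ_succ' n (c + P.η) x)
  rw [show x - (c + P.η) + 2 * n * P.η = x - (c - 2 * n * P.η + P.η) by ring,
    show c + P.η - 2 * P.η = c - P.η by ring] at h
  rw [grp, grp, strP_add, strQ_add]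
  linear_combination -strP P n (c + P.η) x * h

lemma halfVec_sub_half (s x : ℂ) :
    (halfVec P s : ℂ → ℂ) (x - 1 / 2) = th11 P (x + s) * th11 P (x - s) := by
  change th10 P (x - 1 / 2 + s) * th10 P (x - 1 / 2 - s) = _
  rw [th10_eq, th10_eq, show x - 1 / 2 + s + 1 / 2 = x + s by ring,
    show x - 1 / 2 - s + 1 / 2 = x - s by ring]
  ring

lemma intVec_sub_half {d k : ℕ} (hk : k ≤ d) (lam lam' u x : ℂ) :
    (intVec P d k lam lam' u : ℂ → ℂ) (x - 1 / 2) =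
      grp P k ((lam + u) / 2 + (d / 2 - 1) * P.η) x *
        grp P (d - k) ((lam' - u) / 2 + (d / 2 - 1) * P.η) x := by
  obtain ⟨n, rfl⟩ := Nat.exists_eq_add_of_le hk
  let F : ℕ → ℂ := fun i => if i < k then
      th11 P (x + ((lam + u) / 2 + (((k + n : ℕ) : ℂ) / 2 - 1) * P.η) - 2 * i * P.η) *
        th11 P (x - ((lam + u) / 2 + (((k + n : ℕ) : ℂ) / 2 - 1) * P.η) + 2 * i * P.η)
    else th11 P (x + ((lam' - u) / 2 + (((k + n : ℕ) : ℂ) / 2 - 1) * P.η) -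
          2 * ((i : ℂ) - k) * P.η) *
        th11 P (x - ((lam' - u) / 2 + (((k + n : ℕ) : ℂ) / 2 - 1) * P.η) +
          2 * ((i : ℂ) - k) * P.η)
  have h : (intVec P (k + n) k lam lam' u : ℂ → ℂ) (x - 1 / 2) = ∏ i : Fin (k + n), F i := by
    change ∏ i : Fin (k + n), _ = _
    refine Finset.prod_congr rfl fun i _ => ?_
    simp only [F]
    split_ifs with hi
    · rw [halfVec_sub_half]; congr 2 <;> ring
    · rw [halfVec_sub_half]; congr 2 <;> ring
  rw [h, Fin.prod_univ_eq_prod_range F, Finset.prod_range_add]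
  simp only [F]
  simp only [grp, strP, strQ, ← Finset.prod_mul_distrib, Nat.add_sub_cancel_left]
  congr 1
  · refine Finset.prod_congr rfl fun i hi => ?_
    rw [if_pos (Finset.mem_range.1 hi)]
  · refine Finset.prod_congr rfl fun i hi => ?_
    rw [if_neg (by omega)]
    congr 2 <;> (push_cast; ring)

lemma stepVec_sub_half {d k : ℕ} (hk : k ≤ d) {a b : ℤ} (hab : a - b = 2 * k - d) (z x : ℂ) :
    (stepVec P d a b z : ℂ → ℂ) (x - 1 / 2) =
      grp P k ((lamAt P a + z) / 2 + (d / 2 - 1) * P.η) x *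
        grp P (d - k) ((lamAt P b - z) / 2 + (d / 2 - 1) * P.η) x := by
  have h : ((d + a - b) / 2).toNat = k := by omega
  rw [stepVec, h, intVec_sub_half hk]

/-- A vector is determined by its values at generic points. -/
lemma V_ext_half (hη : th11 P (2 * P.η) ≠ 0) {d : ℕ} {f g : V P d}
    (h : ∀ x, th11 P (2 * x) * (f : ℂ → ℂ) (x - 1 / 2) =
      th11 P (2 * x) * (g : ℂ → ℂ) (x - 1 / 2)) : f = g := by
  refine V_ext_mul hη fun y => ?_
  have := h (y + 1 / 2)
  rw [add_sub_cancel_right, show 2 * (y + 1 / 2) = 2 * y + 1 by ring, th11_add_one] at this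
  linear_combination -this

section
variable (hτ : 0 < P.τ.im) (hη : th11 P (2 * P.η) ≠ 0)
include hτ hη

omit hη in
lemma th11_string_identity (t p q x : ℂ) :
    th11 P (t + p - x) * th11 P (t + q + x) * (th11 P (x + p) * th11 P (x - q)) -
      th11 P (t + p + x) * th11 P (t + q - x) * (th11 P (x - p) * th11 P (x + q)) =
      th11 P (2 * x) * th11 P t * th11 P (t + p + q) * th11 P (p - q) := by
  have h := th11_three_term hτ (t + (p + q) / 2) ((p - q) / 2 - x) ((p + q) / 2) ((p - q) / 2 + x)
  rw [show t + (p + q) / 2 + ((p - q) / 2 - x) = t + p - x by ring,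
    show t + (p + q) / 2 - ((p - q) / 2 - x) = t + q + x by ring,
    show (p + q) / 2 + ((p - q) / 2 + x) = x + p by ring,
    show (p + q) / 2 - ((p - q) / 2 + x) = -(x - q) by ring,
    show t + (p + q) / 2 + (p + q) / 2 = t + p + q by ring,
    show t + (p + q) / 2 - (p + q) / 2 = t by ring,
    show (p - q) / 2 - x + ((p - q) / 2 + x) = p - q by ring,
    show (p - q) / 2 - x - ((p - q) / 2 + x) = -(2 * x) by ring,
    show t + (p + q) / 2 + ((p - q) / 2 + x) = t + p + x by ring,
    show t + (p + q) / 2 - ((p - q) / 2 + x) = t + q - x by ring,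
    show (p - q) / 2 - x + (p + q) / 2 = -(x - p) by ring,
    show (p - q) / 2 - x - (p + q) / 2 = -(x + q) by ring, th11_neg, th11_neg, th11_neg,
    th11_neg] at h
  linear_combination -h

/-- The creation operator of one site. -/
lemma opB_stepVec (hl : ∀ a, th11 P (lamAt P a) ≠ 0) {d k : ℕ} (hk : k ≤ d) {a b : ℤ}
    (hab : a - b = 2 * k - d) (z : ℂ) {t : ℂ} (ht : th11 P t ≠ 0) :
    opB P (fun t => Ls P d (t - z)) b a t (stepVec P d a b z) =
      (th11 P (2 * (d - k) * P.η) * th11 P (t - z + P.lam + (a + b) * P.η) /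
        (th11 P (2 * P.η) * th11 P (lamAt P a) * th11 P (lamAt P b))) •
        stepVec P d (a + 1) (b - 1) z := by
  have habc : (a : ℂ) = b + 2 * k - d := by
    have : ((a - b : ℤ) : ℂ) = ((2 * k - d : ℤ) : ℂ) := by rw [hab]
    push_cast at this; linear_combination this
  have hla := hl a
  have hlb := hl b
  suffices h : br (Ls P d (t - z)) (ev P ((lamAt P b + t) / 2)) (ev P ((lamAt P a + t) / 2))
      (stepVec P d a b z) = (-2 * th11 P t * th11 P (2 * (d - k) * P.η) *
        th11 P (t - z + P.lam + (a + b) * P.η) / th11 P (2 * P.η)) •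
        stepVec P d (a + 1) (b - 1) z by
    rw [opB, LinearMap.smul_apply, h, smul_smul]
    congr 1
    generalize th11 P (2 * P.η) = X at *
    field_simp
  refine V_ext_half hη fun x => ?_
  rw [br_Ls hτ hη, dt_ev hτ, dt_ev hτ, dt_ev hτ, dt_ev hτ, Submodule.coe_smul, Pi.smul_apply,
    smul_eq_mul, stepVec_sub_half hk hab, stepVec_sub_half hk hab]
  obtain ⟨p, hp⟩ : ∃ p, p = (lamAt P b - z) / 2 + d / 2 * P.η := ⟨_, rfl⟩
  obtain ⟨q, hq⟩ : ∃ q, q = (lamAt P a - z) / 2 - d / 2 * P.η := ⟨_, rfl⟩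
  obtain ⟨c, hc⟩ : ∃ c, c = (lamAt P a + z) / 2 + (d / 2 - 1) * P.η := ⟨_, rfl⟩
  have key := th11_string_identity hτ t p q x
  rw [show (lamAt P b + t) / 2 + ((t - z) / 2 + d / 2 * P.η - x) = t + p - x by rw [hp]; ring,
    show (lamAt P b + t) / 2 - ((t - z) / 2 + d / 2 * P.η - x) = x + (c - 2 * k * P.η + P.η) by
      rw [hc]; simp only [lamAt, habc]; ring,
    show (t - z) / 2 - d / 2 * P.η + x + (lamAt P a + t) / 2 = t + q + x by rw [hq]; ring,
    show (t - z) / 2 - d / 2 * P.η + x - (lamAt P a + t) / 2 = x - (c + P.η) by rw [hc]; ring,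
    show (lamAt P b + t) / 2 + ((t - z) / 2 + d / 2 * P.η + x) = t + p + x by rw [hp]; ring,
    show (lamAt P b + t) / 2 - ((t - z) / 2 + d / 2 * P.η + x) = -x + (c - 2 * k * P.η + P.η) by
      rw [hc]; simp only [lamAt, habc]; ring,
    show (t - z) / 2 - d / 2 * P.η - x + (lamAt P a + t) / 2 = t + q - x by rw [hq]; ring,
    show (t - z) / 2 - d / 2 * P.η - x - (lamAt P a + t) / 2 = -x - (c + P.η) by rw [hc]; ring,
    ← hc, show (lamAt P b - z) / 2 + (d / 2 - 1) * P.η = p - P.η by rw [hp]; ring,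
    grp_sub k, grp_sub (d - k)]
  have g1 := grp_extend (P := P) k c x
  have g2 := grp_extend (P := P) k c (-x)
  rw [grp_neg] at g2
  rcases Nat.lt_or_ge k d with hkd | hkd
  · obtain ⟨n, hn⟩ : ∃ n, d - k = n + 1 := ⟨d - k - 1, by omega⟩
    have hdn : (d : ℂ) = k + n + 1 := by
      have : d = k + n + 1 := by omega
      rw [this]; push_cast; ring
    have g3 := grp_shrink (P := P) n (p - P.η) x
    have g4 := grp_shrink (P := P) n (p - P.η) (-x)
    rw [grp_neg] at g4
    rw [sub_add_cancel, show p - P.η - 2 * n * P.η - P.η = q by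
      rw [hp, hq]; simp only [lamAt, habc, hdn]; ring] at g3 g4
    rw [stepVec_sub_half (k := k + 1) (by omega) (by push_cast; omega),
      show d - (k + 1) = n by omega, hn,
      show (lamAt P (a + 1) + z) / 2 + (d / 2 - 1) * P.η = c + P.η by
        rw [hc, lamAt_add]; push_cast; ring,
      show (lamAt P (b - 1) - z) / 2 + (d / 2 - 1) * P.η = p - P.η - P.η by
        rw [hp, lamAt_sub]; push_cast; ring, g3, g4]
    have e1 : t + p + q = t - z + P.lam + (a + b) * P.η := by
      rw [hp, hq]; simp only [lamAt]; ring
    have e2 : p - q = 2 * (d - k) * P.η := by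
      rw [hp, hq]; simp only [lamAt, habc]; ring
    rw [← e1, ← e2]
    have s1 : th11 P (-x + p) = -th11 P (x - p) := by rw [← th11_neg]; congr 1; ring
    have s2 : th11 P (-x - q) = -th11 P (x + q) := by rw [← th11_neg]; congr 1; ring
    rw [s1, s2]
    generalize th11 P (2 * P.η) = X at *
    rw [div_eq_mul_inv, mul_inv, ← sub_eq_zero]
    linear_combination (-2 * X⁻¹ * grp P n (p - P.η - P.η) x * (th11 P (t + p - x) *
      th11 P (t + q + x) * (th11 P (x + p) * th11 P (x - q)))) * g1 +
      (2 * X⁻¹ * grp P n (p - P.η - P.η) x * (th11 P (t + p + x) *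
      th11 P (t + q - x) * (th11 P (x - p) * th11 P (x + q)))) * g2 -
      2 * X⁻¹ * grp P n (p - P.η - P.η) x * grp P (k + 1) (c + P.η) x * key
  · obtain rfl : k = d := le_antisymm hk hkd
    have e : p = q := by rw [hp, hq]; simp only [lamAt, habc]; ring
    rw [sub_self, mul_zero, zero_mul, th11_zero, Nat.sub_self, e]
    have g0 : ∀ c x, grp P 0 c x = 1 := fun c x => by simp [grp, strP, strQ]
    rw [g0, g0]
    linear_combination (-(2 * th11 P (2 * P.η))⁻¹ * 4 * th11 P (t + q - x) *
      th11 P (t + q + x)) * (g1 - g2)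

/-- The action of a diagonal operator on the vacuum of one site. -/
lemma opA_stepVec (hl : ∀ a, th11 P (lamAt P a) ≠ 0) (d : ℕ) (a : ℤ) (z : ℂ) {t : ℂ}
    (ht : th11 P t ≠ 0) :
    opA P (fun t => Ls P d (t - z)) (a + d) a t (stepVec P d a (a + d) z) =
      alphaL P d (t - z) • stepVec P d (a - 1) (a + d - 1) z := by
  have hlb := hl (a + d)
  suffices h : br (Ls P d (t - z)) (ev P ((lamAt P (a + d) + t) / 2)) (ev P ((lamAt P a - t) / 2))
      (stepVec P d a (a + d) z) = (-2 * th11 P t * th11 P (lamAt P (a + d)) *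
        th11 P (t - z + d * P.η) / th11 P (2 * P.η)) • stepVec P d (a - 1) (a + d - 1) z by
    rw [opA, LinearMap.smul_apply, h, smul_smul, alphaL]
    congr 1
    generalize th11 P (2 * P.η) = X at *
    field_simp
  have e0 : lamAt P (a + d) = lamAt P a + 2 * d * P.η := by rw [lamAt_add]; push_cast; ring
  refine V_ext_half hη fun x => ?_
  rw [br_Ls hτ hη, dt_ev hτ, dt_ev hτ, dt_ev hτ, dt_ev hτ, Submodule.coe_smul, Pi.smul_apply,
    smul_eq_mul, stepVec_sub_half (k := 0) (by omega) (by push_cast; omega),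
    stepVec_sub_half (k := 0) (by omega) (by push_cast; omega),
    stepVec_sub_half (k := 0) (by omega) (by push_cast; omega)]
  have g0 : ∀ c x, grp P 0 c x = 1 := fun c x => by simp [grp, strP, strQ]
  obtain ⟨p, hp⟩ : ∃ p, p = (lamAt P (a + d) - z) / 2 + d / 2 * P.η := ⟨_, rfl⟩
  obtain ⟨q, hq⟩ : ∃ q, q = (lamAt P a - z) / 2 - d / 2 * P.η := ⟨_, rfl⟩
  obtain ⟨s, hs⟩ : ∃ s, s = (lamAt P a + z) / 2 + d / 2 * P.η := ⟨_, rfl⟩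
  have key := th11_string_identity hτ t p (-s) x
  rw [g0, g0, g0, Nat.sub_zero, one_mul, one_mul, one_mul,
    show (lamAt P (a + d) + t) / 2 + ((t - z) / 2 + d / 2 * P.η - x) = t + p - x by rw [hp]; ring,
    show (lamAt P (a + d) + t) / 2 - ((t - z) / 2 + d / 2 * P.η - x) = x - -s by
      rw [hs, e0]; ring,
    show (t - z) / 2 - d / 2 * P.η + x + (lamAt P a - t) / 2 = x + q by rw [hq]; ring,
    show (t - z) / 2 - d / 2 * P.η + x - (lamAt P a - t) / 2 = t + -s + x by rw [hs]; ring,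
    show (lamAt P (a + d) + t) / 2 + ((t - z) / 2 + d / 2 * P.η + x) = t + p + x by rw [hp]; ring,
    show (lamAt P (a + d) + t) / 2 - ((t - z) / 2 + d / 2 * P.η + x) = -(x + -s) by
      rw [hs, e0]; ring,
    show (t - z) / 2 - d / 2 * P.η - x + (lamAt P a - t) / 2 = -x + q by rw [hq]; ring,
    show (t - z) / 2 - d / 2 * P.η - x - (lamAt P a - t) / 2 = t + -s - x by rw [hs]; ring,
    show (lamAt P (a + d) - z) / 2 + (d / 2 - 1) * P.η = p - P.η by rw [hp]; ring,
    show (lamAt P (a + d - 1) - z) / 2 + (d / 2 - 1) * P.η = p - P.η - P.η by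
      rw [hp, lamAt_sub]; push_cast; ring, grp_sub d]
  have g1 := grp_down (P := P) d (p - P.η) x
  have g2 := grp_down (P := P) d (p - P.η) (-x)
  rw [grp_neg] at g2
  rw [sub_add_cancel, show p - P.η - 2 * d * P.η + P.η = q by rw [hp, hq, e0]; ring] at g1 g2
  have e1 : t + p + -s = t - z + d * P.η := by rw [hp, hs, e0]; ring
  have e2 : p - -s = lamAt P (a + d) := by rw [hp, hs, e0]; ring
  rw [← e1, ← e2]
  have s1 : th11 P (-x + p) = -th11 P (x - p) := by rw [← th11_neg]; congr 1; ring
  rw [s1] at g2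
  rw [th11_neg (x + -s)]
  generalize th11 P (2 * P.η) = X at *
  rw [div_eq_mul_inv, mul_inv]
  linear_combination (-2 * X⁻¹ * (th11 P (t + p - x) * th11 P (t + -s + x) * th11 P (x - -s))) * g1 -
    (2 * X⁻¹ * (th11 P (t + p + x) * th11 P (t + -s - x) * th11 P (x + -s))) * g2 -
    2 * X⁻¹ * grp P d (p - P.η - P.η) x * key

lemma opD_stepVec (hl : ∀ a, th11 P (lamAt P a) ≠ 0) (d : ℕ) (a : ℤ) (z : ℂ) {t : ℂ}
    (ht : th11 P t ≠ 0) :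
    opD P (fun t => Ls P d (t - z)) (a + d) a t (stepVec P d a (a + d) z) =
      deltaL P d (t - z) • stepVec P d (a + 1) (a + d + 1) z := by
  have hla := hl a
  suffices h : br (Ls P d (t - z)) (ev P ((lamAt P (a + d) - t) / 2)) (ev P ((lamAt P a + t) / 2))
      (stepVec P d a (a + d) z) = (2 * th11 P t * th11 P (lamAt P a) *
        th11 P (t - z - d * P.η) / th11 P (2 * P.η)) • stepVec P d (a + 1) (a + d + 1) z by
    rw [opD, LinearMap.smul_apply, h, smul_smul, deltaL]
    congr 1
    generalize th11 P (2 * P.η) = X at *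
    field_simp
  have e0 : lamAt P (a + d) = lamAt P a + 2 * d * P.η := by rw [lamAt_add]; push_cast; ring
  refine V_ext_half hη fun x => ?_
  rw [br_Ls hτ hη, dt_ev hτ, dt_ev hτ, dt_ev hτ, dt_ev hτ, Submodule.coe_smul, Pi.smul_apply,
    smul_eq_mul, stepVec_sub_half (k := 0) (by omega) (by push_cast; omega),
    stepVec_sub_half (k := 0) (by omega) (by push_cast; omega),
    stepVec_sub_half (k := 0) (by omega) (by push_cast; omega)]
  have g0 : ∀ c x, grp P 0 c x = 1 := fun c x => by simp [grp, strP, strQ]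
  obtain ⟨p, hp⟩ : ∃ p, p = (lamAt P (a + d) - z) / 2 + d / 2 * P.η := ⟨_, rfl⟩
  obtain ⟨q, hq⟩ : ∃ q, q = (lamAt P a - z) / 2 - d / 2 * P.η := ⟨_, rfl⟩
  obtain ⟨s, hs⟩ : ∃ s, s = (lamAt P a + z) / 2 + d / 2 * P.η := ⟨_, rfl⟩
  have key := th11_string_identity hτ t (-s) q x
  rw [g0, g0, g0, Nat.sub_zero, one_mul, one_mul, one_mul,
    show (lamAt P (a + d) - t) / 2 + ((t - z) / 2 + d / 2 * P.η - x) = -(x - p) by rw [hp]; ring,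
    show (lamAt P (a + d) - t) / 2 - ((t - z) / 2 + d / 2 * P.η - x) = -(t + -s - x) by
      rw [hs, e0]; ring,
    show (t - z) / 2 - d / 2 * P.η + x + (lamAt P a + t) / 2 = t + q + x by rw [hq]; ring,
    show (t - z) / 2 - d / 2 * P.η + x - (lamAt P a + t) / 2 = x + -s by rw [hs]; ring,
    show (lamAt P (a + d) - t) / 2 + ((t - z) / 2 + d / 2 * P.η + x) = -(-x - p) by rw [hp]; ring,
    show (lamAt P (a + d) - t) / 2 - ((t - z) / 2 + d / 2 * P.η + x) = -(t + -s + x) by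
      rw [hs, e0]; ring,
    show (t - z) / 2 - d / 2 * P.η - x + (lamAt P a + t) / 2 = t + q - x by rw [hq]; ring,
    show (t - z) / 2 - d / 2 * P.η - x - (lamAt P a + t) / 2 = -(x - -s) by rw [hs]; ring,
    show (lamAt P (a + d) - z) / 2 + (d / 2 - 1) * P.η = p - P.η by rw [hp]; ring,
    show (lamAt P (a + d + 1) - z) / 2 + (d / 2 - 1) * P.η = p by
      rw [hp, lamAt_add]; push_cast; ring, grp_sub d]
  have g1 := grp_up (P := P) d (p - P.η) x
  have g2 := grp_up (P := P) d (p - P.η) (-x)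
  rw [grp_neg] at g2
  rw [sub_add_cancel, show p - P.η - 2 * d * P.η + P.η = q by rw [hp, hq, e0]; ring] at g1 g2
  have e1 : t + -s + q = t - z - d * P.η := by rw [hq, hs]; ring
  have e2 : -s - q = -lamAt P a := by rw [hq, hs]; ring
  rw [e1, e2, th11_neg] at key
  have s1 : th11 P (-x - q) = -th11 P (x + q) := by rw [← th11_neg]; congr 1; ring
  rw [s1] at g2
  simp only [th11_neg]
  generalize th11 P (2 * P.η) = X at *
  rw [div_eq_mul_inv, mul_inv]
  linear_combination (-2 * X⁻¹ * (th11 P (t + -s - x) * th11 P (t + q + x) * th11 P (x + -s))) * g1 -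
    (2 * X⁻¹ * (th11 P (t + -s + x) * th11 P (t + q - x) * th11 P (x - -s))) * g2 -
    2 * X⁻¹ * grp P d p x * key

lemma opC_stepVec (d : ℕ) (a : ℤ) (z t : ℂ) :
    opC P (fun t => Ls P d (t - z)) (a + d) a t (stepVec P d a (a + d) z) = 0 := by
  suffices h : br (Ls P d (t - z)) (ev P ((lamAt P (a + d) - t) / 2)) (ev P ((lamAt P a - t) / 2))
      (stepVec P d a (a + d) z) = 0 by
    rw [opC, LinearMap.smul_apply, h, smul_zero]
  have e0 : lamAt P (a + d) = lamAt P a + 2 * d * P.η := by rw [lamAt_add]; push_cast; ring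
  refine V_ext_half hη fun x => ?_
  rw [br_Ls hτ hη, dt_ev hτ, dt_ev hτ, dt_ev hτ, dt_ev hτ, 
    stepVec_sub_half (k := 0) (by omega) (by push_cast; omega),
    stepVec_sub_half (k := 0) (by omega) (by push_cast; omega)]
  have g0 : ∀ c x, grp P 0 c x = 1 := fun c x => by simp [grp, strP, strQ]
  obtain ⟨p, hp⟩ : ∃ p, p = (lamAt P (a + d) - z) / 2 + d / 2 * P.η := ⟨_, rfl⟩
  obtain ⟨q, hq⟩ : ∃ q, q = (lamAt P a - z) / 2 - d / 2 * P.η := ⟨_, rfl⟩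
  obtain ⟨s, hs⟩ : ∃ s, s = (lamAt P a + z) / 2 + d / 2 * P.η := ⟨_, rfl⟩
  rw [g0, g0, Nat.sub_zero, one_mul, one_mul,
    show (lamAt P (a + d) - t) / 2 + ((t - z) / 2 + d / 2 * P.η - x) = -(x - p) by rw [hp]; ring,
    show (lamAt P (a + d) - t) / 2 - ((t - z) / 2 + d / 2 * P.η - x) = -(t + -s - x) by
      rw [hs, e0]; ring,
    show (t - z) / 2 - d / 2 * P.η + x + (lamAt P a - t) / 2 = x + q by rw [hq]; ring,
    show (t - z) / 2 - d / 2 * P.η + x - (lamAt P a - t) / 2 = t + -s + x by rw [hs]; ring,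
    show (lamAt P (a + d) - t) / 2 + ((t - z) / 2 + d / 2 * P.η + x) = x + p by rw [hp]; ring,
    show (lamAt P (a + d) - t) / 2 - ((t - z) / 2 + d / 2 * P.η + x) = -(t + -s + x) by
      rw [hs, e0]; ring,
    show (t - z) / 2 - d / 2 * P.η - x + (lamAt P a - t) / 2 = -x + q by rw [hq]; ring,
    show (t - z) / 2 - d / 2 * P.η - x - (lamAt P a - t) / 2 = t + -s - x by rw [hs]; ring,
    show (lamAt P (a + d) - z) / 2 + (d / 2 - 1) * P.η = p - P.η by rw [hp]; ring, grp_sub d]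
  have g1 := grp_down (P := P) d (p - P.η) x
  have g2 := grp_down (P := P) d (p - P.η) (-x)
  rw [grp_neg] at g2
  rw [sub_add_cancel, show p - P.η - 2 * d * P.η + P.η = q by rw [hp, hq, e0]; ring] at g1 g2
  have s1 : th11 P (-x + p) = -th11 P (x - p) := by rw [← th11_neg]; congr 1; ring
  rw [s1] at g2
  simp only [th11_neg, Submodule.coe_zero, Pi.zero_apply]
  linear_combination (-(2 * th11 P (2 * P.η))⁻¹ * 4 * (th11 P (x - p) * th11 P (t + -s - x) *
      th11 P (t + -s + x))) * g1 - ((2 * th11 P (2 * P.η))⁻¹ * 4 * (th11 P (x + p) *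
      th11 P (t + -s - x) * th11 P (t + -s + x))) * g2

end

/-! ### Transport along homomorphisms of algebras -/

section hom
variable {A A' : Type*} [Ring A] [Algebra ℂ A] [Ring A'] [Algebra ℂ A'] (φ : A →ₐ[ℂ] A')

lemma br_map (T : Matrix (Fin 2) (Fin 2) A) (r c : Fin 2 → ℂ) :
    br (T.map φ) r c = φ (br T r c) := by
  simp only [br_apply, map_sub, map_add, map_smul, Matrix.map_apply]

lemma opA_map (T : ℂ → Matrix (Fin 2) (Fin 2) A) (b a : ℤ) (t : ℂ) :
    opA P (fun u => (T u).map φ) b a t = φ (opA P T b a t) := by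
  rw [opA, br_map, opA, map_smul]

lemma opB_map (T : ℂ → Matrix (Fin 2) (Fin 2) A) (b a : ℤ) (t : ℂ) :
    opB P (fun u => (T u).map φ) b a t = φ (opB P T b a t) := by
  rw [opB, br_map, opB, map_smul]

lemma opC_map (T : ℂ → Matrix (Fin 2) (Fin 2) A) (b a : ℤ) (t : ℂ) :
    opC P (fun u => (T u).map φ) b a t = φ (opC P T b a t) := by
  rw [opC, br_map, opC, map_smul]

lemma opD_map (T : ℂ → Matrix (Fin 2) (Fin 2) A) (b a : ℤ) (t : ℂ) :
    opD P (fun u => (T u).map φ) b a t = φ (opD P T b a t) := by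
  rw [opD, br_map, opD, map_smul]

lemma RTT.map {T : ℂ → Matrix (Fin 2) (Fin 2) A} (h : RTT P T) :
    RTT P fun u => (T u).map φ := by
  intro u v r₁ r₂ c₁ c₂
  have := congrArg φ (h u v r₁ r₂ c₁ c₂)
  simpa only [RR, map_sum, map_smul, LinearMap.compl₁₂_apply, LinearMap.flip_apply,
    LinearMap.mul_apply', map_mul, br_map] using this

lemma RTT.comp_sub {T : ℂ → Matrix (Fin 2) (Fin 2) A} (h : RTT P T) (z : ℂ) :
    RTT P fun u => T (u - z) := by
  intro u v r₁ r₂ c₁ c₂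
  have := h (u - z) (v - z) r₁ r₂ c₁ c₂
  rwa [sub_sub_sub_cancel_right] at this

lemma br_one (r c : Fin 2 → ℂ) : br (1 : Matrix (Fin 2) (Fin 2) A) r c = dt r c • (1 : A) := by
  rw [br_apply, dt]
  simp only [Matrix.one_apply_eq, Matrix.one_apply_ne (show (0 : Fin 2) ≠ 1 by decide),
    Matrix.one_apply_ne (show (1 : Fin 2) ≠ 0 by decide)]
  module

lemma rtt_one : RTT P fun _ => (1 : Matrix (Fin 2) (Fin 2) A) := by
  intro u v r₁ r₂ c₁ c₂
  have h := RR_dt2 (P := P) (u - v) c₁ c₂ r₁ r₂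
  simp only [RR, LinearMap.compl₁₂_apply, LinearMap.flip_apply, LinearMap.mul_apply', br_one,
    smul_mul_smul_comm, mul_one, smul_smul, ← Finset.sum_smul] at h ⊢
  congr 1
  simp only [dt2_apply, dtL_apply, smul_eq_mul] at h
  rw [h]
  exact Finset.sum_congr rfl fun a _ => by ring

lemma creation_map {ι : Type*} (B : ℤ → ℤ → ι → A) (b a : ℤ) (S : Finset ι) :
    creation (fun b a i => φ (B b a i)) b a S = φ (creation B b a S) := by
  rw [creation, creation]
  generalize S.toList = l
  induction l generalizing b a with
  | nil => simp [creationList]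
  | cons i l ih => rw [creationList, creationList, ih, map_mul]

end hom

/-! ### Operators on the tensor factors -/

section site
variable {N : ℕ} {d : Fin N → ℕ}

instance instAddCommGroupH : AddCommGroup (H P d) := inferInstance

instance instRingEndH : Ring (Module.End ℂ (H P d)) := Module.End.instRing

instance instAlgebraEndH : Algebra ℂ (Module.End ℂ (H P d)) := inferInstance

lemma site_tprod (n : Fin N) (T : Module.End ℂ (V P (d n))) (v : ∀ n, V P (d n)) :
    site P d n T (pureTensor v) =
      pureTensor (Function.update v n (T (v n))) := by
  rw [site, PiTensorProduct.map_tprod]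
  congr 1
  funext k
  rcases eq_or_ne k n with rfl | h
  · simp
  · simp [h]

/-- The action on one tensor factor, as a linear map. -/
def siteLin (P : Params) (d : Fin N → ℕ) (n : Fin N) :
    Module.End ℂ (V P (d n)) →ₗ[ℂ] Module.End ℂ (H P d) where
  toFun := site P d n
  map_add' S T := by
    refine PiTensorProduct.ext (MultilinearMap.ext fun v => ?_)
    change site P d n (S + T) (pureTensor v) =
      site P d n S (pureTensor v) + site P d n T (pureTensor v)
    rw [site_tprod, site_tprod, site_tprod, LinearMap.add_apply,
      (pureTensor).map_update_add]
  map_smul' c T := by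
    refine PiTensorProduct.ext (MultilinearMap.ext fun v => ?_)
    change site P d n (c • T) (pureTensor v) =
      c • site P d n T (pureTensor v)
    rw [site_tprod, site_tprod, LinearMap.smul_apply, (pureTensor).map_update_smul]

lemma site_one (n : Fin N) : site P d n 1 = 1 := by
  refine PiTensorProduct.ext (MultilinearMap.ext fun v => ?_)
  change site P d n 1 (pureTensor v) = pureTensor v
  rw [site_tprod, Module.End.one_apply, Function.update_eq_self]

lemma site_mul (n : Fin N) (S T : Module.End ℂ (V P (d n))) :
    site P d n (S * T) = site P d n S * site P d n T := by
  refine PiTensorProduct.ext (MultilinearMap.ext fun v => ?_)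
  change site P d n (S * T) (pureTensor v) =
    site P d n S (site P d n T (pureTensor v))
  rw [site_tprod, site_tprod, site_tprod, Function.update_self, Function.update_idem,
    Module.End.mul_apply]

/-- The action on one tensor factor, as a homomorphism of algebras. -/
def siteHom (P : Params) (d : Fin N → ℕ) (n : Fin N) :
    Module.End ℂ (V P (d n)) →ₐ[ℂ] Module.End ℂ (H P d) :=
  AlgHom.ofLinearMap (siteLin P d n) (site_one n) (site_mul n)

lemma siteHom_apply (n : Fin N) (T : Module.End ℂ (V P (d n))) : siteHom P d n T = site P d n T :=
  rfl

lemma siteHom_tprod (n : Fin N) (T : Module.End ℂ (V P (d n))) (v : ∀ n, V P (d n)) :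
    siteHom P d n T (pureTensor v) =
      pureTensor (Function.update v n (T (v n))) := site_tprod n T v

lemma siteHom_commute {n m : Fin N} (h : n ≠ m) (S : Module.End ℂ (V P (d n)))
    (T : Module.End ℂ (V P (d m))) : Commute (siteHom P d n S) (siteHom P d m T) := by
  refine PiTensorProduct.ext (MultilinearMap.ext fun v => ?_)
  change siteHom P d n S (siteHom P d m T (pureTensor v)) =
    siteHom P d m T (siteHom P d n S (pureTensor v))
  rw [siteHom_tprod, siteHom_tprod, siteHom_tprod, siteHom_tprod, Function.update_of_ne h,
    Function.update_of_ne h.symm, Function.update_comm h]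

lemma Lop_eq (n : Fin N) (u : ℂ) : Lop P d n u = (Ls P (d n) u).map (siteHom P d n) := by
  funext i j
  simp only [Lop, Ls, Matrix.map_apply, map_sum, map_smul, siteHom_apply]

/-- The monodromy matrix of a chain whose sites are taken in the order of the list `o`. -/
def chainT (P : Params) (d : Fin N → ℕ) (z : Fin N → ℂ) (o : List (Fin N)) (u : ℂ) :
    Matrix (Fin 2) (Fin 2) (Module.End ℂ (H P d)) :=
  (o.map fun n => Lop P d n (u - z n)).reverse.prod

variable {z : Fin N → ℂ}

lemma chainT_append (o o' : List (Fin N)) :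
    chainT P d z (o ++ o') = fun u => chainT P d z o' u * chainT P d z o u := by
  funext u; simp [chainT]

lemma chainT_singleton (n : Fin N) : chainT P d z [n] = fun u => Lop P d n (u - z n) := by
  funext u; simp [chainT]

lemma chainT_singleton' (n : Fin N) :
    chainT P d z [n] = fun u => (Ls P (d n) (u - z n)).map (siteHom P d n) := by
  rw [chainT_singleton]; funext u; rw [Lop_eq]

lemma opA_singleton (n : Fin N) (b a : ℤ) (t : ℂ) : opA P (chainT P d z [n]) b a t =
    siteHom P d n (opA P (fun u => Ls P (d n) (u - z n)) b a t) := by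
  rw [chainT_singleton']; exact opA_map _ (fun u => Ls P (d n) (u - z n)) _ _ _

lemma opB_singleton (n : Fin N) (b a : ℤ) (t : ℂ) : opB P (chainT P d z [n]) b a t =
    siteHom P d n (opB P (fun u => Ls P (d n) (u - z n)) b a t) := by
  rw [chainT_singleton']; exact opB_map _ (fun u => Ls P (d n) (u - z n)) _ _ _

lemma opC_singleton (n : Fin N) (b a : ℤ) (t : ℂ) : opC P (chainT P d z [n]) b a t =
    siteHom P d n (opC P (fun u => Ls P (d n) (u - z n)) b a t) := by
  rw [chainT_singleton']; exact opC_map _ (fun u => Ls P (d n) (u - z n)) _ _ _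

lemma opD_singleton (n : Fin N) (b a : ℤ) (t : ℂ) : opD P (chainT P d z [n]) b a t =
    siteHom P d n (opD P (fun u => Ls P (d n) (u - z n)) b a t) := by
  rw [chainT_singleton']; exact opD_map _ (fun u => Ls P (d n) (u - z n)) _ _ _

lemma monodromy_eq_chainT (u : ℂ) : monodromy P d u z = chainT P d z (List.finRange N) u := by
  rw [monodromy, chainT, List.ofFn_eq_map]

lemma chainT_entries_commute {o o' : List (Fin N)} (h : o.Disjoint o') (u v : ℂ)
    (i j i' j' : Fin 2) : Commute (chainT P d z o u i j) (chainT P d z o' v i' j') := by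
  have h1 : ∀ {n : Fin N} {o' : List (Fin N)}, n ∉ o' → ∀ (T : Module.End ℂ (V P (d n))) (i' j'),
      Commute (siteHom P d n T) (chainT P d z o' v i' j') := by
    intro n o' hn T
    induction o' with
    | nil =>
      intro i' j'
      simp only [chainT, List.map_nil, List.reverse_nil, List.prod_nil, Matrix.one_apply]
      split_ifs
      · exact Commute.one_right _
      · exact Commute.zero_right _
    | cons m o' ih =>
      intro i' j'
      rw [← List.singleton_append, chainT_append, chainT_singleton]
      simp only [Matrix.mul_apply, Lop_eq, Matrix.map_apply]
      exact Commute.sum_right _ _ _ fun k _ => (ih (fun h => hn (List.mem_cons_of_mem _ h)) _ _).mul_right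
        (siteHom_commute (by rintro rfl; exact hn List.mem_cons_self) _ _)
  induction o generalizing i j with
  | nil =>
    simp only [chainT, List.map_nil, List.reverse_nil, List.prod_nil, Matrix.one_apply]
    split_ifs
    · exact Commute.one_left _
    · exact Commute.zero_left _
  | cons m o ih =>
    rw [List.disjoint_cons_left] at h
    rw [← List.singleton_append, chainT_append, chainT_singleton]
    simp only [Matrix.mul_apply, Lop_eq, Matrix.map_apply]
    exact Commute.sum_left _ _ _ fun k _ => (ih h.2 _ _).mul_left (h1 h.1 _ _ _)

section
variable (hτ : 0 < P.τ.im) (hη : th11 P (2 * P.η) ≠ 0)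
include hτ hη

lemma rtt_chainT {o : List (Fin N)} (ho : o.Nodup) : RTT P (chainT P d z o) := by
  induction o with
  | nil => exact rtt_one
  | cons n o ih =>
    rw [← List.singleton_append, chainT_append]
    rw [List.nodup_cons] at ho
    refine RTT.mul ?_ (ih ho.2) fun u v i j i' j' => chainT_entries_commute (by simpa using ho.1) _ _ _ _ _ _
    rw [chainT_singleton]
    simp only [Lop_eq]
    exact ((rtt_Ls hτ hη (d n)).comp_sub (z n)).map _

end

/-! ### Labels and states of a chain -/

/-- The increment of the labels to the left of the site `n`, for a chain with the sites in the order
`o` and `m k` excitations at the site `k`. -/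
def lab (d : Fin N → ℕ) (m : Fin N → ℕ) : List (Fin N) → Fin N → ℤ
  | [], _ => 0
  | k :: o, n => if k = n then 0 else (d k : ℤ) - 2 * m k + lab d m o n

/-- The increment of the labels along the whole chain. -/
def labTotal (d : Fin N → ℕ) (m : Fin N → ℕ) (o : List (Fin N)) : ℤ :=
  (o.map fun k => (d k : ℤ) - 2 * m k).sum

lemma lab_append (m : Fin N → ℕ) (o o' : List (Fin N)) (n : Fin N) :
    lab d m (o ++ o') n = if n ∈ o then lab d m o n else labTotal d m o + lab d m o' n := by
  induction o with
  | nil => simp [lab, labTotal]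
  | cons k o ih =>
    rw [List.cons_append, lab, lab, ih]
    by_cases h : k = n
    · simp [h]
    · simp only [h, if_false, List.mem_cons, Ne.symm h, false_or]
      split_ifs
      · rfl
      · simp [labTotal]; ring

lemma lab_congr {m m' : Fin N → ℕ} {o : List (Fin N)} (h : ∀ k ∈ o, m k = m' k) (n : Fin N) :
    lab d m o n = lab d m' o n := by
  induction o with
  | nil => rfl
  | cons k o ih =>
    rw [lab, lab, h k List.mem_cons_self, ih fun k hk => h k (List.mem_cons_of_mem _ hk)]

/-- The vectors at the sites of the chain `o`; the other sites carry the vectors `v`. -/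
def chainState (P : Params) (d : Fin N → ℕ) (z : Fin N → ℂ) (o : List (Fin N)) (a : ℤ)
    (m : Fin N → ℕ) (v : ∀ n, V P (d n)) (n : Fin N) : V P (d n) :=
  if n ∈ o then stepVec P (d n) (a + lab d m o n) (a + lab d m o n + d n - 2 * m n) (z n) else v n

lemma chainState_append_singleton {o : List (Fin N)} {n : Fin N} (hn : n ∉ o) (a : ℤ)
    (m : Fin N → ℕ) (v : ∀ n, V P (d n)) :
    chainState P d z (o ++ [n]) a m v = chainState P d z o a m (Function.update v n
      (stepVec P (d n) (a + labTotal d m o) (a + labTotal d m o + d n - 2 * m n) (z n))) := by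
  funext k
  by_cases hk : k ∈ o
  · simp [chainState, hk, lab_append]
  · by_cases hkn : k = n
    · subst hkn
      simp [chainState, hk, lab_append, lab]
    · simp [chainState, hk, hkn]

lemma chainState_update {o : List (Fin N)} {n : Fin N} (hn : n ∉ o) (a : ℤ) (m : Fin N → ℕ)
    (v : ∀ n, V P (d n)) (w : V P (d n)) :
    Function.update (chainState P d z o a m v) n w =
      chainState P d z o a m (Function.update v n w) := by
  funext k
  by_cases hk : k ∈ o
  · rw [Function.update_of_ne (by rintro rfl; exact hn hk)]
    simp [chainState, hk]
  · by_cases hkn : k = n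
    · subst hkn; simp [chainState, hk]
    · simp [chainState, hk, hkn]

lemma chainState_self {o : List (Fin N)} {n : Fin N} (hn : n ∉ o) (a : ℤ) (m : Fin N → ℕ)
    (v : ∀ n, V P (d n)) : chainState P d z o a m v n = v n := if_neg hn

end site

/-! ### The vacuum of a chain -/

section
variable {N : ℕ} {d : Fin N → ℕ} {z : Fin N → ℂ}
variable (hτ : 0 < P.τ.im) (hη : th11 P (2 * P.η) ≠ 0) (hl : ∀ a, th11 P (lamAt P a) ≠ 0)
include hτ hη hl

lemma chain_vacuum {o : List (Fin N)} (ho : o.Nodup) (a : ℤ) (v : ∀ n, V P (d n)) {t : ℂ}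
    (ht : th11 P t ≠ 0) :
    opC P (chainT P d z o) (a + labTotal d 0 o) a t
        (pureTensor (chainState P d z o a 0 v)) = 0 ∧
      opD P (chainT P d z o) (a + labTotal d 0 o) a t
        (pureTensor (chainState P d z o a 0 v)) =
        (∏ n ∈ o.toFinset, deltaL P (d n) (t - z n)) •
          pureTensor (chainState P d z o (a + 1) 0 v) := by
  induction o using List.reverseRecOn generalizing v with
  | nil =>
    have h1 : chainT P d z [] = fun _ => 1 := by funext u; simp [chainT]
    have hs : ∀ a, chainState P d z [] a 0 v = v := fun a => by funext n; simp [chainState]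
    rw [h1, hs, hs]
    simp only [labTotal, List.map_nil, List.sum_nil, add_zero, opC, opD, br_one, dt_self,
      zero_smul, smul_zero, LinearMap.zero_apply, List.toFinset_nil, Finset.prod_empty, one_smul,
      true_and, smul_smul, dt_ev hτ]
    rw [show (lamAt P a - t) / 2 + (lamAt P a + t) / 2 = lamAt P a by ring,
      show (lamAt P a - t) / 2 - (lamAt P a + t) / 2 = -t by ring, th11_neg]
    have := hl a
    rw [LinearMap.smul_apply, Module.End.one_apply]
    convert one_smul ℂ _
    field_simp
  | append_singleton o n ih =>
    have hn : n ∉ o := fun h => (List.nodup_append.1 ho).2.2 n h n (by simp) rfl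
    have ho' : o.Nodup := (List.nodup_append.1 ho).1
    have hc := fun u v i j i' j' => chainT_entries_commute (P := P) (d := d) (z := z)
      (o := o) (o' := [n]) (by simpa using hn) u v i j i' j'
    have hlt : labTotal d 0 (o ++ [n]) = labTotal d 0 o + d n := by simp [labTotal]
    rw [chainT_append, hlt, ← add_assoc]
    set m := a + labTotal d 0 o with hm
    have hst : ∀ a, chainState P d z (o ++ [n]) a 0 v = chainState P d z o a 0
        (Function.update v n (stepVec P (d n) (a + labTotal d 0 o)
          (a + labTotal d 0 o + d n) (z n))) := fun a => by
      rw [chainState_append_singleton hn]; simp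
    rw [hst, hst, ← hm]
    have hCY : ∀ a', opC P (chainT P d z [n]) (m + d n) m t (pureTensor
        (chainState P d z o a' 0 (Function.update v n (stepVec P (d n) m (m + d n) (z n))))) = 0 := by
      intro a'
      rw [opC_singleton, siteHom_tprod, chainState_self hn, Function.update_self,
        opC_stepVec hτ hη, (pureTensor).map_update_zero]
    have cB : Commute (opB P (chainT P d z o) m a t) (opC P (chainT P d z [n]) (m + d n) m t) :=
      ((br_commute (hc t t) _ _ _ _).smul_left _).smul_right _
    have cA : Commute (opA P (chainT P d z o) m a t) (opC P (chainT P d z [n]) (m + d n) m t) :=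
      ((br_commute (hc t t) _ _ _ _).smul_left _).smul_right _
    obtain ⟨ih1, ih2⟩ := ih ho' (Function.update v n (stepVec P (d n) m (m + d n) (z n)))
    constructor
    · rw [opC_mul hτ hl _ _ _ _ m ht, ← cA.eq, LinearMap.add_apply, Module.End.mul_apply,
        Module.End.mul_apply, hCY, ih1, map_zero, map_zero, add_zero]
    · rw [opD_mul hτ hl _ _ _ _ m ht, ← cB.eq, LinearMap.add_apply, Module.End.mul_apply,
        Module.End.mul_apply, hCY, ih2, map_zero, zero_add, map_smul, opD_singleton, siteHom_tprod,
        chainState_self hn, Function.update_self, opD_stepVec hτ hη hl _ _ _ ht,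
        chainState_update hn, Function.update_idem, ← chainState_update hn,
        (pureTensor).map_update_smul, chainState_update hn, smul_smul]
      rw [List.toFinset_append, Finset.prod_union (by simpa using hn)]
      simp only [List.toFinset_cons, List.toFinset_nil, insert_empty_eq, Finset.prod_singleton]
      congr 5
      · rw [hm]; ring
      · rw [hm]; ring

end

/-! ### The exchange coefficients -/

/-- The coefficient of the unwanted terms in the exchange relations. -/
def unwanted (P : Params) (m : ℤ) (x y : ℂ) : ℂ :=
  th11 P (y - x + lamAt P m) * th11 P (2 * P.η) / (th11 P (lamAt P m) * th11 P (y - x))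

section
variable (hτ : 0 < P.τ.im)
include hτ

lemma th11_three_term_shift (A B l e : ℂ) :
    th11 P (A + e) * th11 P (B + l - e) * (th11 P l * th11 P (B - A)) -
      th11 P (B + l) * th11 P (B - A - e) * (th11 P (l - e) * th11 P A) -
      th11 P (A + l) * th11 P (B - A + l - e) * (th11 P e * th11 P B) = 0 := by
  have h := th11_three_term hτ ((A + B + l) / 2) ((B + l - A) / 2 - e) ((l + B - A) / 2)
    ((l - B + A) / 2)
  have e1 : (B + l - A) / 2 - e - (l + B - A) / 2 = -e := by ring
  rw [e1, th11_neg] at h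
  ring_nf at h ⊢
  linear_combination h

lemma alphaFun_unwanted (hl : ∀ a, th11 P (lamAt P a) ≠ 0) (a : ℤ) {x y z : ℂ}
    (h1 : th11 P (y - x) ≠ 0) (h2 : th11 P (z - x) ≠ 0) (h3 : th11 P (y - z) ≠ 0) :
    alphaFun P (x - z) * -unwanted P (a - 1) x y + -unwanted P a x z * -unwanted P (a - 1) z y =
      -unwanted P a x y * alphaFun P (y - z) := by
  have h := th11_three_term_shift hτ (z - x) (y - x) (lamAt P a) (2 * P.η)
  have e1 : lamAt P (a - 1) = lamAt P a - 2 * P.η := by rw [lamAt_sub]; push_cast; ring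
  have l1 := hl a
  have l2 := hl (a - 1)
  rw [e1] at l2
  rw [alphaFun, alphaFun, unwanted, unwanted, unwanted, unwanted, e1,
    show x - z - 2 * P.η = -(z - x + 2 * P.η) by ring, show x - z = -(z - x) by ring, th11_neg,
    th11_neg, neg_div_neg_eq]
  rw [show y - x - (z - x) = y - z by ring,
    show y - x + lamAt P a - 2 * P.η = y - x + (lamAt P a - 2 * P.η) by ring,
    show y - z + lamAt P a - 2 * P.η = y - z + (lamAt P a - 2 * P.η) by ring] at h
  field_simp
  linear_combination -th11 P (2 * P.η) * h

lemma alphaFun_unwanted' (hl : ∀ a, th11 P (lamAt P a) ≠ 0) (b : ℤ) {x y z : ℂ}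
    (h1 : th11 P (y - x) ≠ 0) (h2 : th11 P (z - x) ≠ 0) (h3 : th11 P (y - z) ≠ 0) :
    alphaFun P (z - x) * unwanted P (b + 1) x y + unwanted P b x z * unwanted P (b + 1) z y =
      unwanted P b x y * alphaFun P (z - y) := by
  have h := th11_three_term_shift hτ (z - x) (y - x) (lamAt P b) (-(2 * P.η))
  have e1 : lamAt P (b + 1) = lamAt P b + 2 * P.η := by rw [lamAt_add]; push_cast; ring
  have l1 := hl b
  have l2 := hl (b + 1)
  rw [e1] at l2
  rw [alphaFun, alphaFun, unwanted, unwanted, unwanted, unwanted, e1,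
    show z - y - 2 * P.η = -(y - z + 2 * P.η) by ring, show z - y = -(y - z) by ring, th11_neg,
    th11_neg, neg_div_neg_eq]
  rw [show y - x - (z - x) = y - z by ring, th11_neg] at h
  simp only [sub_neg_eq_add, ← sub_eq_add_neg] at h
  rw [add_assoc (y - x), add_assoc (y - z)] at h
  generalize lamAt P b + 2 * P.η = l' at *
  field_simp
  linear_combination th11 P (2 * P.η) * h

end

/-! ### Excitations of a single site -/

/-- The scalar factor that does not depend on the spectral parameters, for `m` excitations of the
vacuum with the left label `A` at one site. -/
def siteConst (P : Params) (d : ℕ) (A : ℤ) (m : ℕ) : ℂ :=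
  ∏ k ∈ Finset.range m, th11 P (2 * (d - k) * P.η) /
    (th11 P (2 * P.η) * th11 P (lamAt P (A + k)) * th11 P (lamAt P (A + d - k)))

lemma siteConst_eq_zero {d m : ℕ} (h : d < m) (A : ℤ) : siteConst P d A m = 0 :=
  Finset.prod_eq_zero (Finset.mem_range.2 h) (by simp [th11_zero])

section
variable (hτ : 0 < P.τ.im) (hη : th11 P (2 * P.η) ≠ 0) (hl : ∀ a, th11 P (lamAt P a) ≠ 0)
include hτ hη hl
variable {ι : Type*} {t : ι → ℂ} (ht : ∀ i, th11 P (t i) ≠ 0)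
include ht

lemma creationList_stepVec (d : ℕ) (A : ℤ) (z : ℂ) (l : List ι) :
    creationList (fun b a i => opB P (fun u => Ls P d (u - z)) b a (t i))
        (A + d - l.length) (A + l.length) l (stepVec P d A (A + d) z) =
      (siteConst P d A l.length *
        (l.map fun i => th11 P (t i - z + P.lam + (2 * A + d) * P.η)).prod) •
        stepVec P d (A + l.length) (A + d - l.length) z := by
  induction l with
  | nil => simp [creationList, siteConst]
  | cons i l ih =>
    rw [List.length_cons, creationList, show A + d - ((l.length + 1 : ℕ) : ℤ) + 1 = A + d - l.length
      by push_cast; ring, show A + ((l.length + 1 : ℕ) : ℤ) - 1 = A + l.length by push_cast; ring,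
      Module.End.mul_apply, ih, map_smul, List.map_cons, List.prod_cons]
    rcases lt_or_ge d l.length with hd | hd
    · rw [siteConst_eq_zero hd, siteConst_eq_zero (hd.trans (Nat.lt_succ_self _))]
      simp
    · rw [opB_stepVec hτ hη hl hd (by ring) z (ht i), smul_smul, siteConst, siteConst,
        Finset.prod_range_succ]
      rw [show (((A + l.length : ℤ) : ℂ) + ((A + d - l.length : ℤ) : ℂ)) = 2 * A + d by
          push_cast; ring, show A + (l.length : ℤ) + 1 = A + ((l.length + 1 : ℕ) : ℤ) by
          push_cast; ring, show A + d - (l.length : ℤ) - 1 = A + d - ((l.length + 1 : ℕ) : ℤ) by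
          push_cast; ring]
      congr 1
      ring

lemma creation_stepVec (d : ℕ) (A : ℤ) (z : ℂ) (J : Finset ι) :
    creation (fun b a i => opB P (fun u => Ls P d (u - z)) b a (t i))
        (A + d - J.card) (A + J.card) J (stepVec P d A (A + d) z) =
      (siteConst P d A J.card * ∏ i ∈ J, th11 P (t i - z + P.lam + (2 * A + d) * P.η)) •
        stepVec P d (A + J.card) (A + d - J.card) z := by
  have h := creationList_stepVec hτ hη hl ht d A z J.toList
  rwa [Finset.length_toList, Finset.prod_map_toList] at h

end

/-! ### A sum over maps into a chain -/

section
variable {ι κ β : Type*} [Fintype ι] [DecidableEq ι] [DecidableEq κ] [AddCommMonoid β]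

/-- The maps that send `S` to `o` and coincide with `π₀` outside `S`. -/
def mapsInto (π₀ : ι → κ) (S : Finset ι) (o : Finset κ) : Finset (ι → κ) :=
  Fintype.piFinset fun i => if i ∈ S then o else {π₀ i}

lemma mem_mapsInto {π₀ π : ι → κ} {S : Finset ι} {o : Finset κ} :
    π ∈ mapsInto π₀ S o ↔ (∀ i ∈ S, π i ∈ o) ∧ ∀ i ∉ S, π i = π₀ i := by
  rw [mapsInto, Fintype.mem_piFinset]
  constructor
  · intro h
    exact ⟨fun i hi => by simpa [hi] using h i, fun i hi => by simpa [hi] using h i⟩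
  · rintro ⟨h1, h2⟩ i
    split_ifs with hi
    · exact h1 i hi
    · simpa using h2 i hi

lemma sum_mapsInto_insert (π₀ : ι → κ) (S : Finset ι) {o : Finset κ} {n : κ} (hn : n ∉ o)
    (f : (ι → κ) → β) :
    ∑ π ∈ mapsInto π₀ S (insert n o), f π =
      ∑ J ∈ S.powerset, ∑ π ∈ mapsInto π₀ (S \ J) o, f (J.piecewise (fun _ => n) π) := by
  rw [Finset.sum_sigma']
  refine Finset.sum_bij' (fun π _ => ⟨S.filter fun i => π i = n,
    (S.filter fun i => π i = n).piecewise π₀ π⟩) (fun x _ => x.1.piecewise (fun _ => n) x.2)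
    ?_ ?_ ?_ ?_ ?_
  · intro π hπ
    rw [mem_mapsInto] at hπ
    rw [Finset.mem_sigma, mem_mapsInto]
    refine ⟨by simp, fun i hi => ?_, fun i hi => ?_⟩ <;> dsimp only at hi ⊢
    · simp only [Finset.mem_sdiff, Finset.mem_filter, not_and] at hi
      have := hπ.1 i hi.1
      rw [Finset.piecewise_eq_of_notMem _ _ _ (by simpa using hi.2)]
      exact (Finset.mem_insert.1 this).resolve_left (hi.2 hi.1)
    · simp only [Finset.mem_sdiff, not_and, not_not] at hi
      by_cases h : i ∈ S
      · exact Finset.piecewise_eq_of_mem _ _ _ (hi h)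
      · rw [Finset.piecewise_eq_of_notMem _ _ _ (by simp [h]), hπ.2 i h]
  · rintro ⟨J, π⟩ h
    rw [Finset.mem_sigma, Finset.mem_powerset, mem_mapsInto] at h
    dsimp only at h
    obtain ⟨hJ, h1, h2⟩ := h
    rw [mem_mapsInto]
    refine ⟨fun i hi => ?_, fun i hi => ?_⟩
    · by_cases h : i ∈ J
      · simp [h]
      · simp only [h, not_false_eq_true, Finset.piecewise_eq_of_notMem]
        exact Finset.mem_insert_of_mem (h1 i (Finset.mem_sdiff.2 ⟨hi, h⟩))
    · rw [Finset.piecewise_eq_of_notMem _ _ _ fun h => hi (hJ h)]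
      exact h2 i fun h => hi (Finset.mem_sdiff.1 h).1
  · intro π hπ
    funext i
    by_cases h : i ∈ S.filter fun i => π i = n
    · simp only [h, Finset.piecewise_eq_of_mem]
      exact (Finset.mem_filter.1 h).2.symm
    · simp only [h, not_false_eq_true, Finset.piecewise_eq_of_notMem]
  · rintro ⟨J, π⟩ h
    rw [Finset.mem_sigma, Finset.mem_powerset, mem_mapsInto] at h
    dsimp only at h
    obtain ⟨hJ, h1, h2⟩ := h
    have hJ' : (S.filter fun i => J.piecewise (fun _ => n) π i = n) = J := by
      ext i
      rw [Finset.mem_filter]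
      by_cases h : i ∈ J
      · simp [h, hJ h]
      · simp only [h, not_false_eq_true, Finset.piecewise_eq_of_notMem, iff_false, not_and]
        intro hi he
        exact hn (he ▸ h1 i (Finset.mem_sdiff.2 ⟨hi, h⟩))
    dsimp only
    rw [hJ']
    congr 1
    funext i
    by_cases h : i ∈ J
    · rw [Finset.piecewise_eq_of_mem _ _ _ h, h2 i (by simp [h])]
    · rw [Finset.piecewise_eq_of_notMem _ _ _ h, Finset.piecewise_eq_of_notMem _ _ _ h]
  · intro π hπ
    congr 1
    funext i
    by_cases h : i ∈ S.filter fun i => π i = n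
    · simp only [h, Finset.piecewise_eq_of_mem]
      exact (Finset.mem_filter.1 h).2
    · simp only [h, not_false_eq_true, Finset.piecewise_eq_of_notMem]

end

/-! ### The coefficients of Bethe vectors with respect to path vectors -/

section coef
variable {N : ℕ} {d : Fin N → ℕ} {z : Fin N → ℂ} {ι : Type*}

/-- The number of excitations at the site `n`. -/
def mult (S : Finset ι) (π : ι → Fin N) (n : Fin N) : ℕ := (S.filter fun i => π i = n).card

/-- The left label of the vacuum at the site `n` from which the local state is created. -/
def siteLab (d : Fin N → ℕ) (o : List (Fin N)) (a : ℤ) (m : Fin N → ℕ) (n : Fin N) : ℤ :=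
  a + lab d m o n - m n

/-- The product over the pairs of excitations at different sites. -/
def pairCoef (P : Params) (t : ι → ℂ) (o : List (Fin N)) (S : Finset ι) (π : ι → Fin N) : ℂ :=
  ∏ i ∈ S, ∏ j ∈ S, if o.idxOf (π i) < o.idxOf (π j) then alphaFun P (t i - t j) else 1

/-- The product of the vacuum eigenvalues at the other sites. -/
def vacCoef (P : Params) (d : Fin N → ℕ) (z : Fin N → ℂ) (t : ι → ℂ) (o : List (Fin N))
    (S : Finset ι) (π : ι → Fin N) : ℂ :=
  ∏ i ∈ S, ∏ n ∈ o.toFinset.erase (π i), if o.idxOf (π i) < o.idxOf n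
    then alphaL P (d n) (t i - z n) else deltaL P (d n) (t i - z n)

/-- The product of the local factors. -/
def localCoef (P : Params) (d : Fin N → ℕ) (z : Fin N → ℂ) (t : ι → ℂ) (S : Finset ι)
    (π : ι → Fin N) (A : Fin N → ℤ) : ℂ :=
  ∏ i ∈ S, th11 P (t i - z (π i) + P.lam + (2 * A (π i) + d (π i)) * P.η)

/-- The coefficient of the path vector with the excitations at the sites `π i`. -/
def chainCoef (P : Params) (d : Fin N → ℕ) (z : Fin N → ℂ) (t : ι → ℂ) (o : List (Fin N))
    (S : Finset ι) (π : ι → Fin N) (a : ℤ) : ℂ :=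
  pairCoef P t o S π * vacCoef P d z t o S π *
    localCoef P d z t S π (siteLab d o a (mult S π)) *
    ∏ n ∈ o.toFinset, siteConst P (d n) (siteLab d o a (mult S π) n) (mult S π n)

lemma labTotal_eq (m : Fin N → ℕ) {o : List (Fin N)} (ho : o.Nodup) :
    labTotal d m o = labTotal d 0 o - 2 * ∑ k ∈ o.toFinset, (m k : ℤ) := by
  rw [labTotal, labTotal, ← List.sum_toFinset _ ho, ← List.sum_toFinset _ ho, Finset.mul_sum,
    ← Finset.sum_sub_distrib]
  simp

lemma sum_mult {S : Finset ι} {π : ι → Fin N} {o : Finset (Fin N)} (h : ∀ i ∈ S, π i ∈ o) :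
    ∑ k ∈ o, (mult S π k : ℤ) = S.card := by
  rw [Finset.card_eq_sum_card_fiberwise (f := π) (t := o) (by exact_mod_cast h)]
  push_cast; rfl

section step
variable [DecidableEq ι]
variable {o : List (Fin N)} {n : Fin N} {S J : Finset ι} {π : ι → Fin N}
variable (hn : n ∉ o) (hJ : J ⊆ S) (hπ : ∀ i ∈ S \ J, π i ∈ o)
include hn hJ hπ

lemma mult_piecewise_self : mult S (J.piecewise (fun _ => n) π) n = J.card := by
  rw [mult]
  congr 1
  ext i
  rw [Finset.mem_filter]
  by_cases h : i ∈ J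
  · simp [h, hJ h]
  · simp only [h, not_false_eq_true, Finset.piecewise_eq_of_notMem, iff_false, not_and]
    intro hi he
    exact hn (he ▸ hπ i (Finset.mem_sdiff.2 ⟨hi, h⟩))

omit hJ hπ in
lemma mult_piecewise {k : Fin N} (hk : k ∈ o) :
    mult S (J.piecewise (fun _ => n) π) k = mult (S \ J) π k := by
  have hkn : n ≠ k := by rintro rfl; exact hn hk
  rw [mult, mult]
  congr 1
  ext i
  rw [Finset.mem_filter, Finset.mem_filter, Finset.mem_sdiff]
  by_cases h : i ∈ J
  · simp [h, hkn]
  · simp [h]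

lemma pairCoef_append_singleton (t : ι → ℂ) :
    pairCoef P t (o ++ [n]) S (J.piecewise (fun _ => n) π) =
      (∏ i ∈ S \ J, ∏ j ∈ J, alphaFun P (t i - t j)) * pairCoef P t o (S \ J) π := by
  rw [pairCoef, ← Finset.prod_sdiff hJ, pairCoef]
  have hi : ∀ i ∈ S \ J, (o ++ [n]).idxOf (J.piecewise (fun _ => n) π i) = o.idxOf (π i) ∧
      o.idxOf (π i) < o.length := fun i hi => by
    rw [Finset.piecewise_eq_of_notMem _ _ _ (Finset.mem_sdiff.1 hi).2,
      List.idxOf_append_of_mem (hπ i hi)]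
    exact ⟨rfl, List.idxOf_lt_length_of_mem (hπ i hi)⟩
  have hj : ∀ j ∈ J, (o ++ [n]).idxOf (J.piecewise (fun _ => n) π j) = o.length := fun j hj => by
    rw [Finset.piecewise_eq_of_mem _ _ _ hj, List.idxOf_append_of_notMem hn]; simp
  have h2 : ∀ i ∈ J, ∏ j ∈ S, (if (o ++ [n]).idxOf (J.piecewise (fun _ => n) π i) <
      (o ++ [n]).idxOf (J.piecewise (fun _ => n) π j) then alphaFun P (t i - t j) else 1) = 1 := by
    intro i hiJ
    refine Finset.prod_eq_one fun j hjS => if_neg ?_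
    rw [hj i hiJ]
    by_cases h : j ∈ J
    · rw [hj j h]; exact lt_irrefl _
    · have := hi j (Finset.mem_sdiff.2 ⟨hjS, h⟩)
      rw [this.1]; exact this.2.not_gt
  rw [Finset.prod_congr rfl h2, Finset.prod_const_one, mul_one, ← Finset.prod_mul_distrib]
  refine Finset.prod_congr rfl fun i hiI => ?_
  rw [← Finset.prod_sdiff hJ, mul_comm]
  congr 1
  · refine Finset.prod_congr rfl fun j hjJ => if_pos ?_
    rw [(hi i hiI).1, hj j hjJ]; exact (hi i hiI).2
  · refine Finset.prod_congr rfl fun j hjI => ?_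
    rw [(hi i hiI).1, (hi j hjI).1]

lemma vacCoef_append_singleton (t : ι → ℂ) :
    vacCoef P d z t (o ++ [n]) S (J.piecewise (fun _ => n) π) =
      (∏ i ∈ S \ J, alphaL P (d n) (t i - z n)) *
        (∏ j ∈ J, ∏ k ∈ o.toFinset, deltaL P (d k) (t j - z k)) * vacCoef P d z t o (S \ J) π := by
  have ho : (o ++ [n]).toFinset = insert n o.toFinset := by
    rw [List.toFinset_append]; ext; simp
  have hno : n ∉ o.toFinset := by simpa using hn
  have hidn : (o ++ [n]).idxOf n = o.length := by rw [List.idxOf_append_of_notMem hn]; simp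
  rw [vacCoef, ← Finset.prod_sdiff hJ, vacCoef, mul_right_comm, ← Finset.prod_mul_distrib, ho]
  congr 1
  · refine Finset.prod_congr rfl fun i hi => ?_
    have hin := hπ i hi
    have hne : n ≠ π i := by rintro rfl; exact hn hin
    rw [Finset.piecewise_eq_of_notMem _ _ _ (Finset.mem_sdiff.1 hi).2,
      Finset.erase_insert_of_ne hne, Finset.prod_insert (by simp [hn]), hidn,
      List.idxOf_append_of_mem hin, if_pos (List.idxOf_lt_length_of_mem hin)]
    congr 1
    refine Finset.prod_congr rfl fun k hk => ?_
    rw [List.idxOf_append_of_mem (List.mem_toFinset.1 (Finset.mem_of_mem_erase hk))]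
  · refine Finset.prod_congr rfl fun j hj => ?_
    rw [Finset.piecewise_eq_of_mem _ _ _ hj, Finset.erase_insert hno, hidn]
    refine Finset.prod_congr rfl fun k hk => if_neg ?_
    have hk := List.mem_toFinset.1 hk
    rw [List.idxOf_append_of_mem hk]
    exact (List.idxOf_lt_length_of_mem hk).not_gt

omit hJ hπ in
lemma siteLab_append_singleton (a : ℤ) {k : Fin N} (hk : k ∈ o) :
    siteLab d (o ++ [n]) a (mult S (J.piecewise (fun _ => n) π)) k =
      siteLab d o a (mult (S \ J) π) k := by
  rw [siteLab, siteLab, lab_append, if_pos hk, mult_piecewise hn hk,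
    lab_congr fun k hk => mult_piecewise hn hk]

omit hJ in
lemma labTotal_piecewise (ho : o.Nodup) :
    labTotal d (mult S (J.piecewise (fun _ => n) π)) o = labTotal d 0 o - 2 * (S \ J).card := by
  rw [labTotal_eq _ ho, Finset.sum_congr rfl fun k hk => by
    rw [mult_piecewise hn (List.mem_toFinset.1 hk)], sum_mult fun i hi =>
      List.mem_toFinset.2 (hπ i hi)]

lemma siteLab_append_singleton_self (ho : o.Nodup) (a : ℤ) :
    siteLab d (o ++ [n]) a (mult S (J.piecewise (fun _ => n) π)) n =
      a + labTotal d 0 o - 2 * (S \ J).card - J.card := by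
  rw [siteLab, lab_append, if_neg hn, labTotal_piecewise hn hπ ho,
    mult_piecewise_self hn hJ hπ, lab, if_pos rfl]
  ring

lemma chainCoef_append_singleton (ho : o.Nodup) (t : ι → ℂ) (a A : ℤ)
    (hA : A = a + labTotal d 0 o - 2 * (S \ J).card - J.card) :
    chainCoef P d z t (o ++ [n]) S (J.piecewise (fun _ => n) π) a =
      ((∏ i ∈ S \ J, ∏ j ∈ J, alphaFun P (t i - t j)) *
        (∏ i ∈ S \ J, alphaL P (d n) (t i - z n)) *
        ∏ j ∈ J, ∏ k ∈ o.toFinset, deltaL P (d k) (t j - z k)) *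
      (chainCoef P d z t o (S \ J) π a * (siteConst P (d n) A J.card *
        ∏ i ∈ J, th11 P (t i - z n + P.lam + (2 * A + d n) * P.η))) := by
  have hno : n ∉ o.toFinset := by simpa using hn
  have ho' : (o ++ [n]).toFinset = insert n o.toFinset := by
    rw [List.toFinset_append]; ext; simp
  have hself := siteLab_append_singleton_self (d := d) hn hJ hπ ho a
  rw [← hA] at hself
  have hloc : localCoef P d z t S (J.piecewise (fun _ => n) π)
      (siteLab d (o ++ [n]) a (mult S (J.piecewise (fun _ => n) π))) =
      localCoef P d z t (S \ J) π (siteLab d o a (mult (S \ J) π)) *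
        ∏ i ∈ J, th11 P (t i - z n + P.lam + (2 * A + d n) * P.η) := by
    rw [localCoef, ← Finset.prod_sdiff hJ, localCoef]
    congr 1
    · refine Finset.prod_congr rfl fun i hi => ?_
      rw [Finset.piecewise_eq_of_notMem _ _ _ (Finset.mem_sdiff.1 hi).2,
        siteLab_append_singleton hn a (hπ i hi)]
    · refine Finset.prod_congr rfl fun i hi => ?_
      rw [Finset.piecewise_eq_of_mem _ _ _ hi, hself]
  have hsc : ∏ k ∈ o.toFinset, siteConst P (d k)
      (siteLab d (o ++ [n]) a (mult S (J.piecewise (fun _ => n) π)) k)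
      (mult S (J.piecewise (fun _ => n) π) k) =
      ∏ k ∈ o.toFinset, siteConst P (d k) (siteLab d o a (mult (S \ J) π) k) (mult (S \ J) π k) :=
    Finset.prod_congr rfl fun k hk => by
      rw [siteLab_append_singleton hn a (List.mem_toFinset.1 hk),
        mult_piecewise hn (List.mem_toFinset.1 hk)]
  rw [chainCoef, pairCoef_append_singleton hn hJ hπ, vacCoef_append_singleton hn hJ hπ, hloc, ho',
    Finset.prod_insert hno, hself, mult_piecewise_self hn hJ hπ, chainCoef, hsc]
  ring

lemma chainState_piecewise (ho : o.Nodup) (a A : ℤ)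
    (hA : A = a + labTotal d 0 o - 2 * (S \ J).card - J.card) (v : ∀ n, V P (d n)) :
    chainState P d z (o ++ [n]) a (mult S (J.piecewise (fun _ => n) π)) v =
      chainState P d z o a (mult (S \ J) π) (Function.update v n
        (stepVec P (d n) (A + J.card) (A + d n - J.card) (z n))) := by
  rw [chainState_append_singleton hn, labTotal_piecewise hn hπ ho,
    mult_piecewise_self hn hJ hπ]
  have e1 : a + (labTotal d 0 o - 2 * ((S \ J).card : ℤ)) = A + J.card := by rw [hA]; ring
  have e2 : A + (J.card : ℤ) + d n - 2 * J.card = A + d n - J.card := by ring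
  rw [e1, e2]
  funext k
  by_cases hk : k ∈ o
  · simp only [chainState, hk, if_true]
    rw [mult_piecewise hn hk, lab_congr fun k hk => mult_piecewise hn hk]
  · simp [chainState, hk]

end step
end coef

/-! ### Bethe vectors as combinations of path vectors -/

section expansion
variable {N : ℕ} {d : Fin N → ℕ} {z : Fin N → ℂ} {ι : Type*} [Fintype ι] [DecidableEq ι]
variable (hτ : 0 < P.τ.im) (hη : th11 P (2 * P.η) ≠ 0) (hl : ∀ a, th11 P (lamAt P a) ≠ 0)
variable {t : ι → ℂ} (ht : ∀ i, th11 P (t i) ≠ 0)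

omit [Fintype ι] [DecidableEq ι] in
lemma creationList_opB_one {A : Type*} [Ring A] [Algebra ℂ A] (a : ℤ) {l : List ι} (h : l ≠ []) :
    creationList (fun b a i => opB P (fun _ => (1 : Matrix (Fin 2) (Fin 2) A)) b a (t i))
      (a - l.length) (a + l.length) l = 0 := by
  induction l with
  | nil => exact absurd rfl h
  | cons i l ih =>
    rw [List.length_cons, creationList, show a - ((l.length + 1 : ℕ) : ℤ) + 1 = a - l.length
      by push_cast; ring, show a + ((l.length + 1 : ℕ) : ℤ) - 1 = a + l.length by push_cast; ring]
    rcases eq_or_ne l [] with rfl | hl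
    · simp [opB, br_one, dt_self]
    · rw [ih hl, mul_zero]

include hτ hη hl ht

/-- The expansion of a Bethe vector in path vectors. -/
theorem creation_chain (htt : ∀ i j, i ≠ j → th11 P (t i - t j) ≠ 0)
    (htt2 : ∀ i j, i ≠ j → th11 P (t i - t j + 2 * P.η) ≠ 0) (π₀ : ι → Fin N)
    {o : List (Fin N)} (ho : o.Nodup) (S : Finset ι) (a₀ : ℤ) (v : ∀ n, V P (d n)) :
    creation (fun b a i => opB P (chainT P d z o) b a (t i)) (a₀ + labTotal d 0 o - S.card)
        (a₀ + S.card) S (pureTensor (chainState P d z o a₀ 0 v)) =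
      ∑ π ∈ mapsInto π₀ S o.toFinset, chainCoef P d z t o S π (a₀ + S.card) •
        pureTensor (chainState P d z o (a₀ + S.card) (mult S π) v) := by
  induction o using List.reverseRecOn generalizing S a₀ v with
  | nil =>
    have h1 : chainT P d z [] = fun _ => 1 := by funext u; simp [chainT]
    have hs : ∀ a m, chainState P d z [] a m v = v := fun a m => by funext n; simp [chainState]
    simp only [h1, hs]
    rcases S.eq_empty_or_nonempty with rfl | hS
    · have : mapsInto π₀ (∅ : Finset ι) ([] : List (Fin N)).toFinset = {π₀} := by
        ext π; simp [mem_mapsInto, funext_iff]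
      rw [this]
      simp [chainCoef, pairCoef, vacCoef, localCoef]
    · have : mapsInto π₀ S ([] : List (Fin N)).toFinset = ∅ := by
        ext π
        obtain ⟨i, hi⟩ := hS
        simp only [mem_mapsInto, List.toFinset_nil, Finset.notMem_empty, iff_false, not_and]
        exact fun h => (h i hi).elim
      rw [this, Finset.sum_empty, creation, labTotal, List.map_nil, List.sum_nil, add_zero,
        ← Finset.length_toList, creationList_opB_one a₀ (by simpa using hS.ne_empty),
        LinearMap.zero_apply]
  | append_singleton o n ih =>
    have hn : n ∉ o := fun h => (List.nodup_append.1 ho).2.2 n h n (by simp) rfl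
    have ho' : o.Nodup := (List.nodup_append.1 ho).1
    have hc := fun u v i j i' j' => chainT_entries_commute (P := P) (d := d) (z := z)
      (o := o) (o' := [n]) (by simpa using hn) u v i j i' j'
    have hto : (o ++ [n]).toFinset = insert n o.toFinset := by
      rw [List.toFinset_append]; ext; simp [or_comm]
    have hlt : labTotal d 0 (o ++ [n]) = labTotal d 0 o + d n := by simp [labTotal]
    have hTX := rtt_chainT (d := d) (z := z) hτ hη ho'
    have hTY := rtt_chainT (d := d) (z := z) hτ hη (List.nodup_singleton n)
    have hT := rtt_chainT (d := d) (z := z) hτ hη ho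
    set m₀ := a₀ + labTotal d 0 o with hm
    have hst : ∀ (a : ℤ) w, chainState P d z (o ++ [n]) a 0 w = chainState P d z o a 0
        (Function.update w n (stepVec P (d n) (a + labTotal d 0 o)
          (a + labTotal d 0 o + d n) (z n))) := fun a w => by
      rw [chainState_append_singleton hn]; simp
    have hcomp := creation_composite
      (B := fun b a i => opB P (chainT P d z (o ++ [n])) b a (t i))
      (BX := fun b a i => opB P (chainT P d z o) b a (t i))
      (BY := fun b a i => opB P (chainT P d z [n]) b a (t i))
      (DX := fun b a i => opD P (chainT P d z o) b a (t i))
      (AY := fun b a i => opA P (chainT P d z [n]) b a (t i))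
      (al := fun i j => alphaFun P (t i - t j)) (g := fun m i j => unwanted P m (t i) (t j))
      (dX := fun j => ∏ k ∈ o.toFinset, deltaL P (d k) (t j - z k))
      (aY := fun i => alphaL P (d n) (t i - z n))
      (Ω := fun p q => pureTensor (chainState P d z o (a₀ + p) 0
        (Function.update v n (stepVec P (d n) (m₀ + q) (m₀ + q + d n) (z n)))))
      (a₀ := a₀) (m₀ := m₀) (b₀ := m₀ + d n)
      (fun b a i j hij => opB_mul_opB hτ hη hT b a (htt2 i j hij))
      (fun b a i j hij => opB_mul_opB hτ hη hTX b a (htt2 i j hij))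
      (fun b a i j hij => opB_mul_opB hτ hη hTY b a (htt2 i j hij))
      (fun b a m i => by rw [chainT_append]; exact opB_mul hτ hl _ _ b a m (ht i))
      (fun b a i b' a' j => ((br_commute (hc _ _) _ _ _ _).smul_left _).smul_right _)
      (fun b a i b' a' j => ((br_commute (hc _ _) _ _ _ _).smul_left _).smul_right _)
      (fun b a i b' a' j => ((br_commute (hc _ _) _ _ _ _).smul_left _).smul_right _)
      (fun b a i j hij => by
        rw [opA_mul_opB hτ hη hl hTY b a (htt j i hij.symm), add_neg_cancel_right,
          show a - 1 + -1 = a - 2 by ring]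
        rfl)
      (fun b a i j hij => by
        rw [opD_mul_opB hτ hη hl hTX b a (htt j i hij.symm), sub_add_cancel,
          show b + 1 + 1 = b + 2 by ring]
        rfl)
      (fun a i j k hij hik hjk => alphaFun_unwanted hτ hl a (htt _ _ hij.symm)
        (htt _ _ hik.symm) (htt _ _ hjk))
      (fun b i j k hij hik hjk => alphaFun_unwanted' hτ hl b (htt _ _ hij.symm)
        (htt _ _ hik.symm) (htt _ _ hjk))
      (fun p q i => by
        have := (chain_vacuum (d := d) (z := z) hτ hη hl ho' (a₀ + p) (Function.update v n
          (stepVec P (d n) (m₀ + q) (m₀ + q + d n) (z n))) (ht i)).2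
        rw [show a₀ + p + labTotal d 0 o = m₀ + p by rw [hm]; ring] at this
        rw [this, add_assoc])
      (fun p q i => by
        rw [opA_singleton, siteHom_tprod, chainState_self hn, Function.update_self,
          show m₀ + d n + q = m₀ + q + d n by ring, opA_stepVec hτ hη hl _ _ _ (ht i),
          chainState_update hn, Function.update_idem, ← chainState_update hn,
          (pureTensor).map_update_smul, chainState_update hn,
          show m₀ + (q - 1) = m₀ + q - 1 by ring, show m₀ + q - 1 + d n = m₀ + q + d n - 1 by ring])
      S
    rw [hst, hlt, hto, sum_mapsInto_insert π₀ S (by simpa using hn)]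
    simp only [add_zero] at hcomp
    rw [← add_assoc, ← hm, hcomp]
    refine Finset.sum_congr rfl fun J hJ => ?_
    have hJS := Finset.mem_powerset.1 hJ
    have hcard : (S.card : ℤ) = J.card + (S \ J).card := by
      rw [← Finset.card_sdiff_add_card_eq_card hJS]; push_cast; ring
    have hA : m₀ + -((S \ J).card : ℤ) =
        a₀ + S.card + labTotal d 0 o - 2 * (S \ J).card - J.card := by rw [hcard, hm]; ring
    have hih := ih ho' (S \ J) (a₀ + J.card) (Function.update v n
      (stepVec P (d n) (m₀ + -(S \ J).card) (m₀ + -(S \ J).card + d n) (z n)))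
    rw [show a₀ + (J.card : ℤ) + labTotal d 0 o - (S \ J).card = m₀ + J.card - (S \ J).card by
      rw [hm]; ring, show a₀ + (J.card : ℤ) + (S \ J).card = a₀ + S.card by rw [hcard]; ring] at hih
    rw [hih, map_sum, Finset.smul_sum]
    refine Finset.sum_congr rfl fun π hπ => ?_
    have hπ' : ∀ i ∈ S \ J, π i ∈ o := fun i hi => List.mem_toFinset.1 ((mem_mapsInto.1 hπ).1 i hi)
    have hY : (fun (b a : ℤ) (i : ι) => opB P (chainT P d z [n]) b a (t i)) = fun b a i =>
        siteHom P d n (opB P (fun u => Ls P (d n) (u - z n)) b a (t i)) := by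
      funext b a i; rw [opB_singleton]
    have hcm := creation_map (siteHom P d n) (fun (b a : ℤ) (i : ι) =>
      opB P (fun u => Ls P (d n) (u - z n)) b a (t i)) (m₀ + d n - S.card)
      (m₀ + J.card - (S \ J).card) J
    have hsite := creation_stepVec hτ hη hl ht (d n) (m₀ + -(S \ J).card) (z n) J
    rw [show m₀ + -((S \ J).card : ℤ) + d n - J.card = m₀ + d n - S.card by rw [hcard]; ring,
      show m₀ + -((S \ J).card : ℤ) + J.card = m₀ + J.card - (S \ J).card by ring] at hsite
    rw [map_smul, hY, hcm, siteHom_tprod, chainState_self hn, Function.update_self, hsite,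
      chainState_update hn, Function.update_idem, ← chainState_update hn,
      (pureTensor).map_update_smul, chainState_update hn,
      chainCoef_append_singleton hn hJS hπ' ho' t _ _ hA,
      chainState_piecewise hn hJS hπ' ho' _ _ hA, smul_smul, smul_smul]
    rw [show m₀ + -((S \ J).card : ℤ) + J.card = m₀ + J.card - (S \ J).card by ring,
      show m₀ + -((S \ J).card : ℤ) + d n - J.card = m₀ + d n - S.card by rw [hcard]; ring,
      mul_assoc]

end expansion

/-! ### Symmetry of fused products -/

lemma thIdx_neg (a : Fin 4) (z : ℂ) :
    thIdx P a (-z) = (![-1, 1, 1, 1] : Fin 4 → ℂ) a * thIdx P a z := by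
  fin_cases a
  · simpa [thIdx_zero] using th11_neg z
  · simpa [thIdx] using theta10_neg z P.τ
  · simpa [thIdx] using theta_neg 0 z P.τ
  · have h := theta_neg 1 z P.τ
    have h' := theta_zero_add_two (-1) z P.τ
    norm_num at h'
    simpa [thIdx, h'] using h

section
variable (hτ : 0 < P.τ.im) (hη : th11 P (2 * P.η) ≠ 0)
include hτ hη

lemma RR_neg_two_eta {A : Type*} [AddCommGroup A] [Module ℂ A]
    (β : (Fin 2 → ℂ) →ₗ[ℂ] (Fin 2 → ℂ) →ₗ[ℂ] A) (p q : Fin 2 → ℂ) :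
    RR P (-(2 * P.η)) β p q = th11 P (2 * P.η) • β q p + (-th11 P (2 * P.η)) • β p q := by
  refine RR_eq_of_contract (fun r s => ?_) β
  have hW : ∀ a, th11 P (2 * P.η) ^ 2 * WL P a (-(2 * P.η) + P.η) =
      th11 P (2 * P.η) / 2 * (![-1, 1, 1, 1] : Fin 4 → ℂ) a := fun a => by
    have := thIdx_eta_ne_zero hτ hη a
    rw [show -(2 * P.η) + P.η = -P.η by ring, WL, thIdx_neg]
    field_simp
  simp only [RR, hW, LinearMap.compl₁₂_apply, dtL_apply, LinearMap.mul_apply', smul_eq_mul,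
    Fin.sum_univ_four, dt, pauli, Matrix.mulVec, dotProduct, Fin.sum_univ_two]
  simp
  ring_nf
  simp only [I_sq]
  ring

lemma RTT.symm {A : Type*} [Ring A] [Algebra ℂ A] {T : ℂ → Matrix (Fin 2) (Fin 2) A}
    (hT : RTT P T) (u : ℂ) (r c₁ c₂ : Fin 2 → ℂ) :
    br (T (u + 2 * P.η)) r c₁ * br (T u) r c₂ = br (T (u + 2 * P.η)) r c₂ * br (T u) r c₁ := by
  have h := hT u (u + 2 * P.η) r r c₁ c₂
  rw [show u - (u + 2 * P.η) = -(2 * P.η) by ring, RR_neg_two_eta hτ hη,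
    RR_neg_two_eta hτ hη] at h
  simp only [LinearMap.compl₁₂_apply, LinearMap.flip_apply, LinearMap.mul_apply', neg_smul,
    add_neg_cancel] at h
  exact smul_right_injective A hη (add_neg_eq_zero.1 h.symm)

end

section stack
variable {A B : Type*} [Monoid A]

/-- The product `⋯ X_{k+1}(v₁) X_k(v₀)`. -/
def stack (X : ℕ → B → A) : ℕ → List B → A
  | _, [] => 1
  | k, v :: l => stack X (k + 1) l * X k v

lemma stack_perm {X : ℕ → B → A} (hX : ∀ k v w, X (k + 1) v * X k w = X (k + 1) w * X k v)
    {l l' : List B} (h : l.Perm l') (k : ℕ) : stack X k l = stack X k l' := by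
  induction h generalizing k with
  | nil => rfl
  | cons v _ ih => rw [stack, stack, ih]
  | swap v w l => simp only [stack, mul_assoc, hX]
  | trans _ _ h1 h2 => exact (h1 k).trans (h2 k)

lemma stack_ofFn (X : ℕ → B → A) {d : ℕ} (v : Fin d → B) (k : ℕ) :
    stack X k (List.ofFn v) = (List.ofFn fun i : Fin d => X (k + i) (v i)).reverse.prod := by
  induction d generalizing k with
  | zero => simp [stack]
  | succ d ih =>
    rw [List.ofFn_succ, List.ofFn_succ, stack, ih]
    simp only [List.reverse_cons, List.prod_append, List.prod_singleton, Fin.val_succ, Fin.val_zero,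
      add_zero]
    congr 5
    funext i
    rw [show k + 1 + (i : ℕ) = k + (i + 1) by ring]

end stack

section revProd
variable {A : Type*} [Ring A] [Algebra ℂ A]

/-- The ordered product, with the last factor on the left. -/
def revProd (A : Type*) [Ring A] [Algebra ℂ A] (d : ℕ) : MultilinearMap ℂ (fun _ : Fin d => A) A :=
  (MulOpposite.opLinearEquiv ℂ (M := A)).symm.toLinearMap.compMultilinearMap
    ((MultilinearMap.mkPiAlgebraFin ℂ d Aᵐᵒᵖ).compLinearMap fun _ =>
      (MulOpposite.opLinearEquiv ℂ (M := A)).toLinearMap)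

lemma revProd_apply {d : ℕ} (m : Fin d → A) : revProd A d m = (List.ofFn m).reverse.prod := by
  change MulOpposite.unop (List.ofFn fun i => MulOpposite.op (m i)).prod = _
  rw [MulOpposite.unop_list_prod, List.map_ofFn]
  rfl

end revProd

/-! ### Linear maps on `V^l` from symmetric multilinear maps -/

lemma eq_zero_of_homogeneous_eq_zero {A B : ℂ → ℂ} (hA : Continuous A) (hB : Continuous B)
    (hd : Dense {y | A y ≠ 0}) {y₀ : ℂ} (hA0 : A y₀ = 0) (hB0 : B y₀ ≠ 0) (d : ℕ) (c : ℕ → ℂ)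
    (h : ∀ y, ∑ k ∈ Finset.range (d + 1), c k * (B y ^ k * A y ^ (d - k)) = 0) :
    ∀ k ≤ d, c k = 0 := by
  induction d with
  | zero => intro k hk; obtain rfl : k = 0 := by omega
            simpa using h y₀
  | succ d ih =>
    have hlast : c (d + 1) = 0 := by
      have := h y₀
      rw [Finset.sum_range_succ, Finset.sum_eq_zero, zero_add] at this
      · simpa [hB0] using this
      · intro k hk
        rw [hA0, zero_pow (by have := Finset.mem_range.1 hk; omega)]; simp
    have hfac : ∀ y, A y * ∑ k ∈ Finset.range (d + 1), c k * (B y ^ k * A y ^ (d - k)) = A y * 0 := by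
      intro y
      have := h y
      rw [Finset.sum_range_succ, hlast, zero_mul, add_zero] at this
      rw [mul_zero, ← this, Finset.mul_sum]
      refine Finset.sum_congr rfl fun k hk => ?_
      rw [show d + 1 - k = d - k + 1 by have := Finset.mem_range.1 hk; omega, pow_succ]
      ring
    have hz := eq_of_mul_eq_mul hd (by fun_prop) continuous_const hfac
    intro k hk
    rcases Nat.lt_or_ge k (d + 1) with hk' | hk'
    · exact ih (fun y => congrFun hz y) k (by omega)
    · rw [show k = d + 1 by omega, hlast]

lemma perm_replicate (l : List (Fin 2)) :
    l.Perm (List.replicate (l.count 1) 1 ++ List.replicate (l.count 0) 0) := by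
  rw [List.perm_iff_count]
  intro a
  fin_cases a <;> simp [List.count_replicate]

lemma ofFn_ite_lt {β : Type*} (a b : β) {d k : ℕ} (hk : k ≤ d) :
    List.ofFn (fun i : Fin d => if (i : ℕ) < k then b else a) =
      List.replicate k b ++ List.replicate (d - k) a := by
  apply List.ext_getElem
  · simp; omega
  · intro i h1 h2
    simp only [List.getElem_ofFn, List.getElem_append, List.length_replicate,
      List.getElem_replicate]
    split_ifs <;> rfl

lemma perm_ofFn_ite {β : Type*} (a b : β) {d : ℕ} (s : Fin d → Fin 2) : ∃ k ≤ d,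
    (List.ofFn fun i => (![a, b] : Fin 2 → β) (s i)).Perm
      (List.ofFn fun i : Fin d => if (i : ℕ) < k then b else a) := by
  have h := perm_replicate (List.ofFn s)
  have hc : (List.ofFn s).count 1 + (List.ofFn s).count 0 = d := by
    simpa using h.length_eq.symm
  refine ⟨(List.ofFn s).count 1, by omega, ?_⟩
  rw [ofFn_ite_lt a b (by omega), show d - (List.ofFn s).count 1 = (List.ofFn s).count 0 by omega]
  have h2 := h.map (![a, b] : Fin 2 → β)
  simp only [List.map_ofFn, List.map_append, List.map_replicate] at h2
  exact h2

lemma prodV_apply {d : ℕ} (g : Fin d → V P 1) (y : ℂ) :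
    (prodV P g : ℂ → ℂ) y = ∏ i, (g i : ℂ → ℂ) y := rfl

/-- The product of vectors of spin `1/2` as a multilinear map. -/
def prodVMul (P : Params) (d : ℕ) : MultilinearMap ℂ (fun _ : Fin d => V P 1) (V P d) where
  toFun g := prodV P g
  map_update_add' g i x y := by
    ext z
    simp only [prodV_apply, Submodule.coe_add, Pi.add_apply]
    rw [← Finset.mul_prod_erase _ _ (Finset.mem_univ i), ← Finset.mul_prod_erase _ _ (Finset.mem_univ i),
      ← Finset.mul_prod_erase _ _ (Finset.mem_univ i)]
    simp only [Function.update_self, Submodule.coe_add, Pi.add_apply, add_mul]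
    congr 2 <;>
    exact Finset.prod_congr rfl fun k hk => by
      rw [Function.update_of_ne (Finset.ne_of_mem_erase hk),
        Function.update_of_ne (Finset.ne_of_mem_erase hk)]
  map_update_smul' g i c x := by
    ext z
    simp only [prodV_apply, Submodule.coe_smul, Pi.smul_apply, smul_eq_mul]
    rw [← Finset.mul_prod_erase _ _ (Finset.mem_univ i), ← Finset.mul_prod_erase _ _ (Finset.mem_univ i)]
    simp only [Function.update_self, Submodule.coe_smul, Pi.smul_apply, smul_eq_mul, mul_assoc]
    congr 2
    exact Finset.prod_congr rfl fun k hk => by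
      rw [Function.update_of_ne (Finset.ne_of_mem_erase hk),
        Function.update_of_ne (Finset.ne_of_mem_erase hk)]

lemma prodV_perm {d : ℕ} {v w : Fin d → V P 1} (h : (List.ofFn v).Perm (List.ofFn w)) :
    prodV P v = prodV P w := by
  ext y
  rw [prodV_apply, prodV_apply, ← List.prod_ofFn, ← List.prod_ofFn]
  have := (h.map fun f : V P 1 => (f : ℂ → ℂ) y).prod_eq
  rwa [List.map_ofFn, List.map_ofFn] at this

section
variable (hτ : 0 < P.τ.im) (hη : th11 P (2 * P.η) ≠ 0)
include hτ hη

/-- A symmetric multilinear map factors through the multiplication of functions. -/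
lemma exists_linearMap_prodV {X : Type*} [AddCommGroup X] [Module ℂ X] {d : ℕ}
    (Φ : MultilinearMap ℂ (fun _ : Fin d => Fin 2 → ℂ) X)
    (hΦ : ∀ v w, (List.ofFn v).Perm (List.ofFn w) → Φ v = Φ w) :
    ∃ T : V P d →ₗ[ℂ] X, ∀ v, T (prodV P fun i => gv P (v i)) = Φ v := by
  set a := ev P (2 * P.η) with ha
  set b := ev P 0 with hb
  have hab : dt a b ≠ 0 := by
    rw [ha, hb, dt_ev hτ]; simp [hη]
  let u : ℕ → Fin d → Fin 2 → ℂ := fun k i => if (i : ℕ) < k then b else a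
  let m : Fin (d + 1) → V P d := fun k => prodV P fun i => gv P (u k i)
  have hAd : Dense {y | dt (ev P (y + 1 / 2)) a ≠ 0} := by
    refine dense_ne_zero (gv P a).2.1 ⟨-(1 / 2), ?_⟩
    change dt (ev P (-(1 / 2) + 1 / 2)) a ≠ 0
    rw [neg_add_cancel, ← hb, dt_swap]
    exact neg_ne_zero.2 hab
  have hm : LinearIndependent ℂ m := by
    rw [Fintype.linearIndependent_iff]
    intro c hc k
    have h0 : ∀ y, ∑ k ∈ Finset.range (d + 1), (if h : k < d + 1 then c ⟨k, h⟩ else 0) *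
        (dt (ev P (y + 1 / 2)) b ^ k * dt (ev P (y + 1 / 2)) a ^ (d - k)) = 0 := by
      intro y
      have h1 := congrArg (fun f : V P d => (f : ℂ → ℂ) y) hc
      simp only [Submodule.coe_sum, Submodule.coe_smul, Finset.sum_apply, Pi.smul_apply,
        smul_eq_mul, Submodule.coe_zero, Pi.zero_apply] at h1
      rw [← h1, Finset.sum_range]
      refine Finset.sum_congr rfl fun k _ => ?_
      have h2 : (m k : ℂ → ℂ) y = (List.ofFn fun i : Fin d => if (i : ℕ) < k then
          dt (ev P (y + 1 / 2)) b else dt (ev P (y + 1 / 2)) a).prod := by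
        rw [List.prod_ofFn]
        change ∏ i : Fin d, (gv P (u k i) : ℂ → ℂ) y = _
        refine Finset.prod_congr rfl fun i _ => ?_
        rw [gv_apply, apply_ite (dt (ev P (y + 1 / 2)))]
      rw [h2, ofFn_ite_lt _ _ (Nat.lt_succ_iff.1 k.2), dif_pos k.2, List.prod_append, List.prod_replicate,
        List.prod_replicate]
    have hA0 : dt (ev P (2 * P.η - 1 / 2 + 1 / 2)) a = 0 := by
      rw [sub_add_cancel, ← ha, dt_self]
    have hB0 : dt (ev P (2 * P.η - 1 / 2 + 1 / 2)) b ≠ 0 := by rwa [sub_add_cancel, ← ha]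
    have h3 := eq_zero_of_homogeneous_eq_zero (V_continuous (gv P a)) (V_continuous (gv P b))
      hAd hA0 hB0 d _ h0 k (Nat.lt_succ_iff.1 k.2)
    rwa [dif_pos k.2] at h3
  obtain ⟨T, hT⟩ := LinearMap.exists_extend
    ((Module.Basis.span hm).constr ℂ fun k : Fin (d + 1) => Φ (u k))
  have hTm : ∀ k, T (m k) = Φ (u k) := fun k => by
    have h1 : (Module.Basis.span hm k : V P d) = m k := congrArg Subtype.val (Module.Basis.span_apply hm k)
    rw [← h1]
    have := LinearMap.congr_fun hT (Module.Basis.span hm k)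
    rw [LinearMap.comp_apply, Submodule.subtype_apply] at this
    rw [this, Module.Basis.constr_basis]
  refine ⟨T, fun v => ?_⟩
  have hli : LinearIndependent ℂ (![a, b] : Fin 2 → Fin 2 → ℂ) := by
    rw [LinearIndependent.pair_iff]
    intro s t hst
    have h1 := congrArg (fun w => dt w b) hst
    have h2 := congrArg (fun w => dt a w) hst
    simp only [dt_add_left, dt_smul_left, dt_add_right, dt_smul_right, dt_self, mul_zero, add_zero,
      zero_add] at h1 h2
    rw [show dt 0 b = 0 by simp [dt]] at h1
    rw [show dt a 0 = 0 by simp [dt]] at h2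
    exact ⟨(mul_eq_zero.1 h1).resolve_right hab, (mul_eq_zero.1 h2).resolve_right hab⟩
  let e := basisOfLinearIndependentOfCardEqFinrank hli (by simp)
  have he : ∀ i, e i = (![a, b] : Fin 2 → Fin 2 → ℂ) i := fun i => by simp [e]
  have key : T.compMultilinearMap ((prodVMul P d).compLinearMap fun _ => gv P) = Φ := by
    refine Module.Basis.ext_multilinear (fun _ => e) fun s => ?_
    simp only [he]
    obtain ⟨k, hk, hp⟩ := perm_ofFn_ite a b s
    rw [hΦ _ _ hp]
    change T (prodV P fun i => gv P ((![a, b] : Fin 2 → Fin 2 → ℂ) (s i))) = Φ (u k)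
    have hp' := hp.map (gv P)
    rw [List.map_ofFn, List.map_ofFn] at hp'
    exact (congrArg T (prodV_perm hp')).trans (hTm ⟨k, by omega⟩)
  exact congrArg (fun Ψ : MultilinearMap ℂ (fun _ : Fin d => Fin 2 → ℂ) X => Ψ v) key

end

/-! ### Vectors in a tensor product, given by functions of the variable of one factor -/

/-- The evaluation of the functions in `V^l` at a point. -/
def evalV (P : Params) (d : ℕ) (y : ℂ) : V P d →ₗ[ℂ] ℂ where
  toFun f := (f : ℂ → ℂ) y
  map_add' _ _ := rfl
  map_smul' _ _ := rfl

lemma evalV_apply {d : ℕ} (y : ℂ) (f : V P d) : evalV P d y f = (f : ℂ → ℂ) y := rfl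

section slot
variable {N : ℕ} {d : Fin N → ℕ} {j k : Fin N} {m : ℕ}

/-- The vector with the component `h y`, in the factor `k`, of the value at `y` in the factor `j`,
in terms of an interpolation formula with the nodes `x`. -/
def slotMap (P : Params) (d : Fin N → ℕ) (j k : Fin N) (x c : Fin m → ℂ) (B : Fin m → V P (d j))
    (v : ∀ n, V P (d n)) : (ℂ → V P (d k)) →ₗ[ℂ] H P d :=
  ∑ i, c i • ((pureTensor).toLinearMap (Function.update v j (B i)) k ∘ₗ
    LinearMap.proj (x i))

variable {x c : Fin m → ℂ} {B : Fin m → V P (d j)}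

lemma slotMap_apply (v : ∀ n, V P (d n)) (h : ℂ → V P (d k)) :
    slotMap P d j k x c B v h = ∑ i, c i • pureTensor
      (Function.update (Function.update v j (B i)) k (h (x i))) := by
  simp [slotMap]

lemma siteHom_slotMap_of_ne {n : Fin N} (hj : n ≠ j) (hk : n ≠ k) (E : Module.End ℂ (V P (d n)))
    (v : ∀ n, V P (d n)) (h : ℂ → V P (d k)) :
    siteHom P d n E (slotMap P d j k x c B v h) =
      slotMap P d j k x c B (Function.update v n (E (v n))) h := by
  simp only [slotMap_apply, map_sum, map_smul, siteHom_tprod, Function.update_of_ne hk,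
    Function.update_of_ne hj]
  refine Finset.sum_congr rfl fun i _ => ?_
  rw [Function.update_comm hk.symm, Function.update_comm hj.symm]

variable (hjk : j ≠ k) (hI : ∀ p : V P (d j), p = ∑ i, (c i * (p : ℂ → ℂ) (x i)) • B i)
include hjk hI

lemma slotMap_smul (v : ∀ n, V P (d n)) (p : V P (d j)) (ω : V P (d k)) :
    slotMap P d j k x c B v (fun y => (p : ℂ → ℂ) y • ω) =
      pureTensor (Function.update (Function.update v j p) k ω) := by
  rw [slotMap_apply]
  have h : ∀ q : V P (d j), pureTensor
      (Function.update (Function.update v j q) k ω) =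
      (pureTensor).toLinearMap (Function.update v k ω) j q := fun q => by
    rw [Function.update_comm hjk]; rfl
  rw [h, hI p, map_sum]
  refine Finset.sum_congr rfl fun i _ => ?_
  rw [map_smul, ← h, (pureTensor).map_update_smul, smul_smul, ← hI p]

lemma exists_slotMap_eq (S : ℂ → V P (d j) →ₗ[ℂ] Module.End ℂ (V P (d k))) :
    ∃ T : Module.End ℂ (H P d), ∀ v, T (pureTensor v) =
      slotMap P d j k x c B v fun y => S y (v j) (v k) := by
  refine ⟨∑ i, ∑ i', (c i * c i') • (siteHom P d j ((evalV P (d j) (x i')).smulRight (B i)) *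
    siteHom P d k (S (x i) (B i'))), fun v => ?_⟩
  rw [slotMap_apply, LinearMap.sum_apply]
  refine Finset.sum_congr rfl fun i _ => ?_
  have h : ∀ q : V P (d j), pureTensor
      (Function.update (Function.update v j (B i)) k (S (x i) q (v k))) =
      ((pureTensor).toLinearMap (Function.update v j (B i)) k ∘ₗ
        (S (x i)).flip (v k)) q := fun q => rfl
  rw [h, hI (v j), map_sum, Finset.smul_sum, LinearMap.sum_apply]
  refine Finset.sum_congr rfl fun i' _ => ?_
  rw [map_smul, ← h, LinearMap.smul_apply, Module.End.mul_apply, siteHom_tprod,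
    siteHom_tprod, Function.update_of_ne hjk, LinearMap.smulRight_apply,
    (pureTensor).map_update_smul, Function.update_comm hjk, evalV_apply, smul_smul,
    smul_smul]
  congr 1
  ring

end slot

/-! ### The fused R matrix -/

lemma br_Ls_eq (d : ℕ) (u : ℂ) (r c : Fin 2 → ℂ) :
    br (Ls P d u) r c = ∑ a, (WL P a u * dt r ((pauli a).mulVec c)) • rho P d a := by
  simp only [br_apply, Ls, Fin.sum_univ_four, dt, Matrix.mulVec, dotProduct, Fin.sum_univ_two]
  module

/-- The product of the operators `R^{1/2,l}`, contracted in the spin `1/2` factors. -/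
def fusedOp (P : Params) (n d : ℕ) (u : ℂ) (e : Fin 2 → ℂ) :
    MultilinearMap ℂ (fun _ : Fin n => Fin 2 → ℂ) (Module.End ℂ (V P d)) :=
  (revProd (Module.End ℂ (V P d)) n).compLinearMap fun i =>
    (th11 P (2 * P.η) / th11 P (u + (2 * ((i : ℕ) : ℂ) + 1 - n) * P.η + (d + 1) * P.η)) •
      br (Ls P d (u + (2 * ((i : ℕ) : ℂ) + 1 - n) * P.η + P.η)) e

lemma fusedOp_apply (n d : ℕ) (u : ℂ) (e : Fin 2 → ℂ) (v : Fin n → Fin 2 → ℂ) :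
    fusedOp P n d u e v = (∏ i : Fin n, th11 P (2 * P.η) /
      th11 P (u + (2 * ((i : ℕ) : ℂ) + 1 - n) * P.η + (d + 1) * P.η)) •
      stack (fun i => br (Ls P d (u + (2 * (i : ℂ) + 1 - n) * P.η + P.η)) e) 0 (List.ofFn v) := by
  rw [stack_ofFn]
  simp only [zero_add]
  exact (MultilinearMap.map_smul_univ _ _ _).trans (congrArg _ (revProd_apply _))

section
variable (hτ : 0 < P.τ.im) (hη : th11 P (2 * P.η) ≠ 0)
include hτ hη

lemma fusedOp_perm {n d : ℕ} (u : ℂ) (e : Fin 2 → ℂ) (v w : Fin n → Fin 2 → ℂ)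
    (h : (List.ofFn v).Perm (List.ofFn w)) : fusedOp P n d u e v = fusedOp P n d u e w := by
  rw [fusedOp_apply, fusedOp_apply]
  congr 1
  refine stack_perm (fun k c c' => ?_) h 0
  have := (rtt_Ls hτ hη d).symm hτ hη (u + (2 * (k : ℂ) + 1 - n) * P.η + P.η) e c c'
  rwa [show u + (2 * (k : ℂ) + 1 - n) * P.η + P.η + 2 * P.η =
    u + (2 * ((k + 1 : ℕ) : ℂ) + 1 - n) * P.η + P.η by push_cast; ring] at this

lemma sum_RCoef_rho (d : ℕ) (u y : ℂ) (c : Fin 2 → ℂ) :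
    ∑ a, (RCoef P d a u * (rho P 1 a (gv P c) : ℂ → ℂ) y) • rho P d a =
      (th11 P (2 * P.η) / th11 P (u + (d + 1) * P.η)) •
        br (Ls P d (u + P.η)) (ev P (y + 1 / 2)) c := by
  rw [br_Ls_eq, Finset.smul_sum]
  refine Finset.sum_congr rfl fun a _ => ?_
  rw [rho_one_gv hτ hη, Submodule.coe_smul, Pi.smul_apply, gv_apply, RCoef, smul_smul, smul_eq_mul]
  congr 1
  ring

lemma fusedOp_eq_sum (n d : ℕ) (u y : ℂ) (w : Fin n → Fin 2 → ℂ) :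
    fusedOp P n d u (ev P (y + 1 / 2)) w = ∑ s : Fin n → Fin 4,
      ((∏ i, RCoef P d (s i) (u + (2 * ((i : ℕ) : ℂ) + 1 - n) * P.η)) *
        (prodV P (fun i => rho P 1 (s i) (gv P (w i))) : ℂ → ℂ) y) •
        (List.ofFn fun i => rho P d (s i)).reverse.prod := by
  change (revProd (Module.End ℂ (V P d)) n fun i => (th11 P (2 * P.η) /
    th11 P (u + (2 * ((i : ℕ) : ℂ) + 1 - n) * P.η + (d + 1) * P.η)) •
    br (Ls P d (u + (2 * ((i : ℕ) : ℂ) + 1 - n) * P.η + P.η)) (ev P (y + 1 / 2)) (w i)) = _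
  simp only [← sum_RCoef_rho hτ hη]
  rw [MultilinearMap.map_sum]
  refine Finset.sum_congr rfl fun s _ => ?_
  rw [MultilinearMap.map_smul_univ, revProd_apply, prodV_apply, Finset.prod_mul_distrib]

variable {N : ℕ} {d : Fin N → ℕ} {j k : Fin N} {m : ℕ} {x c : Fin m → ℂ} {B : Fin m → V P (d j)}
variable (hjk : j ≠ k) (hI : ∀ p : V P (d j), p = ∑ i, (c i * (p : ℂ → ℂ) (x i)) • B i)
include hjk hI

lemma isFusedR_iff_slotMap (u : ℂ) (T : Module.End ℂ (H P d)) : IsFusedR P d j k u T ↔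
    ∀ v (w : Fin (d j) → Fin 2 → ℂ),
      T (pureTensor (Function.update v j (prodV P fun i => gv P (w i)))) =
      slotMap P d j k x c B v fun y => fusedOp P (d j) (d k) u (ev P (y + 1 / 2)) w (v k) := by
  have key : ∀ v (w : Fin (d j) → Fin 2 → ℂ), ∑ s : Fin (d j) → Fin 4,
        (∏ i, RCoef P (d k) (s i) (u + (2 * ((i : ℕ) : ℂ) + 1 - d j) * P.η)) •
          pureTensor
            (Function.update
              (Function.update v j (prodV P fun i => rho P 1 (s i) (gv P (w i))))
              k ((List.ofFn fun i => rho P (d k) (s i)).reverse.prod (v k))) =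
      slotMap P d j k x c B v fun y => fusedOp P (d j) (d k) u (ev P (y + 1 / 2)) w (v k) := by
    intro v w
    have h1 : (fun y => fusedOp P (d j) (d k) u (ev P (y + 1 / 2)) w (v k)) =
        ∑ s : Fin (d j) → Fin 4,
          (∏ i, RCoef P (d k) (s i) (u + (2 * ((i : ℕ) : ℂ) + 1 - d j) * P.η)) •
          fun y => (prodV P (fun i => rho P 1 (s i) (gv P (w i))) : ℂ → ℂ) y •
            (List.ofFn fun i => rho P (d k) (s i)).reverse.prod (v k) := by
      funext y
      rw [fusedOp_eq_sum hτ hη, LinearMap.sum_apply, Finset.sum_apply]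
      refine Finset.sum_congr rfl fun s _ => ?_
      rw [LinearMap.smul_apply, Pi.smul_apply, smul_smul]
    rw [h1, map_sum]
    refine Finset.sum_congr rfl fun s _ => ?_
    rw [map_smul, slotMap_smul hjk hI]
  constructor
  · intro h v w
    rw [← key]
    exact h v _
  · intro h v g
    choose w hw using fun i => gv_surjective hτ hη (g i)
    obtain rfl : g = fun i => gv P (w i) := funext fun i => (hw i).symm
    rw [key]
    exact h v w

lemma isFusedR_Rop (u : ℂ) : IsFusedR P d j k u (Rop P d j k u) := by
  have hex : ∃ T, IsFusedR P d j k u T := by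
    have hex : ∀ y : ℂ, ∃ S : V P (d j) →ₗ[ℂ] Module.End ℂ (V P (d k)), ∀ w,
        S (prodV P fun i => gv P (w i)) = fusedOp P (d j) (d k) u (ev P (y + 1 / 2)) w := fun y =>
      exists_linearMap_prodV (X := Module.End ℂ (V P (d k))) (d := d j) hτ hη _ (fusedOp_perm hτ hη u (ev P (y + 1 / 2)))
    choose S hS using hex
    obtain ⟨T, hT⟩ := exists_slotMap_eq hjk hI S
    refine ⟨T, (isFusedR_iff_slotMap hτ hη hjk hI u T).2 fun v w => ?_⟩
    rw [hT, Function.update_self, Function.update_of_ne hjk.symm]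
    simp only [hS, slotMap_apply, Function.update_idem]
  rw [Rop, dif_pos hex]
  exact hex.choose_spec

lemma Rop_tprod (u : ℂ) (v : ∀ n, V P (d n)) (w : Fin (d j) → Fin 2 → ℂ) :
    Rop P d j k u (pureTensor
      (Function.update v j (prodV P fun i => gv P (w i)))) =
      slotMap P d j k x c B v fun y => fusedOp P (d j) (d k) u (ev P (y + 1 / 2)) w (v k) :=
  (isFusedR_iff_slotMap hτ hη hjk hI u _).1 (isFusedR_Rop hτ hη hjk hI u) v w

end

/-! ### Ordered products -/

section desc
variable {A : Type*} [Monoid A]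

/-- The product `f (n - 1) ⋯ f 0`. -/
def descProd (f : ℕ → A) : ℕ → A
  | 0 => 1
  | n + 1 => f n * descProd f n

lemma descProd_eq (f : ℕ → A) (n : ℕ) :
    (List.ofFn fun i : Fin n => f i).reverse.prod = descProd f n := by
  induction n with
  | zero => simp [descProd]
  | succ n ih =>
    rw [List.ofFn_succ', List.concat_eq_append, List.reverse_append, List.prod_append, descProd]
    simp only [List.reverse_singleton, List.prod_singleton, Fin.val_last, Fin.val_castSucc]
    rw [ih]

lemma mul_descProd {f f' g : ℕ → A} {n : ℕ} (h : ∀ i < n, g (i + 1) * f i = f' i * g i) :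
    g n * descProd f n = descProd f' n * g 0 := by
  induction n with
  | zero => simp [descProd]
  | succ n ih =>
    rw [descProd, descProd, ← mul_assoc, h n (Nat.lt_succ_self n), mul_assoc,
      ih fun i hi => h i (hi.trans (Nat.lt_succ_self n)), mul_assoc]

end desc

lemma descProd_eq_prod {A : Type*} [CommMonoid A] (f : ℕ → A) (n : ℕ) :
    descProd f n = ∏ i : Fin n, f i := by
  rw [← descProd_eq, List.prod_reverse, List.prod_ofFn]

/-! ### Strings -/

/-- The points of a string of length `n` with centre `y`. -/
def strE (P : Params) (n : ℕ) (y : ℂ) (i : ℕ) : Fin 2 → ℂ :=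
  ev P (y + (2 * (i : ℂ) + 1 - n) * P.η)

/-- The vector of spin `n / 2` that is given by a string. -/
def strVec (P : Params) (n : ℕ) (y : ℂ) : V P n := prodV P fun i : Fin n => gv P (strE P n y i)

lemma strVec_sub_half (n : ℕ) (y x : ℂ) :
    (strVec P n y : ℂ → ℂ) (x - 1 / 2) = descProd (fun i => dt (ev P x) (strE P n y i)) n := by
  rw [descProd_eq_prod]
  change ∏ i : Fin n, dt (ev P (x - 1 / 2 + 1 / 2)) (strE P n y i) = _
  rw [sub_add_cancel]

lemma strE_neg (n : ℕ) (y : ℂ) {i : ℕ} (hi : i < n) :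
    strE P n (-y) i = strE P n y (n - 1 - i) := by
  rw [strE, strE, ← ev_neg]
  congr 1
  rw [show n - 1 - i = n - (1 + i) by omega, Nat.cast_sub (by omega)]
  push_cast
  ring

lemma strVec_neg (n : ℕ) (y : ℂ) : strVec P n (-y) = strVec P n y := by
  ext x
  rw [strVec, strVec, prodV_apply, prodV_apply, ← Equiv.prod_comp Fin.revPerm]
  refine Finset.prod_congr rfl fun i _ => ?_
  have : n - 1 - (Fin.revPerm i : Fin n) = (i : ℕ) := by
    rw [Fin.revPerm_apply, Fin.val_rev]; omega
  rw [strE_neg _ _ (Fin.is_lt _), this]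

section
variable (hτ : 0 < P.τ.im) (hη : th11 P (2 * P.η) ≠ 0)
include hτ

omit hτ in
lemma stepVec_vacuum_eq (hτ : 0 < P.τ.im) (d : ℕ) (a : ℤ) (z : ℂ) :
    stepVec P d a (a + d) z =
      ((-1 / 2 : ℂ) ^ d) • strVec P d (-((lamAt P a - z) / 2 + d / 2 * P.η)) := by
  ext x
  rw [stepVec, intVec, Submodule.coe_smul, Pi.smul_apply, strVec, prodV_apply, prodV_apply,
    show ((d : ℤ) + a - (a + d)) / 2 = 0 by ring_nf; rfl, smul_eq_mul]
  have : (-1 / 2 : ℂ) ^ d = ∏ _i : Fin d, (-1 / 2 : ℂ) := by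
    rw [Finset.prod_const, Finset.card_univ, Fintype.card_fin]
  rw [this, ← Finset.prod_mul_distrib]
  refine Finset.prod_congr rfl fun i _ => ?_
  simp only [Int.toNat_zero, not_lt_zero, if_false, halfVec_eq hτ, map_smul, Submodule.coe_smul,
    Pi.smul_apply, smul_eq_mul, strE]
  congr 4
  rw [← ev_neg, lamAt_add]
  push_cast
  ring_nf

include hη

lemma RTT.diag {A : Type*} [Ring A] [Algebra ℂ A] {T : ℂ → Matrix (Fin 2) (Fin 2) A}
    (hT : RTT P T) {u v : ℂ} (huv : th11 P (u - v + 2 * P.η) ≠ 0) (p q : ℂ) :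
    br (T u) (ev P (p + (u - v) / 2 - P.η)) (ev P (q + (u - v) / 2)) *
        br (T v) (ev P p) (ev P (q - P.η)) =
      br (T v) (ev P (p - P.η)) (ev P q) *
        br (T u) (ev P (p + (u - v) / 2)) (ev P (q + (u - v) / 2 - P.η)) := by
  have h := hT u v (ev P (u / 2 + (p - v / 2))) (ev P (v / 2 + (p - v / 2) - P.η))
    (ev P (u / 2 + (q - v / 2))) (ev P (v / 2 + (q - v / 2) - P.η))
  rw [show u - v = 2 * (u / 2 - v / 2) by ring, RR_diag hτ hη, RR_diag hτ hη,
    show 2 * (u / 2 - v / 2) = u - v by ring] at h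
  simp only [LinearMap.compl₁₂_apply, LinearMap.flip_apply, LinearMap.mul_apply'] at h
  have h := smul_right_injective A huv h
  rwa [show u / 2 + (p - v / 2) = p + (u - v) / 2 by ring,
    show u / 2 + (q - v / 2) = q + (u - v) / 2 by ring, show v / 2 + (p - v / 2) = p by ring,
    show v / 2 + (q - v / 2) = q by ring] at h

/-- The exchange of `T(s')` with a product of the operators `T`, evaluated on a string. -/
lemma RTT.mul_descProd_string {A : Type*} [Ring A] [Algebra ℂ A]
    {T : ℂ → Matrix (Fin 2) (Fin 2) A} (hT : RTT P T) {n : ℕ} {s s' : ℂ} {w : ℕ → ℂ}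
    (hw : ∀ i, w i = s' - s + (2 * (i : ℂ) + 2 - n) * P.η)
    (hs : ∀ i < n, th11 P (s + (n - 2 * (i : ℂ)) * P.η) ≠ 0) (x y : ℂ) :
    br (T s') (ev P (x + s / 2 - n / 2 * P.η)) (ev P (y + s / 2 + n / 2 * P.η)) *
        descProd (fun i => br (T (w i)) (ev P (x + P.η)) (strE P n y i)) n =
      descProd (fun i => br (T (w i)) (ev P x) (strE P n (y + P.η) i)) n *
        br (T s') (ev P (x + s / 2 + n / 2 * P.η)) (ev P (y + s / 2 - n / 2 * P.η)) := by
  have h := mul_descProd (n := n)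
    (f := fun i => br (T (w i)) (ev P (x + P.η)) (strE P n y i))
    (f' := fun i => br (T (w i)) (ev P x) (strE P n (y + P.η) i))
    (g := fun i => br (T s') (ev P (x + s / 2 + n / 2 * P.η - i * P.η))
      (ev P (y + s / 2 - n / 2 * P.η + i * P.η))) fun i hi => by
    have h := hT.diag hτ hη (u := s') (v := w i) (by
      convert hs i hi using 2; rw [hw]; ring) (x + P.η) (y + (2 * (i : ℂ) + 2 - n) * P.η)
    have e : s' - w i = s - (2 * (i : ℂ) + 2 - n) * P.η := by rw [hw]; ring
    rw [e] at h
    rw [strE, strE]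
    refine Eq.trans (congrArg₂ _ (congrArg₂ (fun a b => br (T s') (ev P a) (ev P b)) ?_ ?_)
      (congrArg (fun a => br (T (w i)) (ev P (x + P.η)) (ev P a)) ?_)) (h.trans
      (congrArg₂ _ (congrArg₂ (fun a b => br (T (w i)) (ev P a) (ev P b)) ?_ ?_)
      (congrArg₂ (fun a b => br (T s') (ev P a) (ev P b)) ?_ ?_))) <;> push_cast <;> ring
  rw [Nat.cast_zero, zero_mul, sub_zero, add_zero,
    show x + s / 2 + n / 2 * P.η - n * P.η = x + s / 2 - n / 2 * P.η by ring,
    show y + s / 2 - n / 2 * P.η + n * P.η = y + s / 2 + n / 2 * P.η by ring] at h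
  exact h

omit hη in
lemma dt_mul_descProd_string (n : ℕ) (s x y : ℂ) :
    dt (ev P (x + s / 2 - n / 2 * P.η)) (ev P (y + s / 2 + n / 2 * P.η)) *
        descProd (fun i => dt (ev P (x + P.η)) (strE P n y i)) n =
      descProd (fun i => dt (ev P x) (strE P n (y + P.η) i)) n *
        dt (ev P (x + s / 2 + n / 2 * P.η)) (ev P (y + s / 2 - n / 2 * P.η)) := by
  have h := mul_descProd (n := n)
    (f := fun i => dt (ev P (x + P.η)) (strE P n y i))
    (f' := fun i => dt (ev P x) (strE P n (y + P.η) i))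
    (g := fun i => dt (ev P (x + s / 2 + n / 2 * P.η - i * P.η))
      (ev P (y + s / 2 - n / 2 * P.η + i * P.η))) fun i hi => by
    simp only [strE, dt_ev hτ]
    push_cast
    ring_nf
  rw [Nat.cast_zero, zero_mul, sub_zero, add_zero,
    show x + s / 2 + n / 2 * P.η - n * P.η = x + s / 2 - n / 2 * P.η by ring,
    show y + s / 2 - n / 2 * P.η + n * P.η = y + s / 2 + n / 2 * P.η by ring] at h
  exact h

lemma br_Ls_strVec (n : ℕ) (s y : ℂ) (r : Fin 2 → ℂ) :
    br (Ls P n s) r (ev P (y + s / 2 + n / 2 * P.η)) (strVec P n y) =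
      (th11 P (s + n * P.η) / th11 P (2 * P.η) * dt r (ev P (y + s / 2 - n / 2 * P.η))) •
        strVec P n (y + P.η) := by
  refine V_ext_half hη fun x => ?_
  have h1 := dt_mul_descProd_string hτ n s x y
  have h2 := dt_mul_descProd_string hτ n s (-x) y
  rw [br_Ls hτ hη, Submodule.coe_smul, Pi.smul_apply, smul_eq_mul, strVec_sub_half,
    strVec_sub_half, strVec_sub_half]
  rw [show -x + P.η = -(x - P.η) by ring] at h2
  simp only [ev_neg] at h2
  rw [show x + s / 2 - n / 2 * P.η = s / 2 - n / 2 * P.η + x by ring,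
    show x + s / 2 + n / 2 * P.η = s / 2 + n / 2 * P.η + x by ring] at h1
  rw [show -x + s / 2 - n / 2 * P.η = s / 2 - n / 2 * P.η - x by ring,
    show -x + s / 2 + n / 2 * P.η = s / 2 + n / 2 * P.η - x by ring] at h2
  rw [mul_assoc (dt r _), h1, mul_assoc (dt r _), h2]
  have h3 := dt_plucker r (ev P (s / 2 + n / 2 * P.η - x)) (ev P (s / 2 + n / 2 * P.η + x))
    (ev P (y + s / 2 - n / 2 * P.η))
  have h4 := dt_ev hτ (P := P) (s / 2 + n / 2 * P.η + x) (s / 2 + n / 2 * P.η - x)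
  rw [dt_swap] at h4
  rw [show s / 2 + n / 2 * P.η + x + (s / 2 + n / 2 * P.η - x) = s + n * P.η by ring,
    show s / 2 + n / 2 * P.η + x - (s / 2 + n / 2 * P.η - x) = 2 * x by ring] at h4
  generalize descProd (fun i => dt (ev P x) (strE P n (y + P.η) i)) n = Q at *
  generalize ev P (s / 2 + n / 2 * P.η - x) = e₁ at *
  generalize ev P (s / 2 + n / 2 * P.η + x) = e₂ at *
  generalize ev P (y + s / 2 - n / 2 * P.η) = e₃ at *
  generalize th11 P (s + n * P.η) = S at *
  field_simp
  linear_combination (-Q) * h3 - Q * dt r e₃ * h4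

end

/-! ### The intertwining property of the R matrix -/

lemma sum_dt_basisE (b : Fin 2 → ℂ) : ∑ m, dt b (basisE m) • basisF m = b := by
  funext i
  fin_cases i <;> simp [dt, basisE, basisF]

lemma sum_dt_basisF (c : Fin 2 → ℂ) : ∑ m, dt (basisF m) c • basisE m = c := by
  funext i
  fin_cases i <;> simp [dt, basisE, basisF]

lemma fusedOp_strE (n d : ℕ) (u y : ℂ) (e : Fin 2 → ℂ) :
    fusedOp P n d u e (fun i => strE P n y i) = (∏ i : Fin n, th11 P (2 * P.η) /
      th11 P (u + (2 * ((i : ℕ) : ℂ) + 1 - n) * P.η + (d + 1) * P.η)) •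
      descProd (fun i => br (Ls P d (u + (2 * (i : ℂ) + 1 - n) * P.η + P.η)) e (strE P n y i)) n := by
  rw [fusedOp_apply, stack_ofFn, ← descProd_eq]
  simp only [zero_add]

section
variable (hτ : 0 < P.τ.im) (hη : th11 P (2 * P.η) ≠ 0)
include hτ hη

/-- The vectors of strings with a generic centre determine linear maps on all strings. -/
lemma strVec_eq_zero_of_generic {X : Type*} [AddCommGroup X] [Module ℂ X] {n : ℕ}
    (Λ : V P n →ₗ[ℂ] X) (h : ∀ y, th11 P (2 * y) ≠ 0 → Λ (strVec P n y) = 0) (y : ℂ) :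
    Λ (strVec P n y) = 0 := by
  obtain ⟨x, c, G, hI⟩ := exists_interpolation hτ hη n
  rw [← Module.forall_dual_apply_eq_zero_iff ℂ]
  intro ξ
  have hc : Continuous fun y => ξ (Λ (strVec P n y)) := by
    have : (fun y => ξ (Λ (strVec P n y))) = fun y => ∑ i, (c i * (strVec P n y : ℂ → ℂ) (x i)) *
        ξ (Λ (prodV P fun j => halfVec P (G i j))) := by
      funext y
      conv_lhs => rw [hI (strVec P n y)]
      simp only [map_sum, map_smul, smul_eq_mul]
    rw [this]
    refine continuous_finsetSum _ fun i _ => (continuous_const.mul ?_).mul continuous_const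
    change Continuous fun y => ∏ l : Fin n, dt (ev P (x i + 1 / 2)) (strE P n y l)
    exact continuous_finsetProd _ fun l _ => continuous_dt continuous_const
      (continuous_ev.comp (by fun_prop))
  have := hc.ext_on (dense_th11_two_mul_ne_zero hη) (continuous_const (y := (0 : ℂ)))
    fun y hy => by dsimp only; rw [h y hy, map_zero]
  exact congrFun this y

lemma fusedOp_exchange {n d : ℕ} {u s s' : ℂ} (hu : s' - s = u)
    (hs : ∀ i < n, th11 P (s + (n - 2 * (i : ℂ)) * P.η) ≠ 0) (x y : ℂ) :
    br (Ls P d s') (ev P (x + s / 2 - n / 2 * P.η)) (ev P (y + s / 2 + n / 2 * P.η)) *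
        fusedOp P n d u (ev P (x + P.η)) (fun i => strE P n y i) =
      fusedOp P n d u (ev P x) (fun i => strE P n (y + P.η) i) *
        br (Ls P d s') (ev P (x + s / 2 + n / 2 * P.η)) (ev P (y + s / 2 - n / 2 * P.η)) := by
  have h := (rtt_Ls hτ hη d).mul_descProd_string hτ hη (s := s) (s' := s')
    (w := fun i => u + (2 * (i : ℂ) + 1 - n) * P.η + P.η)
    (fun i => by rw [hu]; ring) hs x y
  rw [fusedOp_strE, fusedOp_strE, mul_smul_comm, smul_mul_assoc, h]

lemma fusedOp_slot_identity {n d : ℕ} {u s s' : ℂ} (hu : s' - s = u)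
    (hs : ∀ i < n, th11 P (s + (n - 2 * (i : ℂ)) * P.η) ≠ 0) (y : ℂ) (r : Fin 2 → ℂ)
    {S : Type*} [Fintype S] {p : S → V P n} {E : S → Module.End ℂ (V P d)}
    (hp : ∀ X, fusedOp P n d u (ev P (X + 1 / 2)) (fun i => strE P n y i) =
      ∑ a, (p a : ℂ → ℂ) X • E a) (ω : V P d) (X : ℂ) :
    ∑ m, ∑ a, (br (Ls P n s) r (basisE m) (p a) : ℂ → ℂ) X •
        br (Ls P d s') (basisF m) (ev P (y + s / 2 + n / 2 * P.η)) (E a ω) =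
      (th11 P (s + n * P.η) / th11 P (2 * P.η)) •
        fusedOp P n d u (ev P (X + 1 / 2)) (fun i => strE P n (y + P.η) i)
          (br (Ls P d s') r (ev P (y + s / 2 - n / 2 * P.η)) ω) := by
  set c₀ := ev P (y + s / 2 + n / 2 * P.η) with hc₀
  set c₁ := ev P (y + s / 2 - n / 2 * P.η) with hc₁
  have hb : ∀ (b : Fin 2 → ℂ) (q : V P d),
      ∑ m, dt b (basisE m) • br (Ls P d s') (basisF m) c₀ q = br (Ls P d s') b c₀ q := by
    intro b q
    conv_rhs => rw [← sum_dt_basisE b]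
    simp only [map_sum, map_smul, LinearMap.sum_apply, LinearMap.smul_apply]
  have hF : ∀ x, ∑ a, (p a : ℂ → ℂ) (x - 1 / 2) • E a ω =
      fusedOp P n d u (ev P x) (fun i => strE P n y i) ω := fun x => by
    have := hp (x - 1 / 2)
    rw [sub_add_cancel] at this
    rw [this, LinearMap.sum_apply]; rfl
  have key : ∀ x, th11 P (2 * x) • ∑ m, ∑ a, (br (Ls P n s) r (basisE m) (p a) : ℂ → ℂ) (x - 1 / 2) •
        br (Ls P d s') (basisF m) c₀ (E a ω) =
      th11 P (2 * x) • (th11 P (s + n * P.η) / th11 P (2 * P.η)) •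
        fusedOp P n d u (ev P x) (fun i => strE P n (y + P.η) i) (br (Ls P d s') r c₁ ω) := by
    intro x
    have h1 : th11 P (2 * x) • ∑ m, ∑ a, (br (Ls P n s) r (basisE m) (p a) : ℂ → ℂ) (x - 1 / 2) •
        br (Ls P d s') (basisF m) c₀ (E a ω) = -(2 * th11 P (2 * P.η))⁻¹ •
        (dt r (ev P (s / 2 + n / 2 * P.η - x)) • br (Ls P d s') (ev P (s / 2 - n / 2 * P.η + x)) c₀
          (fusedOp P n d u (ev P (x + P.η)) (fun i => strE P n y i) ω) -
        dt r (ev P (s / 2 + n / 2 * P.η + x)) • br (Ls P d s') (ev P (s / 2 - n / 2 * P.η - x)) c₀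
          (fusedOp P n d u (ev P (x - P.η)) (fun i => strE P n y i) ω)) := by
      rw [← hF, ← hF, ← hb, ← hb]
      simp only [Finset.smul_sum, map_sum, map_smul, smul_smul, ← Finset.sum_sub_distrib, ← sub_smul,
        br_Ls hτ hη]
      refine Finset.sum_congr rfl fun m _ => Finset.sum_congr rfl fun a _ => ?_
      congr 1
      ring
    have e1 := congrArg (fun Z => Z ω) (fusedOp_exchange hτ hη (d := d) hu hs x y)
    have e2 := congrArg (fun Z => Z ω) (fusedOp_exchange hτ hη (d := d) hu hs (-x) y)
    simp only [Module.End.mul_apply] at e1 e2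
    rw [show -x + P.η = -(x - P.η) by ring, ev_neg, ev_neg, ← hc₀, ← hc₁,
      show -x + s / 2 - n / 2 * P.η = s / 2 - n / 2 * P.η - x by ring,
      show -x + s / 2 + n / 2 * P.η = s / 2 + n / 2 * P.η - x by ring] at e2
    rw [← hc₀, ← hc₁, show x + s / 2 - n / 2 * P.η = s / 2 - n / 2 * P.η + x by ring,
      show x + s / 2 + n / 2 * P.η = s / 2 + n / 2 * P.η + x by ring] at e1
    rw [h1, e1, e2]
    have h3 := dt_ev hτ (P := P) (s / 2 + n / 2 * P.η + x) (s / 2 + n / 2 * P.η - x)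
    rw [show s / 2 + n / 2 * P.η + x + (s / 2 + n / 2 * P.η - x) = s + n * P.η by ring,
      show s / 2 + n / 2 * P.η + x - (s / 2 + n / 2 * P.η - x) = 2 * x by ring] at h3
    have h4 := dt_smul_eq (ev P (s / 2 + n / 2 * P.η + x)) (ev P (s / 2 + n / 2 * P.η - x)) r
    rw [dt_swap (ev P (s / 2 + n / 2 * P.η + x)) r] at h4
    have h5 := congrArg (fun b => fusedOp P n d u (ev P x) (fun i => strE P n (y + P.η) i)
      (br (Ls P d s') b c₁ ω)) h4
    simp only [map_add, map_smul, LinearMap.add_apply, LinearMap.smul_apply] at h5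
    have aux : ∀ (a b : ℂ) (f g : V P d), a • f - b • g = a • f + (-b) • g := fun a b f g => by
      ext; simp [sub_eq_add_neg]
    rw [aux, ← h5, h3, smul_smul, smul_smul]
    congr 1
    field_simp
  obtain ⟨p', E', hp'⟩ : ∃ (p' : (Fin n → Fin 4) → V P n) (E' : (Fin n → Fin 4) →
      Module.End ℂ (V P d)), ∀ X, fusedOp P n d u (ev P (X + 1 / 2))
      (fun i => strE P n (y + P.η) i) = ∑ a, (p' a : ℂ → ℂ) X • E' a :=
    ⟨fun a => (∏ i, RCoef P d (a i) (u + (2 * ((i : ℕ) : ℂ) + 1 - n) * P.η)) •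
      prodV P (fun i => rho P 1 (a i) (gv P (strE P n (y + P.η) i))), _, fun X => by
      rw [fusedOp_eq_sum hτ hη]; rfl⟩
  ext Y
  have hfun := eq_of_mul_eq_mul (dense_th11_two_mul_ne_zero hη)
    (h₁ := fun x => ((∑ m, ∑ a, (br (Ls P n s) r (basisE m) (p a) : ℂ → ℂ) (x - 1 / 2) •
      br (Ls P d s') (basisF m) c₀ (E a ω) : V P d) : ℂ → ℂ) Y)
    (h₂ := fun x => (((th11 P (s + n * P.η) / th11 P (2 * P.η)) •
        fusedOp P n d u (ev P x) (fun i => strE P n (y + P.η) i) (br (Ls P d s') r c₁ ω) : V P d) :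
          ℂ → ℂ) Y) ?_ ?_ fun x => congrArg (fun f : V P d => (f : ℂ → ℂ) Y) (key x)
  · have := congrFun hfun (X + 1 / 2)
    simpa only [add_sub_cancel_right] using this
  · simp only [Submodule.coe_sum, Submodule.coe_smul, Finset.sum_apply, Pi.smul_apply, smul_eq_mul]
    exact continuous_finsetSum _ fun m _ => continuous_finsetSum _ fun a _ =>
      ((V_continuous _).comp (by fun_prop)).mul continuous_const
  · have : ∀ x, fusedOp P n d u (ev P x) (fun i => strE P n (y + P.η) i) =
        ∑ a, (p' a : ℂ → ℂ) (x - 1 / 2) • E' a := fun x => by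
      have := hp' (x - 1 / 2)
      rwa [sub_add_cancel] at this
    simp only [this, LinearMap.sum_apply, LinearMap.smul_apply, Submodule.coe_sum,
      Submodule.coe_smul, Finset.sum_apply, Pi.smul_apply, smul_eq_mul]
    exact continuous_const.mul (continuous_finsetSum _ fun a _ =>
      ((V_continuous _).comp (by fun_prop)).mul continuous_const)

end

section
variable {N : ℕ} {d : Fin N → ℕ} {j k : Fin N}

lemma slotMap_update {m : ℕ} {x c : Fin m → ℂ} {B : Fin m → V P (d j)} (hjk : j ≠ k)
    (v : ∀ n, V P (d n)) (w : V P (d k)) (h : ℂ → V P (d k)) :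
    slotMap P d j k x c B (Function.update v k w) h = slotMap P d j k x c B v h := by
  simp only [slotMap_apply, Function.update_comm hjk.symm, Function.update_idem]

lemma br_Lop (n : Fin N) (u : ℂ) (r c : Fin 2 → ℂ) :
    br (Lop P d n u) r c = siteHom P d n (br (Ls P (d n) u) r c) := by
  rw [Lop_eq]
  simp only [br_apply, map_sub, map_add, map_smul, Matrix.map_apply]

variable (hτ : 0 < P.τ.im) (hη : th11 P (2 * P.η) ≠ 0) (hjk : j ≠ k)
include hτ hη hjk

lemma br_Lop_mul_strVec (s s' y : ℂ) (r : Fin 2 → ℂ) (v : ∀ n, V P (d n)) :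
    br (Lop P d k s' * Lop P d j s) r (ev P (y + s / 2 + d j / 2 * P.η))
        (pureTensor (Function.update v j (strVec P (d j) y))) =
      (th11 P (s + d j * P.η) / th11 P (2 * P.η)) • pureTensor (Function.update
        (Function.update v k (br (Ls P (d k) s') r (ev P (y + s / 2 - d j / 2 * P.η)) (v k)))
          j (strVec P (d j) (y + P.η))) := by
  have h : br (Ls P (d k) s') r (ev P (y + s / 2 - d j / 2 * P.η)) (v k) =
      ∑ m, dt (basisF m) (ev P (y + s / 2 - d j / 2 * P.η)) •
        br (Ls P (d k) s') r (basisE m) (v k) := by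
    conv_lhs => rw [← sum_dt_basisF (ev P (y + s / 2 - d j / 2 * P.η))]
    simp only [map_sum, map_smul, LinearMap.sum_apply, LinearMap.smul_apply]
  rw [br_mul, LinearMap.sum_apply, h, Function.update_comm hjk.symm,
    (pureTensor).map_update_sum, Finset.smul_sum]
  refine Finset.sum_congr rfl fun m _ => ?_
  rw [Module.End.mul_apply, br_Lop, br_Lop, siteHom_tprod, Function.update_self,
    Function.update_idem, br_Ls_strVec hτ hη, (pureTensor).map_update_smul, map_smul,
    siteHom_tprod, Function.update_of_ne hjk.symm, (pureTensor).map_update_smul,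
    smul_smul]

lemma Rop_br_Lop_mul_of_string {u s s' : ℂ} (hu : s' - s = u)
    (hs : ∀ i < d j, th11 P (s + (d j - 2 * (i : ℂ)) * P.η) ≠ 0) (y : ℂ) (r : Fin 2 → ℂ)
    (v : ∀ n, V P (d n)) :
    Rop P d j k u (br (Lop P d k s' * Lop P d j s) r (ev P (y + s / 2 + d j / 2 * P.η))
        (pureTensor (Function.update v j (strVec P (d j) y)))) =
      br (Lop P d j s * Lop P d k s') r (ev P (y + s / 2 + d j / 2 * P.η))
        (Rop P d j k u
          (pureTensor (Function.update v j (strVec P (d j) y)))) := by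
  obtain ⟨x, c, G, hI⟩ := exists_interpolation hτ hη (d j)
  obtain ⟨p, E, hp⟩ : ∃ (p : (Fin (d j) → Fin 4) → V P (d j)) (E : (Fin (d j) → Fin 4) →
      Module.End ℂ (V P (d k))), ∀ X, fusedOp P (d j) (d k) u (ev P (X + 1 / 2))
      (fun i => strE P (d j) y i) = ∑ a, (p a : ℂ → ℂ) X • E a :=
    ⟨fun a => (∏ i, RCoef P (d k) (a i) (u + (2 * ((i : ℕ) : ℂ) + 1 - d j) * P.η)) •
      prodV P (fun i => rho P 1 (a i) (gv P (strE P (d j) y i))), _, fun X => by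
      rw [fusedOp_eq_sum hτ hη]; rfl⟩
  have hR := fun v y => Rop_tprod hτ hη hjk hI u v (fun i => strE P (d j) y i)
  have key := fusedOp_slot_identity hτ hη hu hs y r hp (v k)
  rw [br_Lop_mul_strVec hτ hη hjk, map_smul]
  conv_lhs => rw [strVec, hR]
  conv_rhs => rw [strVec, hR]
  rw [slotMap_update hjk, Function.update_self, ← map_smul]
  have hL : (fun X => fusedOp P (d j) (d k) u (ev P (X + 1 / 2))
      (fun i => strE P (d j) y i) (v k)) = ∑ a, fun X => (p a : ℂ → ℂ) X • E a (v k) := by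
    funext X
    rw [hp, LinearMap.sum_apply, Finset.sum_apply]; rfl
  have h2 : (th11 P (s + d j * P.η) / th11 P (2 * P.η)) • (fun X => fusedOp P (d j) (d k) u
      (ev P (X + 1 / 2)) (fun i => strE P (d j) (y + P.η) i)
        (br (Ls P (d k) s') r (ev P (y + s / 2 - d j / 2 * P.η)) (v k))) =
      ∑ m, ∑ a, fun X => (br (Ls P (d j) s) r (basisE m) (p a) : ℂ → ℂ) X •
        br (Ls P (d k) s') (basisF m) (ev P (y + s / 2 + d j / 2 * P.η)) (E a (v k)) := by
    funext X
    simp only [Finset.sum_apply]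
    exact (key X).symm
  rw [h2, hL, br_mul, LinearMap.sum_apply, map_sum]
  refine Finset.sum_congr rfl fun m _ => ?_
  rw [map_sum, map_sum, map_sum]
  refine Finset.sum_congr rfl fun a _ => ?_
  rw [slotMap_smul hjk hI, slotMap_smul hjk hI, Module.End.mul_apply, br_Lop, br_Lop, siteHom_tprod,
    Function.update_self, Function.update_idem, siteHom_tprod, Function.update_of_ne hjk,
    Function.update_self, Function.update_comm hjk.symm, Function.update_idem]

/-- The R matrix intertwines the two orders of the factors of the monodromy matrix. -/
lemma Rop_br_Lop_mul {u s s' : ℂ} (hu : s' - s = u)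
    (hs : ∀ i < d j, th11 P (s + (d j - 2 * (i : ℂ)) * P.η) ≠ 0)
    (hs0 : th11 P (s + d j * P.η) ≠ 0) (y : ℂ) (r c : Fin 2 → ℂ) (v : ∀ n, V P (d n)) :
    Rop P d j k u (br (Lop P d k s' * Lop P d j s) r c
        (pureTensor (Function.update v j (strVec P (d j) y)))) =
      br (Lop P d j s * Lop P d k s') r c (Rop P d j k u
        (pureTensor (Function.update v j (strVec P (d j) y)))) := by
  let Λ : V P (d j) →ₗ[ℂ] H P d := (Rop P d j k u ∘ₗ br (Lop P d k s' * Lop P d j s) r c -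
    br (Lop P d j s * Lop P d k s') r c ∘ₗ Rop P d j k u) ∘ₗ
      (pureTensor).toLinearMap v j
  have h := strVec_eq_zero_of_generic hτ hη Λ (fun y hy => ?_) y
  · exact sub_eq_zero.1 h
  refine sub_eq_zero.2 ?_
  change Rop P d j k u (br (Lop P d k s' * Lop P d j s) r c
        (pureTensor (Function.update v j (strVec P (d j) y)))) =
      br (Lop P d j s * Lop P d k s') r c (Rop P d j k u
        (pureTensor (Function.update v j (strVec P (d j) y))))
  have h1 := Rop_br_Lop_mul_of_string hτ hη hjk hu hs y r v
  have h2 := Rop_br_Lop_mul_of_string hτ hη hjk hu hs (-y) r v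
  rw [strVec_neg] at h2
  generalize pureTensor (Function.update v j (strVec P (d j) y)) = w at *
  have hd := dt_ev hτ (P := P) (y + s / 2 + d j / 2 * P.η) (-y + s / 2 + d j / 2 * P.η)
  rw [show y + s / 2 + d j / 2 * P.η + (-y + s / 2 + d j / 2 * P.η) = s + d j * P.η by ring,
    show y + s / 2 + d j / 2 * P.η - (-y + s / 2 + d j / 2 * P.η) = 2 * y by ring] at hd
  have hd0 : dt (ev P (y + s / 2 + d j / 2 * P.η)) (ev P (-y + s / 2 + d j / 2 * P.η)) ≠ 0 := by
    rw [hd]; exact mul_ne_zero (mul_ne_zero (by norm_num) hs0) hy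
  have h4 := dt_smul_eq (ev P (y + s / 2 + d j / 2 * P.η)) (ev P (-y + s / 2 + d j / 2 * P.η)) c
  refine smul_right_injective _ hd0 ?_
  have e1 := congrArg (fun c => Rop P d j k u (br (Lop P d k s' * Lop P d j s) r c w)) h4
  have e2 := congrArg (fun c => br (Lop P d j s * Lop P d k s') r c (Rop P d j k u w)) h4
  simp only [map_add, map_smul, LinearMap.add_apply, LinearMap.smul_apply] at e1 e2
  rw [h1, h2] at e1
  exact e1.trans e2.symm

end

/-! ### The exchange of two sites of a chain -/

/-- The span of the vectors that are given by strings. -/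
def strSpan (P : Params) (n : ℕ) : Submodule ℂ (V P n) := Submodule.span ℂ (Set.range (strVec P n))

lemma br_Ls_mem_strSpan (hτ : 0 < P.τ.im) (hη : th11 P (2 * P.η) ≠ 0) {n : ℕ} {s : ℂ}
    (hs : th11 P (s + n * P.η) ≠ 0) (r c : Fin 2 → ℂ) {f : V P n} (hf : f ∈ strSpan P n) :
    br (Ls P n s) r c f ∈ strSpan P n := by
  have hY : ∀ y, br (Ls P n s) r (ev P (y + s / 2 + n / 2 * P.η)) (strVec P n y) ∈ strSpan P n := by
    intro y
    rw [br_Ls_strVec hτ hη]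
    exact Submodule.smul_mem _ _ (Submodule.subset_span ⟨_, rfl⟩)
  have hgen : ∀ y, br (Ls P n s) r c (strVec P n y) ∈ strSpan P n := by
    intro y
    rw [← Submodule.Quotient.mk_eq_zero]
    refine strVec_eq_zero_of_generic hτ hη ((strSpan P n).mkQ ∘ₗ br (Ls P n s) r c)
      (fun y hy => (Submodule.Quotient.mk_eq_zero _).2 ?_) y
    have hd0 : dt (ev P (y + s / 2 + n / 2 * P.η)) (ev P (-y + s / 2 + n / 2 * P.η)) ≠ 0 := by
      rw [dt_ev hτ, show y + s / 2 + n / 2 * P.η + (-y + s / 2 + n / 2 * P.η) = s + n * P.η by ring,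
        show y + s / 2 + n / 2 * P.η - (-y + s / 2 + n / 2 * P.η) = 2 * y by ring]
      exact mul_ne_zero (mul_ne_zero (by norm_num) hs) hy
    have e := congrArg (fun c => br (Ls P n s) r c (strVec P n y))
      (dt_smul_eq (ev P (y + s / 2 + n / 2 * P.η)) (ev P (-y + s / 2 + n / 2 * P.η)) c)
    simp only [map_add, map_smul, LinearMap.add_apply, LinearMap.smul_apply] at e
    have h2 := hY (-y)
    rw [strVec_neg] at h2
    rw [← Submodule.smul_mem_iff _ hd0, e]
    exact Submodule.add_mem _ (Submodule.smul_mem _ _ (hY y)) (Submodule.smul_mem _ _ h2)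
  induction hf using Submodule.span_induction with
  | mem x hx => obtain ⟨y, rfl⟩ := hx; exact hgen y
  | zero => rw [map_zero]; exact Submodule.zero_mem _
  | add x y _ _ hx hy => rw [map_add]; exact Submodule.add_mem _ hx hy
  | smul a x _ hx => rw [map_smul]; exact Submodule.smul_mem _ _ hx

section
variable {N : ℕ} {d : Fin N → ℕ} {j k : Fin N}

/-- The vectors whose factor at the site `j` is given by strings. -/
def strH (P : Params) (d : Fin N → ℕ) (j : Fin N) : Submodule ℂ (H P d) :=
  Submodule.span ℂ {w | ∃ v : ∀ n, V P (d n), v j ∈ strSpan P (d j) ∧ w = pureTensor v}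

/-- `X` preserves the subspace `U`, and `R` intertwines `X` and `Y` there. -/
def IntertwinesOn {E : Type*} [AddCommGroup E] [Module ℂ E] (U : Submodule ℂ E)
    (R X Y : Module.End ℂ E) : Prop :=
  ∀ w ∈ U, X w ∈ U ∧ R (X w) = Y (R w)

namespace IntertwinesOn
variable {E : Type*} [AddCommGroup E] [Module ℂ E] {U : Submodule ℂ E} {R X Y X' Y' : Module.End ℂ E}

lemma one : IntertwinesOn U R 1 1 := fun _ hw => ⟨hw, rfl⟩

lemma mul (h : IntertwinesOn U R X Y) (h' : IntertwinesOn U R X' Y') :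
    IntertwinesOn U R (X * X') (Y * Y') := fun w hw =>
  ⟨(h _ (h' w hw).1).1, ((h _ (h' w hw).1).2).trans (congrArg Y (h' w hw).2)⟩

lemma smul (h : IntertwinesOn U R X Y) (c : ℂ) : IntertwinesOn U R (c • X) (c • Y) := fun w hw =>
  ⟨U.smul_mem c (h w hw).1, by
    rw [LinearMap.smul_apply, map_smul, (h w hw).2, LinearMap.smul_apply]⟩

lemma sum {ι : Type*} {s : Finset ι} {X Y : ι → Module.End ℂ E}
    (h : ∀ i ∈ s, IntertwinesOn U R (X i) (Y i)) :
    IntertwinesOn U R (∑ i ∈ s, X i) (∑ i ∈ s, Y i) := fun w hw => by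
  rw [LinearMap.sum_apply, LinearMap.sum_apply, map_sum]
  exact ⟨U.sum_mem fun i hi => (h i hi w hw).1, Finset.sum_congr rfl fun i hi => (h i hi w hw).2⟩

end IntertwinesOn

lemma intertwinesOn_br_mul {U : Submodule ℂ (H P d)} {R : Module.End ℂ (H P d)}
    {X Y X' Y' : Matrix (Fin 2) (Fin 2) (Module.End ℂ (H P d))}
    (h : ∀ r c, IntertwinesOn U R (br X r c) (br Y r c))
    (h' : ∀ r c, IntertwinesOn U R (br X' r c) (br Y' r c)) (r c : Fin 2 → ℂ) :
    IntertwinesOn U R (br (X * X') r c) (br (Y * Y') r c) := by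
  rw [br_mul, br_mul]
  exact IntertwinesOn.sum fun m _ => (h _ _).mul (h' _ _)

lemma siteHom_mem_strH {n : Fin N} (T : Module.End ℂ (V P (d n)))
    (hT : n = j → ∀ f ∈ strSpan P (d n), T f ∈ strSpan P (d n))
    {w : H P d} (hw : w ∈ strH P d j) : siteHom P d n T w ∈ strH P d j := by
  induction hw using Submodule.span_induction with
  | mem x hx =>
    obtain ⟨v, hv, rfl⟩ := hx
    rw [siteHom_tprod]
    refine Submodule.subset_span ⟨_, ?_, rfl⟩
    rcases eq_or_ne n j with rfl | h
    · rw [Function.update_self]; exact hT rfl _ hv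
    · rwa [Function.update_of_ne h.symm]
  | zero => rw [map_zero]; exact Submodule.zero_mem _
  | add x y _ _ hx hy => rw [map_add]; exact Submodule.add_mem _ hx hy
  | smul a x _ hx => rw [map_smul]; exact Submodule.smul_mem _ _ hx

/-- Linear maps that agree on strings agree on `strH`. -/
lemma eq_on_strH {X Y : Module.End ℂ (H P d)}
    (h : ∀ (v : ∀ n, V P (d n)) y, X (pureTensor (Function.update v j (strVec P (d j) y))) =
      Y (pureTensor (Function.update v j (strVec P (d j) y)))) {w : H P d}
    (hw : w ∈ strH P d j) : X w = Y w := by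
  refine LinearMap.eqOn_span (f := X) (g := Y) (fun x hx => ?_) hw
  obtain ⟨v, hv, rfl⟩ := hx
  have h2 : ∀ f ∈ strSpan P (d j), (X ∘ₗ (pureTensor).toLinearMap v j) f =
      (Y ∘ₗ (pureTensor).toLinearMap v j) f := fun f hf =>
    LinearMap.eqOn_span (fun y hy => by obtain ⟨y, rfl⟩ := hy; exact h v y) hf
  have := h2 _ hv
  change X (pureTensor (Function.update v j (v j))) =
    Y (pureTensor (Function.update v j (v j))) at this
  rwa [Function.update_eq_self] at this

section
variable (hτ : 0 < P.τ.im) (hη : th11 P (2 * P.η) ≠ 0) (hjk : j ≠ k)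
include hτ hη hjk

lemma intertwinesOn_site (u : ℂ) {n : Fin N} (hj : n ≠ j) (hk : n ≠ k)
    (T : Module.End ℂ (V P (d n))) :
    IntertwinesOn (strH P d j) (Rop P d j k u) (siteHom P d n T) (siteHom P d n T) := by
  intro w hw
  refine ⟨siteHom_mem_strH T (fun h => absurd h hj) hw, ?_⟩
  refine eq_on_strH (X := Rop P d j k u ∘ₗ siteHom P d n T) (Y := siteHom P d n T ∘ₗ Rop P d j k u)
    (fun v y => ?_) hw
  obtain ⟨x, c, G, hI⟩ := exists_interpolation hτ hη (d j)
  rw [LinearMap.comp_apply, LinearMap.comp_apply, siteHom_tprod, Function.update_of_ne hj,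
    Function.update_comm hj.symm, strVec, Rop_tprod hτ hη hjk hI, Rop_tprod hτ hη hjk hI,
    siteHom_slotMap_of_ne hj hk, Function.update_of_ne hk.symm]

lemma intertwinesOn_Lop_mul {u s s' : ℂ} (hu : s' - s = u)
    (hs : ∀ i < d j, th11 P (s + (d j - 2 * (i : ℂ)) * P.η) ≠ 0)
    (hs0 : th11 P (s + d j * P.η) ≠ 0) (r c : Fin 2 → ℂ) :
    IntertwinesOn (strH P d j) (Rop P d j k u) (br (Lop P d k s' * Lop P d j s) r c)
      (br (Lop P d j s * Lop P d k s') r c) := by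
  intro w hw
  constructor
  · rw [br_mul, LinearMap.sum_apply]
    refine Submodule.sum_mem _ fun m _ => ?_
    rw [Module.End.mul_apply, br_Lop, br_Lop]
    exact siteHom_mem_strH _ (fun h => absurd h hjk.symm)
      (siteHom_mem_strH _ (fun _ f hf => br_Ls_mem_strSpan hτ hη hs0 _ _ hf) hw)
  · exact eq_on_strH (X := Rop P d j k u ∘ₗ br (Lop P d k s' * Lop P d j s) r c)
      (Y := br (Lop P d j s * Lop P d k s') r c ∘ₗ Rop P d j k u)
      (fun v y => Rop_br_Lop_mul hτ hη hjk hu hs hs0 y r c v) hw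

variable {z : Fin N → ℂ}

lemma intertwinesOn_chainT_of_notMem (u : ℂ) {l : List (Fin N)} (hj : j ∉ l) (hk : k ∉ l) (t : ℂ)
    (r c : Fin 2 → ℂ) : IntertwinesOn (strH P d j) (Rop P d j k u) (br (chainT P d z l t) r c)
      (br (chainT P d z l t) r c) := by
  induction l generalizing r c with
  | nil =>
    have : chainT P d z [] t = 1 := by simp [chainT]
    rw [this, br_one]
    exact IntertwinesOn.one.smul _
  | cons n l ih =>
    rw [List.mem_cons, not_or] at hj hk
    rw [← List.singleton_append, chainT_append, chainT_singleton]
    refine intertwinesOn_br_mul (ih hj.2 hk.2) (fun r c => ?_) r c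
    rw [br_Lop]
    exact intertwinesOn_site hτ hη hjk u (Ne.symm hj.1) (Ne.symm hk.1) _

lemma intertwinesOn_chainT {l₁ l₂ : List (Fin N)} (hn : (l₁ ++ j :: k :: l₂).Nodup) {t : ℂ}
    (hs : ∀ i ≤ d j, th11 P (t - z j + (d j - 2 * (i : ℂ)) * P.η) ≠ 0) (r c : Fin 2 → ℂ) :
    IntertwinesOn (strH P d j) (Rop P d j k (z j - z k))
      (br (chainT P d z (l₁ ++ j :: k :: l₂) t) r c)
      (br (chainT P d z (l₁ ++ k :: j :: l₂) t) r c) := by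
  have hn' : j ∉ l₁ ∧ k ∉ l₁ ∧ j ∉ l₂ ∧ k ∉ l₂ := by
    simp only [List.nodup_append, List.nodup_cons, List.mem_cons] at hn
    exact ⟨fun h => hn.2.2 j h j (Or.inl rfl) rfl, fun h => hn.2.2 k h k (Or.inr (Or.inl rfl)) rfl,
      fun h => hn.2.1.1 (Or.inr h), hn.2.1.2.1⟩
  have h2 : ∀ n m : Fin N, chainT P d z (l₁ ++ n :: m :: l₂) t = chainT P d z l₂ t *
      (Lop P d m (t - z m) * Lop P d n (t - z n)) * chainT P d z l₁ t := fun n m => by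
    simp [chainT, mul_assoc]
  rw [h2, h2]
  refine intertwinesOn_br_mul (intertwinesOn_br_mul
    (intertwinesOn_chainT_of_notMem hτ hη hjk _ hn'.2.2.1 hn'.2.2.2 _)
    (intertwinesOn_Lop_mul hτ hη hjk (by ring) (fun i hi => hs i hi.le) ?_))
    (intertwinesOn_chainT_of_notMem hτ hη hjk _ hn'.1 hn'.2.1 _) r c
  simpa using hs 0 (Nat.zero_le _)

lemma intertwinesOn_creation {ι : Type*} {t : ι → ℂ} {l₁ l₂ : List (Fin N)}
    (hn : (l₁ ++ j :: k :: l₂).Nodup)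
    (hs : ∀ s, ∀ i ≤ d j, th11 P (t s - z j + (d j - 2 * (i : ℂ)) * P.η) ≠ 0) (b a : ℤ)
    (S : Finset ι) :
    IntertwinesOn (strH P d j) (Rop P d j k (z j - z k))
      (creation (fun b a i => opB P (chainT P d z (l₁ ++ j :: k :: l₂)) b a (t i)) b a S)
      (creation (fun b a i => opB P (chainT P d z (l₁ ++ k :: j :: l₂)) b a (t i)) b a S) := by
  rw [creation, creation]
  generalize S.toList = l
  induction l generalizing b a with
  | nil => exact IntertwinesOn.one
  | cons i l ih =>
    exact ((intertwinesOn_chainT hτ hη hjk hn (hs i) _ _).smul _).mul (ih _ _)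

omit hjk in
lemma fusedOp_strVec {n m : ℕ} {u : ℂ}
    (hu : ∀ i < n, th11 P (u + (2 * (i : ℂ) + 1 - n) * P.η + (m + 1) * P.η) ≠ 0) (Y Y' : ℂ)
    (hY : Y' = Y - u / 2 - (n / 2 + m / 2) * P.η) (e : Fin 2 → ℂ) :
    fusedOp P n m u e (fun i => strE P n Y i) (strVec P m Y') =
      (∏ i : Fin n, dt e (strE P n (Y - m * P.η) i)) • strVec P m (Y' + n * P.η) := by
  have key : ∀ n' ≤ n, descProd (fun i => br (Ls P m (u + (2 * (i : ℂ) + 1 - n) * P.η + P.η)) e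
      (strE P n Y i)) n' (strVec P m Y') =
      (∏ i ∈ Finset.range n', (th11 P (u + (2 * (i : ℂ) + 1 - n) * P.η + (m + 1) * P.η) /
        th11 P (2 * P.η) * dt e (strE P n (Y - m * P.η) i))) • strVec P m (Y' + n' * P.η) := by
    intro n' hn'
    induction n' with
    | zero => simp [descProd]
    | succ i ih =>
      have h := br_Ls_strVec hτ hη m (u + (2 * (i : ℂ) + 1 - n) * P.η + P.η) (Y' + i * P.η) e
      have e1 : Y' + i * P.η + (u + (2 * (i : ℂ) + 1 - n) * P.η + P.η) / 2 + m / 2 * P.η =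
        Y + (2 * (i : ℂ) + 1 - n) * P.η := by rw [hY]; ring
      have e2 : Y' + i * P.η + (u + (2 * (i : ℂ) + 1 - n) * P.η + P.η) / 2 - m / 2 * P.η =
        Y - m * P.η + (2 * (i : ℂ) + 1 - n) * P.η := by rw [hY]; ring
      rw [e1, e2] at h
      rw [descProd, Module.End.mul_apply, ih (by omega), map_smul, strE, h, smul_smul,
        Finset.prod_range_succ]
      rw [show u + (2 * (i : ℂ) + 1 - n) * P.η + P.η + m * P.η =
        u + (2 * (i : ℂ) + 1 - n) * P.η + (m + 1) * P.η by ring,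
        show Y' + i * P.η + P.η = Y' + ((i + 1 : ℕ) : ℂ) * P.η by push_cast; ring]
      rfl
  rw [fusedOp_strE, LinearMap.smul_apply, key n le_rfl, smul_smul, Finset.prod_range,
    ← Finset.prod_mul_distrib]
  congr 1
  refine Finset.prod_congr rfl fun i _ => ?_
  have := hu i i.2
  rw [← mul_assoc, div_mul_div_cancel₀ this, div_self hη, one_mul]

lemma Rop_strVec {u : ℂ}
    (hu : ∀ i < d j, th11 P (u + (2 * (i : ℂ) + 1 - d j) * P.η + (d k + 1) * P.η) ≠ 0) (Y Y' : ℂ)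
    (hY : Y' = Y - u / 2 - (d j / 2 + d k / 2) * P.η) (v : ∀ n, V P (d n)) :
    Rop P d j k u (pureTensor (Function.update (Function.update v k
        (strVec P (d k) Y')) j (strVec P (d j) Y))) =
      pureTensor (Function.update (Function.update v k
        (strVec P (d k) (Y' + d j * P.η))) j (strVec P (d j) (Y - d k * P.η))) := by
  obtain ⟨x, c, G, hI⟩ := exists_interpolation hτ hη (d j)
  conv_lhs => rw [strVec, strVec, Rop_tprod hτ hη hjk hI, Function.update_self, ← strVec]
  simp only [fusedOp_strVec hτ hη hu Y Y' hY]
  rw [slotMap_update hjk]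
  have := slotMap_smul hjk hI v (strVec P (d j) (Y - d k * P.η)) (strVec P (d k) (Y' + d j * P.η))
  rw [Function.update_comm hjk] at this
  exact this

/-- The R matrix exchanges two neighbouring sites of the vacuum. -/
lemma Rop_vacuum {l₁ l₂ : List (Fin N)} (hn : (l₁ ++ j :: k :: l₂).Nodup)
    (hu : ∀ i < d j, th11 P (z j - z k + (2 * (i : ℂ) + 1 - d j) * P.η + (d k + 1) * P.η) ≠ 0)
    (a : ℤ) (v : ∀ n, V P (d n)) :
    Rop P d j k (z j - z k)
        (pureTensor (chainState P d z (l₁ ++ j :: k :: l₂) a 0 v)) =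
      pureTensor (chainState P d z (l₁ ++ k :: j :: l₂) a 0 v) := by
  have hn' : j ∉ l₁ ∧ k ∉ l₁ ∧ j ∉ l₂ ∧ k ∉ l₂ := by
    simp only [List.nodup_append, List.nodup_cons, List.mem_cons] at hn
    exact ⟨fun h => hn.2.2 j h j (Or.inl rfl) rfl, fun h => hn.2.2 k h k (Or.inr (Or.inl rfl)) rfl,
      fun h => hn.2.1.1 (Or.inr h), hn.2.1.2.1⟩
  set A := a + labTotal d 0 l₁ with hA
  have hlab : ∀ p q : Fin N, p ∉ l₁ → lab d 0 (l₁ ++ p :: q :: l₂) p = labTotal d 0 l₁ := by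
    intro p q hp
    rw [lab_append, if_neg hp, lab, if_pos rfl, add_zero]
  have hlab' : ∀ p q : Fin N, q ∉ l₁ → p ≠ q →
      lab d 0 (l₁ ++ p :: q :: l₂) q = labTotal d 0 l₁ + d p := by
    intro p q hq hpq
    rw [lab_append, if_neg hq, lab, if_neg hpq, lab, if_pos rfl]
    simp
  have hst : ∀ (p q n : Fin N), n ∈ l₁ ++ p :: q :: l₂ →
      chainState P d z (l₁ ++ p :: q :: l₂) a 0 v n = stepVec P (d n)
        (a + lab d 0 (l₁ ++ p :: q :: l₂) n) (a + lab d 0 (l₁ ++ p :: q :: l₂) n + d n) (z n) := by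
    intro p q n h
    rw [chainState, if_pos h]
    simp
  set v₀ := chainState P d z (l₁ ++ j :: k :: l₂) a 0 v with hv₀
  have h1 : v₀ = Function.update (Function.update v₀ k
      (stepVec P (d k) (A + d j) (A + d j + d k) (z k))) j (stepVec P (d j) A (A + d j) (z j)) := by
    funext n
    by_cases hj : n = j
    · subst hj
      rw [Function.update_self, hv₀, hst _ _ _ (by simp), hlab _ _ hn'.1]
    · by_cases hk : n = k
      · subst hk
        rw [Function.update_of_ne hj, Function.update_self, hv₀, hst _ _ _ (by simp),
          hlab' _ _ hn'.2.1 hjk, hA, ← add_assoc a]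
      · rw [Function.update_of_ne hj, Function.update_of_ne hk]
  have h2 : chainState P d z (l₁ ++ k :: j :: l₂) a 0 v = Function.update (Function.update v₀ k
      (stepVec P (d k) A (A + d k) (z k))) j
      (stepVec P (d j) (A + d k) (A + d k + d j) (z j)) := by
    funext n
    by_cases hj : n = j
    · subst hj
      rw [Function.update_self, hst _ _ _ (by simp), hlab' _ _ hn'.1 hjk.symm, hA, ← add_assoc a]
    · by_cases hk : n = k
      · subst hk
        rw [Function.update_of_ne hj, Function.update_self, hst _ _ _ (by simp),
          hlab _ _ hn'.2.1]
      · rw [Function.update_of_ne hj, Function.update_of_ne hk, hv₀, chainState, chainState]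
        have : lab d 0 (l₁ ++ k :: j :: l₂) n = lab d 0 (l₁ ++ j :: k :: l₂) n := by
          simp only [lab_append, lab, if_neg (Ne.symm hj), if_neg (Ne.symm hk)]
          split_ifs <;> ring
        rw [this]
        simp only [List.mem_append, List.mem_cons, hj, hk, false_or]
  rw [h1, h2, stepVec_vacuum_eq hτ, stepVec_vacuum_eq hτ, stepVec_vacuum_eq hτ,
    stepVec_vacuum_eq hτ]
  have hsm : ∀ (x y : ℂ) f g, pureTensor (Function.update (Function.update v₀ k
      (x • f)) j (y • g)) = (x * y) • pureTensor
        (Function.update (Function.update v₀ k f) j g) := by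
    intro x y f g
    rw [(pureTensor).map_update_smul, Function.update_comm hjk.symm,
      (pureTensor).map_update_smul, Function.update_comm hjk, smul_smul, mul_comm]
  rw [hsm, hsm, map_smul, Rop_strVec hτ hη hjk hu]
  · clear_value A
    rw [lamAt_add, lamAt_add]
    congr 7
    · push_cast; ring
    · push_cast; ring
  · rw [lamAt_add]; push_cast; ring

omit hη hjk in
lemma vacuum_mem_strH (o : List (Fin N)) (hj : j ∈ o) (a : ℤ) (v : ∀ n, V P (d n)) :
    pureTensor (chainState P d z o a 0 v) ∈ strH P d j := by
  refine Submodule.subset_span ⟨_, ?_, rfl⟩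
  rw [chainState, if_pos hj]
  simp only [Pi.zero_apply, Nat.cast_zero, mul_zero, sub_zero]
  rw [stepVec_vacuum_eq hτ]
  exact Submodule.smul_mem _ _ (Submodule.subset_span ⟨_, rfl⟩)

/-- The off-shell Bethe vector of a chain with the sites in the order `o`. -/
def chainBethe (P : Params) (d : Fin N → ℕ) (z : Fin N → ℂ) {ι : Type*} (t : ι → ℂ) (S : Finset ι)
    (o : List (Fin N)) (b a a₀ : ℤ) (v : ∀ n, V P (d n)) : H P d :=
  creation (fun b a i => opB P (chainT P d z o) b a (t i)) b a S
    (pureTensor (chainState P d z o a₀ 0 v))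

omit hjk in
lemma Rop_chainBethe {ι : Type*} {t : ι → ℂ} {l₁ l₂ : List (Fin N)}
    (hn : (l₁ ++ j :: k :: l₂).Nodup)
    (hs : ∀ s, ∀ i ≤ d j, th11 P (t s - z j + (d j - 2 * (i : ℂ)) * P.η) ≠ 0)
    (hu : ∀ i < d j, th11 P (z j - z k + (2 * (i : ℂ) + 1 - d j) * P.η + (d k + 1) * P.η) ≠ 0)
    (S : Finset ι) (b a a₀ : ℤ) (v : ∀ n, V P (d n)) :
    Rop P d j k (z j - z k) (chainBethe P d z t S (l₁ ++ j :: k :: l₂) b a a₀ v) =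
      chainBethe P d z t S (l₁ ++ k :: j :: l₂) b a a₀ v := by
  have hjk : j ≠ k := by
    rintro rfl
    simp [List.nodup_append] at hn
  rw [chainBethe, ((intertwinesOn_creation hτ hη hjk hn hs b a S) _
    (vacuum_mem_strH hτ _ (by simp) _ _)).2, Rop_vacuum hτ hη hjk hn hu, chainBethe]

omit hjk in
lemma prod_Rop_chainBethe {ι : Type*} {t : ι → ℂ} {l₁ m l₂ : List (Fin N)}
    (hn : (l₁ ++ j :: (m ++ l₂)).Nodup)
    (hs : ∀ s, ∀ i ≤ d j, th11 P (t s - z j + (d j - 2 * (i : ℂ)) * P.η) ≠ 0)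
    (hu : ∀ k ∈ m, ∀ i < d j,
      th11 P (z j - z k + (2 * (i : ℂ) + 1 - d j) * P.η + (d k + 1) * P.η) ≠ 0)
    (S : Finset ι) (b a a₀ : ℤ) (v : ∀ n, V P (d n)) :
    (m.reverse.map fun k => Rop P d j k (z j - z k)).prod
        (chainBethe P d z t S (l₁ ++ j :: (m ++ l₂)) b a a₀ v) =
      chainBethe P d z t S (l₁ ++ m ++ j :: l₂) b a a₀ v := by
  induction m generalizing l₁ with
  | nil => simp
  | cons k m ih =>
    rw [List.cons_append] at hn ⊢
    rw [List.reverse_cons, List.map_append, List.prod_append, Module.End.mul_apply, List.map_singleton,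
      List.prod_singleton, Rop_chainBethe hτ hη hn hs (hu k List.mem_cons_self)]
    have e : ∀ l : List (Fin N), l₁ ++ k :: l = (l₁ ++ [k]) ++ l := fun l => by simp
    rw [e, ih ?_ fun k hk => hu k (List.mem_cons_of_mem _ hk)]
    · simp
    · refine (List.Perm.nodup_iff ?_).1 hn
      simp only [List.append_assoc, List.singleton_append]
      exact List.Perm.append_left _ (List.Perm.swap _ _ _)

end
end

section

/-! ### The weights on the lattice -/

open Filter Topology

lemma nhdsNE_le_codiscrete (x : ℂ) : 𝓝[≠] x ≤ codiscrete ℂ := by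
  intro s hs
  have := (mem_codiscrete.1 hs) x
  rwa [disjoint_principal_right, compl_compl] at this

lemma eventually_th11_ne_zero (hη : th11 P (2 * P.η) ≠ 0) {a : ℂ} (ha : a ≠ 0) (b x : ℂ) :
    ∀ᶠ s in 𝓝[≠] x, th11 P (a * s + b) ≠ 0 :=
  nhdsNE_le_codiscrete x (eventually_codiscrete_ne_zero
    (th11_differentiable.comp (by fun_prop : Differentiable ℂ fun s : ℂ => a * s + b))
    ⟨(2 * P.η - b) / a, by
      change th11 P (a * ((2 * P.η - b) / a) + b) ≠ 0
      rwa [mul_div_cancel₀ _ ha, sub_add_cancel]⟩)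

lemma eq_of_eventuallyEq_nhdsNE {X : Type*} [TopologicalSpace X] [T2Space X] {f g : ℂ → X} {x : ℂ}
    (hf : ContinuousAt f x) (hg : ContinuousAt g x) (h : ∀ᶠ s in 𝓝[≠] x, f s = g s) : f x = g x :=
  tendsto_nhds_unique_of_eventuallyEq (hf.mono_left nhdsWithin_le_nhds)
    (hg.mono_left nhdsWithin_le_nhds) h

section
variable (hτ : 0 < P.τ.im) (hη : th11 P (2 * P.η) ≠ 0)
include hη

lemma IsSolF.shift {d : ℕ} {F : ℂ → ℂ} (h : IsSolF P d F) {s : ℂ} (h0 : AnalyticAt ℂ F s)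
    (h1 : AnalyticAt ℂ F (s + P.κ)) :
    th11 P (s + P.κ + d * P.η) * F (s + P.κ) = th11 P (s - d * P.η) * F s := by
  refine eq_of_eventuallyEq_nhdsNE (x := s)
    (f := fun s => th11 P (s + P.κ + d * P.η) * F (s + P.κ))
    (g := fun s => th11 P (s - d * P.η) * F s)
    (ContinuousAt.mul (th11_continuous.comp (by fun_prop)).continuousAt
      (h1.continuousAt.comp_of_eq (by fun_prop) rfl))
    (ContinuousAt.mul (th11_continuous.comp (by fun_prop)).continuousAt h0.continuousAt) ?_
  filter_upwards [nhdsNE_le_codiscrete s h.2,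
    eventually_th11_ne_zero hη one_ne_zero (P.κ + d * P.η) s] with t ht h2
  rw [one_mul, ← add_assoc] at h2
  rw [ht, deltaL, alphaL, div_div_div_cancel_right₀ hη]
  field_simp

omit hη in
lemma divTheta_of_ne_zero {Φ : ℂ → ℂ} {s : ℂ} (h : th11 P s ≠ 0) :
    divTheta P Φ s = Φ s / th11 P s := if_neg h

include hτ

lemma continuousAt_divTheta {Φ : ℂ → ℂ} {s : ℂ} (h : AnalyticAt ℂ Φ s)
    (h0 : th11 P s = 0 → Φ s = 0) : ContinuousAt (divTheta P Φ) s := by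
  rw [continuousAt_iff_punctured_nhds]
  have he : ∀ᶠ u in 𝓝[≠] s, Φ u / th11 P u = divTheta P Φ u := by
    filter_upwards [eventually_th11_ne_zero hη one_ne_zero 0 s] with u hu
    rw [one_mul, add_zero] at hu
    rw [divTheta_of_ne_zero hu]
  refine Tendsto.congr' he ?_
  by_cases hs : th11 P s = 0
  · rw [divTheta, if_pos hs]
    have h1 := h.differentiableAt.hasDerivAt.tendsto_slope
    have h2 := (th11_differentiable (P := P) s).hasDerivAt.tendsto_slope
    refine (h1.div h2 (deriv_th11_ne_zero hτ hη hs)).congr' ?_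
    filter_upwards [self_mem_nhdsWithin] with u hu
    rw [Pi.div_apply, slope_def_field, slope_def_field, h0 hs, hs, sub_zero, sub_zero,
      div_div_div_cancel_right₀ (sub_ne_zero.2 hu)]
  · rw [divTheta_of_ne_zero hs]
    exact (h.continuousAt.div th11_continuous.continuousAt hs).mono_left nhdsWithin_le_nhds

lemma IsSolPhi.shift {Φ : ℂ → ℂ} (h : IsSolPhi P Φ) {s : ℂ} (h0 : AnalyticAt ℂ Φ s)
    (h0' : th11 P s = 0 → Φ s = 0) (h1 : AnalyticAt ℂ Φ (s + P.κ))
    (h1' : th11 P (s + P.κ) = 0 → Φ (s + P.κ) = 0) :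
    th11 P (s + P.κ - 2 * P.η) * divTheta P Φ (s + P.κ) =
      th11 P (s + 2 * P.η) * divTheta P Φ s := by
  refine eq_of_eventuallyEq_nhdsNE (x := s)
    (f := fun s => th11 P (s + P.κ - 2 * P.η) * divTheta P Φ (s + P.κ))
    (g := fun s => th11 P (s + 2 * P.η) * divTheta P Φ s)
    (ContinuousAt.mul (th11_continuous.comp (by fun_prop)).continuousAt
      ((continuousAt_divTheta hτ hη h1 h1').comp_of_eq (by fun_prop) rfl))
    (ContinuousAt.mul (th11_continuous.comp (by fun_prop)).continuousAt
      (continuousAt_divTheta hτ hη h0 h0')) ?_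
  filter_upwards [nhdsNE_le_codiscrete s h.2, eventually_th11_ne_zero hη one_ne_zero 0 s,
    eventually_th11_ne_zero hη one_ne_zero P.κ s,
    eventually_th11_ne_zero hη one_ne_zero (P.κ - 2 * P.η) s] with t ht h2 h3 h4
  rw [one_mul, add_zero] at h2
  rw [one_mul] at h3
  rw [one_mul, ← add_sub_assoc] at h4
  rw [divTheta_of_ne_zero h2, divTheta_of_ne_zero h3, ht, alphaFun, alphaFun,
    show -t - 2 * P.η = -(t + 2 * P.η) by ring, th11_neg, th11_neg]
  field_simp

end

section weight
variable {N M : ℕ} {d : Fin N → ℕ} {F : ℕ → ℂ → ℂ} {Φ : ℂ → ℂ} {z : Fin N → ℂ}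

/-- `F` and `Φ / θ₁₁` have no poles at the point `t`. -/
def RegularAt (P : Params) (d : Fin N → ℕ) (F : ℕ → ℂ → ℂ) (Φ : ℂ → ℂ) (z : Fin N → ℂ)
    (t : Fin M → ℂ) : Prop :=
  (∀ i n, AnalyticAt ℂ (F (d n)) (t i - z n)) ∧
    ∀ i j, i < j → AnalyticAt ℂ Φ (t i - t j) ∧ (th11 P (t i - t j) = 0 → Φ (t i - t j) = 0)

lemma RegularAt.continuousAt_phiFun {t : Fin M → ℂ} (h : RegularAt P d F Φ z t) :
    ContinuousAt (phiFun P d F Φ z) t := by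
  unfold phiFun
  refine ContinuousAt.mul (ContinuousAt.mul (by fun_prop) ?_) ?_
  · refine tendsto_finsetProd _ fun i _ => tendsto_finsetProd _ fun j hj => ?_
    exact ((h.2 i j (Finset.mem_Ioi.1 hj)).1.continuousAt).comp_of_eq
      (f := fun t : Fin M → ℂ => t i - t j) (by fun_prop) rfl
  · refine tendsto_finsetProd _ fun i _ => tendsto_finsetProd _ fun n _ => ?_
    exact ((h.1 i n).continuousAt).comp_of_eq (f := fun t : Fin M → ℂ => t i - z n)
      ((continuous_apply i).sub continuous_const).continuousAt rfl

lemma RegularAt.continuousAt_weightTerm (hτ : 0 < P.τ.im) (hη : th11 P (2 * P.η) ≠ 0)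
    {t : Fin M → ℂ} (h : RegularAt P d F Φ z t) (π : Fin M → Fin N) (k : Fin M → ℤ)
    (ε : Fin M → Fin N → ℤˣ) (σ : Fin M → Fin M → SignType) :
    ContinuousAt (weightTerm P d F Φ z π k ε σ) t := by
  have hθ : ∀ f : (Fin M → ℂ) → ℂ, Continuous f → ContinuousAt (fun t => th11 P (f t)) t :=
    fun f hf => (th11_continuous.comp hf).continuousAt
  unfold weightTerm
  refine ContinuousAt.mul (ContinuousAt.mul (ContinuousAt.mul (by fun_prop) ?_) ?_) ?_
  · refine tendsto_finsetProd _ fun i _ => tendsto_finsetProd _ fun j hj => ?_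
    refine Tendsto.mul (hθ _ (by fun_prop)) ?_
    have hij := h.2 i j (Finset.mem_Ioi.1 hj)
    exact (continuousAt_divTheta hτ hη hij.1 hij.2).comp_of_eq
      (f := fun t : Fin M → ℂ => t i - t j) (by fun_prop) rfl
  · refine tendsto_finsetProd _ fun i _ => tendsto_finsetProd _ fun n _ => ?_
    exact ((h.1 i n).continuousAt).comp_of_eq (f := fun t : Fin M → ℂ => t i - z n)
      ((continuous_apply i).sub continuous_const).continuousAt rfl
  · exact tendsto_finsetProd _ fun i _ => Tendsto.mul (hθ _ (by fun_prop))
      (tendsto_finsetProd _ fun n _ => hθ _ (by fun_prop))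

/-- The factor of the weights that does not depend on the integration variables. -/
def weightConst (P : Params) (d : Fin N → ℕ) (π : Fin M → Fin N) (A : Fin N → ℤ) : ℂ :=
  (∏ i : Fin M, ∏ _n ∈ Finset.univ.erase (π i), (th11 P (2 * P.η))⁻¹) *
    ∏ n, siteConst P (d n) (A n) (mult Finset.univ π n)

/-- The product of `φ` and of the coefficient of a path vector, for the chain `o`. -/
def chainWeight (P : Params) (d : Fin N → ℕ) (F : ℕ → ℂ → ℂ) (Φ : ℂ → ℂ) (z : Fin N → ℂ)
    (o : List (Fin N)) (π : Fin M → Fin N) (A : Fin N → ℤ) (t : Fin M → ℂ) : ℂ :=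
  weightConst P d π A * weightTerm P d F Φ z π (fun i => 2 * A (π i) + d (π i))
    (fun i n => if o.idxOf (π i) < o.idxOf n then 1 else -1)
    (fun i j => SignType.sign ((o.idxOf (π i) : ℤ) - o.idxOf (π j))) t

lemma phiFun_mul_chainCoef {o : List (Fin N)} (ho : o.toFinset = Finset.univ)
    (π : Fin M → Fin N) (a : ℤ) {t : Fin M → ℂ} (ht : ∀ i j, i ≠ j → th11 P (t i - t j) ≠ 0) :
    phiFun P d F Φ z t * chainCoef P d z t o Finset.univ π a =
      chainWeight P d F Φ z o π (siteLab d o a (mult Finset.univ π)) t := by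
  have hp : (∏ i, ∏ j ∈ Finset.Ioi i, Φ (t i - t j)) * pairCoef P t o Finset.univ π =
      ∏ i, ∏ j ∈ Finset.Ioi i, th11 P (t i - t j + 2 * (((SignType.sign ((o.idxOf (π i) : ℤ) -
        o.idxOf (π j)) : SignType) : ℤ) : ℂ) * P.η) * divTheta P Φ (t i - t j) := by
    have h1 : pairCoef P t o Finset.univ π = ∏ i : Fin M, ∏ j ∈ Finset.Ioi i,
        (if o.idxOf (π j) < o.idxOf (π i) then alphaFun P (t j - t i) else 1) *
        (if o.idxOf (π i) < o.idxOf (π j) then alphaFun P (t i - t j) else 1) := by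
      rw [Finset.prod_prod_Ioi_mul_eq_prod_prod_off_diag (f := fun j i : Fin M =>
        if o.idxOf (π j) < o.idxOf (π i) then alphaFun P (t j - t i) else 1), pairCoef,
        Finset.prod_comm]
      refine Finset.prod_congr rfl fun i _ => ?_
      rw [Finset.compl_eq_univ_sdiff, Finset.sdiff_singleton_eq_erase]
      refine (Finset.prod_erase _ ?_).symm
      exact if_neg (lt_irrefl _)
    rw [h1, ← Finset.prod_mul_distrib]
    refine Finset.prod_congr rfl fun i _ => ?_
    rw [← Finset.prod_mul_distrib]
    refine Finset.prod_congr rfl fun j hj => ?_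
    have hij := (Finset.mem_Ioi.1 hj).ne
    have h0 := ht i j hij
    rw [divTheta_of_ne_zero h0]
    rcases lt_trichotomy (o.idxOf (π i)) (o.idxOf (π j)) with h | h | h
    · rw [if_neg h.not_gt, if_pos h, sign_neg (by omega), alphaFun, one_mul]
      push_cast
      simp only [SignType.coe_one]
      rw [show t i - t j + 2 * -1 * P.η = t i - t j - 2 * P.η by ring]
      ring
    · rw [if_neg h.symm.not_lt, if_neg h.not_lt, h, sub_self, sign_zero]
      simp only [mul_one, SignType.coe_zero, Int.cast_zero, mul_zero, zero_mul, add_zero]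
      field_simp
    · rw [if_pos h, if_neg h.not_gt, sign_pos (by omega), alphaFun, mul_one,
        show t j - t i - 2 * P.η = -(t i - t j + 2 * P.η) by ring,
        show t j - t i = -(t i - t j) by ring, th11_neg, th11_neg, neg_div_neg_eq]
      push_cast
      simp only [SignType.coe_one]
      rw [show t i - t j + 2 * 1 * P.η = t i - t j + 2 * P.η by ring]
      ring
  have hv : vacCoef P d z t o Finset.univ π = (∏ i, ∏ _n ∈ Finset.univ.erase (π i),
      (th11 P (2 * P.η))⁻¹) * ∏ i, ∏ n ∈ Finset.univ.erase (π i), th11 P (t i - z n +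
        (((if o.idxOf (π i) < o.idxOf n then 1 else -1 : ℤˣ) : ℤ) : ℂ) * d n * P.η) := by
    rw [vacCoef, ho, ← Finset.prod_mul_distrib]
    refine Finset.prod_congr rfl fun i _ => ?_
    rw [← Finset.prod_mul_distrib]
    refine Finset.prod_congr rfl fun n _ => ?_
    split_ifs
    · rw [alphaL]; push_cast; rw [one_mul]; ring
    · rw [deltaL]; push_cast
      rw [show t i - z n + -1 * (d n : ℂ) * P.η = t i - z n - d n * P.η by ring]; ring
  rw [chainCoef, phiFun, chainWeight, weightTerm, weightConst, ← hp, ho, hv, localCoef,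
    Finset.prod_mul_distrib]
  push_cast
  ring

end weight

end

section
variable {N M : ℕ} {d : Fin N → ℕ} {F : ℕ → ℂ → ℂ} {Φ : ℂ → ℂ} {z : Fin N → ℂ}

/-- The point with the variables of the excitations at the site `j` shifted by `κ`. -/
def shiftT (P : Params) (π : Fin M → Fin N) (j : Fin N) (t : Fin M → ℂ) (i : Fin M) : ℂ :=
  if π i = j then t i + P.κ else t i

lemma sum_shiftT (π : Fin M → Fin N) (j : Fin N) (t : Fin M → ℂ) :
    ∑ i, shiftT P π j t i = ∑ i, t i + mult Finset.univ π j * P.κ := by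
  have : ∀ i, shiftT P π j t i = t i + if π i = j then P.κ else 0 := fun i => by
    rw [shiftT]; split_ifs <;> simp
  simp only [this, Finset.sum_add_distrib]
  rw [Finset.sum_ite, Finset.sum_const, Finset.sum_const_zero, add_zero, nsmul_eq_mul, mult]

lemma idxOf_last {j : Fin N} {l : List (Fin N)} (hj : j ∉ l) : (l ++ [j]).idxOf j = l.length := by
  rw [List.idxOf_append_of_notMem hj]; simp

lemma idxOf_last_of_ne {j n : Fin N} {l : List (Fin N)} (hn : n ≠ j → n ∈ l) (h : n ≠ j) :
    (l ++ [j]).idxOf n = l.idxOf n ∧ l.idxOf n < l.length :=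
  ⟨List.idxOf_append_of_mem (hn h), List.idxOf_lt_length_of_mem (hn h)⟩

/-- The weights of the chain with the site `j` moved from the last to the first place. -/
lemma chainWeight_shift (hτ : 0 < P.τ.im) (hη : th11 P (2 * P.η) ≠ 0) (hκ : P.κ ≠ 0)
    (hF : ∀ n, IsSolF P (d n) (F (d n))) (hΦ : IsSolPhi P Φ) {j : Fin N} {l : List (Fin N)}
    (hj : j ∉ l) (hl : ∀ n, n ≠ j → n ∈ l) (π : Fin M → Fin N) (A : Fin N → ℤ) {t : Fin M → ℂ}
    (h : RegularAt P d F Φ z t) (h' : RegularAt P d F Φ (shiftZ P z j) (shiftT P π j t)) :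
    chainWeight P d F Φ (shiftZ P z j) (j :: l) π A (shiftT P π j t) =
      exp (-2 * P.c * mult Finset.univ π j) * chainWeight P d F Φ z (l ++ [j]) π A t := by
  have hz : ∀ n, n ≠ j → shiftZ P z j n = z n := fun n hn => Function.update_of_ne hn _ _
  have hzj : shiftZ P z j j = z j + P.κ := Function.update_self _ _ _
  have ht : ∀ i, π i ≠ j → shiftT P π j t i = t i := fun i hi => if_neg hi
  have htj : ∀ i, π i = j → shiftT P π j t i = t i + P.κ := fun i hi => if_pos hi
  have hc : ∀ n, n ≠ j → (j :: l).idxOf n = l.idxOf n + 1 := fun n hn =>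
    List.idxOf_cons_ne _ (Ne.symm hn)
  have hcj : (j :: l).idxOf j = 0 := List.idxOf_cons_self
  have hexp : exp (-2 * P.c / P.κ * ∑ i, shiftT P π j t i) =
      exp (-2 * P.c * mult Finset.univ π j) * exp (-2 * P.c / P.κ * ∑ i, t i) := by
    rw [sum_shiftT, ← Complex.exp_add]
    congr 1
    field_simp
    ring
  have hpair : ∀ i k, i < k → th11 P (shiftT P π j t i - shiftT P π j t k + 2 * (((SignType.sign
      (((j :: l).idxOf (π i) : ℤ) - (j :: l).idxOf (π k)) : SignType) : ℤ) : ℂ) * P.η) *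
        divTheta P Φ (shiftT P π j t i - shiftT P π j t k) =
      th11 P (t i - t k + 2 * (((SignType.sign (((l ++ [j]).idxOf (π i) : ℤ) -
        (l ++ [j]).idxOf (π k)) : SignType) : ℤ) : ℂ) * P.η) * divTheta P Φ (t i - t k) := by
    intro i k hik
    have r := h.2 i k hik
    have r' := h'.2 i k hik
    by_cases hi : π i = j <;> by_cases hk : π k = j
    · rw [htj i hi, htj k hk, hi, hk, sub_self, sub_self, add_sub_add_right_eq_sub]
    · rw [htj i hi, ht k hk] at r' ⊢
      rw [hi, hcj, hc _ hk, idxOf_last hj, (idxOf_last_of_ne (hl _) hk).1, sign_neg (by omega),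
        sign_pos (by have := (idxOf_last_of_ne (hl _) hk).2; omega)]
      push_cast
      simp only [SignType.coe_one]
      have e : t i + P.κ - t k = t i - t k + P.κ := by ring
      rw [e] at r' ⊢
      have := hΦ.shift hτ hη r.1 r.2 r'.1 r'.2
      rw [show t i - t k + P.κ + 2 * -1 * P.η = t i - t k + P.κ - 2 * P.η by ring, this,
        show t i - t k + 2 * 1 * P.η = t i - t k + 2 * P.η by ring]
    · rw [ht i hi, htj k hk] at r' ⊢
      rw [hk, hcj, hc _ hi, idxOf_last hj, (idxOf_last_of_ne (hl _) hi).1, sign_pos (by omega),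
        sign_neg (by have := (idxOf_last_of_ne (hl _) hi).2; omega)]
      push_cast
      simp only [SignType.coe_one]
      have e : t i - t k = t i - (t k + P.κ) + P.κ := by ring
      rw [e] at r ⊢
      have := hΦ.shift hτ hη r'.1 r'.2 r.1 r.2
      rw [show t i - (t k + P.κ) + P.κ + 2 * -1 * P.η = t i - (t k + P.κ) + P.κ - 2 * P.η by ring,
        this, show t i - (t k + P.κ) + 2 * 1 * P.η = t i - (t k + P.κ) + 2 * P.η by ring]
    · rw [ht i hi, ht k hk, hc _ hi, hc _ hk, (idxOf_last_of_ne (hl _) hi).1,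
        (idxOf_last_of_ne (hl _) hk).1]
      push_cast
      rw [add_sub_add_right_eq_sub]
  have hsite : ∀ i, ∀ n ∈ Finset.univ.erase (π i), F (d n) (shiftT P π j t i - shiftZ P z j n) *
      th11 P (shiftT P π j t i - shiftZ P z j n + (((if (j :: l).idxOf (π i) < (j :: l).idxOf n
        then 1 else -1 : ℤˣ) : ℤ) : ℂ) * d n * P.η) = F (d n) (t i - z n) *
      th11 P (t i - z n + (((if (l ++ [j]).idxOf (π i) < (l ++ [j]).idxOf n
        then 1 else -1 : ℤˣ) : ℤ) : ℂ) * d n * P.η) := by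
    intro i n hn
    have hn := Finset.ne_of_mem_erase hn
    have r := h.1 i n
    have r' := h'.1 i n
    by_cases hi : π i = j
    · have hnj : n ≠ j := fun e => hn (e.trans hi.symm)
      rw [htj i hi, hz n hnj] at r' ⊢
      rw [hi, hcj, hc _ hnj, idxOf_last hj, (idxOf_last_of_ne (hl _) hnj).1, if_pos (by omega),
        if_neg (by have := (idxOf_last_of_ne (hl _) hnj).2; omega)]
      have e : t i + P.κ - z n = t i - z n + P.κ := by ring
      rw [e] at r' ⊢
      have := (hF n).shift hη r r'
      push_cast
      rw [one_mul, mul_comm, this, show t i - z n + -1 * (d n : ℂ) * P.η = t i - z n - d n * P.η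
        by ring, mul_comm]
    · rw [ht i hi] at r' ⊢
      by_cases hnj : n = j
      · subst hnj
        rw [hzj] at r' ⊢
        rw [hcj, hc _ hi, idxOf_last hj, (idxOf_last_of_ne (hl _) hi).1, if_neg (by omega),
          if_pos (idxOf_last_of_ne (hl _) hi).2]
        have e : t i - z n = t i - (z n + P.κ) + P.κ := by ring
        rw [e] at r ⊢
        have := (hF n).shift hη r' r
        push_cast
        rw [one_mul, mul_comm (F (d n) (t i - (z n + P.κ) + P.κ)), this,
          show t i - (z n + P.κ) + -1 * (d n : ℂ) * P.η = t i - (z n + P.κ) - d n * P.η by ring,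
          mul_comm]
      · rw [hz n hnj, hc _ hi, hc _ hnj, (idxOf_last_of_ne (hl _) hi).1,
          (idxOf_last_of_ne (hl _) hnj).1]
        simp only [Nat.add_lt_add_iff_right]
  have hdiff : ∀ i, shiftT P π j t i - shiftZ P z j (π i) = t i - z (π i) := by
    intro i
    by_cases hi : π i = j
    · rw [htj i hi, hi, hzj]; ring
    · rw [ht i hi, hz _ hi]
  rw [chainWeight, chainWeight, weightTerm, weightTerm, hexp,
    Finset.prod_congr rfl fun i _ => Finset.prod_congr rfl fun k hk => hpair i k
      (Finset.mem_Ioi.1 hk)]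
  have hall : (∏ i, ∏ n, F (d n) (shiftT P π j t i - shiftZ P z j n)) * ∏ i,
      (th11 P (shiftT P π j t i - shiftZ P z j (π i) + P.lam + ((2 * A (π i) + d (π i) : ℤ) : ℂ) * P.η) *
        ∏ n ∈ Finset.univ.erase (π i), th11 P (shiftT P π j t i - shiftZ P z j n +
          (((if (j :: l).idxOf (π i) < (j :: l).idxOf n then 1 else -1 : ℤˣ) : ℤ) : ℂ) *
            d n * P.η)) = (∏ i, ∏ n, F (d n) (t i - z n)) * ∏ i,
      (th11 P (t i - z (π i) + P.lam + ((2 * A (π i) + d (π i) : ℤ) : ℂ) * P.η) *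
        ∏ n ∈ Finset.univ.erase (π i), th11 P (t i - z n +
          (((if (l ++ [j]).idxOf (π i) < (l ++ [j]).idxOf n then 1 else -1 : ℤˣ) : ℤ) : ℂ) *
            d n * P.η)) := by
    rw [← Finset.prod_mul_distrib, ← Finset.prod_mul_distrib]
    refine Finset.prod_congr rfl fun i _ => ?_
    have := Finset.prod_congr rfl (hsite i)
    rw [Finset.prod_mul_distrib, Finset.prod_mul_distrib] at this
    rw [← Finset.mul_prod_erase _ _ (Finset.mem_univ (π i)),
      ← Finset.mul_prod_erase _ _ (Finset.mem_univ (π i)), hdiff]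
    linear_combination F (d (π i)) (t i - z (π i)) * th11 P (t i - z (π i) + P.lam +
      ((2 * A (π i) + d (π i) : ℤ) : ℂ) * P.η) * this
  rw [mul_assoc (_ * _) (∏ i, ∏ n, F (d n) (shiftT P π j t i - shiftZ P z j n)), hall]
  ring

end

/-! ### Path vectors of a chain -/

section
variable {N : ℕ} {d : Fin N → ℕ} {z : Fin N → ℂ}

/-- The labels of the chain `o` with the leftmost label `a` and `m k` excitations at the site `k`. -/
def pathLab (d : Fin N → ℕ) (m : Fin N → ℕ) (o : List (Fin N)) (a : ℤ) (p : ℕ) : ℤ :=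
  a + ∑ k, if o.idxOf k < p then (d k : ℤ) - 2 * m k else 0

lemma pathLab_zero (m : Fin N → ℕ) (o : List (Fin N)) (a : ℤ) : pathLab d m o a 0 = a := by
  simp [pathLab]

lemma pathLab_succ (m : Fin N → ℕ) {o : List (Fin N)} (a : ℤ) {n : Fin N} (hn : n ∈ o) :
    pathLab d m o a (o.idxOf n + 1) = pathLab d m o a (o.idxOf n) + d n - 2 * m n := by
  have h : ∀ k, (if o.idxOf k < o.idxOf n + 1 then (d k : ℤ) - 2 * m k else 0) =
      (if o.idxOf k < o.idxOf n then (d k : ℤ) - 2 * m k else 0) +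
        if k = n then (d n : ℤ) - 2 * m n else 0 := by
    intro k
    by_cases hk : k = n
    · subst hk; simp
    · have : o.idxOf k ≠ o.idxOf n := fun e => hk ((List.idxOf_inj hn).1 e.symm).symm
      rw [if_neg hk, add_zero]
      exact if_congr (by omega) rfl rfl
  simp only [pathLab, h, Finset.sum_add_distrib, Finset.sum_ite_eq', Finset.mem_univ, if_true]
  ring

lemma pathLab_idxOf (m : Fin N → ℕ) {o : List (Fin N)} (ho : o.Nodup) (a : ℤ) {n : Fin N}
    (hn : n ∈ o) : pathLab d m o a (o.idxOf n) = a + lab d m o n := by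
  induction o generalizing a with
  | nil => simp at hn
  | cons k o ih =>
    rw [List.nodup_cons] at ho
    by_cases hk : k = n
    · subst hk; simp [pathLab, lab]
    · have hno : n ∈ o := by
        rcases List.mem_cons.1 hn with h | h
        · exact absurd h.symm hk
        · exact h
      have hi := ih ho.2 (a + (d k - 2 * m k)) hno
      rw [lab, if_neg hk, ← add_assoc, ← hi, pathLab, pathLab, List.idxOf_cons_ne _ hk, add_assoc]
      congr 1
      rw [← Finset.add_sum_erase _ _ (Finset.mem_univ k),
        ← Finset.add_sum_erase _ (fun k => if o.idxOf k < o.idxOf n then _ else _)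
          (Finset.mem_univ k), List.idxOf_cons_self, if_pos (by omega), if_neg, zero_add]
      · congr 1
        refine Finset.sum_congr rfl fun i hi => ?_
        rw [List.idxOf_cons_ne _ (Finset.ne_of_mem_erase hi).symm]
        exact if_congr Nat.succ_lt_succ_iff rfl rfl
      · rw [List.idxOf_eq_length ho.1]
        exact (List.idxOf_lt_length_of_mem hno).le.not_gt

lemma pathLab_length (m : Fin N → ℕ) {o : List (Fin N)} (ho : ∀ n, n ∈ o) (a : ℤ) {p : ℕ}
    (hp : o.length ≤ p) : pathLab d m o a p = a + ∑ k, ((d k : ℤ) - 2 * m k) := by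
  rw [pathLab]
  congr 1
  exact Finset.sum_congr rfl fun k _ => if_pos ((List.idxOf_lt_length_of_mem (ho k)).trans_le hp)

lemma pathVecAt_pathLab (m : Fin N → ℕ) {o : List (Fin N)} (ho : o.Nodup) (hall : ∀ n, n ∈ o)
    (a : ℤ) (v : ∀ n, V P (d n)) :
    pathVecAt P d (fun n => o.idxOf n) (pathLab d m o a) z =
      pureTensor (chainState P d z o a m v) := by
  rw [pathVecAt]
  congr 1
  funext n
  rw [chainState, if_pos (hall n), pathLab_succ m a (hall n), pathLab_idxOf m ho a (hall n)]

lemma pseudoVac_eq (a : ℤ) (v : ∀ n, V P (d n)) : pseudoVac P d a z =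
    pureTensor (chainState P d z (List.finRange N) a 0 v) := by
  rw [← pathVecAt_pathLab 0 (List.nodup_finRange N) List.mem_finRange, pseudoVac]
  simp only [List.idxOf_finRange]
  congr 1
  funext p
  simp [vacLabels, pathLab]

lemma eq_filter_append_cons {j : Fin N} {o : List (Fin N)} (ho : o.Pairwise (· < ·)) (hj : j ∈ o) :
    o = o.filter (· < j) ++ j :: o.filter (j < ·) := by
  induction o with
  | nil => simp at hj
  | cons k o ih =>
    rw [List.pairwise_cons] at ho
    by_cases hk : j = k
    · subst hk
      have h1 : o.filter (fun n => decide (n < j)) = [] :=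
        List.filter_eq_nil_iff.2 fun n hn => by simpa using (ho.1 n hn).le
      have h2 : o.filter (fun n => decide (j < n)) = o :=
        List.filter_eq_self.2 fun n hn => by simpa using ho.1 n hn
      simp [h1, h2]
    · have hjo := (List.mem_cons.1 hj).resolve_left hk
      have hkj := ho.1 j hjo
      rw [List.filter_cons_of_pos (by simpa using hkj), List.filter_cons_of_neg (by simpa using hkj.le),
        List.cons_append, ← ih ho.2 hjo]

/-- The sites other than `j`, in their order. -/
def otherSites (j : Fin N) : List (Fin N) :=
  (List.finRange N).filter (· < j) ++ (List.finRange N).filter (j < ·)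

lemma finRange_eq (j : Fin N) : List.finRange N =
    (List.finRange N).filter (· < j) ++ j :: (List.finRange N).filter (j < ·) :=
  eq_filter_append_cons (List.pairwise_lt_finRange N) (List.mem_finRange j)

lemma notMem_otherSites (j : Fin N) : j ∉ otherSites j := by simp [otherSites]

lemma mem_otherSites {j n : Fin N} (h : n ≠ j) : n ∈ otherSites j := by
  rcases lt_or_gt_of_ne h with h | h <;> simp [otherSites, h]

lemma perm_otherSites (j : Fin N) : (j :: otherSites j).Perm (List.finRange N) := by
  conv_rhs => rw [finRange_eq j]
  exact List.perm_middle.symm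

lemma nodup_otherSites (j : Fin N) : (j :: otherSites j).Nodup :=
  (perm_otherSites j).nodup_iff.2 (List.nodup_finRange N)

lemma length_otherSites (j : Fin N) : (otherSites j).length + 1 = N := by
  have := (perm_otherSites j).length_eq
  simpa using this

lemma posFirst_eq (j n : Fin N) : posFirst j n = (j :: otherSites j).idxOf n := by
  set L := (List.finRange N).filter (· < j) with hL
  set R := (List.finRange N).filter (j < ·) with hR
  have hidx : ∀ n : Fin N, (n : ℕ) = (L ++ j :: R).idxOf n := fun n => by
    rw [hL, hR, ← finRange_eq j, List.idxOf_finRange]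
  have hmem : ∀ n, n ∈ L ↔ n < j := fun n => by simp [hL]
  have hlen : (j : ℕ) = L.length := by
    rw [hidx j, List.idxOf_append_of_notMem (by simp [hmem])]; simp
  rw [posFirst]
  change _ = (j :: (L ++ R)).idxOf n
  split_ifs with h1 h2
  · rw [List.idxOf_cons_ne _ h1.ne', List.idxOf_append_of_mem ((hmem n).2 h1), hidx n,
      List.idxOf_append_of_mem ((hmem n).2 h1)]
  · subst h2; simp
  · rw [List.idxOf_cons_ne _ (Ne.symm h2), List.idxOf_append_of_notMem (by simpa [hmem] using h1),
      hidx n, List.idxOf_append_of_notMem (by simpa [hmem] using h1),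
      List.idxOf_cons_ne _ (Ne.symm h2)]
    rfl

lemma posLast_eq (j n : Fin N) : posLast j n = (otherSites j ++ [j]).idxOf n := by
  by_cases h : n = j
  · subst h
    rw [idxOf_last (notMem_otherSites n), posLast, if_neg (lt_irrefl _), if_pos rfl]
    have := length_otherSites n
    omega
  · have := posFirst_eq j n
    rw [List.idxOf_cons_ne _ (Ne.symm h), posFirst, if_neg h] at this
    rw [(idxOf_last_of_ne mem_otherSites h).1, posLast, if_neg h]
    split_ifs at this ⊢ <;> omega

end

/-! ### The creation operators of the chain -/

section
variable {N : ℕ} {d : Fin N → ℕ} {z : Fin N → ℂ}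

lemma Bop_eq (hτ : 0 < P.τ.im) (a a' : ℤ) (u : ℂ) (hl : th11 P (lamAt P a) ≠ 0) :
    Bop P d a a' u z = opB P (chainT P d z (List.finRange N)) a a' u := by
  have hg : ∀ lam, gauge P lam u = !![ev P ((lam - u) / 2) 0, ev P ((lam + u) / 2) 0 * (th11 P lam)⁻¹;
      ev P ((lam - u) / 2) 1, ev P ((lam + u) / 2) 1 * (th11 P lam)⁻¹] := by
    intro lam
    rw [gauge, Matrix.mul_fin_two]
    simp [ev]
  have hdet : (gauge P (lamAt P a) u).det = 2 * th11 P u := by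
    have h := dt_ev hτ (P := P) ((lamAt P a - u) / 2) ((lamAt P a + u) / 2)
    rw [show (lamAt P a - u) / 2 + (lamAt P a + u) / 2 = lamAt P a by ring,
      show (lamAt P a - u) / 2 - (lamAt P a + u) / 2 = -u by ring, th11_neg, dt] at h
    rw [hg, Matrix.det_fin_two_of]
    field_simp
    linear_combination h
  have hinv : ∀ i, (gauge P (lamAt P a) u)⁻¹ 0 i = (2 * th11 P u)⁻¹ * (th11 P (lamAt P a))⁻¹ *
      ![ev P ((lamAt P a + u) / 2) 1, -ev P ((lamAt P a + u) / 2) 0] i := by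
    intro i
    rw [Matrix.inv_def, hdet, Ring.inverse_eq_inv', hg, Matrix.adjugate_fin_two_of]
    fin_cases i <;> simp <;> ring
  have hcol : ∀ i, gauge P (lamAt P a') u i 1 = (th11 P (lamAt P a'))⁻¹ *
      ev P ((lamAt P a' + u) / 2) i := by
    intro i
    rw [hg]
    fin_cases i <;> simp <;> ring
  rw [Bop, twistedMonodromy, monodromy_eq_chainT, opB, br_apply]
  generalize chainT P d z (List.finRange N) u = T
  simp only [Matrix.mul_apply, Fin.sum_univ_two, Matrix.map_apply, hinv, hcol,
    ← Algebra.commutes, ← Algebra.smul_def, Matrix.cons_val_zero, Matrix.cons_val_one, mul_inv]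
  module

lemma creationList_ofFn {A ι : Type*} [Ring A] (B : ℤ → ℤ → ι → A) {M : ℕ} (f : Fin M → ι)
    (b a : ℤ) : creationList B b a (List.ofFn f) =
      (List.ofFn fun i : Fin M => B (b + ((i : ℕ) + 1)) (a - ((i : ℕ) + 1)) (f i)).prod := by
  induction M generalizing b a with
  | zero => simp [creationList]
  | succ M ih =>
    rw [List.ofFn_succ, creationList, ih, List.ofFn_succ, List.prod_cons]
    congr 3
    funext i
    simp only [Fin.val_succ]
    push_cast
    congr 1 <;> ring

lemma creation_univ (hτ : 0 < P.τ.im) (hη : th11 P (2 * P.η) ≠ 0) {A : Type*} [Ring A] [Algebra ℂ A]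
    {T : ℂ → Matrix (Fin 2) (Fin 2) A} (hT : RTT P T) {M : ℕ} {t : Fin M → ℂ}
    (ht : ∀ i j, i ≠ j → th11 P (t i - t j + 2 * P.η) ≠ 0) (b a : ℤ) :
    creation (fun b a i => opB P T b a (t i)) b a Finset.univ =
      (List.ofFn fun i : Fin M => opB P T (b + ((i : ℕ) + 1)) (a - ((i : ℕ) + 1)) (t i)).prod := by
  have hB : ∀ (b a : ℤ) (i j : Fin M), i ≠ j → opB P T b a (t i) * opB P T (b + 1) (a - 1) (t j) =
      opB P T b a (t j) * opB P T (b + 1) (a - 1) (t i) := fun b a i j hij =>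
    opB_mul_opB hτ hη hT b a (ht i j hij)
  have hp : (Finset.univ : Finset (Fin M)).toList.Perm (List.ofFn id) :=
    (List.perm_ext_iff_of_nodup (Finset.nodup_toList _)
      (List.nodup_ofFn.2 Function.injective_id)).2 (by simp)
  exact (creationList_perm (B := fun b a i => opB P T b a (t i)) hB hp b a).trans
    (creationList_ofFn _ _ _ _)

/-- `Ψ` in terms of the Bethe vectors of the chain. -/
lemma prod_Bop_pseudoVac (hτ : 0 < P.τ.im) (hη : th11 P (2 * P.η) ≠ 0)
    (hl : ∀ a, th11 P (lamAt P a) ≠ 0) {M : ℕ} {t : Fin M → ℂ}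
    (ht : ∀ i j, i ≠ j → th11 P (t i - t j + 2 * P.η) ≠ 0) (a : ℤ) (v : ∀ n, V P (d n)) :
    (List.ofFn fun i : Fin M => Bop P d (a + ((i : ℕ) + 1)) (a - ((i : ℕ) + 1)) (t i) z).prod
      (pseudoVac P d (a - M) z) =
      chainBethe P d z t Finset.univ (List.finRange N) a a (a - M) v := by
  have hT : RTT P (chainT P d z (List.finRange N)) := rtt_chainT hτ hη (List.nodup_finRange N)
  have hB := creation_univ hτ hη hT ht a a
  have hb : (fun i : Fin M => Bop P d (a + ((i : ℕ) + 1)) (a - ((i : ℕ) + 1)) (t i) z) = fun i : Fin M =>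
      opB P (chainT P d z (List.finRange N)) (a + ((i : ℕ) + 1)) (a - ((i : ℕ) + 1)) (t i) :=
    funext fun i => Bop_eq hτ _ _ _ (hl _)
  rw [chainBethe, pseudoVac_eq (a - M) v, hb]
  exact (LinearMap.congr_fun hB _).symm

end

section

open Filter Topology

/-! ### Operators that depend continuously on parameters -/

section
variable {X A : Type*} [TopologicalSpace X] [Ring A] [Algebra ℂ A] {x : X}

/-- `f` is a combination of fixed elements with coefficients that are continuous at `x`. -/
def ContinuousCoeffAt (f : X → A) (x : X) : Prop :=
  ∃ (ι : Type) (_ : Fintype ι) (c : ι → X → ℂ) (B : ι → A), (∀ i, ContinuousAt (c i) x) ∧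
    ∀ y, f y = ∑ i, c i y • B i

lemma continuousCoeffAt_const (B : A) : ContinuousCoeffAt (fun _ : X => B) x :=
  ⟨Unit, inferInstance, fun _ _ => 1, fun _ => B, fun _ => continuousAt_const, fun _ => by simp⟩

namespace ContinuousCoeffAt
variable {f g : X → A}

lemma smul {c : X → ℂ} (hc : ContinuousAt c x) (hf : ContinuousCoeffAt f x) :
    ContinuousCoeffAt (fun y => c y • f y) x := by
  obtain ⟨ι, _, e, B, he, h⟩ := hf
  refine ⟨ι, inferInstance, fun i y => c y * e i y, B, fun i => hc.mul (he i), fun y => ?_⟩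
  simp only [h, Finset.smul_sum, smul_smul]

lemma add (hf : ContinuousCoeffAt f x) (hg : ContinuousCoeffAt g x) :
    ContinuousCoeffAt (fun y => f y + g y) x := by
  obtain ⟨ι, _, c, B, hc, h⟩ := hf
  obtain ⟨κ, _, e, C, he, h'⟩ := hg
  refine ⟨ι ⊕ κ, inferInstance, Sum.elim c e, Sum.elim B C, ?_, fun y => ?_⟩
  · rintro (i | i)
    exacts [hc i, he i]
  · simp [h, h']

lemma mul (hf : ContinuousCoeffAt f x) (hg : ContinuousCoeffAt g x) :
    ContinuousCoeffAt (fun y => f y * g y) x := by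
  obtain ⟨ι, _, c, B, hc, h⟩ := hf
  obtain ⟨κ, _, e, C, he, h'⟩ := hg
  refine ⟨ι × κ, inferInstance, fun p y => c p.1 y * e p.2 y, fun p => B p.1 * C p.2,
    fun p => (hc p.1).mul (he p.2), fun y => ?_⟩
  simp only [h, h', Fintype.sum_prod_type, Finset.sum_mul_sum, smul_mul_smul_comm]

lemma sum {ι : Type*} {s : Finset ι} {f : ι → X → A} (hf : ∀ i ∈ s, ContinuousCoeffAt (f i) x) :
    ContinuousCoeffAt (fun y => ∑ i ∈ s, f i y) x := by
  classical
  induction s using Finset.induction_on with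
  | empty => simpa using continuousCoeffAt_const (0 : A)
  | insert i s hi ih =>
    simp only [Finset.sum_insert hi]
    exact (hf i (Finset.mem_insert_self _ _)).add
      (ih fun j hj => hf j (Finset.mem_insert_of_mem hj))

lemma prod_ofFn {M : ℕ} {f : Fin M → X → A} (hf : ∀ i, ContinuousCoeffAt (f i) x) :
    ContinuousCoeffAt (fun y => (List.ofFn fun i => f i y).prod) x := by
  induction M with
  | zero => simpa using continuousCoeffAt_const (1 : A)
  | succ M ih =>
    simp only [List.ofFn_succ, List.prod_cons]
    exact (hf 0).mul (ih fun i => hf i.succ)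

lemma continuousAt_apply {f : X → A} (hf : ContinuousCoeffAt f x) (ξ : A →ₗ[ℂ] ℂ) :
    ContinuousAt (fun y => ξ (f y)) x := by
  obtain ⟨ι, _, c, B, hc, h⟩ := hf
  simp only [h, map_sum, map_smul, smul_eq_mul]
  exact tendsto_finsetSum _ fun i _ => (hc i).mul tendsto_const_nhds

end ContinuousCoeffAt
end

section
variable {N : ℕ} {d : Fin N → ℕ} {z : Fin N → ℂ}

lemma continuousCoeffAt_chainT (o : List (Fin N)) (i j : Fin 2) (u : ℂ) :
    ContinuousCoeffAt (fun u => chainT P d z o u i j) u := by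
  induction o generalizing i j with
  | nil =>
    have : (fun u => chainT P d z [] u i j) = fun _ => (1 : Matrix (Fin 2) (Fin 2) _) i j := by
      funext u; simp [chainT]
    rw [this]
    exact continuousCoeffAt_const _
  | cons n o ih =>
    rw [← List.singleton_append, chainT_append, chainT_singleton]
    simp only [Matrix.mul_apply]
    refine ContinuousCoeffAt.sum fun k _ => (ih _ _).mul ?_
    simp only [Lop]
    refine ContinuousCoeffAt.sum fun a _ => ContinuousCoeffAt.smul ?_ (continuousCoeffAt_const _)
    have hc : Continuous (thIdx P a) := (theta_differentiable _ _ _).continuous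
    unfold WL
    exact ((hc.comp (by fun_prop)).div_const _ |>.mul continuous_const).continuousAt

lemma continuousCoeffAt_opB (o : List (Fin N)) (b a : ℤ) {u : ℂ} (hu : th11 P u ≠ 0)
    (hb : th11 P (lamAt P b) ≠ 0) (ha : th11 P (lamAt P a) ≠ 0) :
    ContinuousCoeffAt (fun u => opB P (chainT P d z o) b a u) u := by
  have he : ∀ (l : ℂ) (i : Fin 2), Continuous fun u => ev P ((l + u) / 2) i := fun l i =>
    (continuous_apply i).comp (continuous_ev.comp (by fun_prop))
  have hc : ∀ (i j : Fin 2), ContinuousAt (fun u => ev P ((lamAt P b + u) / 2) i *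
      ev P ((lamAt P a + u) / 2) j) u := fun i j => ((he _ i).mul (he _ j)).continuousAt
  unfold opB
  refine ContinuousCoeffAt.smul ?_ ?_
  · have h1 : ContinuousAt (fun u => 2 * th11 P u * th11 P (lamAt P a) * th11 P (lamAt P b)) u :=
      (((continuous_const.mul th11_continuous).mul continuous_const).mul
        continuous_const).continuousAt
    exact (h1.inv₀ (mul_ne_zero (mul_ne_zero (mul_ne_zero two_ne_zero hu) ha) hb)).neg
  · simp only [br_apply, sub_eq_add_neg]
    simp only [← neg_smul]
    exact (((continuousCoeffAt_chainT o _ _ _).smul (hc 0 0)).add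
      ((continuousCoeffAt_chainT o _ _ _).smul (hc 0 1))).add
      ((continuousCoeffAt_chainT o _ _ _).smul (hc 1 0).neg) |>.add
      ((continuousCoeffAt_chainT o _ _ _).smul (hc 1 1).neg)

end

/-! ### Weighted Bethe vectors -/

section
variable {N M : ℕ} {d : Fin N → ℕ} {F : ℕ → ℂ → ℂ} {Φ : ℂ → ℂ} {z : Fin N → ℂ}

/-- The combination of path vectors of the chain `o` that is equal to `φ` times a Bethe vector. -/
def chainVec (P : Params) (d : Fin N → ℕ) (F : ℕ → ℂ → ℂ) (Φ : ℂ → ℂ) (z : Fin N → ℂ)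
    (o : List (Fin N)) (a : ℤ) (t : Fin M → ℂ) : H P d :=
  ∑ π : Fin M → Fin N, chainWeight P d F Φ z o π (siteLab d o a (mult Finset.univ π)) t •
    pureTensor (chainState P d z o a (mult Finset.univ π) 0)

lemma RegularAt.continuousAt_chainVec (hτ : 0 < P.τ.im) (hη : th11 P (2 * P.η) ≠ 0)
    {t : Fin M → ℂ} (h : RegularAt P d F Φ z t) (o : List (Fin N)) (a : ℤ)
    (ξ : Module.Dual ℂ (H P d)) :
    ContinuousAt (fun t : Fin M → ℂ => ξ (chainVec P d F Φ z o a t)) t := by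
  simp only [chainVec, map_sum, map_smul, smul_eq_mul]
  exact tendsto_finsetSum _ fun π _ => (tendsto_const_nhds.mul
    (h.continuousAt_weightTerm hτ hη _ _ _ _)).mul tendsto_const_nhds

/-- A line through `t` in general position. -/
def genLine (t : Fin M → ℂ) (s : ℂ) (i : Fin M) : ℂ := t i + ((i : ℕ) + 1) * s

lemma genLine_zero (t : Fin M → ℂ) : genLine t 0 = t := by funext i; simp [genLine]

lemma continuousAt_genLine (t : Fin M → ℂ) : ContinuousAt (genLine t) 0 :=
  (continuous_pi fun i => by unfold genLine; fun_prop).continuousAt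

lemma eventually_genLine (hη : th11 P (2 * P.η) ≠ 0) (t : Fin M → ℂ) (c : ℂ) (i : Fin M) :
    ∀ᶠ s in 𝓝[≠] 0, th11 P (genLine t s i + c) ≠ 0 := by
  filter_upwards [eventually_th11_ne_zero hη (a := (i : ℕ) + 1) (by exact_mod_cast (i : ℕ).succ_ne_zero) (t i + c) 0]
    with s hs
  rwa [show genLine t s i + c = ((i : ℕ) + 1) * s + (t i + c) by rw [genLine]; ring]

lemma eventually_genLine_sub (hη : th11 P (2 * P.η) ≠ 0) (t : Fin M → ℂ) (c : ℂ) :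
    ∀ᶠ s in 𝓝[≠] 0, ∀ i j, i ≠ j → th11 P (genLine t s i - genLine t s j + c) ≠ 0 := by
  rw [eventually_all]; intro i
  rw [eventually_all]; intro j
  rw [eventually_imp_distrib_left]; intro hij
  have : ((i : ℕ) : ℂ) - ((j : ℕ) : ℂ) ≠ 0 := sub_ne_zero.2 fun h => hij (Fin.ext (by exact_mod_cast h))
  filter_upwards [eventually_th11_ne_zero hη this (t i - t j + c) 0] with s hs
  rwa [show genLine t s i - genLine t s j + c = (((i : ℕ) : ℂ) - ((j : ℕ) : ℂ)) * s + (t i - t j + c)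
    by rw [genLine, genLine]; ring]

variable (hτ : 0 < P.τ.im) (hη : th11 P (2 * P.η) ≠ 0) (hl : ∀ a, th11 P (lamAt P a) ≠ 0)
  (hd : ∑ n, d n = 2 * M)
include hτ hη hl hd

lemma phiFun_smul_chainBethe {t : Fin M → ℂ} (ht : ∀ i, th11 P (t i) ≠ 0)
    (htt : ∀ i j, i ≠ j → th11 P (t i - t j) ≠ 0)
    (htt2 : ∀ i j, i ≠ j → th11 P (t i - t j + 2 * P.η) ≠ 0)
    {o : List (Fin N)} (ho : o.Nodup) (hall : ∀ n, n ∈ o) (a : ℤ) :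
    phiFun P d F Φ z t • chainBethe P d z t Finset.univ o a a (a - M) 0 =
      chainVec P d F Φ z o a t := by
  have hto : o.toFinset = Finset.univ := Finset.eq_univ_iff_forall.2 fun n => List.mem_toFinset.2 (hall n)
  have hπ : Nonempty (Fin M → Fin N) := by
    rcases Nat.eq_zero_or_pos N with rfl | hN
    · obtain rfl : M = 0 := by simpa using hd
      exact ⟨Fin.elim0⟩
    · exact ⟨fun _ => ⟨0, hN⟩⟩
  have h := creation_chain (d := d) (z := z) hτ hη hl ht htt htt2 hπ.some ho Finset.univ (a - M) 0
  have hlab : labTotal d 0 o = 2 * M := by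
    rw [labTotal, ← List.sum_toFinset _ ho, hto]
    simp only [Pi.zero_apply, Nat.cast_zero, mul_zero, sub_zero]
    exact_mod_cast hd
  rw [hlab, Finset.card_univ, Fintype.card_fin, sub_add_cancel,
    show a - (M : ℤ) + 2 * M - M = a by ring] at h
  rw [chainBethe, h, Finset.smul_sum, chainVec]
  have hU : mapsInto hπ.some Finset.univ o.toFinset = Finset.univ := by
    rw [hto]; ext π; simp [mem_mapsInto]
  rw [hU]
  refine Finset.sum_congr rfl fun π _ => ?_
  rw [smul_smul, phiFun_mul_chainCoef hto π a htt]

lemma phiFun_smul_prod_Bop {t : Fin M → ℂ} (h : RegularAt P d F Φ z t)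
    (ht : ∀ i, th11 P (t i) ≠ 0) (a : ℤ) :
    phiFun P d F Φ z t • (List.ofFn fun i : Fin M =>
      Bop P d (a + ((i : ℕ) + 1)) (a - ((i : ℕ) + 1)) (t i) z).prod (pseudoVac P d (a - M) z) =
      chainVec P d F Φ z (List.finRange N) a t := by
  refine sub_eq_zero.1 ((Module.forall_dual_apply_eq_zero_iff ℂ _).1 fun ξ => ?_)
  rw [map_sub, sub_eq_zero]
  have hB : ContinuousCoeffAt (fun t : Fin M → ℂ => (List.ofFn fun i : Fin M =>
      Bop P d (a + ((i : ℕ) + 1)) (a - ((i : ℕ) + 1)) (t i) z).prod) t := by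
    refine ContinuousCoeffAt.prod_ofFn fun i => ?_
    obtain ⟨ι, _, c, B, hc, hB⟩ := continuousCoeffAt_opB (d := d) (z := z) (List.finRange N)
      (a + ((i : ℕ) + 1)) (a - ((i : ℕ) + 1)) (ht i) (hl _) (hl _)
    exact ⟨ι, inferInstance, fun k t => c k (t i), B,
      fun k => (hc k).comp_of_eq (continuous_apply i).continuousAt rfl, fun t => by
        exact (Bop_eq hτ _ _ _ (hl _)).trans (hB (t i))⟩
  have h1 : ContinuousAt (fun t : Fin M → ℂ => ξ (phiFun P d F Φ z t • (List.ofFn fun i : Fin M =>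
      Bop P d (a + ((i : ℕ) + 1)) (a - ((i : ℕ) + 1)) (t i) z).prod (pseudoVac P d (a - M) z))) t := by
    simp only [map_smul, smul_eq_mul]
    exact h.continuousAt_phiFun.mul (hB.continuousAt_apply
      (ξ ∘ₗ LinearMap.applyₗ (pseudoVac P d (a - M) z)))
  have := eq_of_eventuallyEq_nhdsNE (x := (0 : ℂ))
    (h1.comp_of_eq (continuousAt_genLine t) (genLine_zero t))
    ((h.continuousAt_chainVec hτ hη (List.finRange N) a ξ).comp_of_eq (continuousAt_genLine t)
      (genLine_zero t)) ?_
  · simpa only [Function.comp_apply, genLine_zero] using this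
  filter_upwards [eventually_all.2 (eventually_genLine hη t 0), eventually_genLine_sub hη t 0,
    eventually_genLine_sub hη t (2 * P.η)] with s h0 h1 h2
  simp only [add_zero] at h0 h1
  rw [Function.comp_apply, Function.comp_apply, prod_Bop_pseudoVac hτ hη hl h2 a 0,
    phiFun_smul_chainBethe hτ hη hl hd h0 h1 h2 (List.nodup_finRange N) List.mem_finRange]

lemma prod_Rop_chainVec {t : Fin M → ℂ} (h : RegularAt P d F Φ z t) {j : Fin N}
    {l₁ m l₂ : List (Fin N)} (hn : (l₁ ++ j :: (m ++ l₂)).Nodup)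
    (hall : ∀ n, n ∈ l₁ ++ j :: (m ++ l₂))
    (hu : ∀ k ∈ m, ∀ i < d j,
      th11 P (z j - z k + (2 * (i : ℂ) + 1 - d j) * P.η + (d k + 1) * P.η) ≠ 0) (a : ℤ) :
    (m.reverse.map fun k => Rop P d j k (z j - z k)).prod
        (chainVec P d F Φ z (l₁ ++ j :: (m ++ l₂)) a t) =
      chainVec P d F Φ z (l₁ ++ m ++ j :: l₂) a t := by
  refine sub_eq_zero.1 ((Module.forall_dual_apply_eq_zero_iff ℂ _).1 fun ξ => ?_)
  rw [map_sub, sub_eq_zero]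
  have hp : (l₁ ++ j :: (m ++ l₂)).Perm (l₁ ++ m ++ j :: l₂) := by
    rw [List.append_assoc]
    exact List.Perm.append_left _ List.perm_middle.symm
  have := eq_of_eventuallyEq_nhdsNE (x := (0 : ℂ))
    ((h.continuousAt_chainVec hτ hη (l₁ ++ j :: (m ++ l₂)) a
      (ξ ∘ₗ (m.reverse.map fun k => Rop P d j k (z j - z k)).prod)).comp_of_eq
      (continuousAt_genLine t) (genLine_zero t))
    ((h.continuousAt_chainVec hτ hη (l₁ ++ m ++ j :: l₂) a ξ).comp_of_eq (continuousAt_genLine t)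
      (genLine_zero t)) ?_
  · simpa only [Function.comp_apply, genLine_zero, LinearMap.comp_apply] using this
  filter_upwards [eventually_all.2 (eventually_genLine hη t 0), eventually_genLine_sub hη t 0,
    eventually_genLine_sub hη t (2 * P.η), eventually_all.2 fun i => (eventually_all.2
      fun q : Fin (d j + 1) => eventually_genLine hη t (-z j + (d j - 2 * ((q : ℕ) : ℂ)) * P.η) i)]
      with s h0 h1 h2 h3
  simp only [add_zero] at h0 h1
  rw [Function.comp_apply, Function.comp_apply, LinearMap.comp_apply,
    ← phiFun_smul_chainBethe hτ hη hl hd h0 h1 h2 hn hall,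
    ← phiFun_smul_chainBethe hτ hη hl hd h0 h1 h2 (hp.nodup_iff.1 hn)
      (fun n => hp.mem_iff.1 (hall n)), map_smul, prod_Rop_chainBethe hτ hη hn ?_ hu]
  intro i q hq
  have := h3 i ⟨q, Nat.lt_succ_of_le hq⟩
  rwa [← add_assoc, ← sub_eq_add_neg] at this

end

end

/-! ### Periodicity in the labels -/

lemma th11_add_two_mul_int (x : ℂ) (n : ℤ) : th11 P (x + 2 * n) = th11 P x := by
  have h : Function.Periodic (th11 P) 2 := fun x => by
    rw [← one_add_one_eq_two, ← add_assoc, th11_add_one, th11_add_one, neg_neg]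
  rw [mul_comm]
  exact h.int_mul n x

lemma halfVec_add_int (s : ℂ) (n : ℤ) : halfVec P (s + n) = halfVec P s := by
  have h : Function.Periodic (halfVec P) 1 := fun s => by
    ext y
    change th10 P (y + (s + 1)) * th10 P (y - (s + 1)) = th10 P (y + s) * th10 P (y - s)
    have h1 : th10 P (y - s) = -th10 P (y - (s + 1)) := by
      rw [show y - s = y - (s + 1) + 1 by ring]; exact theta10_add_one _ _
    have h2 : th10 P (y + (s + 1)) = -th10 P (y + s) := by
      rw [← add_assoc]; exact theta10_add_one _ _
    rw [h1, h2]; ring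
  have := h.int_mul n s
  rwa [mul_one] at this

section
variable {q n : ℤ} (hq : q * P.η = n)
include hq

lemma lamAt_add_period (a : ℤ) : lamAt P (a + q) = lamAt P a + 2 * n := by
  rw [lamAt_add, mul_assoc, hq]

lemma stepVec_add_period (d : ℕ) (a b : ℤ) (z : ℂ) :
    stepVec P d (a + q) (b + q) z = stepVec P d a b z := by
  rw [stepVec, stepVec, show (d : ℤ) + (a + q) - (b + q) = d + a - b by ring, intVec, intVec]
  congr 1
  funext i
  rw [lamAt_add_period hq, lamAt_add_period hq]
  congr 1
  · conv_rhs => rw [← halfVec_add_int _ n]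
    congr 1; ring
  · conv_rhs => rw [← halfVec_add_int _ n]
    congr 1; ring

lemma wave_add_period (a : ℤ) (ν : ZMod P.r) : wave P (a + q) ν = wave P a ν := by
  rw [wave, wave, Complex.exp_eq_exp_iff_exists_int]
  refine ⟨(ν.val : ℤ) * n, ?_⟩
  push_cast
  rw [← hq]
  ring

variable {N M : ℕ} {d : Fin N → ℕ} {F : ℕ → ℂ → ℂ} {Φ : ℂ → ℂ} {z : Fin N → ℂ}

lemma chainState_add_period (o : List (Fin N)) (a : ℤ) (m : Fin N → ℕ) (v : ∀ n, V P (d n)) :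
    chainState P d z o (a + q) m v = chainState P d z o a m v := by
  funext k
  rw [chainState, chainState, show a + q + lab d m o k = a + lab d m o k + q by ring,
    show a + lab d m o k + q + d k - 2 * m k = a + lab d m o k + d k - 2 * m k + q by ring,
    stepVec_add_period hq]

lemma chainWeight_add_period (o : List (Fin N)) (π : Fin M → Fin N) (A : Fin N → ℤ)
    (t : Fin M → ℂ) : chainWeight P d F Φ z o π (fun n => A n + q) t =
      chainWeight P d F Φ z o π A t := by
  have h1 : weightConst P d π (fun n => A n + q) = weightConst P d π A := by
    rw [weightConst, weightConst]
    congr 1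
    refine Finset.prod_congr rfl fun k _ => Finset.prod_congr rfl fun i _ => ?_
    rw [show A k + q + (i : ℤ) = A k + i + q by ring,
      show A k + q + (d k : ℤ) - i = A k + d k - i + q by ring, lamAt_add_period hq,
      lamAt_add_period hq, th11_add_two_mul_int, th11_add_two_mul_int]
  rw [chainWeight, chainWeight, h1, weightTerm, weightTerm]
  congr 2
  refine Finset.prod_congr rfl fun i _ => ?_
  congr 1
  conv_rhs => rw [← th11_add_two_mul_int _ n]
  congr 1
  push_cast
  rw [← hq]
  ring

end

/-! ### Linear maps that are defined on path vectors -/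

lemma r_mul_η (hr : 0 < P.r) : ((P.r : ℤ) : ℂ) * P.η = P.rnum := by
  rw [Params.η, Int.cast_natCast, mul_div_cancel₀]
  exact_mod_cast hr.ne'

lemma sum_zmod_val {r : ℕ} [NeZero r] {X : Type*} [AddCommMonoid X] (f : ℕ → X) :
    ∑ ν : ZMod r, f ν.val = ∑ i ∈ Finset.range r, f i := by
  obtain ⟨k, rfl⟩ := Nat.exists_eq_succ_of_ne_zero (NeZero.ne r)
  exact Fin.sum_univ_eq_sum_range f (k + 1)

lemma exists_label_period {P : Params} {a : ℤ} (h : exp (2 * Real.pi * I * (a * P.η)) = 1) :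
    ∃ n : ℤ, a * P.η = n := by
  obtain ⟨n, hn⟩ := Complex.exp_eq_one_iff.1 h
  refine ⟨n, ?_⟩
  have h0 : (2 * Real.pi * I : ℂ) ≠ 0 := Complex.two_pi_I_ne_zero
  exact mul_left_cancel₀ h0 (by rw [hn]; ring)

open Classical in
lemma sum_wave_mul_wave [NeZero P.r] (a b : ℤ) : ∑ ν, wave P (-a) ν * wave P b ν =
    if ∃ n : ℤ, ((b - a : ℤ) : ℂ) * P.η = n then (P.r : ℂ) else 0 := by
  set ζ := exp (2 * Real.pi * I * (((b - a : ℤ) : ℂ) * P.η)) with hζ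
  have h : ∀ ν : ZMod P.r, wave P (-a) ν * wave P b ν = ζ ^ ν.val := fun ν => by
    rw [wave, wave, ← Complex.exp_add, hζ, ← Complex.exp_nat_mul]
    congr 1
    push_cast
    ring
  simp only [h]
  rw [sum_zmod_val (fun i => ζ ^ i)]
  split_ifs with hn
  · obtain ⟨n, hn⟩ := hn
    have : ζ = 1 := by
      rw [hζ, hn, Complex.exp_eq_one_iff]
      exact ⟨n, by ring⟩
    simp [this]
  · have h1 : ζ ≠ 1 := fun h => hn (exists_label_period h)
    rw [geom_sum_eq h1]
    have : ζ ^ P.r = 1 := by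
      have hr : (P.r : ℂ) ≠ 0 := NeZero.ne _
      rw [hζ, ← Complex.exp_nat_mul, Complex.exp_eq_one_iff]
      refine ⟨(b - a) * P.rnum, ?_⟩
      rw [Params.η]
      push_cast
      field_simp
    rw [this, sub_self, zero_div]

section
variable {N : ℕ} {d : Fin N → ℕ} {z : Fin N → ℂ} {o : List (Fin N)}

/-- The intertwining vectors at each site are linearly independent. -/
abbrev IndepSteps (P : Params) (d : Fin N → ℕ) (z : Fin N → ℂ) : Prop :=
  ∀ (n : Fin N) (b : ℤ), LinearIndependent ℂ
    fun k : Fin (d n + 1) => stepVec P (d n) (b + 2 * (k : ℕ) - d n) b (z n)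

/-- The biorthogonal functionals of the path vectors with equal outer labels. -/
lemma exists_dual_path (hLI : IndepSteps P d z)
    (ho : o.Nodup) (hall : ∀ n, n ∈ o) (b : ℤ) (μ : ∀ n, Fin (d n + 1))
    (hμ : ∑ n, ((d n : ℤ) - 2 * (μ n : ℕ)) = 0) :
    ∃ ξ : Module.Dual ℂ (H P d), ∀ μ' : ∀ n, Fin (d n + 1), ∑ n, ((d n : ℤ) - 2 * (μ' n : ℕ)) = 0 →
      ξ (pureTensor (chainState P d z o b (fun n => μ' n) 0)) =
        if μ' = μ then 1 else 0 := by
  have hΘ : ∀ n (b : ℤ), ∃ Θ : V P (d n) →ₗ[ℂ] (Fin (d n + 1) →₀ ℂ), ∀ k : Fin (d n + 1),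
      Θ (stepVec P (d n) (b + 2 * (k : ℕ) - d n) b (z n)) = Finsupp.single k 1 := fun n b => by
    obtain ⟨Θ, h⟩ := LinearMap.exists_leftInverse_of_injective _
      (LinearMap.ker_eq_bot.2 (hLI n b))
    refine ⟨Θ, fun k => ?_⟩
    have := LinearMap.congr_fun h (Finsupp.single k 1)
    simpa using this
  choose Θ hΘ using hΘ
  let ρ : (∀ n, Fin (d n + 1)) → Fin N → ℤ := fun μ n =>
    pathLab d (fun n => μ n) o b (o.idxOf n + 1)
  have hst : ∀ (μ' : ∀ n, Fin (d n + 1)) n, chainState P d z o b (fun n => μ' n) 0 n =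
      stepVec P (d n) (ρ μ' n + 2 * (μ' n : ℕ) - d n) (ρ μ' n) (z n) := fun μ' n => by
    simp only [ρ]
    rw [chainState, if_pos (hall n), pathLab_succ _ _ (hall n), pathLab_idxOf _ ho b (hall n)]
    congr 1; ring
  refine ⟨PiTensorProduct.lift ((MultilinearMap.mkPiAlgebra ℂ (Fin N) ℂ).compLinearMap fun n =>
    Finsupp.lapply (μ n) ∘ₗ Θ n (ρ μ n)), fun μ' hμ' => ?_⟩
  rw [PiTensorProduct.lift.tprod, MultilinearMap.compLinearMap_apply,
    MultilinearMap.mkPiAlgebra_apply]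
  simp only [hst, LinearMap.comp_apply, Finsupp.lapply_apply]
  split_ifs with h
  · subst h
    simp [hΘ]
  · have hne : (Finset.univ.filter fun n => μ' n ≠ μ n).Nonempty := by
      by_contra hcon
      refine h (funext fun n => ?_)
      by_contra hn
      exact hcon ⟨n, by simpa using hn⟩
    obtain ⟨n, hn, hmax⟩ := Finset.exists_max_image _ (fun n => o.idxOf n) hne
    have hn := (Finset.mem_filter.1 hn).2
    have hρ : ρ μ n = ρ μ' n := by
      have key : ∀ ν : ∀ n, Fin (d n + 1), ∑ n, ((d n : ℤ) - 2 * (ν n : ℕ)) = 0 → ρ ν n = b -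
          ∑ k, if o.idxOf k < o.idxOf n + 1 then 0 else (d k : ℤ) - 2 * (ν k : ℕ) := by
        intro ν hν
        simp only [ρ]
        rw [pathLab, eq_sub_iff_add_eq, add_assoc, ← Finset.sum_add_distrib]
        conv_rhs => rw [← add_zero b, ← hν]
        congr 1
        refine Finset.sum_congr rfl fun k _ => ?_
        split_ifs <;> simp
      rw [key μ hμ, key μ' hμ']
      congr 1
      refine Finset.sum_congr rfl fun k _ => ?_
      split_ifs with hk
      · rfl
      · have : μ' k = μ k := by
          by_contra hcon
          have := hmax k (Finset.mem_filter.2 ⟨Finset.mem_univ _, hcon⟩)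
          omega
        rw [this]
    refine Finset.prod_eq_zero (Finset.mem_univ n) ?_
    rw [hρ, hΘ, Finsupp.single_apply, if_neg hn]

/-- A linear map on functions of `ν` with prescribed values on path vectors. -/
lemma exists_linearMap_waveVec (hr : 0 < P.r) (hLI : IndepSteps P d z)
    (ho : o.Nodup) (hall : ∀ n, n ∈ o) (U : ℤ → (Fin N → ℕ) → HFun P d)
    (hU : ∀ (q n b : ℤ) m, q * P.η = n → U (b + q) m = U b m) :
    ∃ T : Module.End ℂ (HFun P d), ∀ (b : ℤ) (m : Fin N → ℕ), (∀ n, m n ≤ d n) →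
      ∑ n, ((d n : ℤ) - 2 * m n) = 0 →
      T (waveVec P d b (pureTensor (chainState P d z o b m 0))) = U b m := by
  classical
  have : NeZero P.r := ⟨hr.ne'⟩
  choose ξ hξ using exists_dual_path hLI ho hall
  let sim : ℤ → ℤ → Prop := fun a b => ∃ n : ℤ, ((b - a : ℤ) : ℂ) * P.η = n
  have hsymm : ∀ {a b}, sim a b → sim b a := fun {a b} ⟨n, hn⟩ => ⟨-n, by
    push_cast at hn ⊢; linear_combination -hn⟩
  have htrans : ∀ {a b c}, sim a b → sim b c → sim a c := fun {a b c} ⟨n, hn⟩ ⟨n', hn'⟩ =>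
    ⟨n + n', by push_cast at hn hn' ⊢; linear_combination hn + hn'⟩
  let g : ℤ → ℂ := fun a => ((Finset.range P.r).filter fun a' : ℕ => sim a a').card
  let B : Finset (∀ n, Fin (d n + 1)) :=
    Finset.univ.filter fun μ => ∑ n, ((d n : ℤ) - 2 * (μ n : ℕ)) = 0
  let T : Module.End ℂ (HFun P d) := ∑ a ∈ Finset.range P.r, ∑ ν, ∑ μ ∈ B.attach,
    ((P.r * g a)⁻¹ * wave P (-a) ν) • (ξ a μ (Finset.mem_filter.1 μ.2).2 ∘ₗ
      LinearMap.proj ν).smulRight (U a fun n => (μ : ∀ n, Fin (d n + 1)) n)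
  refine ⟨T, fun b m hm hm0 => ?_⟩
  let μ₀ : ∀ n, Fin (d n + 1) := fun n => ⟨m n, Nat.lt_succ_of_le (hm n)⟩
  have hμ₀ : μ₀ ∈ B := Finset.mem_filter.2 ⟨Finset.mem_univ _, hm0⟩
  have hr0 : (P.r : ℂ) ≠ 0 := NeZero.ne _
  have hterm : ∀ a ∈ Finset.range P.r, ∑ ν, ∑ μ ∈ B.attach,
      (((P.r * g a)⁻¹ * wave P (-a) ν) • (ξ a μ (Finset.mem_filter.1 μ.2).2 ∘ₗ
      LinearMap.proj ν).smulRight (U a fun n => (μ : ∀ n, Fin (d n + 1)) n))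
        (waveVec P d b (pureTensor (chainState P d z o b m 0))) =
      if sim b a then (g b)⁻¹ • U b m else 0 := by
    intro a _
    rw [Finset.sum_comm]
    have h1 : ∀ μ ∈ B.attach, ∑ ν, (((P.r * g a)⁻¹ * wave P (-a) ν) •
        (ξ a μ (Finset.mem_filter.1 μ.2).2 ∘ₗ LinearMap.proj ν).smulRight
          (U a fun n => (μ : ∀ n, Fin (d n + 1)) n))
        (waveVec P d b (pureTensor (chainState P d z o b m 0))) =
        ((P.r * g a)⁻¹ * (if sim a b then (P.r : ℂ) else 0) *
          ξ a μ (Finset.mem_filter.1 μ.2).2 (pureTensor (chainState P d z o b m 0))) •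
          (U a fun n => (μ : ∀ n, Fin (d n + 1)) n) := by
      intro μ _
      rw [← sum_wave_mul_wave, Finset.mul_sum, Finset.sum_mul, Finset.sum_smul]
      refine Finset.sum_congr rfl fun ν _ => ?_
      rw [LinearMap.smul_apply, LinearMap.smulRight_apply, LinearMap.comp_apply,
        LinearMap.proj_apply, waveVec, map_smul, smul_smul, smul_eq_mul]
      congr 1
      ring
    rw [Finset.sum_congr rfl h1]
    by_cases hab : sim a b
    · obtain ⟨n, hn⟩ := hab
      have hba : b = a + (b - a) := by ring
      have hg : g a = g b := by
        simp only [g]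
        congr 2
        ext a'
        simp only [Finset.mem_filter]
        exact and_congr_right fun _ =>
          ⟨fun h => htrans (hsymm ⟨n, hn⟩) h, fun h => htrans ⟨n, hn⟩ h⟩
      rw [if_pos ⟨n, hn⟩, if_pos (hsymm ⟨n, hn⟩)]
      have h2 : ∀ μ ∈ B.attach, ((P.r * g a)⁻¹ * (P.r : ℂ) *
          ξ a μ (Finset.mem_filter.1 μ.2).2 (pureTensor (chainState P d z o b m 0))) •
          (U a fun n => (μ : ∀ n, Fin (d n + 1)) n) =
          if μ = ⟨μ₀, hμ₀⟩ then (g b)⁻¹ • U b m else 0 := by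
        intro μ _
        rw [hba, chainState_add_period hn]
        have := hξ a μ (Finset.mem_filter.1 μ.2).2 μ₀ hm0
        have e : (fun n => ((μ₀ n : Fin (d n + 1)) : ℕ)) = m := rfl
        rw [e] at this
        rw [this, ← hba, ← hg]
        by_cases hμ : μ = ⟨μ₀, hμ₀⟩
        · rw [if_pos hμ, if_pos (by rw [hμ]), hμ]
          have e2 : U b m = U a m := by rw [hba, hU _ _ _ _ hn]
          rw [e2, mul_one, mul_inv, mul_assoc, mul_comm (g a)⁻¹, ← mul_assoc, inv_mul_cancel₀ hr0,
            one_mul]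
        · rw [if_neg hμ, if_neg (fun h => hμ (Subtype.ext h.symm)), mul_zero, zero_smul]
      rw [Finset.sum_congr rfl h2, Finset.sum_ite_eq' B.attach, if_pos (Finset.mem_attach _ _)]
    · rw [if_neg hab, if_neg fun h => hab (hsymm h)]
      simp
  have hT : T (waveVec P d b (pureTensor (chainState P d z o b m 0))) =
      ∑ a ∈ Finset.range P.r, if sim b a then (g b)⁻¹ • U b m else 0 := by
    rw [← Finset.sum_congr rfl hterm]
    simp only [T, LinearMap.sum_apply]
  rw [hT, Finset.sum_ite, Finset.sum_const_zero, add_zero, Finset.sum_const, ← Nat.cast_smul_eq_nsmul ℂ,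
    smul_smul]
  have hg : g b ≠ 0 := by
    simp only [g]
    rw [Nat.cast_ne_zero, Finset.card_ne_zero]
    have hb0 : 0 ≤ b % P.r := Int.emod_nonneg _ (by exact_mod_cast hr.ne')
    refine ⟨(b % P.r).toNat, Finset.mem_filter.2 ⟨Finset.mem_range.2 ?_, ?_⟩⟩
    · have := Int.emod_lt_of_pos b (by exact_mod_cast hr : (0 : ℤ) < P.r)
      omega
    · refine ⟨-(b / P.r) * P.rnum, ?_⟩
      rw [Int.toNat_of_nonneg hb0, Int.emod_def, Params.η]
      push_cast
      field_simp
      ring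
  rw [mul_inv_cancel₀ hg, one_smul]

end

/-! ### The boundary operator on path vectors -/

section
variable {N : ℕ} {d : Fin N → ℕ} {z : Fin N → ℂ} {j : Fin N} {m : Fin N → ℕ}

lemma nodup_otherSites_append (j : Fin N) : (otherSites j ++ [j]).Nodup :=
  (List.perm_append_singleton _ _).nodup_iff.2 (nodup_otherSites j)

lemma mem_cons_otherSites (j n : Fin N) : n ∈ j :: otherSites j :=
  (perm_otherSites j).mem_iff.2 (List.mem_finRange n)

lemma mem_otherSites_append (j n : Fin N) : n ∈ otherSites j ++ [j] :=
  (List.perm_append_singleton _ _).mem_iff.2 (mem_cons_otherSites j n)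

lemma lab_rotate (hm : ∑ n, ((d n : ℤ) - 2 * m n) = 0) (n : Fin N) :
    lab d m (j :: otherSites j) n = lab d m (otherSites j ++ [j]) n + (d j - 2 * m j) := by
  by_cases hn : n = j
  · subst hn
    have h : labTotal d m (n :: otherSites n) = 0 := by
      rw [labTotal, ((perm_otherSites n).map _).sum_eq, ← hm]
      exact (List.sum_ofFn (f := fun k => (d k : ℤ) - 2 * m k)).symm ▸ by
        rw [List.ofFn_eq_map]
    rw [labTotal, List.map_cons, List.sum_cons, ← labTotal] at h
    rw [lab_append, if_neg (notMem_otherSites n), lab, lab, if_pos rfl, if_pos rfl]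
    linarith
  · rw [lab, if_neg (Ne.symm hn), lab_append, if_pos (mem_otherSites hn), add_comm]

/-- The image of a path vector under the boundary operator. -/
def boundaryVec (P : Params) (d : Fin N → ℕ) (z : Fin N → ℂ) (j : Fin N) (b : ℤ) (m : Fin N → ℕ) :
    HFun P d :=
  exp (-2 * P.c * m j) • waveVec P d (b - (d j - 2 * m j)) (pureTensor
    (chainState P d (shiftZ P z j) (j :: otherSites j) (b - (d j - 2 * m j)) m 0))

lemma boundaryVec_add_period {q n : ℤ} (hq : q * P.η = n) (b : ℤ) :
    boundaryVec P d z j (b + q) m = boundaryVec P d z j b m := by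
  rw [boundaryVec, boundaryVec, show b + q - (d j - 2 * m j) = b - (d j - 2 * m j) + q by ring,
    chainState_add_period hq]
  congr 1
  funext ν
  rw [waveVec, waveVec, wave_add_period hq]

section
variable {a : ℕ → ℤ} {b : ℤ} (ha : ∀ p ≤ N, a p = pathLab d m (otherSites j ++ [j]) b p)
include ha

lemma label_posLast (n : Fin N) : a (posLast j n) = b + lab d m (otherSites j ++ [j]) n ∧
    a (posLast j n + 1) = b + lab d m (otherSites j ++ [j]) n + d n - 2 * m n := by
  have hn := mem_otherSites_append j n
  have h := List.idxOf_lt_length_of_mem hn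
  rw [List.length_append, List.length_singleton, length_otherSites, ← posLast_eq] at h
  rw [ha _ h.le, ha _ h, posLast_eq, pathLab_succ m b hn,
    pathLab_idxOf m (nodup_otherSites_append j) b hn]
  exact ⟨rfl, rfl⟩

lemma pathVecAt_posLast : pathVecAt P d (posLast j) a z =
    pureTensor (chainState P d z (otherSites j ++ [j]) b m 0) := by
  rw [pathVecAt]
  congr 1
  funext n
  rw [chainState, if_pos (mem_otherSites_append j n), (label_posLast ha n).1,
    (label_posLast ha n).2]

lemma label_pred (hm : ∑ n, ((d n : ℤ) - 2 * m n) = 0) : a (N - 1) = b - (d j - 2 * m j) := by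
  have h1 := (label_posLast ha j).1
  have h2 := lab_rotate (j := j) hm j
  rw [lab, if_pos rfl] at h2
  rw [posLast, if_neg (lt_irrefl _), if_pos rfl] at h1
  linarith

lemma label_last (hm : ∑ n, ((d n : ℤ) - 2 * m n) = 0) : a N = b := by
  rw [ha N le_rfl, pathLab_length m (mem_otherSites_append j) b, hm, add_zero]
  rw [List.length_append, List.length_singleton, length_otherSites]

lemma pathVecAt_posFirst (hm : ∑ n, ((d n : ℤ) - 2 * m n) = 0) (w : Fin N → ℂ) :
    pathVecAt P d (posFirst j) (rotLabels N a) w = pureTensor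
      (chainState P d w (j :: otherSites j) (b - (d j - 2 * m j)) m 0) := by
  rw [pathVecAt]
  congr 1
  funext n
  rw [chainState, if_pos (mem_cons_otherSites j n)]
  by_cases hn : n = j
  · subst hn
    have h0 : a 0 = b := by rw [ha 0 (Nat.zero_le _), pathLab_zero]
    rw [posFirst, if_neg (lt_irrefl _), if_pos rfl, lab, if_pos rfl, rotLabels, if_pos rfl,
      label_pred ha hm, rotLabels, if_neg (by omega), Nat.zero_add, Nat.sub_self, h0]
    congr 1 <;> ring
  · have hp : posFirst j n = posLast j n + 1 := by
      rw [posFirst_eq, posLast_eq, (idxOf_last_of_ne mem_otherSites hn).1,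
        List.idxOf_cons_ne _ (Ne.symm hn)]
    rw [hp, rotLabels, if_neg (by omega), rotLabels, if_neg (by omega), Nat.add_sub_cancel,
      Nat.add_sub_cancel, (label_posLast ha n).1, (label_posLast ha n).2, lab_rotate hm]
    congr 1 <;> ring

end

lemma exists_pathLab {a : ℕ → ℤ} (ha : AdmissibleAt d (posLast j) a) (h0 : a N = a 0) :
    ∃ m : Fin N → ℕ, (∀ n, m n ≤ d n) ∧ ∑ n, ((d n : ℤ) - 2 * m n) = 0 ∧
      ∀ p ≤ N, a p = pathLab d m (otherSites j ++ [j]) (a 0) p := by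
  choose m hm ha using ha
  have hlen : (otherSites j ++ [j]).length = N := by
    rw [List.length_append, List.length_singleton, length_otherSites]
  have key : ∀ p ≤ N, a p = pathLab d m (otherSites j ++ [j]) (a 0) p := by
    intro p
    induction p with
    | zero => intro _; rw [pathLab_zero]
    | succ p ih =>
      intro hp
      have hi : (otherSites j ++ [j]).idxOf ((otherSites j ++ [j])[p]'(by omega)) = p :=
        (nodup_otherSites_append j).idxOf_getElem p (by omega)
      set n := (otherSites j ++ [j])[p]'(by omega)
      have h := ha n
      have h2 := pathLab_succ (d := d) m (a 0) (mem_otherSites_append j n)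
      rw [posLast_eq, hi, ih (by omega)] at h
      rw [hi] at h2
      linarith
  refine ⟨m, hm, ?_, key⟩
  have := key N le_rfl
  rw [pathLab_length m (mem_otherSites_append j) _ hlen.le, h0] at this
  linarith

lemma exists_isBoundary (hr : 0 < P.r) (hLI : IndepSteps P d z) (j : Fin N) :
    ∃ T, IsBoundary P d z j T := by
  obtain ⟨T, hT⟩ := exists_linearMap_waveVec hr hLI (nodup_otherSites_append j)
    (mem_otherSites_append j) (boundaryVec P d z j) fun q n b m h => boundaryVec_add_period h b
  refine ⟨T, fun a ha h0 => ?_⟩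
  obtain ⟨m, hm, hs, hp⟩ := exists_pathLab ha h0
  rw [pathVecAt_posLast hp, h0, hT _ m hm hs, boundaryVec, pathVecAt_posFirst hp hs,
    label_pred hp hs]
  congr 2
  push_cast
  ring

lemma Zop_waveVec (hr : 0 < P.r) (hLI : IndepSteps P d z)
    (hm : ∀ n, m n ≤ d n) (hs : ∑ n, ((d n : ℤ) - 2 * m n) = 0) (b : ℤ) :
    Zop P d z j (waveVec P d b (pureTensor
      (chainState P d z (otherSites j ++ [j]) b m 0))) = boundaryVec P d z j b m := by
  have hZ : IsBoundary P d z j (Zop P d z j) := by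
    rw [Zop, dif_pos (exists_isBoundary hr hLI j)]
    exact (exists_isBoundary hr hLI j).choose_spec
  have hp : ∀ p ≤ N, pathLab d m (otherSites j ++ [j]) b p =
      pathLab d m (otherSites j ++ [j]) b p := fun _ _ => rfl
  have h := hZ (pathLab d m (otherSites j ++ [j]) b) (fun n => ⟨m n, hm n, by
    rw [(label_posLast hp n).1, (label_posLast hp n).2]; ring⟩)
    (by rw [label_last hp hs, pathLab_zero])
  rw [pathVecAt_posLast hp, label_last hp hs, pathVecAt_posFirst hp hs, label_pred hp hs] at h
  rw [h, boundaryVec]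
  congr 2
  push_cast
  ring

end

/-! ### Jackson sums -/

section
variable {N M : ℕ} {d : Fin N → ℕ} {C : Set (Fin M → ℂ)}

lemma IsJacksonSum.unique {g : (Fin M → ℂ) → H P d} {v w : H P d} (hv : IsJacksonSum P d C g v)
    (hw : IsJacksonSum P d C g w) : v = w :=
  sub_eq_zero.1 ((Module.forall_dual_apply_eq_zero_iff ℂ _).1 fun ξ => by
    rw [map_sub, sub_eq_zero]; exact (hv ξ).unique (hw ξ))

lemma IsJacksonSum.congr {g g' : (Fin M → ℂ) → H P d} {v : H P d} (hv : IsJacksonSum P d C g v)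
    (h : ∀ t ∈ C, g' t = g t) : IsJacksonSum P d C g' v := fun ξ => by
  have : (fun t : C => ξ (g' t)) = fun t : C => ξ (g t) := funext fun t => by rw [h t t.2]
  rw [this]; exact hv ξ

lemma IsJacksonSum.map {g : (Fin M → ℂ) → H P d} {v : H P d} (hv : IsJacksonSum P d C g v)
    (T : Module.End ℂ (H P d)) : IsJacksonSum P d C (fun t => T (g t)) (T v) :=
  fun ξ => hv (ξ ∘ₗ T)

lemma IsJacksonSum.mem [NeZero P.r] {p : Submodule ℂ (HFun P d)}
    {g : (Fin M → ℂ) → HFun P d} {v : HFun P d}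
    (hv : ∀ ν, IsJacksonSum P d C (fun t => g t ν) (v ν)) (hg : ∀ t ∈ C, g t ∈ p) : v ∈ p := by
  by_contra h
  obtain ⟨f, hf, hp⟩ := Submodule.exists_le_ker_of_notMem h
  let e : ZMod P.r → H P d →ₗ[ℂ] HFun P d := LinearMap.single ℂ fun _ => H P d
  have hs : ∀ w : HFun P d, f w = ∑ ν, (f ∘ₗ e ν) (w ν) := fun w => by
    simp only [LinearMap.comp_apply]
    rw [← map_sum]
    exact congrArg f (LinearMap.sum_single_apply _ w).symm
  have h1 : HasSum (fun t : C => f (g t)) (f v) := by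
    rw [hs v, funext fun t : C => hs (g t)]
    exact hasSum_sum fun ν _ => hv ν (f ∘ₗ e ν)
  have h2 : (fun t : C => f (g t)) = fun _ => 0 := funext fun t => hp (hg t t.2)
  rw [h2] at h1
  exact hf (h1.unique hasSum_zero)

lemma fSol_eq {F : ℕ → ℂ → ℂ} {Φ : ℂ → ℂ} {z : Fin N → ℂ} {v : HFun P d}
    (h : ∀ ν, IsJacksonSum P d C (fun t => phiFun P d F Φ z t • Psi P d z t ν) (v ν)) :
    fSol P d F Φ C z = v := by
  funext ν
  have hex : ∃ v, IsJacksonSum P d C (fun t => phiFun P d F Φ z t • Psi P d z t ν) v := ⟨_, h ν⟩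
  rw [fSol, dif_pos hex]
  exact hex.choose_spec.unique (h ν)

end

section
variable {N M : ℕ} {d : Fin N → ℕ} {F : ℕ → ℂ → ℂ} {Φ : ℂ → ℂ} {z : Fin N → ℂ}
  {C : Set (Fin M → ℂ)}

/-- The summand of the Jackson sum for the chain `o`. -/
def waveSum (P : Params) (d : Fin N → ℕ) (F : ℕ → ℂ → ℂ) (Φ : ℂ → ℂ) (z : Fin N → ℂ)
    (o : List (Fin N)) (t : Fin M → ℂ) : HFun P d := fun ν =>
  ∑ a ∈ Finset.range P.r, wave P a ν • chainVec P d F Φ z o a t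

/-- The combination of path vectors of the chain `o` with the coefficients `s`. -/
def pathSum (P : Params) (d : Fin N → ℕ) (z : Fin N → ℂ) (o : List (Fin N))
    (s : ℤ → (Fin M → Fin N) → ℂ) : HFun P d :=
  ∑ a ∈ Finset.range P.r, ∑ π, s a π • waveVec P d a
    (pureTensor (chainState P d z o a (mult Finset.univ π) 0))

lemma waveSum_eq_pathSum (o : List (Fin N)) (t : Fin M → ℂ) : waveSum P d F Φ z o t =
    pathSum P d z o fun a π => chainWeight P d F Φ z o π (siteLab d o a (mult Finset.univ π)) t := by
  funext ν
  simp only [waveSum, pathSum, chainVec, Finset.sum_apply, Pi.smul_apply, waveVec,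
    Finset.smul_sum, smul_comm (wave P _ ν)]

lemma isJacksonSum_pathSum {o : List (Fin N)} {s : ℤ → (Fin M → Fin N) → ℂ}
    (h : ∀ a π, HasSum (fun t : C => chainWeight P d F Φ z o π
      (siteLab d o a (mult Finset.univ π)) t) (s a π)) (ν : ZMod P.r) :
    IsJacksonSum P d C (fun t => waveSum P d F Φ z o t ν) (pathSum P d z o s ν) := by
  intro ξ
  simp only [waveSum_eq_pathSum, pathSum, Finset.sum_apply, Pi.smul_apply, map_sum, map_smul,
    smul_eq_mul]
  exact hasSum_sum fun a _ => hasSum_sum fun π _ => (h a π).mul_right _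

lemma lift_prod_apply {ι : Type*} (l : List ι) (T : ι → Module.End ℂ (H P d)) (f : HFun P d)
    (ν : ZMod P.r) : (l.map fun k => lift P d (T k)).prod f ν = (l.map T).prod (f ν) := by
  induction l with
  | nil => rfl
  | cons k l ih =>
    rw [List.map_cons, List.prod_cons, List.map_cons, List.prod_cons, Module.End.mul_apply,
      Module.End.mul_apply, ← ih]
    rfl

lemma chainWeight_eq_zero {π : Fin M → Fin N} {n : Fin N} (h : d n < mult Finset.univ π n)
    (o : List (Fin N)) (A : Fin N → ℤ) (t : Fin M → ℂ) : chainWeight P d F Φ z o π A t = 0 := by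
  rw [chainWeight, weightConst, Finset.prod_eq_zero (Finset.mem_univ n) (siteConst_eq_zero h _),
    mul_zero, zero_mul]

lemma sum_sub_mult (hd : ∑ n, d n = 2 * M) (π : Fin M → Fin N) :
    ∑ n, ((d n : ℤ) - 2 * mult Finset.univ π n) = 0 := by
  rw [Finset.sum_sub_distrib, ← Finset.mul_sum, sum_mult fun i _ => Finset.mem_univ (π i),
    Finset.card_univ, Fintype.card_fin, ← Nat.cast_sum, hd]
  push_cast
  ring

lemma waveSum_mem_betheSpace (hd : ∑ n, d n = 2 * M) (t : Fin M → ℂ) :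
    waveSum P d F Φ z (List.finRange N) t ∈ betheSpace P d z := by
  rw [waveSum_eq_pathSum]
  refine Submodule.sum_mem _ fun a _ => Submodule.sum_mem _ fun π _ => ?_
  by_cases h : ∀ n, mult Finset.univ π n ≤ d n
  · refine Submodule.smul_mem _ _ (Submodule.subset_span
      ⟨pathLab d (mult Finset.univ π) (List.finRange N) a, fun n => ⟨_, h n, ?_⟩, ?_, ?_⟩)
    · have := pathLab_succ (d := d) (mult Finset.univ π) a (List.mem_finRange n)
      rw [List.idxOf_finRange] at this
      rw [this]; ring
    · rw [pathLab_zero, pathLab_length _ List.mem_finRange _ (List.length_finRange).le,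
        sum_sub_mult hd, add_zero]
    · have := pathVecAt_pathLab (P := P) (d := d) (z := z) (mult Finset.univ π)
        (List.nodup_finRange N) List.mem_finRange a 0
      simp only [List.idxOf_finRange] at this
      rw [pathLab_zero, this]
  · push Not at h
    obtain ⟨n, hn⟩ := h
    simp only [chainWeight_eq_zero hn, zero_smul]
    exact Submodule.zero_mem _

section
variable (hτ : 0 < P.τ.im) (hη : th11 P (2 * P.η) ≠ 0) (hl : ∀ a, th11 P (lamAt P a) ≠ 0)
  (hd : ∑ n, d n = 2 * M)
include hτ hη hl hd

lemma phiFun_smul_Psi {t : Fin M → ℂ}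
    (h : RegularAt P d F Φ z t) (ht : ∀ i, th11 P (t i) ≠ 0) (ν : ZMod P.r) :
    phiFun P d F Φ z t • Psi P d z t ν = waveSum P d F Φ z (List.finRange N) t ν := by
  rw [Psi, waveSum, Finset.smul_sum]
  refine Finset.sum_congr rfl fun a _ => ?_
  rw [smul_comm, phiFun_smul_prod_Bop hτ hη hl hd h ht]

lemma prod_Rop_waveSum {t : Fin M → ℂ}
    (h : RegularAt P d F Φ z t) {j : Fin N}
    {l₁ m l₂ : List (Fin N)} (hn : (l₁ ++ j :: (m ++ l₂)).Nodup)
    (hall : ∀ n, n ∈ l₁ ++ j :: (m ++ l₂))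
    (hu : ∀ k ∈ m, ∀ i < d j,
      th11 P (z j - z k + (2 * (i : ℂ) + 1 - d j) * P.η + (d k + 1) * P.η) ≠ 0) (ν : ZMod P.r) :
    (m.reverse.map fun k => Rop P d j k (z j - z k)).prod
        (waveSum P d F Φ z (l₁ ++ j :: (m ++ l₂)) t ν) =
      waveSum P d F Φ z (l₁ ++ m ++ j :: l₂) t ν := by
  simp only [waveSum, map_sum, map_smul, prod_Rop_chainVec hτ hη hl hd h hn hall hu]

end

lemma sum_range_add_of_periodic {X : Type*} [AddCommGroup X] {r : ℕ} {h : ℤ → X}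
    (hh : ∀ a, h (a + r) = h a) (q : ℤ) :
    ∑ a ∈ Finset.range r, h (a + q) = ∑ a ∈ Finset.range r, h a := by
  have hp : Function.Periodic (fun q : ℤ => ∑ a ∈ Finset.range r, h (a + q)) 1 := fun q => by
    have h1 := Finset.sum_range_succ (fun a : ℕ => h (a + q)) r
    have h2 := Finset.sum_range_succ' (fun a : ℕ => h (a + q)) r
    rw [h1, Nat.cast_zero, zero_add, show (r : ℤ) + q = q + r by ring, hh] at h2
    refine Eq.trans ?_ (add_right_cancel h2).symm
    refine Finset.sum_congr rfl fun a _ => ?_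
    congr 1
    push_cast
    ring
  have := hp.int_mul_eq q
  simpa using this

lemma Zop_pathSum (hr : 0 < P.r) (hLI : IndepSteps P d z)
    (hd : ∑ n, d n = 2 * M) (j : Fin N) {s : ℤ → (Fin M → Fin N) → ℂ}
    (hs : ∀ a π n, d n < mult Finset.univ π n → s a π = 0)
    (hper : ∀ a π, s (a + P.r) π = s a π) :
    Zop P d z j (pathSum P d z (otherSites j ++ [j]) s) =
      pathSum P d (shiftZ P z j) (j :: otherSites j) fun a π =>
        exp (-2 * P.c * mult Finset.univ π j) * s (a + (d j - 2 * mult Finset.univ π j)) π := by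
  have h1 : Zop P d z j (pathSum P d z (otherSites j ++ [j]) s) = ∑ π, ∑ a ∈ Finset.range P.r,
      s a π • boundaryVec P d z j a (mult Finset.univ π) := by
    rw [pathSum, Finset.sum_comm]
    simp only [map_sum, map_smul]
    refine Finset.sum_congr rfl fun π _ => Finset.sum_congr rfl fun a _ => ?_
    by_cases h : ∀ n, mult Finset.univ π n ≤ d n
    · rw [Zop_waveVec hr hLI h (sum_sub_mult hd π)]
    · push Not at h
      obtain ⟨n, hn⟩ := h
      rw [hs _ _ n hn, zero_smul, zero_smul]
  rw [h1, pathSum, Finset.sum_comm (s := Finset.range P.r)]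
  refine Finset.sum_congr rfl fun π _ => ?_
  rw [← sum_range_add_of_periodic (r := P.r)
    (h := fun a => s a π • boundaryVec P d z j a (mult Finset.univ π))
    (fun a => by rw [hper, boundaryVec_add_period (r_mul_η hr)]) (d j - 2 * mult Finset.univ π j)]
  refine Finset.sum_congr rfl fun a _ => ?_
  simp only [boundaryVec]
  rw [add_sub_cancel_right, smul_smul, mul_comm]

end

/-! ### Solutions of the system -/

section
variable {N M : ℕ} {d : Fin N → ℕ} {F : ℕ → ℂ → ℂ} {Φ : ℂ → ℂ} {z : Fin N → ℂ}
  {x : Fin M → ℂ} {C : Set (Fin M → ℂ)}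
  (hF : ∀ (i : Fin M) (n : Fin N) (m : ℤ), AnalyticAt ℂ (F (d n)) (x i - z n + m * P.κ))
  (hΦ : ∀ (i j : Fin M) (m : ℤ), i < j → AnalyticAt ℂ Φ (x i - x j + m * P.κ) ∧
    (th11 P (x i - x j + m * P.κ) = 0 → Φ (x i - x j + m * P.κ) = 0))

include hF hΦ in
lemma regularAt_lattice (m : Fin M → ℤ) : RegularAt P d F Φ z (fun i => x i + m i * P.κ) := by
  refine ⟨fun i n => ?_, fun i j hij => ?_⟩
  · have := hF i n (m i)
    rwa [show x i - z n + m i * P.κ = x i + m i * P.κ - z n by ring] at this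
  · have := hΦ i j (m i - m j) hij
    push_cast at this
    rwa [show x i - x j + (m i - m j) * P.κ = x i + m i * P.κ - (x j + m j * P.κ) by ring] at this

include hF in
lemma analyticAt_shiftZ (k : Fin N) (i : Fin M) (n : Fin N) (m : ℤ) :
    AnalyticAt ℂ (F (d n)) (x i - shiftZ P z k n + m * P.κ) := by
  rcases eq_or_ne n k with rfl | h
  · have := hF i n (m - 1)
    push_cast at this
    rwa [shiftZ, Function.update_self, show x i - (z n + P.κ) + m * P.κ =
      x i - z n + (m - 1) * P.κ by ring]
  · rw [shiftZ, Function.update_of_ne h]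
    exact hF i n m

lemma exists_cycleSum (hC : ∀ π k ε σ, IsCycle P.κ x C (weightTerm P d F Φ z π k ε σ))
    (o : List (Fin N)) : ∃ s : ℤ → (Fin M → Fin N) → ℂ, ∀ a π (n : Fin M → ℤ),
      HasSum (fun t : C => chainWeight P d F Φ z o π (siteLab d o a (mult Finset.univ π))
        fun i => (t : Fin M → ℂ) i + n i * P.κ) (s a π) := by
  choose s hs using fun π k ε σ => (hC π k ε σ).2
  exact ⟨fun a π => _, fun a π n => (hs π _ _ _ n).mul_left _⟩

variable (hτ : 0 < P.τ.im) (hη : th11 P (2 * P.η) ≠ 0) (hκ : P.κ ≠ 0) (hd : ∑ n, d n = 2 * M)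
  (hFs : ∀ n, IsSolF P (d n) (F (d n))) (hΦs : IsSolPhi P Φ)
  (hC' : ∀ t ∈ C, ∃ m : Fin M → ℤ, t = fun i => x i + m i * P.κ)
include hτ hη hκ hd hFs hΦs hF hΦ hC'

/-- The summand of the chain with the site `j` in the first place, after the shift of `z_j`. -/
lemma hasSum_chainWeight_shiftZ
    (j : Fin N)
    {s : ℤ → (Fin M → Fin N) → ℂ} (hs : ∀ a π (n : Fin M → ℤ),
      HasSum (fun t : C => chainWeight P d F Φ z (otherSites j ++ [j]) π
        (siteLab d (otherSites j ++ [j]) a (mult Finset.univ π))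
        fun i => (t : Fin M → ℂ) i + n i * P.κ) (s a π)) (a : ℤ) (π : Fin M → Fin N) :
    HasSum (fun t : C => chainWeight P d F Φ (shiftZ P z j) (j :: otherSites j) π
      (siteLab d (j :: otherSites j) a (mult Finset.univ π)) t)
      (exp (-2 * P.c * mult Finset.univ π j) * s (a + (d j - 2 * mult Finset.univ π j)) π) := by
  let n : Fin M → ℤ := fun i => if π i = j then -1 else 0
  refine ((hs _ π n).mul_left _).congr_fun fun t => ?_
  obtain ⟨m, hm⟩ := hC' t t.2
  have hlab : siteLab d (otherSites j ++ [j]) (a + (d j - 2 * mult Finset.univ π j))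
      (mult Finset.univ π) = siteLab d (j :: otherSites j) a (mult Finset.univ π) := by
    funext k
    rw [siteLab, siteLab, lab_rotate (sum_sub_mult hd π)]
    ring
  have ht : shiftT P π j (fun i => (t : Fin M → ℂ) i + n i * P.κ) = t := by
    funext i
    simp only [shiftT, n]
    split_ifs <;> simp
  have h0 : (fun i => (t : Fin M → ℂ) i + n i * P.κ) = fun i => x i + (m i + n i : ℤ) * P.κ := by
    funext i
    rw [hm]
    push_cast
    ring
  have := chainWeight_shift hτ hη hκ hFs hΦs (notMem_otherSites j) (fun _ => mem_otherSites) π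
    (siteLab d (j :: otherSites j) a (mult Finset.univ π))
    (h0 ▸ regularAt_lattice hF hΦ _)
    (ht.symm ▸ hm ▸ regularAt_lattice (analyticAt_shiftZ hF j) hΦ m)
  rw [ht] at this
  rw [this, hlab]

set_option maxHeartbeats 1000000 in
lemma isJacksonSum_Aop (hr : 0 < P.r) (hl : ∀ a, th11 P (lamAt P a) ≠ 0) (hLI : IndepSteps P d z)
    (hR : ∀ j k : Fin N, j < k → ∀ i < d j,
      th11 P (z j - z k + (2 * (i : ℂ) + 1 - d j) * P.η + (d k + 1) * P.η) ≠ 0)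
    (hR' : ∀ j k : Fin N, k < j → ∀ i < d j,
      th11 P (z j + P.κ - z k + (2 * (i : ℂ) + 1 - d j) * P.η + (d k + 1) * P.η) ≠ 0)
    (hC : ∀ π k ε σ, IsCycle P.κ x C (weightTerm P d F Φ z π k ε σ))
    {f : HFun P d}
    (hf : ∀ ν, IsJacksonSum P d C (fun t => waveSum P d F Φ z (List.finRange N) t ν) (f ν))
    (j : Fin N) (ν : ZMod P.r) :
    IsJacksonSum P d C (fun t => waveSum P d F Φ (shiftZ P z j) (List.finRange N) t ν)
      (Aop P d z j f ν) := by
  set L := (List.finRange N).filter (· < j) with hL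
  set R := (List.finRange N).filter (j < ·) with hRd
  have hreg : ∀ t ∈ C, RegularAt P d F Φ z t := fun t htC => by
    obtain ⟨m, rfl⟩ := hC' t htC
    exact regularAt_lattice hF hΦ m
  have hreg' : ∀ t ∈ C, RegularAt P d F Φ (shiftZ P z j) t := fun t htC => by
    obtain ⟨m, rfl⟩ := hC' t htC
    exact regularAt_lattice (analyticAt_shiftZ hF j) hΦ m
  have hfin : List.finRange N = L ++ j :: R := finRange_eq j
  have hoth : otherSites j = L ++ R := rfl
  obtain ⟨s, hs⟩ := exists_cycleSum (d := d) hC (otherSites j ++ [j])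
  have hs0 : ∀ a π, HasSum (fun t : C => chainWeight P d F Φ z (otherSites j ++ [j]) π
      (siteLab d (otherSites j ++ [j]) a (mult Finset.univ π)) t) (s a π) := fun a π => by
    simpa using hs a π 0
  have h1 : (R.reverse.map fun k => lift P d (Rop P d j k (z j - z k))).prod f =
      pathSum P d z (otherSites j ++ [j]) s := by
    funext ν
    rw [lift_prod_apply]
    refine ((hf ν).map _).unique ((isJacksonSum_pathSum hs0 ν).congr fun t htC => ?_)
    have h := prod_Rop_waveSum hτ hη hl hd (hreg t htC) (j := j) (l₁ := L) (m := R) (l₂ := [])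
      (by rw [List.append_nil, ← hfin]; exact List.nodup_finRange N)
      (by rw [List.append_nil, ← hfin]; exact List.mem_finRange)
      (fun k hk => hR j k (by simpa [hRd] using hk)) ν
    rwa [List.append_nil, ← hfin] at h
  have h2 : Zop P d z j (pathSum P d z (otherSites j ++ [j]) s) = _ :=
    Zop_pathSum hr hLI hd j (fun a π n hn => (hs0 a π).unique (by
      simp only [chainWeight_eq_zero hn]; exact hasSum_zero)) fun a π => (hs0 _ π).unique (by
        have := hs0 a π
        rw [funext fun t : C => (chainWeight_add_period (r_mul_η hr) _ _ _ _).symm] at this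
        convert this using 4
        rw [siteLab, siteLab]; ring)
  have h3 := isJacksonSum_pathSum
    (hasSum_chainWeight_shiftZ hF hΦ hτ hη hκ hd hFs hΦs hC' j hs) ν
  have hz : ∀ k ∈ L, shiftZ P z j j - shiftZ P z j k = z j + P.κ - z k := fun k hk => by
    have : k < j := by simpa [hL] using hk
    rw [shiftZ, Function.update_self, Function.update_of_ne this.ne]
  rw [Aop, Module.End.mul_apply, Module.End.mul_apply, h1, h2, lift_prod_apply]
  refine (h3.map _).congr fun t htC => ?_
  have h := prod_Rop_waveSum hτ hη hl hd (hreg' t htC) (j := j) (l₁ := []) (m := L) (l₂ := R)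
    (by rw [List.nil_append, ← hoth]; exact nodup_otherSites j)
    (by rw [List.nil_append, ← hoth]; exact mem_cons_otherSites j)
    (fun k hk => by rw [hz k hk]; exact hR' j k (by simpa [hL] using hk)) ν
  rw [List.nil_append, List.nil_append, ← hoth, ← hfin] at h
  rw [← h]
  congr 2
  refine List.map_congr_left fun k hk => ?_
  rw [hz k (List.mem_reverse.1 hk)]

end

end EllipticKZ

end

open EllipticKZ in
theorem mainTheorem2 (P : Params) (hτ : 0 < P.τ.im) (hr : 0 < P.r) (hκ : P.κ ≠ 0)
    (hη : th11 P (2 * P.η) ≠ 0) :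
    (0 < P.κ.im → (∀ d : ℕ, IsSolF P d (FProd P d)) ∧ IsSolPhi P (PhiProd P)) ∧
    ∀ (N M : ℕ) (d : Fin N → ℕ) (_ : ∑ n, d n = 2 * M)
      (_ : ∀ a : ℤ, th11 P (lamAt P a) ≠ 0)
      (F : ℕ → ℂ → ℂ) (Φ : ℂ → ℂ)
      (_ : ∀ n, IsSolF P (d n) (F (d n))) (_ : IsSolPhi P Φ)
      (z : Fin N → ℂ) (x : Fin M → ℂ) (C : Set (Fin M → ℂ))
      -- the intertwining vectors form bases
      (_ : ∀ (n : Fin N) (b : ℤ), LinearIndependent ℂ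
        fun k : Fin (d n + 1) => stepVec P (d n) (b + 2 * (k : ℕ) - d n) b (z n))
      -- the R matrices in `A_j(z)` are regular
      (_ : ∀ j k : Fin N, j < k → ∀ i < d j,
        th11 P (z j - z k + (2 * (i : ℂ) + 1 - d j) * P.η + (d k + 1) * P.η) ≠ 0)
      (_ : ∀ j k : Fin N, k < j → ∀ i < d j,
        th11 P (z j + P.κ - z k + (2 * (i : ℂ) + 1 - d j) * P.η + (d k + 1) * P.η) ≠ 0)
      -- `F` and `Φ / θ₁₁` have no poles on the lattice `x + κ ℤ^M`
      (_ : ∀ (i : Fin M) (n : Fin N) (m : ℤ), AnalyticAt ℂ (F (d n)) (x i - z n + m * P.κ))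
      (_ : ∀ (i j : Fin M) (m : ℤ), i < j → AnalyticAt ℂ Φ (x i - x j + m * P.κ) ∧
        (th11 P (x i - x j + m * P.κ) = 0 → Φ (x i - x j + m * P.κ) = 0))
      -- the gauge matrices `M_λ(t_i)` are invertible
      (_ : ∀ t ∈ C, ∀ i, th11 P (t i) ≠ 0)
      -- `C` is a cycle with step `κ`
      (_ : ∀ π k ε σ, IsCycle P.κ x C (weightTerm P d F Φ z π k ε σ)),
      (∀ ν, IsJacksonSum P d C (fun t => phiFun P d F Φ z t • Psi P d z t ν)
        (fSol P d F Φ C z ν)) ∧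
      fSol P d F Φ C z ∈ betheSpace P d z ∧
      ∀ j : Fin N,
        (∀ ν, IsJacksonSum P d C
          (fun t => phiFun P d F Φ (shiftZ P z j) t • Psi P d (shiftZ P z j) t ν)
          (fSol P d F Φ C (shiftZ P z j) ν)) ∧
        fSol P d F Φ C (shiftZ P z j) ∈ betheSpace P d (shiftZ P z j) ∧
        fSol P d F Φ C (shiftZ P z j) = Aop P d z j (fSol P d F Φ C z) := by
  have : NeZero P.r := ⟨hr.ne'⟩
  refine ⟨fun hκi => ⟨fun d => isSolF_FProd hτ hκi hη hκ d, isSolPhi_PhiProd hτ hκi hη hκ⟩, ?_⟩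
  intro N M d hd hl F Φ hFs hΦs z x C hLI hR hR' hF hΦ ht hC
  have hC' : ∀ t ∈ C, ∃ m : Fin M → ℤ, t = fun i => x i + m i * P.κ := by
    rcases isEmpty_or_nonempty (Fin M → Fin N) with h | ⟨⟨π⟩⟩
    · intro t _
      exfalso
      rcases Nat.eq_zero_or_pos N with rfl | hN
      · obtain rfl : M = 0 := by simpa using hd
        exact h.false Fin.elim0
      · exact h.false fun _ => ⟨0, hN⟩
    · exact (hC π 0 1 0).1
  have hsum : ∀ w : Fin N → ℂ, (∀ (i : Fin M) (n : Fin N) (m : ℤ),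
      AnalyticAt ℂ (F (d n)) (x i - w n + m * P.κ)) → ∀ f : HFun P d,
      (∀ ν, IsJacksonSum P d C (fun t => waveSum P d F Φ w (List.finRange N) t ν) (f ν)) →
      (∀ ν, IsJacksonSum P d C (fun t => phiFun P d F Φ w t • Psi P d w t ν)
        (fSol P d F Φ C w ν)) ∧ fSol P d F Φ C w ∈ betheSpace P d w ∧ fSol P d F Φ C w = f := by
    intro w hw f hf
    have h : ∀ ν, IsJacksonSum P d C (fun t => phiFun P d F Φ w t • Psi P d w t ν) (f ν) := by
      refine fun ν => (hf ν).congr fun t htC => ?_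
      obtain ⟨m, hm⟩ := hC' t htC
      exact phiFun_smul_Psi hτ hη hl hd (hm ▸ regularAt_lattice hw hΦ m) (ht t htC) ν
    rw [fSol_eq h]
    exact ⟨h, IsJacksonSum.mem hf fun t _ => waveSum_mem_betheSpace hd t, rfl⟩
  obtain ⟨s, hs⟩ := exists_cycleSum (d := d) hC (List.finRange N)
  have hf := isJacksonSum_pathSum (P := P) (fun a π => by simpa using hs a π 0)
  obtain ⟨h1, h2, h3⟩ := hsum z hF _ hf
  refine ⟨h1, h2, fun j => ?_⟩
  rw [h3]
  exact hsum _ (analyticAt_shiftZ hF j) _ fun ν => isJacksonSum_Aop hF hΦ hτ hη hκ hd hFs hΦs hC' hr hl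
    hLI hR hR' hC hf j ν
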